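/- **Setting.** Let $(\Omega,\mathcal A,\mathbb P)$ be a probability space, $Y\in\mathbb R^d$ and $Z\in\mathbb R^q$ independent random vectors, $\varphi:\mathbb R^d\times\mathbb R^q\to\mathbb R$ measurable with $\varphi(Y,Z)\in L^2(\mathbb P)$, and $(Z^{(k)})_{k\ge1}$ i.i.d. copies of $Z$, independent of $Y$. Let $\mathcal H=\{1/K:K=1,2,\dots\}$ and $\overline{\mathcal H}=\mathcal H\cup\{0\}$. Put $X_0=\mathbb E[\varphi(Y,Z)\mid Y]$ and $X_h=\frac1K\sum_{k=1}^K\varphi(Y,Z^{(k)})$ for $h=1/K\in\mathcal H$. Fix $\alpha\in(0,1)$. For $h\in\overline{\mathcal H}$ let $F_{X_h}$ be the distribution function of $X_h$, $V_h(\xi)=\xi+\frac1{1-\alpha}\mathbb E[(X_h-\xi)^+]$, $\Theta_h=\operatorname{Argmin}V_h$, $\xi^h_\star\in\Theta_h$ and $\chi^h_\star=\min V_h=V_h(\xi^h_\star)$. Let $k_\alpha=1\vee\frac{\alpha}{1-\alpha}$, and let $\|\cdot\|_\infty$ and $[\cdot]_{\rm Lip}$ denote the supremum norm and the best Lipschitz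 constant. **Assumption 1.** (i) There are functions $v$ and $w(\cdot,h)$, $h\in\mathcal H$, with $F_{X_h}(\xi)-F_{X_0}(\xi)=v(\xi)h+w(\xi,h)h$ for all $\xi\in\mathbb R$, $h\in\mathcal H$, such that for every $\xi^0_\star\in\Theta_0$ the function $v$ is integrable on $(\xi^0_\star,\infty)$, $w(\xi^0_\star,h)\to0$ and $\int_{\xi^0_\star}^\infty w(\xi,h)\,d\xi\to0$ as $\mathcal H\ni h\downarrow0$. (ii) For every $h\in\overline{\mathcal H}$, $X_h$ has a continuous density $f_{X_h}$, and $f_{X_h}\to f_{X_0}$ locally uniformly as $\mathcal H\ni h\downarrow0$. **Assumption 2.** (i) $\inf\{f_{X_h}(\xi):h\in\overline{\mathcal H},\ |\xi-\xi^0_\star|<R\}>0$ for every $R>0$. (ii) $\sup_{h\in\overline{\mathcal H}}(\|f_{X_h}\|_\infty+[f_{X_h}]_{\rm Lip})<\infty$. **Assumption 3.** There are $C,\delta>0$ such that $\sup_{\xi\in\mathcal K}|f_{X_h}(\xi)-f_{X_0}(\xi)|\le Ch^{\frac14+\delta}$ for all $h\in\mathcal H$ and all compact $\mathcal K\subset\mathbb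 R$. **Levels and scenarios.** Let $h_\ell=h_0M^{-\ell}$ with $h_0\in\mathcal H$ and an integer $M\ge2$. Suppose that one of the following three scenarios holds, and let $\epsilon$ be the function attached to it: 1. $\mathbb E[|\varphi(Y,Z)-X_0|^{p_\star}]<\infty$ for some $p_\star>1$; $\epsilon(h)=h^{\frac{p_\star}{2(1+p_\star)}}$. 2. There is $C_g\in[0,\infty)$ such that for all $u\in\mathbb R$, $\mathbb E[\exp(u(\varphi(Y,Z)-X_0))\mid Y]\le e^{C_gu^2}$ almost surely; $\epsilon(h)=h^{\frac12}|\ln h|^{\frac12}$. 3. $\sup_{\ell\ge1}\mathbb E[|G_\ell|K_\ell(G_\ell)]<\infty$, where $G_\ell=h_\ell^{-1/2}(X_{h_\ell}-X_{h_{\ell-1}})$ and $K_\ell(g)$ is the best Lipschitz constant of $x\mapsto\mathbb P(X_{h_{\ell-1}}\le x\mid G_\ell=g)$ (for a regular version); $\epsilon(h)=h^{\frac12}$. **Scheme.** Let $\gamma_n=\gamma_1n^{-\beta}$ with $\gamma_1>0$, $\beta\in(0,1]$, and $\bar\gamma_n=\frac1n\sum_{k=1}^n\gamma_k$. Let $$\bar\lambda_2=\inf_{h\in\overline{\mathcal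 H}}\Big(\tfrac34V_h''(\xi^h_\star)\wedge4\|V_h''\|_\infty\frac{V_h''(\xi^h_\star)^4}{4[V_h'']_{\rm Lip}^2}\Big),$$ and suppose that $\bar\lambda_2\gamma_1>2$ if $\beta=1$. At level $\ell\ge0$, for $h=h_j$, $j\in\{(\ell-1)^+,\ell\}$, define, from initial values $(\xi^h_0,\chi^h_0)$, $$\xi^h_{n+1}=\xi^h_n-\gamma_{n+1}\Big(1-\tfrac1{1-\alpha}\mathbf 1_{X^{(n+1)}_h\ge\xi^h_n}\Big),\qquad \chi^h_{n+1}=\chi^h_n-\tfrac1{n+1}\Big(\chi^h_n-\xi^h_n-\tfrac1{1-\alpha}(X^{(n+1)}_h-\xi^h_n)^+\Big),$$ where at level $\ell\ge1$ the pairs $(X^{(n)}_{h_{\ell-1}},X^{(n)}_{h_\ell})_{n\ge1}$ are i.i.d. with the law of $(X_{h_{\ell-1}},X_{h_\ell})$, at level $0$ the $(X^{(n)}_{h_0})_{n\ge1}$ are i.i.d. with the law of $X_{h_0}$, the samples of different levels are independent, and all samples are jointly independent of the initial values. The initial values satisfy $$\sup\mathbb E\Big[|\xi^h_0|^4\exp\Big(\tfrac{16}{1-\alpha}k_\alpha\sup_{h'\in\overline{\mathcal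 H}}\|f_{X_{h'}}\|_\infty|\xi^h_0|\Big)\Big]+\sup\mathbb E[(\chi^h_0)^2]<\infty,$$ the suprema being over all levels $\ell$ and $h=h_j$, $j\in\{(\ell-1)^+,\ell\}$. For $\mathbf N=(N_0,\dots,N_L)$ let $$\xi^{ML}_{\mathbf N}=\xi^{h_0}_{N_0}+\sum_{\ell=1}^L\big(\xi^{h_\ell}_{N_\ell}-\xi^{h_{\ell-1}}_{N_\ell}\big),\qquad \chi^{ML}_{\mathbf N}=\chi^{h_0}_{N_0}+\sum_{\ell=1}^L\big(\chi^{h_\ell}_{N_\ell}-\chi^{h_{\ell-1}}_{N_\ell}\big),$$ where the $\ell$-th summand uses the iterates of level $\ell$. **Theorem.** Under Assumptions 1–3 and the above conditions there is a constant $K<\infty$ such that, for every integer $L\ge1$ and all positive integers $N_0,\dots,N_L$, $$\mathbb E\big[(\xi^{ML}_{\mathbf N}-\xi^{h_L}_\star)^2\big]\le K\Big(\gamma_{N_0}+\Big(\sum_{\ell=1}^L\gamma_{N_\ell}\Big)^2+\sum_{\ell=1}^L\gamma_{N_\ell}^{\frac32}+\sum_{\ell=1}^L\gamma_{N_\ell}\epsilon(h_\ell)\Big)$$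 and $$\mathbb E\big[(\chi^{ML}_{\mathbf N}-\chi^{h_L}_\star)^2\big]\le K\Big(\frac1{N_0^{1\wedge2\beta}}+\sum_{\ell=1}^L\frac{h_\ell}{N_\ell}+\sum_{\ell=1}^L\frac{\bar\gamma_{N_\ell}}{N_\ell}\epsilon(h_\ell)+\sum_{\ell=1}^L\frac1{N_\ell^2}\sum_{k=1}^{N_\ell}\gamma_k^{\frac32}+\Big(\sum_{\ell=1}^L\bar\gamma_{N_\ell}\Big)^2\Big).$$ -/

import Mathlib

open MeasureTheory ProbabilityTheory Filter Topology
open scoped ENNReal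

noncomputable section

namespace MLSA

/-! ### Losses, objective functions and general notions

The bias parameters `h = 1 / K`, `K ≥ 1`, and the limiting parameter `h = 0` are all indexed by a
natural number `K`, where `K = 0` stands for `h = 0`. The limit `h ↓ 0` is `K → ∞`. -/

/-- The standing assumptions on the nested model: `Y` and `Z` are independent random vectors,
`φ` is measurable, and `Zc 0, Zc 1, …` are i.i.d. copies of `Z`, jointly independent of `Y`. -/
structure IsNestedModel {Ω : Type*} [MeasurableSpace Ω] (P : Measure Ω) {d q : ℕ}
    (φ : EuclideanSpace ℝ (Fin d) → EuclideanSpace ℝ (Fin q) → ℝ)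
    (Y : Ω → EuclideanSpace ℝ (Fin d)) (Z : Ω → EuclideanSpace ℝ (Fin q))
    (Zc : ℕ → Ω → EuclideanSpace ℝ (Fin q)) : Prop where
  measurable_φ : Measurable (Function.uncurry φ)
  measurable_Y : Measurable Y
  measurable_Z : Measurable Z
  measurable_Zc : ∀ k, Measurable (Zc k)
  indep_Y_Z : IndepFun Y Z P
  identDistrib_Zc : ∀ k, IdentDistrib (Zc k) Z P P
  iIndep_Zc : iIndepFun Zc P
  indep_Y_Zc : IndepFun Y (fun ω k => Zc k ω) P

/-- The losses: `X_0 = E[φ(Y, Z) | Y]` for `K = 0`, and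
`X_h = (1 / K) ∑_{k = 1}^K φ(Y, Z^{(k)})` for `h = 1 / K`, `K ≥ 1`. -/
def loss {Ω : Type*} [MeasurableSpace Ω] (P : Measure Ω) {d q : ℕ}
    (φ : EuclideanSpace ℝ (Fin d) → EuclideanSpace ℝ (Fin q) → ℝ)
    (Y : Ω → EuclideanSpace ℝ (Fin d)) (Z : Ω → EuclideanSpace ℝ (Fin q))
    (Zc : ℕ → Ω → EuclideanSpace ℝ (Fin q)) (K : ℕ) : Ω → ℝ :=
  if K = 0 then P[fun ω => φ (Y ω) (Z ω) | MeasurableSpace.comap Y inferInstance]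
  else fun ω => 1 / (K : ℝ) * ∑ k ∈ Finset.range K, φ (Y ω) (Zc k ω)

/-- `V(ξ) = ξ + (1 - α)⁻¹ E[(X - ξ)⁺]`. -/
def objective {Ω : Type*} [MeasurableSpace Ω] (P : Measure Ω) (α : ℝ) (X : Ω → ℝ) (ξ : ℝ) : ℝ :=
  ξ + 1 / (1 - α) * ∫ ω, max (X ω - ξ) 0 ∂P

/-- The set of global minimizers of a function. -/
def argmin (V : ℝ → ℝ) : Set ℝ := {ξ | ∀ ξ', V ξ ≤ V ξ'}

/-- The supremum norm (of a bounded function). -/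
def supNorm (g : ℝ → ℝ) : ℝ := ⨆ x, |g x|

/-- The best Lipschitz constant (of a Lipschitz function); the terms with equal
arguments contribute `0`. -/
def lipNorm (g : ℝ → ℝ) : ℝ := ⨆ p : ℝ × ℝ, |g p.1 - g p.2| / |p.1 - p.2|

/-- `f` is a continuous probability density function of the random variable `X`. -/
structure IsContinuousPDF {Ω : Type*} [MeasurableSpace Ω] (P : Measure Ω) (X : Ω → ℝ)
    (f : ℝ → ℝ) : Prop where
  nonneg : ∀ x, 0 ≤ f x
  continuous : Continuous f
  map_eq : P.map X = volume.withDensity (fun x => ENNReal.ofReal (f x))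

/-! ### The assumptions on the family of losses

`X : ℕ → Ω → ℝ` is the family of losses and `f K` is the density of `X K`. -/

/-- First order expansion of the distribution functions in `h`, and locally uniform convergence of
the continuous densities. -/
structure ExpansionAssumption {Ω : Type*} [MeasurableSpace Ω] (P : Measure Ω) (α : ℝ)
    (X : ℕ → Ω → ℝ) (f : ℕ → ℝ → ℝ) : Prop where
  expansion : ∃ (v : ℝ → ℝ) (w : ℝ → ℕ → ℝ),
    (∀ K : ℕ, 1 ≤ K → ∀ ξ : ℝ,
      P.real {ω | X K ω ≤ ξ} - P.real {ω | X 0 ω ≤ ξ}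
        = v ξ * (1 / (K : ℝ)) + w ξ K * (1 / (K : ℝ))) ∧
    ∀ ξ₀ ∈ argmin (objective P α (X 0)),
      IntegrableOn v (Set.Ioi ξ₀) ∧
      Tendsto (fun K => w ξ₀ K) atTop (𝓝 0) ∧
      Tendsto (fun K => ∫ ξ in Set.Ioi ξ₀, w ξ K) atTop (𝓝 0)
  pdf : ∀ K, IsContinuousPDF P (X K) (f K)
  tendsto_pdf : TendstoLocallyUniformly f (f 0) atTop

/-- The densities are bounded away from `0` on every ball around the minimizer `ξ₀` of `V_0`,
uniformly in `h`, and they are uniformly bounded and uniformly Lipschitz. -/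
structure DensityAssumption (f : ℕ → ℝ → ℝ) (ξ₀ : ℝ) : Prop where
  lower_bound : ∀ R : ℝ, 0 < R → ∃ c : ℝ, 0 < c ∧ ∀ K, ∀ ξ ∈ Metric.ball ξ₀ R, c ≤ f K ξ
  bounded_lipschitz : ∃ C : ℝ, ∀ K, (∀ ξ, |f K ξ| ≤ C) ∧ ∀ ξ ξ', |f K ξ - f K ξ'| ≤ C * |ξ - ξ'|

/-- Rate of convergence of the densities. -/
def DensityRateAssumption (f : ℕ → ℝ → ℝ) : Prop :=
  ∃ C δ : ℝ, 0 < C ∧ 0 < δ ∧ ∀ K : ℕ, 1 ≤ K → ∀ S : Set ℝ, IsCompact S → ∀ ξ ∈ S,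
    |f K ξ - f 0 ξ| ≤ C * (1 / (K : ℝ)) ^ (1 / 4 + δ)

/-! ### The constants `k_α` and `lambdaBar` -/

/-- `k_α = 1 ∨ (α / (1 - α))`. -/
def kConst (α : ℝ) : ℝ := max 1 (α / (1 - α))

/-- For an objective function `V` with minimizer `ξs`,
`(3/8) q V''(ξs) ∧ μ V''(ξs)^4 / (4 [V'']_Lip^2)` with `μ = q^2 ‖V''‖_∞`. -/
def lambdaOf (V : ℝ → ℝ) (ξs : ℝ) (q : ℕ) : ℝ :=
  min (3 / 8 * (q : ℝ) * deriv (deriv V) ξs)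
    (((q : ℝ) ^ 2 * supNorm (deriv (deriv V))) *
      (deriv (deriv V) ξs ^ 4 / (4 * lipNorm (deriv (deriv V)) ^ 2)))

/-- The infimum of `lambdaOf` over all bias parameters, `h = 0` included. -/
def lambdaBar (V : ℕ → ℝ → ℝ) (ξs : ℕ → ℝ) (q : ℕ) : ℝ := ⨅ K, lambdaOf (V K) (ξs K) q

/-! ### The levels and the three scenarios -/

/-- The integer `1 / h_ℓ = K₀ M^ℓ`, where `h_ℓ = h_0 / M^ℓ` and `h_0 = 1 / K₀`. -/
def levelK (K₀ M ℓ : ℕ) : ℕ := K₀ * M ^ ℓ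

/-- The bias parameter `h_ℓ`. -/
def levelH (K₀ M ℓ : ℕ) : ℝ := 1 / (levelK K₀ M ℓ : ℝ)

/-- For a regular version `F_{A | G = g}` of the conditional distribution function of `A` given
`G = g`, its best Lipschitz constant, possibly infinite. -/
def condCdfLip {Ω : Type*} [MeasurableSpace Ω] (P : Measure Ω) [IsFiniteMeasure P]
    (A G : Ω → ℝ) (g : ℝ) : ℝ≥0∞ :=
  ⨆ (x : ℝ) (y : ℝ) (_ : x ≠ y), ENNReal.ofReal
    (|(condDistrib A G P g).real (Set.Iic x) - (condDistrib A G P g).real (Set.Iic y)| / |x - y|)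

/-- `G_ℓ = h_ℓ^{-1/2} (X_{h_ℓ} - X_{h_{ℓ-1}})`. -/
def levelG {Ω : Type*} (X : ℕ → Ω → ℝ) (K₀ M ℓ : ℕ) (ω : Ω) : ℝ :=
  levelH K₀ M ℓ ^ (-(1 / 2) : ℝ) * (X (levelK K₀ M ℓ) ω - X (levelK K₀ M (ℓ - 1)) ω)

/-- Scenario 1: `φ(Y, Z) - E[φ(Y, Z) | Y]` has a finite moment of order `p`. Here and below
`D` stands for that difference. -/
def MomentScenario {Ω : Type*} [MeasurableSpace Ω] (P : Measure Ω) (D : Ω → ℝ) (p : ℝ) : Prop :=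
  Integrable (fun ω => |D ω| ^ p) P

/-- Scenario 2: conditionally on `Y`, the difference `D` is sub-Gaussian, uniformly. -/
def GaussianScenario {Ω : Type*} [MeasurableSpace Ω] (P : Measure Ω) {d : ℕ}
    (Y : Ω → EuclideanSpace ℝ (Fin d)) (D : Ω → ℝ) : Prop :=
  ∃ Cg : ℝ, 0 ≤ Cg ∧ ∀ u : ℝ, Integrable (fun ω => Real.exp (u * D ω)) P ∧
    ∀ᵐ ω ∂P, (P[fun ω' => Real.exp (u * D ω') | MeasurableSpace.comap Y inferInstance]) ω
      ≤ Real.exp (Cg * u ^ 2)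

/-- Scenario 3: `sup_{ℓ ≥ 1} E[|G_ℓ| K_ℓ(G_ℓ)] < ∞`, with `K_ℓ(g)` the Lipschitz constant of the
conditional distribution function of `X_{h_{ℓ-1}}` given `G_ℓ = g`. -/
def LipschitzScenario {Ω : Type*} [MeasurableSpace Ω] (P : Measure Ω) [IsFiniteMeasure P]
    (X : ℕ → Ω → ℝ) (K₀ M : ℕ) : Prop :=
  (⨆ (ℓ : ℕ) (_ : 1 ≤ ℓ), ∫⁻ ω, ENNReal.ofReal |levelG X K₀ M ℓ ω| *
    condCdfLip P (X (levelK K₀ M (ℓ - 1))) (levelG X K₀ M ℓ) (levelG X K₀ M ℓ ω) ∂P) < ⊤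

/-- `ε` is the rate function attached to one of the three scenarios, and that scenario holds. -/
def IsStrongErrorRate {Ω : Type*} [MeasurableSpace Ω] (P : Measure Ω) [IsFiniteMeasure P] {d : ℕ}
    (Y : Ω → EuclideanSpace ℝ (Fin d)) (D : Ω → ℝ) (X : ℕ → Ω → ℝ) (K₀ M : ℕ) (ε : ℝ → ℝ) :
    Prop :=
  (∃ p : ℝ, 1 < p ∧ MomentScenario P D p ∧ ε = fun h => h ^ (p / (2 * (1 + p)))) ∨
  (GaussianScenario P Y D ∧ ε = fun h => h ^ (1 / 2 : ℝ) * |Real.log h| ^ (1 / 2 : ℝ)) ∨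
  (LipschitzScenario P X K₀ M ∧ ε = fun h => h ^ (1 / 2 : ℝ))

/-! ### The stochastic approximation schemes -/

/-- `H_1(ξ, x) = 1 - (1 - α)⁻¹ 1_{x ≥ ξ}`. -/
def H1 (α ξ x : ℝ) : ℝ := 1 - 1 / (1 - α) * (if ξ ≤ x then 1 else 0)

/-- `H_2(ξ, χ, x) = χ - (ξ + (1 - α)⁻¹ (x - ξ)⁺)`. -/
def H2 (α ξ χ x : ℝ) : ℝ := χ - (ξ + 1 / (1 - α) * max (x - ξ) 0)

/-- The learning rate `γ_n = γ_1 n^{-β}`, `n ≥ 1`. -/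
def stepSize (γ₁ β : ℝ) (n : ℕ) : ℝ := γ₁ * (n : ℝ) ^ (-β)

/-- The averaged learning rate `(1 / n) ∑_{k = 1}^n γ_k`. -/
def avgStep (γ₁ β : ℝ) (n : ℕ) : ℝ := 1 / (n : ℝ) * ∑ k ∈ Finset.Icc 1 n, stepSize γ₁ β k

/-- The iterates `(ξ_n, χ_n)` started at `θ₀ = (ξ_0, χ_0)`; `x n` is the sample consumed by the
step from `n` to `n + 1`. -/
def iterate (α : ℝ) (γ : ℕ → ℝ) (θ₀ : ℝ × ℝ) (x : ℕ → ℝ) : ℕ → ℝ × ℝ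
  | 0 => θ₀
  | n + 1 =>
    ((iterate α γ θ₀ x n).1 - γ (n + 1) * H1 α (iterate α γ θ₀ x n).1 (x n),
      (iterate α γ θ₀ x n).2 -
        1 / ((n : ℝ) + 1) * H2 α (iterate α γ θ₀ x n).1 (iterate α γ θ₀ x n).2 (x n))

/-- The random inputs of the multilevel scheme. At level `ℓ`, for `j ∈ {(ℓ - 1)⁺, ℓ}`,
`init ℓ j` is the initial value `(ξ_0^{h_j}, χ_0^{h_j})` and `x ℓ j n` is the `(n + 1)`-th sample of
`X_{h_j}` (other values of `j` are not used). The pairs of samples are independent over all levels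
and steps, at level `ℓ` they have the law of `(X_{h_{ℓ-1}}, X_{h_ℓ})` (of `X_{h_0}` if `ℓ = 0`), and
they are jointly independent of the initial values. -/
structure IsMultilevelSampling {Ω : Type*} [MeasurableSpace Ω] (P : Measure Ω)
    (X : ℕ → Ω → ℝ) (K₀ M : ℕ) (init : ℕ → ℕ → Ω → ℝ × ℝ) (x : ℕ → ℕ → ℕ → Ω → ℝ) : Prop where
  measurable_init : ∀ ℓ j, Measurable (init ℓ j)
  measurable_x : ∀ ℓ j n, Measurable (x ℓ j n)
  identDistrib : ∀ ℓ n, IdentDistrib (fun ω => (x ℓ (ℓ - 1) n ω, x ℓ ℓ n ω))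
    (fun ω => (X (levelK K₀ M (ℓ - 1)) ω, X (levelK K₀ M ℓ) ω)) P P
  iIndep : iIndepFun (fun (i : ℕ × ℕ) ω => (x i.1 (i.1 - 1) i.2 ω, x i.1 i.1 i.2 ω)) P
  indep_init : IndepFun (fun ω (ℓ : ℕ) => (init ℓ (ℓ - 1) ω, init ℓ ℓ ω))
    (fun ω (i : ℕ × ℕ) => (x i.1 (i.1 - 1) i.2 ω, x i.1 i.1 i.2 ω)) P

/-- The pair `(ξ^{h_j}_n, χ^{h_j}_n)` computed at level `ℓ`. -/
def levelIterate {Ω : Type*} (α : ℝ) (γ : ℕ → ℝ) (init : ℕ → ℕ → Ω → ℝ × ℝ)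
    (x : ℕ → ℕ → ℕ → Ω → ℝ) (ℓ j n : ℕ) (ω : Ω) : ℝ × ℝ :=
  iterate α γ (init ℓ j ω) (fun m => x ℓ j m ω) n

/-- The multilevel estimator `(ξ^{ML}_N, χ^{ML}_N)` with `L` levels and `N ℓ` steps at level `ℓ`. -/
def estimator {Ω : Type*} (α : ℝ) (γ : ℕ → ℝ) (init : ℕ → ℕ → Ω → ℝ × ℝ)
    (x : ℕ → ℕ → ℕ → Ω → ℝ) (L : ℕ) (N : ℕ → ℕ) (ω : Ω) : ℝ × ℝ :=
  levelIterate α γ init x 0 0 (N 0) ω +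
    ∑ ℓ ∈ Finset.Icc 1 L, (levelIterate α γ init x ℓ ℓ (N ℓ) ω -
      levelIterate α γ init x ℓ (ℓ - 1) (N ℓ) ω)

/-- The moment condition on the initial values, over all levels `ℓ` and `j ∈ {(ℓ - 1)⁺, ℓ}`;
`B` stands for the supremum over `h` of the sup norms of the densities. -/
def InitMoments {Ω : Type*} [MeasurableSpace Ω] (P : Measure Ω) (α B : ℝ)
    (init : ℕ → ℕ → Ω → ℝ × ℝ) : Prop :=
  (⨆ (ℓ : ℕ) (j ∈ Finset.Icc (ℓ - 1) ℓ), ∫⁻ ω, ENNReal.ofReal (|(init ℓ j ω).1| ^ 4 *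
      Real.exp (16 / (1 - α) * kConst α * B * |(init ℓ j ω).1|)) ∂P) +
    (⨆ (ℓ : ℕ) (j ∈ Finset.Icc (ℓ - 1) ℓ), ∫⁻ ω, ENNReal.ofReal ((init ℓ j ω).2 ^ 2) ∂P) < ⊤

end MLSA

end

/-! Everything rests on one linearization. At bias `h` the error of the first component satisfies
`e_{n+1} = e_n - γ_{n+1} (V_h'(ξ_n) + noise_n)`. Beside it runs a linear recursion with the same
noise, started at `0`, whose drift is `a` times its own state, with `a = V_0''(ξ⋆⁰)` common to all
`h`. The targets telescope over the levels, so the multilevel error is the error of level `0`, plus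
differences of linear parts, plus differences of remainders.

The linear parts are combinations of centred increments, so their differences at distinct levels are
orthogonal and the variances add. The two indicators of a level differ only if exactly one sample
reaches its threshold. At a common threshold this has probability of order `ε(h_ℓ)` by the scenarios
(`switchProb_level_le`); moving the threshold costs a density bound times the distance of the two
iterates, of order `γ^{1/2} + h_ℓ`. The linear recursion turns this into `γ ε + γ^{3/2}`
(`integral_sq_linearDiff_le`).

The remainders are not centred and are summed by the triangle inequality in `L²`. They are driven by
`(V_h''(ξ⋆ʰ) - a) e + O(e²)`, hence have mean square `h^{1/2 + 2δ} γ + γ²` (`remainder_le`).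
Cauchy–Schwarz against the convergent series `∑ h_ℓ^{2δ}` together with `h^{1/2} ≤ C ε(h)` turns the
first part into `∑ γ ε` (`sq_sum_remainder_rate_le`); the second part gives `(∑ γ)²`.

The quadratic term requires fourth moments of order `γ²` (`fourth_moment_le`). They come from the
Lyapunov function `W² e^{μ W}` with `W = V_h - min V_h`. Near the minimizer `W²` behaves like `e⁴`;
far away `W` is only linear and its gradient is bounded, and the exponential restores both the drift
and the control of `e⁴`. The contraction rate is `λ̄₂`, and `λ̄₂ γ₁ > 2` is what lets it beat the
decay of `γ_n²` when `β = 1`.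

For the second component the weights `1/(n+1)` make `χ_n` an exact empirical mean: `min V_h`, plus
the average of the gaps `W(ξ_k)`, plus an average of centred increments (`iterate_snd_eq`). The gaps
are quadratic in the error, so the fourth moment bounds their average by `γ̄_n` in `L²`. The
increments are orthogonal over steps and levels, and the variance of their difference is at most a
multiple of `E(ξ - ξ')² + E(X - X')²`, of order `h + γ ε + γ^{3/2}`. -/

namespace MLSA

/-! ### Step sizes and scalar recursions -/

section Recursion

theorem stepSize_pos {γ₁ β : ℝ} (hγ₁ : 0 < γ₁) {n : ℕ} (hn : 1 ≤ n) : 0 < stepSize γ₁ β n := by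
  have : (0 : ℝ) < n := by exact_mod_cast hn
  unfold stepSize; positivity

theorem stepSize_nonneg {γ₁ β : ℝ} (hγ₁ : 0 < γ₁) (n : ℕ) : 0 ≤ stepSize γ₁ β n := by
  unfold stepSize; positivity

theorem stepSize_succ_pos {γ₁ β : ℝ} (hγ₁ : 0 < γ₁) (n : ℕ) : 0 < stepSize γ₁ β (n + 1) :=
  stepSize_pos hγ₁ (by omega)

theorem stepSize_anti {γ₁ β : ℝ} (hγ₁ : 0 < γ₁) (hβ : 0 ≤ β) {m n : ℕ} (hm : 1 ≤ m)
    (hmn : m ≤ n) : stepSize γ₁ β n ≤ stepSize γ₁ β m := by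
  have : (0 : ℝ) < m := by exact_mod_cast hm
  unfold stepSize
  refine mul_le_mul_of_nonneg_left ?_ hγ₁.le
  exact Real.rpow_le_rpow_of_nonpos this (by exact_mod_cast hmn) (by linarith)

theorem stepSize_one (γ₁ β : ℝ) : stepSize γ₁ β 1 = γ₁ := by simp [stepSize]

theorem stepSize_le {γ₁ β : ℝ} (hγ₁ : 0 < γ₁) (hβ : 0 ≤ β) {n : ℕ} (hn : 1 ≤ n) :
    stepSize γ₁ β n ≤ γ₁ := by
  simpa [stepSize_one] using stepSize_anti hγ₁ hβ le_rfl hn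

theorem stepSize_tendsto {γ₁ β : ℝ} (hβ : 0 < β) :
    Tendsto (fun n => stepSize γ₁ β n) atTop (𝓝 0) := by
  have := ((tendsto_rpow_neg_atTop hβ).comp tendsto_natCast_atTop_atTop).const_mul γ₁
  simpa [stepSize] using this

theorem succ_rpow_div_tendsto {β : ℝ} (hβ : β ∈ Set.Ioc (0 : ℝ) 1) :
    Tendsto (fun n : ℕ => ((n : ℝ) + 1) ^ β / n) atTop (𝓝 (if β = 1 then 1 else 0)) := by
  have h1 : Tendsto (fun n : ℕ => ((n : ℝ) + 1) / n) atTop (𝓝 1) := by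
    have := tendsto_inv_atTop_nhds_zero_nat (𝕜 := ℝ)
    have h2 : Tendsto (fun n : ℕ => 1 + ((n : ℝ))⁻¹) atTop (𝓝 (1 + 0)) := this.const_add 1
    rw [add_zero] at h2
    refine h2.congr' ?_
    filter_upwards [eventually_ge_atTop 1] with n hn
    have : (n : ℝ) ≠ 0 := by positivity
    field_simp
  split_ifs with h
  · subst h; simpa using h1
  · have hlt : 0 < 1 - β := by
      have := lt_of_le_of_ne hβ.2 h; linarith
    have h2 : Tendsto (fun n : ℕ => (n : ℝ) ^ (-(1 - β))) atTop (𝓝 0) :=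
      (tendsto_rpow_neg_atTop hlt).comp tendsto_natCast_atTop_atTop
    have h3 := (h1.rpow_const (p := β) (Or.inl one_ne_zero)).mul h2
    rw [mul_zero] at h3
    refine h3.congr' ?_
    filter_upwards [eventually_ge_atTop 1] with n hn
    have hn0 : (0 : ℝ) < n := by exact_mod_cast hn
    rw [Real.div_rpow (by positivity) hn0.le, neg_sub, Real.rpow_sub hn0, Real.rpow_one]
    field_simp

/-- The ratio of consecutive powers is `(1 + 1/n)^{βp}`, about `1 + βp/n`. For `β < 1` the quantity
`1/n` is negligible against `γ_{n+1}`; for `β = 1` it is asymptotically `γ_{n+1} / γ₁`. Only in the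
latter case does the size of `γ₁` matter. -/
theorem stepSize_ratio_eventually {γ₁ β p l : ℝ} (hγ₁ : 0 < γ₁) (hβ : β ∈ Set.Ioc (0 : ℝ) 1)
    (hp : 0 < p) (hl : 0 < l) (hβ1 : β = 1 → p < l * γ₁) :
    ∀ᶠ n : ℕ in atTop,
      stepSize γ₁ β n ^ p ≤ (1 + l * stepSize γ₁ β (n + 1)) * stepSize γ₁ β (n + 1) ^ p := by
  set s := β * p with hs
  have hs0 : 0 < s := mul_pos hβ.1 hp
  have hinv := tendsto_inv_atTop_nhds_zero_nat (𝕜 := ℝ)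
  have hlim : Tendsto (fun n : ℕ => s * (1 + s * (n : ℝ)⁻¹) * (((n : ℝ) + 1) ^ β / n) / γ₁) atTop
      (𝓝 (s * (1 + s * 0) * (if β = 1 then 1 else 0) / γ₁)) := by
    refine Tendsto.div_const (Tendsto.mul ?_ (succ_rpow_div_tendsto hβ)) _
    exact ((hinv.const_mul s).const_add 1).const_mul s
  have hlt : s * (1 + s * 0) * (if β = 1 then 1 else 0) / γ₁ < l := by
    split_ifs with h
    · rw [div_lt_iff₀ hγ₁]; simpa [hs, h] using hβ1 h
    · simpa using hl
  have hsmall : ∀ᶠ n : ℕ in atTop, s * (n : ℝ)⁻¹ < 1 := by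
    have := hinv.const_mul s
    rw [mul_zero] at this
    exact this.eventually_lt_const one_pos
  filter_upwards [hlim.eventually_lt_const hlt, hsmall, eventually_ge_atTop 1] with n h1 h2 hn
  have hn0 : (0 : ℝ) < n := by exact_mod_cast hn
  set t : ℝ := (n : ℝ)⁻¹ with ht
  have ht0 : 0 < t := by positivity
  have hpow : (1 + t) ^ s ≤ 1 + s * t * (1 + s * t) := by
    have e1 : (1 + t) ^ s ≤ Real.exp (s * t) := by
      rw [Real.rpow_def_of_pos (by positivity)]
      apply Real.exp_le_exp.mpr
      have := Real.log_le_sub_one_of_pos (show 0 < 1 + t by positivity)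
      nlinarith
    have e2 := Real.abs_exp_sub_one_sub_id_le (x := s * t)
      (by rw [abs_of_pos (by positivity)]; exact h2.le)
    have e3 := le_of_abs_le e2
    nlinarith
  have hg : stepSize γ₁ β n = (1 + t) ^ β * stepSize γ₁ β (n + 1) := by
    have : (1 + t) = ((n : ℝ) + 1) / n := by rw [ht]; field_simp
    rw [this, Real.div_rpow (by positivity) hn0.le]
    unfold stepSize
    push_cast
    rw [Real.rpow_neg hn0.le, Real.rpow_neg (by positivity)]
    have hb : ((n : ℝ) + 1) ^ β ≠ 0 := by positivity
    field_simp
  have hg' : s * t * (1 + s * t) ≤ l * stepSize γ₁ β (n + 1) := by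
    have hb : 0 < ((n : ℝ) + 1) ^ β := by positivity
    have : stepSize γ₁ β (n + 1) = γ₁ / ((n : ℝ) + 1) ^ β := by
      unfold stepSize
      push_cast
      rw [Real.rpow_neg (by positivity), div_eq_mul_inv]
    rw [this, ← mul_div_assoc, le_div_iff₀ hb]
    rw [div_lt_iff₀ hγ₁] at h1
    have : s * t * (1 + s * t) * ((n : ℝ) + 1) ^ β = s * (1 + s * t) * (((n : ℝ) + 1) ^ β / n) := by
      rw [ht]; field_simp
    linarith
  have hpos : 0 < stepSize γ₁ β (n + 1) := stepSize_succ_pos hγ₁ n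
  rw [hg, Real.mul_rpow (by positivity) hpos.le, ← Real.rpow_mul (by positivity), ← hs]
  gcongr
  linarith

/-- The contraction rate `λ` of a perturbed linear recursion dominates the decay of `γ_n ^ p`. -/
theorem recursion_bound_single {γ₁ β p l D : ℝ} (hγ₁ : 0 < γ₁) (hβ : β ∈ Set.Ioc (0 : ℝ) 1)
    (hp : 0 < p) (hl : 0 < l) (hβ1 : β = 1 → p < l * γ₁) (hD : 0 ≤ D) :
    ∃ C : ℝ, 0 ≤ C ∧ ∀ u : ℕ → ℝ, (∀ n, 0 ≤ u n) → u 0 ≤ D →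
      (∀ n, u (n + 1) ≤ max 0 (1 - l * stepSize γ₁ β (n + 1) + D * stepSize γ₁ β (n + 1) ^ 2) * u n
        + D * stepSize γ₁ β (n + 1) ^ (1 + p)) →
      ∀ n, u n ≤ C * stepSize γ₁ β (n + 1) ^ p := by
  -- A rate strictly below `l` that still beats the decay of `γ^p`; the gap `l - l' = 2η` pays for
  -- the lower-order terms.
  obtain ⟨l', hl'0, hl'l, hl'1⟩ : ∃ l', 0 < l' ∧ l' < l ∧ (β = 1 → p < l' * γ₁) := by
    by_cases h : β = 1
    · have h1 := hβ1 h
      have h2 : p / γ₁ < l := by rwa [div_lt_iff₀ hγ₁]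
      obtain ⟨l', h3, h4⟩ := exists_between h2
      exact ⟨l', lt_trans (by positivity) h3, h4, fun _ => by rwa [div_lt_iff₀ hγ₁] at h3⟩
    · exact ⟨l / 2, by linarith, by linarith, fun h' => absurd h' h⟩
  set g := fun n => stepSize γ₁ β (n + 1) with hgdef
  have hg0 : ∀ n, 0 < g n := fun n => stepSize_succ_pos hγ₁ n
  set η := (l - l') / 2 with hη
  have hη0 : 0 < η := by rw [hη]; linarith
  have hlim : Tendsto g atTop (𝓝 0) := (tendsto_add_atTop_iff_nat 1).2 (stepSize_tendsto hβ.1)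
  have hratio := (tendsto_add_atTop_nat 1).eventually
    (stepSize_ratio_eventually hγ₁ hβ hp hl'0 hl'1)
  -- This closes the induction: of the gap `2η`, one `η` absorbs `D γ²` and the other the forcing
  -- term.
  have hev : ∀ᶠ n in atTop, (1 + l' * g (n + 1)) * (max 0 (1 - l * g n + D * g n ^ 2) + η * g n) ≤ 1 := by
    have h1 : ∀ᶠ n in atTop, l * g n < 1 / 2 := by
      have := hlim.const_mul l
      rw [mul_zero] at this
      exact this.eventually_lt_const (by norm_num)
    have h2 : ∀ᶠ n in atTop, D * g n * (1 + l' * g n) < η := by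
      have := (hlim.const_mul D).mul ((hlim.const_mul l').const_add 1)
      simp only [mul_zero, zero_mul] at this
      exact this.eventually_lt_const hη0
    filter_upwards [h1, h2] with n h1 h2
    have hm : g (n + 1) ≤ g n := stepSize_anti hγ₁ hβ.1.le (by omega) (by omega)
    have hq : 0 ≤ 1 - l * g n + D * g n ^ 2 := by
      have := mul_nonneg hD (sq_nonneg (g n)); linarith
    rw [max_eq_right hq]
    have hgn := hg0 n
    calc (1 + l' * g (n + 1)) * (1 - l * g n + D * g n ^ 2 + η * g n)
        ≤ (1 + l' * g n) * (1 - l * g n + D * g n ^ 2 + η * g n) := by gcongr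
      _ ≤ 1 := by
        have e1 : D * g n * (1 + l' * g n) * g n ≤ η * g n := by gcongr
        have e2 : 0 ≤ (l' + η) * l' * g n ^ 2 := by positivity
        have e3 : l = l' + 2 * η := by rw [hη]; ring
        rw [e3]
        linarith
  obtain ⟨n₀, hn₀⟩ := eventually_atTop.1 (hratio.and hev)
  -- the first `n₀` terms
  let b : ℕ → ℝ := fun n => max 0 (1 - l * g n + D * g n ^ 2)
  have hb : ∀ n, 0 ≤ b n := fun n => le_max_left _ _
  -- The extremal solution dominates every admissible `u`, so the constant taken from its first
  -- terms does not depend on `u`.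
  let c : ℕ → ℝ := fun n => Nat.rec D (fun k r => b k * r + D * g k ^ (1 + p)) n
  have hc : ∀ n, 0 ≤ c n := by
    intro n
    induction n with
    | zero => exact hD
    | succ k ih =>
      have := hb k; have := hg0 k
      change 0 ≤ b k * c k + D * g k ^ (1 + p)
      positivity
  -- The sum covers the indices up to `n₀`; the summand `D / η` gives `D ≤ C η`, so the forcing fits
  -- into the room left by `hev`.
  set C := ∑ k ∈ Finset.range (n₀ + 1), c k / g k ^ p + D / η with hC
  have hterm : ∀ k, 0 ≤ c k / g k ^ p := fun k => by
    have := hc k; have := hg0 k; positivity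
  have hC0 : 0 ≤ C := add_nonneg (Finset.sum_nonneg fun k _ => hterm k) (by positivity)
  refine ⟨C, hC0, fun u hu hu0 hrec n => ?_⟩
  have huc : ∀ n, u n ≤ c n := by
    intro n
    induction n with
    | zero => exact hu0
    | succ k ih =>
      have h1 := hrec k
      change u (k + 1) ≤ b k * c k + D * g k ^ (1 + p)
      have := mul_le_mul_of_nonneg_left ih (hb k)
      change u (k + 1) ≤ b k * u k + D * g k ^ (1 + p) at h1
      linarith
  have hinit : ∀ k ≤ n₀, u k ≤ C * g k ^ p := by
    intro k hk
    have h1 : c k / g k ^ p ≤ C := by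
      have := Finset.single_le_sum (f := fun k => c k / g k ^ p) (fun k _ => hterm k)
        (Finset.mem_range.2 (Nat.lt_succ_of_le hk))
      have h2 : 0 ≤ D / η := by positivity
      linarith
    have : 0 < g k ^ p := Real.rpow_pos_of_pos (hg0 k) _
    rw [div_le_iff₀ this] at h1
    exact (huc k).trans h1
  change u n ≤ C * g n ^ p
  rcases le_total n n₀ with h | h
  · exact hinit n h
  induction n, h using Nat.le_induction with
  | base => exact hinit n₀ le_rfl
  | succ n hn ih =>
    obtain ⟨h1, h2⟩ := hn₀ n hn
    change g n ^ p ≤ (1 + l' * g (n + 1)) * g (n + 1) ^ p at h1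
    have h3 : u (n + 1) ≤ b n * u n + D * g n ^ (1 + p) := hrec n
    have hgp : 0 < g n ^ p := Real.rpow_pos_of_pos (hg0 n) _
    have hgp1 : 0 < g (n + 1) ^ p := Real.rpow_pos_of_pos (hg0 (n + 1)) _
    have hl1 : 0 < 1 + l' * g (n + 1) := by have := hg0 (n + 1); positivity
    have hDη : D ≤ C * η := by
      have : D / η ≤ C := by
        have := Finset.sum_nonneg (s := Finset.range (n₀ + 1)) (fun k _ => hterm k)
        linarith
      rwa [div_le_iff₀ hη0] at this
    have h4 : g n ^ (1 + p) = g n * g n ^ p := by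
      rw [Real.rpow_add (hg0 n), Real.rpow_one]
    calc u (n + 1) ≤ b n * (C * g n ^ p) + C * η * (g n * g n ^ p) := by
          rw [h4] at h3
          have := mul_le_mul_of_nonneg_left ih (hb n)
          have := mul_le_mul_of_nonneg_right hDη (mul_pos (hg0 n) hgp).le
          linarith
      _ = C * (b n + η * g n) * g n ^ p := by ring
      _ ≤ C * (b n + η * g n) * ((1 + l' * g (n + 1)) * g (n + 1) ^ p) := by
          have := hb n; have := hg0 n
          gcongr
      _ = C * ((1 + l' * g (n + 1)) * (b n + η * g n)) * g (n + 1) ^ p := by ring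
      _ ≤ C * 1 * g (n + 1) ^ p := by gcongr
      _ = C * g (n + 1) ^ p := by ring

/-- Two driving terms with different decay. -/
theorem recursion_bound {γ₁ β p p' l D : ℝ} (hγ₁ : 0 < γ₁) (hβ : β ∈ Set.Ioc (0 : ℝ) 1)
    (hp : 0 < p) (hp' : 0 < p') (hl : 0 < l) (hβ1 : β = 1 → p < l * γ₁)
    (hβ1' : β = 1 → p' < l * γ₁) (hD : 0 ≤ D) :
    ∃ C : ℝ, 0 ≤ C ∧ ∀ (u : ℕ → ℝ) (c c' : ℝ), 0 ≤ c → 0 ≤ c' → (∀ n, 0 ≤ u n) → u 0 ≤ D * c' →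
      (∀ n, u (n + 1) ≤ (1 - l * stepSize γ₁ β (n + 1) + D * stepSize γ₁ β (n + 1) ^ 2) * u n
        + D * stepSize γ₁ β (n + 1) *
          (c * stepSize γ₁ β (n + 1) ^ p + c' * stepSize γ₁ β (n + 1) ^ p')) →
      ∀ n, u n ≤ C * (c * stepSize γ₁ β (n + 1) ^ p + c' * stepSize γ₁ β (n + 1) ^ p') := by
  obtain ⟨C, hC, h⟩ := recursion_bound_single hγ₁ hβ hp hl hβ1 hD
  obtain ⟨C', hC', h'⟩ := recursion_bound_single hγ₁ hβ hp' hl hβ1' hD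
  refine ⟨max C C', le_max_of_le_left hC, fun u c c' hc hc' hu hu0 hrec n => ?_⟩
  set g := fun n => stepSize γ₁ β (n + 1) with hgdef
  have hg0 : ∀ n, 0 < g n := fun n => stepSize_succ_pos hγ₁ n
  -- The positive part makes the recursion monotone, so solutions can be compared and superposed:
  -- one solution per forcing term, with the initial value attached to the second.
  let b : ℕ → ℝ := fun n => max 0 (1 - l * g n + D * g n ^ 2)
  have hb : ∀ n, 0 ≤ b n := fun n => le_max_left _ _
  let v : ℕ → ℝ := fun n => Nat.rec 0 (fun k r => b k * r + D * g k ^ (1 + p)) n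
  let v' : ℕ → ℝ := fun n => Nat.rec D (fun k r => b k * r + D * g k ^ (1 + p')) n
  have hv : ∀ n, 0 ≤ v n := by
    intro n
    induction n with
    | zero => exact le_rfl
    | succ k ih =>
      have := hb k; have := hg0 k
      change 0 ≤ b k * v k + D * g k ^ (1 + p)
      positivity
  have hv' : ∀ n, 0 ≤ v' n := by
    intro n
    induction n with
    | zero => exact hD
    | succ k ih =>
      have := hb k; have := hg0 k
      change 0 ≤ b k * v' k + D * g k ^ (1 + p')
      positivity
  have huv : ∀ n, u n ≤ c * v n + c' * v' n := by
    intro n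
    induction n with
    | zero => change u 0 ≤ c * 0 + c' * D; linarith
    | succ k ih =>
      have h1 : u (k + 1) ≤ (1 - l * g k + D * g k ^ 2) * u k
        + D * g k * (c * g k ^ p + c' * g k ^ p') := hrec k
      have h2 : (1 - l * g k + D * g k ^ 2) * u k ≤ b k * u k :=
        mul_le_mul_of_nonneg_right (le_max_right _ _) (hu k)
      have h3 := mul_le_mul_of_nonneg_left ih (hb k)
      change u (k + 1) ≤ c * (b k * v k + D * g k ^ (1 + p))
        + c' * (b k * v' k + D * g k ^ (1 + p'))
      rw [Real.rpow_add (hg0 k), Real.rpow_add (hg0 k), Real.rpow_one]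
      linarith
  have h1 : v n ≤ C * g n ^ p := h v hv hD (fun n => le_rfl) n
  have h2 : v' n ≤ C' * g n ^ p' := h' v' hv' le_rfl (fun n => le_rfl) n
  have e1 : 0 ≤ g n ^ p := Real.rpow_nonneg (hg0 n).le _
  have e2 : 0 ≤ g n ^ p' := Real.rpow_nonneg (hg0 n).le _
  calc u n ≤ c * v n + c' * v' n := huv n
    _ ≤ c * (max C C' * g n ^ p) + c' * (max C C' * g n ^ p') := by
        gcongr
        · exact h1.trans (by gcongr; exact le_max_left _ _)
        · exact h2.trans (by gcongr; exact le_max_right _ _)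
    _ = max C C' * (c * g n ^ p + c' * g n ^ p') := by ring

end Recursion

/-! ### Convex potentials and the Lyapunov function -/

section Lyapunov

/-- The Taylor-type inequalities to the right of a point come from differentiating the gap between
their two sides; `reflect` transfers them to the left. -/
theorem nonneg_of_hasDerivAt_nonneg_right {h h' : ℝ → ℝ} {z : ℝ}
    (hd : ∀ x, HasDerivAt h (h' x) x) (hz : 0 ≤ h z) (hp : ∀ x, z < x → 0 ≤ h' x) {x : ℝ}
    (hx : z ≤ x) : 0 ≤ h x := by
  have hm : MonotoneOn h (Set.Ici z) := by
    apply monotoneOn_of_deriv_nonneg (convex_Ici z)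
    · exact fun x _ => (hd x).continuousAt.continuousWithinAt
    · exact fun x _ => (hd x).differentiableAt.differentiableWithinAt
    · intro x hx
      rw [interior_Ici] at hx
      rw [(hd x).deriv]; exact hp x hx
  exact hz.trans (hm Set.self_mem_Ici hx hx)

/-- `W ≥ 0` is convex with minimum `0` at `z`, its derivative `g` is bounded by `k`, and its second
derivative `p` is bounded by `B`. -/
structure IsConvexPotential (W g p : ℝ → ℝ) (z k B : ℝ) : Prop where
  hasDerivAt_W : ∀ x, HasDerivAt W (g x) x
  hasDerivAt_g : ∀ x, HasDerivAt g (p x) x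
  W_min : W z = 0
  g_min : g z = 0
  p_nonneg : ∀ x, 0 ≤ p x
  p_le : ∀ x, p x ≤ B
  abs_g_le : ∀ x, |g x| ≤ k
  B_pos : 0 < B
  k_pos : 0 < k

namespace IsConvexPotential

variable {W g p : ℝ → ℝ} {z k B : ℝ}

theorem reflect (h : IsConvexPotential W g p z k B) :
    IsConvexPotential (fun x => W (-x)) (fun x => -g (-x)) (fun x => p (-x)) (-z) k B where
  hasDerivAt_W x := by
    simpa [Function.comp_def] using (h.hasDerivAt_W (-x)).comp x (hasDerivAt_neg x)
  hasDerivAt_g x := by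
    have := ((h.hasDerivAt_g (-x)).comp x (hasDerivAt_neg x)).neg
    simp only [mul_neg, mul_one, neg_neg] at this
    exact this
  W_min := by simp [h.W_min]
  g_min := by simp [h.g_min]
  p_nonneg x := h.p_nonneg _
  p_le x := h.p_le _
  abs_g_le x := by simpa using h.abs_g_le (-x)
  B_pos := h.B_pos
  k_pos := h.k_pos

theorem g_mono (h : IsConvexPotential W g p z k B) : Monotone g :=
  monotone_of_hasDerivAt_nonneg h.hasDerivAt_g h.p_nonneg

theorem g_sub_le (h : IsConvexPotential W g p z k B) {x y : ℝ} (hxy : x ≤ y) :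
    g y - g x ≤ B * (y - x) := by
  have := nonneg_of_hasDerivAt_nonneg_right (h := fun t => B * (t - x) - (g t - g x))
    (h' := fun t => B * 1 - p t) (z := x)
    (fun t => (((hasDerivAt_id t).sub_const x).const_mul B).sub ((h.hasDerivAt_g t).sub_const _))
    (by simp) (fun t _ => by linarith [h.p_le t]) hxy
  linarith

theorem lower_right (h : IsConvexPotential W g p z k B) {x y : ℝ} (hxy : x ≤ y) :
    W x + g x * (y - x) ≤ W y := by
  have := nonneg_of_hasDerivAt_nonneg_right (h := fun t => W t - W x - g x * (t - x))
    (h' := fun t => g t - g x * 1) (z := x)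
    (fun t => ((h.hasDerivAt_W t).sub_const _).sub
      (((hasDerivAt_id t).sub_const x).const_mul (g x)))
    (by simp) (fun t ht => by linarith [h.g_mono ht.le]) hxy
  linarith

theorem upper_right (h : IsConvexPotential W g p z k B) {x y : ℝ} (hxy : x ≤ y) :
    W y ≤ W x + g x * (y - x) + B / 2 * (y - x) ^ 2 := by
  have := nonneg_of_hasDerivAt_nonneg_right
    (h := fun t => B / 2 * (t - x) ^ 2 - (W t - W x - g x * (t - x)))
    (h' := fun t => B / 2 * (((2 : ℕ) : ℝ) * (t - x) ^ (2 - 1) * 1) - (g t - g x * 1)) (z := x)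
    (fun t => ((((hasDerivAt_id t).sub_const x).pow 2).const_mul (B / 2)).sub
      (((h.hasDerivAt_W t).sub_const _).sub (((hasDerivAt_id t).sub_const x).const_mul (g x))))
    (by simp) (fun t ht => by have := h.g_sub_le ht.le; norm_num; linarith) hxy
  linarith

theorem lower (h : IsConvexPotential W g p z k B) (x y : ℝ) : W x + g x * (y - x) ≤ W y := by
  rcases le_total x y with hxy | hxy
  · exact h.lower_right hxy
  · have := h.reflect.lower_right (neg_le_neg hxy)
    simp only [neg_neg] at this
    linarith

theorem upper (h : IsConvexPotential W g p z k B) (x y : ℝ) :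
    W y ≤ W x + g x * (y - x) + B / 2 * (y - x) ^ 2 := by
  rcases le_total x y with hxy | hxy
  · exact h.upper_right hxy
  · have := h.reflect.upper_right (neg_le_neg hxy)
    simp only [neg_neg] at this
    linarith

theorem W_nonneg (h : IsConvexPotential W g p z k B) (x : ℝ) : 0 ≤ W x := by
  simpa [h.W_min, h.g_min] using h.lower z x

theorem W_le_sq (h : IsConvexPotential W g p z k B) (x : ℝ) : W x ≤ B / 2 * (x - z) ^ 2 := by
  simpa [h.W_min, h.g_min] using h.upper z x

theorem abs_W_sub_le (h : IsConvexPotential W g p z k B) (x y : ℝ) :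
    |W y - W x| ≤ k * |y - x| := by
  have h1 := h.lower x y
  have h2 := h.lower y x
  have h3 : |g x * (y - x)| ≤ k * |y - x| := by
    rw [abs_mul]; exact mul_le_mul_of_nonneg_right (h.abs_g_le x) (abs_nonneg _)
  have h4 : |g y * (x - y)| ≤ k * |y - x| := by
    rw [abs_mul, abs_sub_comm x y]
    exact mul_le_mul_of_nonneg_right (h.abs_g_le y) (abs_nonneg _)
  rw [abs_le] at *
  constructor <;> linarith [h3.1, h3.2, h4.1, h4.2]

theorem W_le_abs (h : IsConvexPotential W g p z k B) (x : ℝ) : W x ≤ k * |x - z| := by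
  have := h.abs_W_sub_le z x
  rw [h.W_min, sub_zero] at this
  exact (le_abs_self _).trans this

/-- The value at the gradient step `x - g x / B` is nonnegative, and the quadratic upper bound makes
it at most `W x - g x ^ 2 / (2 * B)`. -/
theorem sq_g_le (h : IsConvexPotential W g p z k B) (x : ℝ) : g x ^ 2 ≤ 2 * B * W x := by
  have h1 := h.upper x (x - g x / B)
  have h2 := h.W_nonneg (x - g x / B)
  have hB := h.B_pos
  have e : W x + g x * (x - g x / B - x) + B / 2 * (x - g x / B - x) ^ 2
      = W x - g x ^ 2 / (2 * B) := by field_simp; ring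
  rw [e] at h1
  have h3 : g x ^ 2 / (2 * B) ≤ W x := by linarith
  rw [div_le_iff₀ (by positivity)] at h3
  linarith

theorem g_sub_linear_right (h : IsConvexPotential W g p z k B) {lip : ℝ}
    (hlip : ∀ x, |p x - p z| ≤ lip * |x - z|) {x : ℝ} (hx : z ≤ x) :
    |g x - p z * (x - z)| ≤ lip / 2 * (x - z) ^ 2 := by
  have key : ∀ t, z < t → |p t - p z| ≤ lip * (t - z) := fun t ht => by
    simpa [abs_of_pos (sub_pos.2 ht)] using hlip t
  have h1 := nonneg_of_hasDerivAt_nonneg_right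
    (h := fun t => lip / 2 * (t - z) ^ 2 - (g t - p z * (t - z)))
    (h' := fun t => lip / 2 * (((2 : ℕ) : ℝ) * (t - z) ^ (2 - 1) * 1) - (p t - p z * 1)) (z := z)
    (fun t => ((((hasDerivAt_id t).sub_const z).pow 2).const_mul (lip / 2)).sub
      ((h.hasDerivAt_g t).sub (((hasDerivAt_id t).sub_const z).const_mul (p z))))
    (by simp [h.g_min]) (fun t ht => by have := (abs_le.1 (key t ht)).2; norm_num; linarith) hx
  have h2 := nonneg_of_hasDerivAt_nonneg_right
    (h := fun t => lip / 2 * (t - z) ^ 2 + (g t - p z * (t - z)))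
    (h' := fun t => lip / 2 * (((2 : ℕ) : ℝ) * (t - z) ^ (2 - 1) * 1) + (p t - p z * 1)) (z := z)
    (fun t => ((((hasDerivAt_id t).sub_const z).pow 2).const_mul (lip / 2)).add
      ((h.hasDerivAt_g t).sub (((hasDerivAt_id t).sub_const z).const_mul (p z))))
    (by simp [h.g_min]) (fun t ht => by have := (abs_le.1 (key t ht)).1; norm_num; linarith) hx
  rw [abs_le]
  constructor <;> linarith

theorem g_sub_linear (h : IsConvexPotential W g p z k B) {lip : ℝ}
    (hlip : ∀ x, |p x - p z| ≤ lip * |x - z|) (x : ℝ) :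
    |g x - p z * (x - z)| ≤ lip / 2 * (x - z) ^ 2 := by
  rcases le_total z x with hx | hx
  · exact h.g_sub_linear_right hlip hx
  · have := h.reflect.g_sub_linear_right (lip := lip)
      (fun x => by simpa [abs_sub_comm, neg_add_eq_sub, add_comm] using hlip (-x)) (neg_le_neg hx)
    simp only [neg_neg] at this
    have e : -g x - p z * (-x - -z) = -(g x - p z * (x - z)) := by ring
    rw [e, abs_neg] at this
    linarith

theorem W_upper_cubic_right (h : IsConvexPotential W g p z k B) {lip : ℝ}
    (hlip : ∀ x, |p x - p z| ≤ lip * |x - z|) {x : ℝ} (hx : z ≤ x) :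
    W x ≤ p z / 2 * (x - z) ^ 2 + lip / 6 * (x - z) ^ 3 := by
  have h1 := nonneg_of_hasDerivAt_nonneg_right
    (h := fun t => p z / 2 * (t - z) ^ 2 + lip / 6 * (t - z) ^ 3 - W t)
    (h' := fun t => p z / 2 * (((2 : ℕ) : ℝ) * (t - z) ^ (2 - 1) * 1)
      + lip / 6 * (((3 : ℕ) : ℝ) * (t - z) ^ (3 - 1) * 1) - g t) (z := z)
    (fun t => (((((hasDerivAt_id t).sub_const z).pow 2).const_mul (p z / 2)).add
      ((((hasDerivAt_id t).sub_const z).pow 3).const_mul (lip / 6))).sub (h.hasDerivAt_W t))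
    (by simp [h.W_min])
    (fun t ht => by have := (abs_le.1 (h.g_sub_linear hlip t)).2; norm_num; linarith) hx
  linarith

/-- The two arguments of the minimum defining the rate correspond to two regions. Within `p z / lip`
of the minimizer, Taylor bounds give `g² ≥ (3/8) p z W`, and the term `2 W` of the bracket suffices.
Beyond it, monotonicity keeps `g` above its lower bound `(p z)² / (2 lip)` at that distance, and the
term `μ W²` suffices. -/
theorem drift_right (h : IsConvexPotential W g p z k B) {lip μ l : ℝ} (hlip0 : 0 < lip)
    (hlip : ∀ x, |p x - p z| ≤ lip * |x - z|) (hμ : 0 ≤ μ) (ha : 0 < p z)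
    (hl1 : l ≤ 3 / 4 * p z) (hl2 : l ≤ μ * (p z ^ 4 / (4 * lip ^ 2))) {x : ℝ} (hx : z ≤ x) :
    l * W x ^ 2 ≤ g x ^ 2 * (2 * W x + μ * W x ^ 2) := by
  have hW := h.W_nonneg x
  set a := p z
  rcases le_total (x - z) (a / lip) with hs | hs
  · have hg := (abs_le.1 (h.g_sub_linear hlip x)).1
    have hWu := h.W_upper_cubic_right hlip hx
    set s := x - z with hsdef
    have hs0 : 0 ≤ s := sub_nonneg.2 hx
    obtain ⟨t, ht⟩ : ∃ t, t = lip * s / a := ⟨_, rfl⟩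
    have hta : lip * s = t * a := by rw [ht]; field_simp
    have ht0 : 0 ≤ t := by rw [ht]; positivity
    have ht1 : t ≤ 1 := by
      rw [le_div_iff₀ hlip0] at hs
      rw [ht, div_le_one ha]; linarith
    have e1 : a * s * (1 - t / 2) ≤ g x := by
      have : lip / 2 * s ^ 2 = a * s * (t / 2) := by
        calc lip / 2 * s ^ 2 = (lip * s) * s / 2 := by ring
          _ = _ := by rw [hta]; ring
      linarith
    have e2 : W x ≤ a * s ^ 2 * (1 / 2 + t / 6) := by
      have : lip / 6 * s ^ 3 = a * s ^ 2 * (t / 6) := by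
        calc lip / 6 * s ^ 3 = (lip * s) * s ^ 2 / 6 := by ring
          _ = _ := by rw [hta]; ring
      linarith
    have e0 : 0 ≤ a * s * (1 - t / 2) := mul_nonneg (by positivity) (by linarith)
    have e3 : (a * s * (1 - t / 2)) ^ 2 ≤ g x ^ 2 := pow_le_pow_left₀ e0 e1 2
    -- Equality holds at `t = 1`: this is the origin of `3/8`.
    have e4 : 3 / 8 * (1 / 2 + t / 6) ≤ (1 - t / 2) ^ 2 := by nlinarith
    have e5 : 3 / 8 * a * W x ≤ g x ^ 2 := by
      calc 3 / 8 * a * W x ≤ 3 / 8 * a * (a * s ^ 2 * (1 / 2 + t / 6)) := by gcongr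
        _ = a ^ 2 * s ^ 2 * (3 / 8 * (1 / 2 + t / 6)) := by ring
        _ ≤ a ^ 2 * s ^ 2 * (1 - t / 2) ^ 2 := by gcongr
        _ = (a * s * (1 - t / 2)) ^ 2 := by ring
        _ ≤ g x ^ 2 := e3
    calc l * W x ^ 2 ≤ 3 / 4 * a * W x ^ 2 := by gcongr
      _ = 3 / 8 * a * W x * (2 * W x) := by ring
      _ ≤ g x ^ 2 * (2 * W x) := by gcongr
      _ ≤ g x ^ 2 * (2 * W x + μ * W x ^ 2) := by
          gcongr; linarith [mul_nonneg hμ (sq_nonneg (W x))]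
  · have hg := (abs_le.1 (h.g_sub_linear hlip (z + a / lip))).1
    have hm : g (z + a / lip) ≤ g x := h.g_mono (by linarith)
    have e1 : a ^ 2 / (2 * lip) ≤ g x := by
      have : lip / 2 * (z + a / lip - z) ^ 2 = a ^ 2 / (2 * lip) := by field_simp; ring
      have : a * (z + a / lip - z) = a ^ 2 / (2 * lip) + a ^ 2 / (2 * lip) := by field_simp; ring
      linarith
    have e2 : (a ^ 2 / (2 * lip)) ^ 2 ≤ g x ^ 2 := pow_le_pow_left₀ (by positivity) e1 2
    calc l * W x ^ 2 ≤ μ * (a ^ 4 / (4 * lip ^ 2)) * W x ^ 2 := by gcongr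
      _ = (a ^ 2 / (2 * lip)) ^ 2 * (μ * W x ^ 2) := by field_simp; ring
      _ ≤ g x ^ 2 * (μ * W x ^ 2) := by gcongr
      _ ≤ g x ^ 2 * (2 * W x + μ * W x ^ 2) := by gcongr; linarith

theorem drift (h : IsConvexPotential W g p z k B) {lip μ l : ℝ} (hlip0 : 0 < lip)
    (hlip : ∀ x, |p x - p z| ≤ lip * |x - z|) (hμ : 0 ≤ μ) (ha : 0 < p z)
    (hl1 : l ≤ 3 / 4 * p z) (hl2 : l ≤ μ * (p z ^ 4 / (4 * lip ^ 2))) (x : ℝ) :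
    l * W x ^ 2 ≤ g x ^ 2 * (2 * W x + μ * W x ^ 2) := by
  rcases le_total z x with hx | hx
  · exact h.drift_right hlip0 hlip hμ ha hl1 hl2 hx
  · have := h.reflect.drift_right (lip := lip) (μ := μ) (l := l) hlip0
      (fun x => by simpa [abs_sub_comm, neg_add_eq_sub, add_comm] using hlip (-x)) hμ
      (by simpa using ha) (by simpa using hl1) (by simpa using hl2) (neg_le_neg hx)
    simpa using this

/-- The second derivative is bounded below only near the minimizer. Two integrations give quadratic
growth there; beyond, the graph lies above its tangent at `z + 1`, hence growth is linear. -/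
theorem W_lower_right (h : IsConvexPotential W g p z k B) {c : ℝ} (hc0 : 0 ≤ c)
    (hc : ∀ x, |x - z| ≤ 1 → c ≤ p x) {x : ℝ} (hx : z ≤ x) :
    (x - z ≤ 1 → c / 2 * (x - z) ^ 2 ≤ W x) ∧ (1 ≤ x - z → c / 2 * (x - z) ≤ W x) := by
  have hg : ∀ t, z ≤ t → t ≤ z + 1 → c * (t - z) ≤ g t := by
    intro t h1 h2
    have hm : MonotoneOn (fun t => g t - c * (t - z)) (Set.Icc z (z + 1)) := by
      have hd : ∀ t, HasDerivAt (fun t => g t - c * (t - z)) (p t - c * 1) t := fun t =>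
        (h.hasDerivAt_g t).sub (((hasDerivAt_id t).sub_const z).const_mul c)
      apply monotoneOn_of_deriv_nonneg (convex_Icc _ _)
      · exact fun x _ => (hd x).continuousAt.continuousWithinAt
      · exact fun x _ => (hd x).differentiableAt.differentiableWithinAt
      · intro x hx
        rw [interior_Icc] at hx
        rw [(hd x).deriv]
        have := hc x (by rw [abs_le]; constructor <;> linarith [hx.1, hx.2])
        linarith
    have := hm (Set.left_mem_Icc.2 (by linarith)) ⟨h1, h2⟩ h1
    simp only [h.g_min, sub_self, mul_zero] at this
    linarith
  have hW : ∀ t, z ≤ t → t ≤ z + 1 → c / 2 * (t - z) ^ 2 ≤ W t := by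
    intro t h1 h2
    have hm : MonotoneOn (fun t => W t - c / 2 * (t - z) ^ 2) (Set.Icc z (z + 1)) := by
      have hd : ∀ t, HasDerivAt (fun t => W t - c / 2 * (t - z) ^ 2)
          (g t - c / 2 * (((2 : ℕ) : ℝ) * (t - z) ^ (2 - 1) * 1)) t := fun t =>
        (h.hasDerivAt_W t).sub ((((hasDerivAt_id t).sub_const z).pow 2).const_mul (c / 2))
      apply monotoneOn_of_deriv_nonneg (convex_Icc _ _)
      · exact fun x _ => (hd x).continuousAt.continuousWithinAt
      · exact fun x _ => (hd x).differentiableAt.differentiableWithinAt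
      · intro x hx
        rw [interior_Icc] at hx
        rw [(hd x).deriv]
        have := hg x hx.1.le hx.2.le
        norm_num
        linarith
    have := hm (Set.left_mem_Icc.2 (by linarith)) ⟨h1, h2⟩ h1
    simp only [h.W_min, sub_self] at this
    norm_num at this
    linarith
  refine ⟨fun h1 => hW x hx (by linarith), fun h1 => ?_⟩
  have e1 := hW (z + 1) (by linarith) le_rfl
  have e2 := hg (z + 1) (by linarith) le_rfl
  have e3 := h.lower (z + 1) x
  have e4 : c * (x - (z + 1)) ≤ g (z + 1) * (x - (z + 1)) := by
    have : c ≤ g (z + 1) := by linarith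
    gcongr; linarith
  nlinarith

theorem W_lower (h : IsConvexPotential W g p z k B) {c : ℝ} (hc0 : 0 ≤ c)
    (hc : ∀ x, |x - z| ≤ 1 → c ≤ p x) (x : ℝ) :
    (|x - z| ≤ 1 → c / 2 * (x - z) ^ 2 ≤ W x) ∧ (1 ≤ |x - z| → c / 2 * |x - z| ≤ W x) := by
  rcases le_total z x with hx | hx
  · rw [abs_of_nonneg (sub_nonneg.2 hx)]
    exact h.W_lower_right hc0 hc hx
  · have := h.reflect.W_lower_right hc0
      (fun x hx => hc _ (by
        rw [← abs_neg] at hx; simpa [neg_add_eq_sub, add_comm] using hx)) (neg_le_neg hx)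
    rw [abs_of_nonpos (sub_nonpos.2 hx)]
    simp only [neg_neg] at this
    constructor
    · intro h1
      have := this.1 (by linarith)
      nlinarith
    · intro h1
      have := this.2 (by linarith)
      linarith

end IsConvexPotential

/-- `φ(w) = w² e^{μ w}`. -/
noncomputable def expSq (μ w : ℝ) : ℝ := w ^ 2 * Real.exp (μ * w)

theorem expSq_nonneg (μ w : ℝ) : 0 ≤ expSq μ w := by unfold expSq; positivity

theorem exp_le_one_add_add {μ T d : ℝ} (hμ : 0 ≤ μ) (hd : |d| ≤ T) :
    Real.exp (μ * d) ≤ 1 + μ * d + μ ^ 2 * Real.exp (μ * T) * d ^ 2 := by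
  have h2 : Real.exp (μ * d) - (1 + μ * d) ≤ |μ * d| ^ 2 * Real.exp |μ * d| := by
    have := Complex.norm_exp_sub_sum_le_norm_mul_exp ((μ * d : ℝ) : ℂ) 2
    simp only [Finset.sum_range_succ, Finset.range_zero, Finset.sum_empty, pow_zero,
      Nat.factorial, pow_one, Complex.norm_real, Real.norm_eq_abs] at this
    have e : (Complex.exp ((μ * d : ℝ) : ℂ) - (0 + 1 / ((1 : ℕ) : ℂ)
        + ((μ * d : ℝ) : ℂ) / (((0 + 1) * 1 : ℕ) : ℂ)))
        = ((Real.exp (μ * d) - (1 + μ * d) : ℝ) : ℂ) := by push_cast; ring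
    rw [e, Complex.norm_real, Real.norm_eq_abs] at this
    exact (le_abs_self _).trans this
  have h3 : |μ * d| ≤ μ * T := by rw [abs_mul, abs_of_nonneg hμ]; gcongr
  have h4 : Real.exp |μ * d| ≤ Real.exp (μ * T) := Real.exp_le_exp.2 h3
  have h5 : |μ * d| ^ 2 * Real.exp |μ * d| ≤ |μ * d| ^ 2 * Real.exp (μ * T) := by gcongr
  rw [sq_abs] at h2 h5
  linarith

/-- A second-order expansion in which the coefficient of `d` is the exact derivative of `w² e^{μ
w}`. The error must carry the factor `e^{μ w}` so that it can be compared with the function itself.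
-/
theorem expSq_add_le {μ T : ℝ} (hμ : 0 ≤ μ) (hT : 0 ≤ T) :
    ∃ C, 0 ≤ C ∧ ∀ w d : ℝ, |d| ≤ T →
      expSq μ (w + d) ≤ expSq μ w + (2 * w + μ * w ^ 2) * Real.exp (μ * w) * d
        + C * (d ^ 2 * (1 + w ^ 2) * Real.exp (μ * w)) := by
  set E := μ ^ 2 * Real.exp (μ * T) with hE
  have hE0 : 0 ≤ E := by positivity
  refine ⟨1 + μ + μ * T + 2 * E + 2 * E * T ^ 2, by positivity, fun w d hd => ?_⟩
  have h1 := exp_le_one_add_add hμ hd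
  rw [← hE] at h1
  have hdT := abs_le.1 hd
  have hd2 : d ^ 2 ≤ T ^ 2 := sq_le_sq' hdT.1 hdT.2
  have hrem : 1 + 2 * μ * w + μ * d + E * (w + d) ^ 2
      ≤ (1 + μ + μ * T + 2 * E + 2 * E * T ^ 2) * (1 + w ^ 2) := by
    have a1 : 2 * μ * w ≤ μ * (1 + w ^ 2) := by nlinarith [mul_nonneg hμ (sq_nonneg (w - 1))]
    have a2 : μ * d ≤ μ * T := by gcongr; exact hdT.2
    have a3 : E * (w + d) ^ 2 ≤ E * (2 * w ^ 2 + 2 * T ^ 2) := by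
      gcongr; nlinarith [sq_nonneg (w - d)]
    have a4 : 0 ≤ (1 + μ * T + 2 * E * T ^ 2) * w ^ 2 := by positivity
    nlinarith
  have key : (w + d) ^ 2 * Real.exp (μ * d) ≤ w ^ 2 + (2 * w + μ * w ^ 2) * d
      + (1 + μ + μ * T + 2 * E + 2 * E * T ^ 2) * (d ^ 2 * (1 + w ^ 2)) := by
    calc (w + d) ^ 2 * Real.exp (μ * d) ≤ (w + d) ^ 2 * (1 + μ * d + E * d ^ 2) := by gcongr
      _ = w ^ 2 + (2 * w + μ * w ^ 2) * d
          + d ^ 2 * (1 + 2 * μ * w + μ * d + E * (w + d) ^ 2) := by ring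
      _ ≤ w ^ 2 + (2 * w + μ * w ^ 2) * d + d ^ 2 *
          ((1 + μ + μ * T + 2 * E + 2 * E * T ^ 2) * (1 + w ^ 2)) := by gcongr
      _ = _ := by ring
  unfold expSq
  rw [mul_add, Real.exp_add]
  calc (w + d) ^ 2 * (Real.exp (μ * w) * Real.exp (μ * d))
      = ((w + d) ^ 2 * Real.exp (μ * d)) * Real.exp (μ * w) := by ring
    _ ≤ (w ^ 2 + (2 * w + μ * w ^ 2) * d
      + (1 + μ + μ * T + 2 * E + 2 * E * T ^ 2) * (d ^ 2 * (1 + w ^ 2))) * Real.exp (μ * w) := by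
        gcongr
    _ = _ := by ring

/-- For `w ≥ 1` lower powers of `w` times `e^{μ w}` are dominated by `w² e^{μ w}`; for `w ≤ 1` the
exponential is at most `e^μ`. -/
theorem exp_le_expSq {μ w : ℝ} (hμ : 0 ≤ μ) (hw : 0 ≤ w) :
    Real.exp (μ * w) ≤ Real.exp μ + expSq μ w ∧
      w * Real.exp (μ * w) ≤ Real.exp μ * w + expSq μ w ∧
      w ^ 2 ≤ expSq μ w := by
  have he := Real.exp_pos (μ * w)
  have h1 : 1 ≤ Real.exp (μ * w) := Real.one_le_exp (by positivity)
  refine ⟨?_, ?_, ?_⟩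
  · rcases le_total w 1 with h | h
    · have : Real.exp (μ * w) ≤ Real.exp μ := Real.exp_le_exp.2 (by nlinarith)
      linarith [expSq_nonneg μ w]
    · unfold expSq
      have : 1 ≤ w ^ 2 := by nlinarith
      nlinarith [Real.exp_pos μ]
  · rcases le_total w 1 with h | h
    · have : Real.exp (μ * w) ≤ Real.exp μ := Real.exp_le_exp.2 (by nlinarith)
      nlinarith [expSq_nonneg μ w]
    · unfold expSq
      have : w ≤ w ^ 2 := by nlinarith
      nlinarith [mul_nonneg (Real.exp_pos μ).le hw]
  · unfold expSq; nlinarith [sq_nonneg w]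

/-- Expansion of `W² e^{μ W}` along an increment of size at most `k c`. -/
theorem expSq_increment_le {k B μ G : ℝ} (hk : 0 < k) (hB : 0 < B) (hμ : 0 ≤ μ) (hG : 0 < G) :
    ∃ a, 0 ≤ a ∧ ∀ (W g p : ℝ → ℝ) (z : ℝ), IsConvexPotential W g p z k B →
      ∀ y c u : ℝ, 0 < c → c ≤ G → |u| ≤ k * c →
        expSq μ (W (y + u)) ≤ expSq μ (W y)
          + (2 * W y + μ * W y ^ 2) * Real.exp (μ * W y) * g y * u
          + a * (c ^ 2 * W y + c ^ 2 * W y ^ 2 + c ^ 4 * (1 + W y ^ 2)) * Real.exp (μ * W y) := by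
  obtain ⟨C₁, hC₁, hφ⟩ := expSq_add_le hμ (T := k * (k * G)) (by positivity)
  set a₁ := B * k ^ 2 + C₁ * (4 * B * k ^ 2) with ha₁
  set a₂ := μ * B * k ^ 2 / 2 + C₁ * (2 * k ^ 4) with ha₂
  set a₃ := C₁ * (B ^ 2 * k ^ 4 / 2) with ha₃
  have ha₁0 : 0 ≤ a₁ := by positivity
  have ha₂0 : 0 ≤ a₂ := by positivity
  have ha₃0 : 0 ≤ a₃ := by positivity
  refine ⟨a₁ + a₂ + a₃, by positivity, fun W g p z hW y c u hc hcG hu => ?_⟩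
  have hw := hW.W_nonneg y
  obtain ⟨w, hwdef⟩ : ∃ w, w = W y := ⟨_, rfl⟩
  rw [← hwdef] at hw ⊢
  have hgk : g y ^ 2 ≤ k ^ 2 := by
    rw [← sq_abs]; exact pow_le_pow_left₀ (abs_nonneg _) (hW.abs_g_le y) 2
  have hgB := hW.sq_g_le y
  rw [← hwdef] at hgB
  have he := Real.exp_pos (μ * w)
  have hu2 : u ^ 2 ≤ k ^ 2 * c ^ 2 := by
    rw [← sq_abs, ← mul_pow]; exact pow_le_pow_left₀ (abs_nonneg _) hu 2
  obtain ⟨d, hd⟩ : ∃ d, d = W (y + u) - w := ⟨_, rfl⟩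
  have hd1 : |d| ≤ k * |u| := by
    have := hW.abs_W_sub_le y (y + u)
    rw [hd, hwdef]; simpa using this
  have hd2 : d ≤ g y * u + B / 2 * u ^ 2 := by
    have := hW.upper y (y + u)
    rw [hd, hwdef]
    simp only [add_sub_cancel_left] at this
    linarith
  have hd3 : g y * u ≤ d := by
    have := hW.lower y (y + u)
    rw [hd, hwdef]
    simp only [add_sub_cancel_left] at this
    linarith
  have hd4 : d ^ 2 ≤ 2 * g y ^ 2 * u ^ 2 + B ^ 2 / 2 * u ^ 4 := by
    have e1 : (d - g y * u) ^ 2 ≤ (B / 2 * u ^ 2) ^ 2 :=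
      pow_le_pow_left₀ (by linarith) (by linarith) 2
    nlinarith [sq_nonneg (d - g y * u - g y * u)]
  have h1 := hφ w d (hd1.trans (by gcongr; exact hu.trans (by gcongr)))
  have e1 : w + d = W (y + u) := by rw [hd]; ring
  rw [e1] at h1
  have hw2 : 0 ≤ 2 * w + μ * w ^ 2 := by positivity
  have e2 : (2 * w + μ * w ^ 2) * d
      ≤ (2 * w + μ * w ^ 2) * (g y * u) + (2 * w + μ * w ^ 2) * (B / 2 * (k ^ 2 * c ^ 2)) := by
    rw [← mul_add]
    refine mul_le_mul_of_nonneg_left (hd2.trans ?_) hw2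
    gcongr
  have hu4 : u ^ 4 ≤ k ^ 4 * c ^ 4 := by
    calc u ^ 4 = (u ^ 2) ^ 2 := by ring
      _ ≤ (k ^ 2 * c ^ 2) ^ 2 := pow_le_pow_left₀ (sq_nonneg _) hu2 2
      _ = _ := by ring
  -- In the product without `w²`, the bound `g² ≤ 2 B W` is used rather than `g² ≤ k²`: it leaves a
  -- factor `w`. A bare `c²` would be too large for the decay `γ²` aimed at.
  have e3 : d ^ 2 * (1 + w ^ 2) ≤ 2 * k ^ 2 * c ^ 2 * (2 * B * w + k ^ 2 * w ^ 2)
      + B ^ 2 / 2 * (k ^ 4 * c ^ 4) * (1 + w ^ 2) := by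
    calc d ^ 2 * (1 + w ^ 2) ≤ (2 * g y ^ 2 * u ^ 2 + B ^ 2 / 2 * u ^ 4) * (1 + w ^ 2) := by
          gcongr
      _ = 2 * u ^ 2 * (g y ^ 2 + g y ^ 2 * w ^ 2) + B ^ 2 / 2 * u ^ 4 * (1 + w ^ 2) := by ring
      _ ≤ 2 * (k ^ 2 * c ^ 2) * (2 * B * w + k ^ 2 * w ^ 2)
          + B ^ 2 / 2 * (k ^ 4 * c ^ 4) * (1 + w ^ 2) := by gcongr
      _ = _ := by ring
  have e4 : a₁ * (c ^ 2 * w) + a₂ * (c ^ 2 * w ^ 2) + a₃ * (c ^ 4 * (1 + w ^ 2))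
      ≤ (a₁ + a₂ + a₃) * (c ^ 2 * w + c ^ 2 * w ^ 2 + c ^ 4 * (1 + w ^ 2)) := by
    have q1 : 0 ≤ c ^ 2 * w := by positivity
    have q2 : 0 ≤ c ^ 2 * w ^ 2 := by positivity
    have q3 : 0 ≤ c ^ 4 * (1 + w ^ 2) := by positivity
    have q := add_nonneg (add_nonneg q1 q2) q3
    have r1 : a₁ * (c ^ 2 * w) ≤ a₁ * (c ^ 2 * w + c ^ 2 * w ^ 2 + c ^ 4 * (1 + w ^ 2)) := by
      gcongr; linarith
    have r2 : a₂ * (c ^ 2 * w ^ 2) ≤ a₂ * (c ^ 2 * w + c ^ 2 * w ^ 2 + c ^ 4 * (1 + w ^ 2)) := by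
      gcongr; linarith
    have r3 : a₃ * (c ^ 4 * (1 + w ^ 2))
        ≤ a₃ * (c ^ 2 * w + c ^ 2 * w ^ 2 + c ^ 4 * (1 + w ^ 2)) := by
      gcongr; linarith
    linarith
  calc expSq μ (W (y + u)) ≤ expSq μ w + ((2 * w + μ * w ^ 2) * d
        + C₁ * (d ^ 2 * (1 + w ^ 2))) * Real.exp (μ * w) := by linarith
    _ ≤ expSq μ w + ((2 * w + μ * w ^ 2) * (g y * u)
        + (2 * w + μ * w ^ 2) * (B / 2 * (k ^ 2 * c ^ 2))
        + C₁ * (2 * k ^ 2 * c ^ 2 * (2 * B * w + k ^ 2 * w ^ 2)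
          + B ^ 2 / 2 * (k ^ 4 * c ^ 4) * (1 + w ^ 2))) * Real.exp (μ * w) := by
        gcongr
    _ = expSq μ w + (2 * w + μ * w ^ 2) * Real.exp (μ * w) * g y * u
        + (a₁ * (c ^ 2 * w) + a₂ * (c ^ 2 * w ^ 2) + a₃ * (c ^ 4 * (1 + w ^ 2)))
          * Real.exp (μ * w) := by rw [ha₁, ha₂, ha₃]; ring
    _ ≤ _ := by gcongr

/-- The critical term is `c² w`. Young's inequality splits it into `η c w²`, paid by a small part of
the drift, and `c³`, the forcing compatible with a decay of order `c²`. -/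
theorem expSq_remainder_le {a μ G η : ℝ} (ha : 0 ≤ a) (hμ : 0 ≤ μ) (hG : 0 < G) (hη : 0 < η) :
    ∃ C, 0 ≤ C ∧ ∀ w c : ℝ, 0 ≤ w → 0 < c → c ≤ G →
      a * (c ^ 2 * w + c ^ 2 * w ^ 2 + c ^ 4 * (1 + w ^ 2)) * Real.exp (μ * w)
        ≤ η * c * expSq μ w + C * c ^ 2 * expSq μ w + C * c ^ 3 := by
  set b := a * Real.exp μ with hb
  have hb0 : 0 ≤ b := by positivity
  refine ⟨2 * a + a * (2 * G ^ 2) + a * G * Real.exp μ + b ^ 2 / (4 * η), by positivity,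
    fun w c hw hc hcG => ?_⟩
  set C := 2 * a + a * (2 * G ^ 2) + a * G * Real.exp μ + b ^ 2 / (4 * η) with hC
  obtain ⟨x1, x2, x3⟩ := exp_le_expSq hμ hw
  have hφ0 := expSq_nonneg μ w
  have y3 : a * (c ^ 2 * w + c ^ 2 * w ^ 2 + c ^ 4 * (1 + w ^ 2)) * Real.exp (μ * w)
      = a * c ^ 2 * (w * Real.exp (μ * w)) + a * c ^ 2 * expSq μ w
      + a * c ^ 4 * Real.exp (μ * w) + a * c ^ 4 * expSq μ w := by
    unfold expSq; ring
  generalize expSq μ w = F at *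
  have y1 : a * c ^ 2 * (w * Real.exp (μ * w)) ≤ a * c ^ 2 * (Real.exp μ * w + F) := by
    gcongr
  have y2 : a * c ^ 4 * Real.exp (μ * w) ≤ a * c ^ 4 * (Real.exp μ + F) := by gcongr
  have y4 : b * c ^ 2 * w ≤ η * c * F + b ^ 2 / (4 * η) * c ^ 3 := by
    have : b * c * w ≤ η * w ^ 2 + b ^ 2 / (4 * η) * c ^ 2 := by
      have : 0 ≤ (2 * η * w - b * c) ^ 2 / (4 * η) := by positivity
      have e : (2 * η * w - b * c) ^ 2 / (4 * η)
        = η * w ^ 2 + b ^ 2 / (4 * η) * c ^ 2 - b * c * w := by field_simp; ring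
      linarith
    calc b * c ^ 2 * w = c * (b * c * w) := by ring
      _ ≤ c * (η * w ^ 2 + b ^ 2 / (4 * η) * c ^ 2) := by gcongr
      _ = η * c * w ^ 2 + b ^ 2 / (4 * η) * c ^ 3 := by ring
      _ ≤ _ := by gcongr
  have y5 : a * c ^ 4 * F ≤ a * G ^ 2 * (c ^ 2 * F) := by
    have : c ^ 4 ≤ G ^ 2 * c ^ 2 := by
      calc c ^ 4 = c ^ 2 * c ^ 2 := by ring
        _ ≤ G ^ 2 * c ^ 2 := by gcongr
    calc a * c ^ 4 * F ≤ a * (G ^ 2 * c ^ 2) * F := by gcongr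
      _ = _ := by ring
  have y6 : a * c ^ 4 * Real.exp μ ≤ a * G * Real.exp μ * c ^ 3 := by
    have : c ^ 4 ≤ G * c ^ 3 := by
      calc c ^ 4 = c * c ^ 3 := by ring
        _ ≤ G * c ^ 3 := by gcongr
    calc a * c ^ 4 * Real.exp μ ≤ a * (G * c ^ 3) * Real.exp μ := by gcongr
      _ = _ := by ring
  have y7 : (2 * a + a * (2 * G ^ 2)) * (c ^ 2 * F) ≤ C * (c ^ 2 * F) := by
    gcongr
    rw [hC]
    have : 0 ≤ a * G * Real.exp μ + b ^ 2 / (4 * η) := by positivity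
    linarith
  have y8 : (a * G * Real.exp μ + b ^ 2 / (4 * η)) * c ^ 3 ≤ C * c ^ 3 := by
    gcongr
    rw [hC]
    have : 0 ≤ 2 * a + a * (2 * G ^ 2) := by positivity
    linarith
  have y9 : a * c ^ 2 * (Real.exp μ * w + F) = b * c ^ 2 * w + a * (c ^ 2 * F) := by
    rw [hb]; ring
  clear_value C b
  rw [y3]
  linarith

/-- The Lyapunov function `W² e^{μ W}` contracts along one step of the scheme. -/
theorem lyapunov_step {k B μ G η : ℝ} (hk : 0 < k) (hB : 0 < B) (hμ : 0 ≤ μ) (hG : 0 < G)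
    (hη : 0 < η) :
    ∃ C, 0 ≤ C ∧ ∀ (W g p : ℝ → ℝ) (z l : ℝ), IsConvexPotential W g p z k B →
      (∀ x, l * W x ^ 2 ≤ g x ^ 2 * (2 * W x + μ * W x ^ 2)) →
      ∀ y c θ u v : ℝ, 0 < c → c ≤ G → 0 ≤ θ → θ ≤ 1 → |u| ≤ k * c → |v| ≤ k * c →
        θ * u + (1 - θ) * v = -c * g y →
        θ * expSq μ (W (y + u)) + (1 - θ) * expSq μ (W (y + v))
          ≤ (1 - (l - η) * c + C * c ^ 2) * expSq μ (W y) + C * c ^ 3 := by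
  obtain ⟨a, ha, hstep⟩ := expSq_increment_le hk hB hμ hG
  obtain ⟨C, hC0, hrem⟩ := expSq_remainder_le ha hμ hG hη
  refine ⟨C, hC0, fun W g p z l hW hdrift y c θ u v hc hcG hθ0 hθ1 hu hv huv => ?_⟩
  have hw := hW.W_nonneg y
  have hs1 := mul_le_mul_of_nonneg_left (hstep W g p z hW y c u hc hcG hu) hθ0
  have hs2 := mul_le_mul_of_nonneg_left (hstep W g p z hW y c v hc hcG hv) (sub_nonneg.2 hθ1)
  have hR := hrem (W y) c hw hc hcG
  have hdr : l * expSq μ (W y) ≤ (2 * W y + μ * W y ^ 2) * Real.exp (μ * W y) * g y * g y := by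
    have := hdrift y
    unfold expSq
    calc l * (W y ^ 2 * Real.exp (μ * W y)) = l * W y ^ 2 * Real.exp (μ * W y) := by ring
      _ ≤ g y ^ 2 * (2 * W y + μ * W y ^ 2) * Real.exp (μ * W y) := by gcongr
      _ = _ := by ring
  have hdr' := mul_le_mul_of_nonneg_left hdr hc.le
  generalize (2 * W y + μ * W y ^ 2) * Real.exp (μ * W y) * g y = A at *
  generalize a * (c ^ 2 * W y + c ^ 2 * W y ^ 2 + c ^ 4 * (1 + W y ^ 2)) * Real.exp (μ * W y) = R
    at *
  -- The mean increment is `-c g`, so the first-order terms average to minus the drift.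
  have hlin : θ * (A * u) + (1 - θ) * (A * v) = -(c * (A * g y)) := by
    calc θ * (A * u) + (1 - θ) * (A * v) = A * (θ * u + (1 - θ) * v) := by ring
      _ = _ := by rw [huv]; ring
  generalize expSq μ (W y) = F at *
  generalize expSq μ (W (y + u)) = F₁ at *
  generalize expSq μ (W (y + v)) = F₂ at *
  linarith

/-- Near the minimizer `W` is at least quadratic and `W²` alone suffices. Farther away `W` is only
known to be at least linear, so `W⁴` is needed; the exponential supplies it through `e^t ≥ t²/2`. -/
theorem IsConvexPotential.pow_four_le_expSq {k B c μ : ℝ} (hc : 0 < c) (hμ : 0 < μ) :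
    ∃ C, 0 ≤ C ∧ ∀ (W g p : ℝ → ℝ) (z : ℝ), IsConvexPotential W g p z k B →
      (∀ x, |x - z| ≤ 1 → c ≤ p x) → ∀ x, (x - z) ^ 4 ≤ C * expSq μ (W x) := by
  refine ⟨4 / c ^ 2 + 32 / (μ ^ 2 * c ^ 4), by positivity, fun W g p z h hp x => ?_⟩
  obtain ⟨h1, h2⟩ := h.W_lower hc.le hp x
  have hW := h.W_nonneg x
  have he : (μ * W x) ^ 2 / 2 ≤ Real.exp (μ * W x) := by
    have := Real.quadratic_le_exp_of_nonneg (x := μ * W x) (by positivity)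
    have : 0 ≤ μ * W x := by positivity
    linarith
  have hφ0 := expSq_nonneg μ (W x)
  rcases le_total (|x - z|) 1 with hx | hx
  · have h3 := (exp_le_expSq hμ.le hW).2.2
    have h4 : (c / 2 * (x - z) ^ 2) ^ 2 ≤ W x ^ 2 := pow_le_pow_left₀ (by positivity) (h1 hx) 2
    have h5 : (x - z) ^ 4 = 4 / c ^ 2 * (c / 2 * (x - z) ^ 2) ^ 2 := by field_simp; ring
    rw [h5, add_mul]
    have : 0 ≤ 32 / (μ ^ 2 * c ^ 4) * expSq μ (W x) := by positivity
    have : 4 / c ^ 2 * (c / 2 * (x - z) ^ 2) ^ 2 ≤ 4 / c ^ 2 * expSq μ (W x) := by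
      gcongr; exact h4.trans h3
    linarith
  · have h4 : (c / 2 * |x - z|) ^ 4 ≤ W x ^ 4 := pow_le_pow_left₀ (by positivity) (h2 hx) 4
    have h6 : μ ^ 2 / 2 * W x ^ 4 ≤ expSq μ (W x) := by
      unfold expSq
      calc μ ^ 2 / 2 * W x ^ 4 = W x ^ 2 * ((μ * W x) ^ 2 / 2) := by ring
        _ ≤ _ := by gcongr
    have h7 : (x - z) ^ 4 = |x - z| ^ 4 := by
      rw [show (4 : ℕ) = 2 * 2 from rfl, pow_mul, pow_mul, sq_abs]
    have h5 : (x - z) ^ 4 = 32 / (μ ^ 2 * c ^ 4) * (μ ^ 2 / 2 * (c / 2 * |x - z|) ^ 4) := by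
      rw [h7]; field_simp; ring
    rw [h5, add_mul]
    have : 0 ≤ 4 / c ^ 2 * expSq μ (W x) := by positivity
    have : 32 / (μ ^ 2 * c ^ 4) * (μ ^ 2 / 2 * (c / 2 * |x - z|) ^ 4)
        ≤ 32 / (μ ^ 2 * c ^ 4) * expSq μ (W x) := by
      gcongr
      refine le_trans ?_ h6
      gcongr
    linarith

theorem IsConvexPotential.expSq_le {W g p : ℝ → ℝ} {z k B μ : ℝ}
    (h : IsConvexPotential W g p z k B) (hμ : 0 ≤ μ) (x : ℝ) :
    expSq μ (W x) ≤ B ^ 2 / 4 * (x - z) ^ 4 * Real.exp (μ * k * |x - z|) := by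
  have hW := h.W_nonneg x
  have h1 : W x ^ 2 ≤ (B / 2 * (x - z) ^ 2) ^ 2 := pow_le_pow_left₀ hW (h.W_le_sq x) 2
  have h2 : Real.exp (μ * W x) ≤ Real.exp (μ * k * |x - z|) := by
    rw [Real.exp_le_exp, mul_assoc]; gcongr; exact h.W_le_abs x
  unfold expSq
  calc W x ^ 2 * Real.exp (μ * W x)
      ≤ (B / 2 * (x - z) ^ 2) ^ 2 * Real.exp (μ * k * |x - z|) := by gcongr
    _ = _ := by ring

end Lyapunov

/-! ### Derivatives of the objective function -/

section Objective

variable {Ω : Type*} [MeasurableSpace Ω] {P : Measure Ω} {X : Ω → ℝ} {f : ℝ → ℝ}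

theorem IsContinuousPDF.measure_eq (hf : IsContinuousPDF P X f) (hX : Measurable X) {s : Set ℝ}
    (hs : MeasurableSet s) : P (X ⁻¹' s) = ∫⁻ x in s, ENNReal.ofReal (f x) := by
  rw [← Measure.map_apply hX hs, hf.map_eq, withDensity_apply _ hs]

theorem IsContinuousPDF.measure_eq_zero (hf : IsContinuousPDF P X f) (hX : Measurable X) (c : ℝ) :
    P {ω | X ω = c} = 0 := by
  have := hf.measure_eq hX (measurableSet_singleton c)
  rw [Measure.restrict_singleton] at this
  have h2 : P (X ⁻¹' {c}) = 0 := by simpa using this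
  exact h2

theorem IsContinuousPDF.ae_ne (hf : IsContinuousPDF P X f) (hX : Measurable X) (c : ℝ) :
    ∀ᵐ ω ∂P, X ω ≠ c := by
  rw [ae_iff]; simpa using hf.measure_eq_zero hX c

variable [IsProbabilityMeasure P]

theorem IsContinuousPDF.cdf_sub (hf : IsContinuousPDF P X f) (hX : Measurable X) {x y : ℝ}
    (hxy : x ≤ y) : P.real {ω | X ω ≤ y} - P.real {ω | X ω ≤ x} = ∫ t in x..y, f t := by
  have h1 : P.real {ω | X ω ≤ y} = P.real {ω | X ω ≤ x} + P.real (X ⁻¹' Set.Ioc x y) := by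
    rw [← measureReal_union]
    · congr 1; ext ω; simp only [Set.mem_ofPred_eq, Set.mem_union, Set.mem_preimage, Set.mem_Ioc]
      constructor
      · intro h; rcases le_or_gt (X ω) x with h' | h'
        · exact Or.inl h'
        · exact Or.inr ⟨h', h⟩
      · rintro (h | h)
        · exact h.trans hxy
        · exact h.2
    · rw [Set.disjoint_left]; intro ω h h'; exact absurd h'.1 (not_lt.2 h)
    · exact hX measurableSet_Ioc
  rw [h1, add_sub_cancel_left, intervalIntegral.integral_of_le hxy,
    integral_eq_lintegral_of_nonneg_ae (Eventually.of_forall hf.nonneg)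
      hf.continuous.aestronglyMeasurable.restrict, measureReal_def,
    hf.measure_eq hX measurableSet_Ioc]

theorem IsContinuousPDF.cdf_sub' (hf : IsContinuousPDF P X f) (hX : Measurable X) (x y : ℝ) :
    P.real {ω | X ω ≤ y} - P.real {ω | X ω ≤ x} = ∫ t in x..y, f t := by
  rcases le_total x y with h | h
  · exact hf.cdf_sub hX h
  · rw [intervalIntegral.integral_symm, ← hf.cdf_sub hX h]; ring

theorem IsContinuousPDF.hasDerivAt_cdf (hf : IsContinuousPDF P X f) (hX : Measurable X) (x : ℝ) :
    HasDerivAt (fun ξ => P.real {ω | X ω ≤ ξ}) (f x) x := by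
  have h1 : (fun ξ => P.real {ω | X ω ≤ ξ}) = fun ξ => P.real {ω | X ω ≤ 0} + ∫ t in (0:ℝ)..ξ, f t := by
    funext ξ; rw [← hf.cdf_sub' hX]; ring
  rw [h1]
  exact (intervalIntegral.integral_hasDerivAt_right (hf.continuous.intervalIntegrable _ _)
    (hf.continuous.stronglyMeasurableAtFilter _ _) hf.continuous.continuousAt).const_add _

theorem IsContinuousPDF.cdf_sub_le (hf : IsContinuousPDF P X f) (hX : Measurable X) {B : ℝ}
    (hB : ∀ x, f x ≤ B) {x y : ℝ} (hxy : x ≤ y) :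
    P.real {ω | X ω ≤ y} - P.real {ω | X ω ≤ x} ≤ B * (y - x) := by
  rw [hf.cdf_sub hX hxy]
  calc ∫ t in x..y, f t ≤ ∫ t in x..y, B :=
        intervalIntegral.integral_mono_on hxy (hf.continuous.intervalIntegrable _ _)
          (by simp) (fun t _ => hB t)
    _ = B * (y - x) := by simp [mul_comm]

theorem IsContinuousPDF.measureReal_le (hf : IsContinuousPDF P X f) (hX : Measurable X) (x : ℝ) :
    P.real {ω | x ≤ X ω} = 1 - P.real {ω | X ω ≤ x} := by
  rw [← probReal_compl_eq_one_sub (measurableSet_le hX measurable_const)]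
  apply measureReal_congr
  filter_upwards [hf.ae_ne hX x] with ω hω
  apply propext
  change x ≤ X ω ↔ ¬ X ω ≤ x
  rw [not_le]
  exact ⟨fun h => lt_of_le_of_ne h hω.symm, le_of_lt⟩

/-- Differentiation under the integral: `c ↦ max (X - c) 0` is 1-Lipschitz, and differentiable at
`ξ` off the event `X = ξ`, which is null because `X` has a density. -/
theorem hasDerivAt_objective (hf : IsContinuousPDF P X f) (hX : Measurable X)
    (hXi : Integrable X P) {α : ℝ} (hα : α < 1) (ξ : ℝ) :
    HasDerivAt (objective P α X) ((P.real {ω | X ω ≤ ξ} - α) / (1 - α)) ξ := by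
  have hint : ∀ c, Integrable (fun ω => max (X ω - c) 0) P := fun c =>
    (hXi.sub (integrable_const c)).pos_part
  have key := (hasDerivAt_integral_of_dominated_loc_of_lip (μ := P) (𝕜 := ℝ)
    (F := fun c ω => max (X ω - c) 0) (F' := fun ω => if ξ ≤ X ω then (-1 : ℝ) else 0)
    (x₀ := ξ) (bound := fun _ => 1) (s := Set.univ) univ_mem
    (Eventually.of_forall fun c => (hint c).aestronglyMeasurable) (hint ξ)
    ?_ ?_ (integrable_const _) ?_).2
  · have hval : ∫ ω, (if ξ ≤ X ω then (-1 : ℝ) else 0) ∂P = -(1 - P.real {ω | X ω ≤ ξ}) := by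
      have : (fun ω => if ξ ≤ X ω then (-1 : ℝ) else 0)
          = Set.indicator {ω | ξ ≤ X ω} (fun _ => (-1 : ℝ)) := by
        funext ω; simp [Set.indicator]
      rw [this, integral_indicator_const _ (measurableSet_le measurable_const hX),
        hf.measureReal_le hX]
      simp
    rw [hval] at key
    have h2 : HasDerivAt (objective P α X) (1 + 1 / (1 - α) * -(1 - P.real {ω | X ω ≤ ξ})) ξ :=
      (hasDerivAt_id ξ).add (key.const_mul (1 / (1 - α)))
    refine h2.congr_deriv ?_
    have : (1 - α) ≠ 0 := by linarith
    field_simp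
    ring
  · exact (Measurable.ite (measurableSet_le measurable_const hX) measurable_const
      measurable_const).aestronglyMeasurable
  · refine Eventually.of_forall fun ω => ?_
    rw [lipschitzOnWith_iff_dist_le_mul]
    intro a _ b _
    simp only [Real.dist_eq]
    have := abs_max_sub_max_le_abs (X ω - a) (X ω - b) 0
    rw [show X ω - a - (X ω - b) = b - a by ring, abs_sub_comm b a] at this
    simpa using this
  · filter_upwards [hf.ae_ne hX ξ] with ω hω
    rcases lt_or_gt_of_ne hω with h | h
    · rw [if_neg (not_le.2 h)]
      refine (hasDerivAt_const ξ (0 : ℝ)).congr_of_eventuallyEq ?_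
      filter_upwards [eventually_gt_nhds h] with c hc
      exact max_eq_right (by linarith)
    · rw [if_pos h.le]
      refine ((hasDerivAt_id ξ).const_sub (X ω)).congr_of_eventuallyEq ?_
      filter_upwards [eventually_lt_nhds h] with c hc
      exact max_eq_left (by simp; linarith)

theorem deriv_deriv_objective (hf : IsContinuousPDF P X f) (hX : Measurable X)
    (hXi : Integrable X P) {α : ℝ} (hα : α < 1) :
    deriv (deriv (objective P α X)) = fun ξ => f ξ / (1 - α) := by
  have h1 : deriv (objective P α X) = fun ξ => (P.real {ω | X ω ≤ ξ} - α) / (1 - α) :=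
    funext fun ξ => (hasDerivAt_objective hf hX hXi hα ξ).deriv
  rw [h1]
  exact funext fun ξ => (((hf.hasDerivAt_cdf hX ξ).sub_const α).div_const _).deriv

theorem cdf_eq_of_mem_argmin (hf : IsContinuousPDF P X f) (hX : Measurable X)
    (hXi : Integrable X P) {α : ℝ} (hα : α < 1) {ξ : ℝ} (hξ : ξ ∈ argmin (objective P α X)) :
    P.real {ω | X ω ≤ ξ} = α := by
  have h1 : IsLocalMin (objective P α X) ξ := Eventually.of_forall hξ
  have h2 := h1.hasDerivAt_eq_zero (hasDerivAt_objective hf hX hXi hα ξ)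
  have : (1 - α) ≠ 0 := by linarith
  rw [div_eq_zero_iff] at h2
  rcases h2 with h2 | h2
  · linarith
  · exact absurd h2 this

theorem one_le_kConst (α : ℝ) : 1 ≤ kConst α := le_max_left _ _

theorem isConvexPotential_objective (hf : IsContinuousPDF P X f) (hX : Measurable X)
    (hXi : Integrable X P) {α : ℝ} (hα : α ∈ Set.Ioo (0 : ℝ) 1) {ξ : ℝ}
    (hξ : ξ ∈ argmin (objective P α X)) {B : ℝ} (hB0 : 0 < B) (hB : ∀ x, f x ≤ B) :
    IsConvexPotential (fun x => objective P α X x - objective P α X ξ)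
      (fun x => (P.real {ω | X ω ≤ x} - α) / (1 - α)) (fun x => f x / (1 - α)) ξ (kConst α)
      (B / (1 - α)) := by
  have h1 : 0 < 1 - α := by linarith [hα.2]
  refine ⟨fun x => (hasDerivAt_objective hf hX hXi hα.2 x).sub_const _,
    fun x => ((hf.hasDerivAt_cdf hX x).sub_const α).div_const _, by simp, ?_, fun x => ?_,
    fun x => ?_, fun x => ?_, by positivity, by linarith [one_le_kConst α]⟩
  · simp [cdf_eq_of_mem_argmin hf hX hXi hα.2 hξ]
  · have := hf.nonneg x; positivity
  · have := hB x; gcongr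
  · have h2 : 0 ≤ P.real {ω | X ω ≤ x} := measureReal_nonneg
    have h3 : P.real {ω | X ω ≤ x} ≤ 1 := measureReal_le_one
    rw [abs_le]
    constructor
    · have : -(α / (1 - α)) ≤ (P.real {ω | X ω ≤ x} - α) / (1 - α) := by
        rw [← neg_div]; gcongr; linarith
      have := le_max_right 1 (α / (1 - α))
      unfold kConst; linarith
    · have : (P.real {ω | X ω ≤ x} - α) / (1 - α) ≤ 1 := by
        rw [div_le_one h1]; linarith
      linarith [one_le_kConst α]

/-- The mean field of the scheme is `V'`. -/
theorem integral_H1 (hf : IsContinuousPDF P X f) (hX : Measurable X) {α : ℝ} (hα : α < 1) (ξ : ℝ) :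
    ∫ ω, H1 α ξ (X ω) ∂P = (P.real {ω | X ω ≤ ξ} - α) / (1 - α) := by
  have h0 : (1 - α) ≠ 0 := by linarith
  have e : (fun ω => if ξ ≤ X ω then (1 : ℝ) else 0)
      = Set.indicator {ω | ξ ≤ X ω} (fun _ => (1 : ℝ)) := by
    funext ω; simp [Set.indicator]
  have hi : Integrable (fun ω => if ξ ≤ X ω then (1 : ℝ) else 0) P := by
    rw [e]
    exact (integrable_const _).indicator (measurableSet_le measurable_const hX)
  unfold H1
  rw [integral_sub (integrable_const _) (hi.const_mul _), integral_const_mul, e,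
    integral_indicator_const _ (measurableSet_le measurable_const hX), hf.measureReal_le hX]
  simp
  field_simp
  ring

theorem abs_H1_le {α : ℝ} (hα : α ∈ Set.Ioo (0 : ℝ) 1) (ξ x : ℝ) : |H1 α ξ x| ≤ kConst α := by
  have h1 : 0 < 1 - α := by linarith [hα.2]
  unfold H1 kConst
  split_ifs
  · have : 1 - 1 / (1 - α) * 1 = -(α / (1 - α)) := by field_simp; ring
    rw [this, abs_neg, abs_of_nonneg (div_nonneg hα.1.le h1.le)]
    exact le_max_right _ _
  · simp

end Objective

/-! ### Integration over independent variables -/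

section Independence

variable {Ω Ω' E F G ι : Type*} [MeasurableSpace Ω] [MeasurableSpace Ω'] [MeasurableSpace E]
  [MeasurableSpace F] [MeasurableSpace G] {P : Measure Ω}
  {P' : Measure Ω'}

theorem indepFun_of_measurable_comap {T : Ω → E} {S : Ω → F} {U : Ω → G}
    (h : IndepFun T U P) (hS : Measurable[MeasurableSpace.comap T inferInstance] S) :
    IndepFun S U P := by
  rw [IndepFun_iff_Indep] at *
  exact indep_of_indep_of_le_left h hS.comap_le

variable [IsProbabilityMeasure P]

/-- The joint law factors as a product in two stages; regrouping the factors is the associativity of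
product measures. -/
theorem indepFun_prodMk_of_indepFun {A : Ω → E} {R : Ω → F} {U : Ω → G} (hA : Measurable A)
    (hR : Measurable R) (hU : Measurable U) (h1 : IndepFun A (fun ω => (R ω, U ω)) P)
    (h2 : IndepFun R U P) : IndepFun (fun ω => (A ω, R ω)) U P := by
  have h3 : IndepFun A R P := h1.comp measurable_id measurable_fst
  rw [indepFun_iff_map_prod_eq_prod_map_map hA.aemeasurable (hR.prodMk hU).aemeasurable] at h1
  rw [indepFun_iff_map_prod_eq_prod_map_map hR.aemeasurable hU.aemeasurable] at h2
  rw [indepFun_iff_map_prod_eq_prod_map_map hA.aemeasurable hR.aemeasurable] at h3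
  rw [indepFun_iff_map_prod_eq_prod_map_map (hA.prodMk hR).aemeasurable hU.aemeasurable, h3]
  have : IsProbabilityMeasure (P.map A) := Measure.isProbabilityMeasure_map hA.aemeasurable
  have : IsProbabilityMeasure (P.map R) := Measure.isProbabilityMeasure_map hR.aemeasurable
  have : IsProbabilityMeasure (P.map U) := Measure.isProbabilityMeasure_map hU.aemeasurable
  have e : (fun ω => ((A ω, R ω), U ω)) = MeasurableEquiv.prodAssoc.symm ∘
      fun ω => (A ω, (R ω, U ω)) := rfl
  rw [e, ← Measure.map_map (MeasurableEquiv.measurable _) (hA.prodMk (hR.prodMk hU)), h1, h2]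
  rw [← Measure.prodAssoc_prod, MeasurableEquiv.map_symm_map]

/-- `A` and all `U j`, `j ≠ i`, are jointly independent of `U i`. -/
theorem indepFun_rest {A : Ω → E} {U : ι → Ω → F} (hA : Measurable A) (hU : ∀ i, Measurable (U i))
    (hind : iIndepFun U P) (hAU : IndepFun A (fun ω i => U i ω) P) (i : ι) :
    IndepFun (fun ω => (A ω, fun j : {j // j ≠ i} => U j ω)) (U i) P := by
  have hR : Measurable (fun ω => fun j : {j // j ≠ i} => U j ω) :=
    measurable_pi_lambda _ fun j => hU j
  refine indepFun_prodMk_of_indepFun hA hR (hU i) ?_ ?_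
  · exact hAU.comp (φ := id) (ψ := fun u : ι → F => (fun j : {j // j ≠ i} => u j, u i))
      measurable_id ((measurable_pi_lambda _ fun j => measurable_pi_apply _).prodMk
        (measurable_pi_apply i))
  · have h := indep_iSup_of_disjoint (m := fun j => MeasurableSpace.comap (U j) inferInstance)
      (S := {i}ᶜ) (T := {i}) (fun j => (hU j).comap_le) hind disjoint_compl_left
    rw [IndepFun_iff_Indep]
    refine indep_of_indep_of_le_right (indep_of_indep_of_le_left h ?_) ?_
    · rw [MeasurableSpace.pi, MeasurableSpace.comap_iSup]
      refine iSup_le fun j => ?_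
      rw [MeasurableSpace.comap_comp]
      exact le_iSup₂ (f := fun j (_ : j ∈ ({i}ᶜ : Set ι)) =>
        MeasurableSpace.comap (U j) inferInstance) j.1 j.2
    · exact le_iSup₂ (f := fun j (_ : j ∈ ({i} : Set ι)) =>
        MeasurableSpace.comap (U j) inferInstance) i rfl

/-- Fubini for an independent pair, with the inner variable replaced by a copy. In the analysis of
the schemes this plays the role of conditioning on the past. -/
theorem lintegral_indepFun {S : Ω → E} {U : Ω → F} {U' : Ω' → F} (hS : Measurable S)
    (hU : Measurable U) (hind : IndepFun S U P) (hid : IdentDistrib U U' P P')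
    {f : E × F → ℝ≥0∞} (hf : Measurable f) :
    ∫⁻ ω, f (S ω, U ω) ∂P = ∫⁻ ω, ∫⁻ ω', f (S ω, U' ω') ∂P' ∂P := by
  rw [indepFun_iff_map_prod_eq_prod_map_map hS.aemeasurable hU.aemeasurable] at hind
  have : IsProbabilityMeasure (P.map U) := Measure.isProbabilityMeasure_map hU.aemeasurable
  rw [← lintegral_map (f := f) hf (hS.prodMk hU), hind, lintegral_prod _ hf.aemeasurable,
    lintegral_map hf.lintegral_prod_right' hS]
  refine lintegral_congr fun ω => ?_
  rw [hid.map_eq]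
  exact lintegral_map' (hf.comp measurable_prodMk_left).aemeasurable hid.aemeasurable_snd

theorem integral_indepFun {S : Ω → E} {U : Ω → F} {U' : Ω' → F} (hS : Measurable S)
    (hU : Measurable U) (hind : IndepFun S U P) (hid : IdentDistrib U U' P P')
    {f : E × F → ℝ} (hf : Measurable f) (hint : Integrable (fun ω => f (S ω, U ω)) P) :
    ∫ ω, f (S ω, U ω) ∂P = ∫ ω, ∫ ω', f (S ω, U' ω') ∂P' ∂P := by
  rw [indepFun_iff_map_prod_eq_prod_map_map hS.aemeasurable hU.aemeasurable] at hind
  have : IsProbabilityMeasure (P.map U) := Measure.isProbabilityMeasure_map hU.aemeasurable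
  have : IsProbabilityMeasure (P.map S) := Measure.isProbabilityMeasure_map hS.aemeasurable
  have h1 : Integrable f ((P.map S).prod (P.map U)) := by
    rw [← hind, integrable_map_measure hf.aestronglyMeasurable (hS.prodMk hU).aemeasurable]
    exact hint
  rw [← integral_map (f := f) (φ := fun ω => (S ω, U ω)) (hS.prodMk hU).aemeasurable
    hf.aestronglyMeasurable, hind, integral_prod _ h1, integral_map hS.aemeasurable
    hf.stronglyMeasurable.integral_prod_right'.aestronglyMeasurable]
  refine integral_congr_ae (Eventually.of_forall fun ω => ?_)
  simp only
  rw [hid.map_eq]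
  exact integral_map hid.aemeasurable_snd (hf.comp measurable_prodMk_left).aestronglyMeasurable

/-- Freezing `Y`: the candidate is a function of `Y`, and testing it against an event of `Y` is
again Fubini. -/
theorem condExp_indepFun {Y : Ω → E} {Z : Ω → F} (hY : Measurable Y) (hZ : Measurable Z)
    (hind : IndepFun Y Z P) {f : E × F → ℝ} (hf : Measurable f)
    (hint : Integrable (fun ω => f (Y ω, Z ω)) P) :
    P[fun ω => f (Y ω, Z ω) | MeasurableSpace.comap Y inferInstance]
      =ᵐ[P] fun ω => ∫ z, f (Y ω, z) ∂(P.map Z) := by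
  have : IsProbabilityMeasure (P.map Z) := Measure.isProbabilityMeasure_map hZ.aemeasurable
  have : IsProbabilityMeasure (P.map Y) := Measure.isProbabilityMeasure_map hY.aemeasurable
  have hprod := (indepFun_iff_map_prod_eq_prod_map_map hY.aemeasurable hZ.aemeasurable).1 hind
  have h1 : Integrable f ((P.map Y).prod (P.map Z)) := by
    rw [← hprod, integrable_map_measure hf.aestronglyMeasurable (hY.prodMk hZ).aemeasurable]
    exact hint
  have hm : Measurable fun y => ∫ z, f (y, z) ∂(P.map Z) :=
    hf.stronglyMeasurable.integral_prod_right'.measurable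
  have h2 : Integrable (fun ω => ∫ z, f (Y ω, z) ∂(P.map Z)) P :=
    (integrable_map_measure hm.aestronglyMeasurable hY.aemeasurable).1 h1.integral_prod_left
  symm
  refine ae_eq_condExp_of_forall_setIntegral_eq hY.comap_le hint (fun s _ _ => h2.integrableOn)
    ?_ ?_
  · rintro s ⟨t, ht, rfl⟩ -
    have e1 : ∀ g : Ω → ℝ, ∫ ω in Y ⁻¹' t, g ω ∂P
        = ∫ ω, t.indicator (fun _ => (1 : ℝ)) (Y ω) * g ω ∂P := by
      intro g
      rw [← integral_indicator (hY ht)]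
      refine integral_congr_ae (Eventually.of_forall fun ω => ?_)
      by_cases h : Y ω ∈ t <;> simp [Set.indicator, h]
    have hti : Measurable (t.indicator (fun _ => (1 : ℝ))) := measurable_const.indicator ht
    rw [e1, e1]
    have := integral_indepFun (P' := P) (U' := Z) hY hZ hind (IdentDistrib.refl hZ.aemeasurable)
      (f := fun q => t.indicator (fun _ => (1 : ℝ)) q.1 * f q)
      ((hti.comp measurable_fst).mul hf) (by
        have := hint.indicator (hY ht)
        refine this.congr (Eventually.of_forall fun ω => ?_)
        by_cases h : Y ω ∈ t <;> simp [Set.indicator, h])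
    rw [this]
    refine integral_congr_ae (Eventually.of_forall fun ω => ?_)
    simp only
    rw [integral_const_mul]
    congr 1
    exact integral_map (f := fun z => f (Y ω, z)) hZ.aemeasurable
      (hf.comp measurable_prodMk_left).aestronglyMeasurable
  · have : Measurable[MeasurableSpace.comap Y inferInstance]
        (fun ω => ∫ z, f (Y ω, z) ∂(P.map Z)) :=
      hm.comp (comap_measurable Y)
    exact this.stronglyMeasurable.aestronglyMeasurable

end Independence

/-! ### Elementary inequalities for powers -/

section Moments

/-- For `|t| ≥ 1/2` every term is dominated by `t² + |t|^p`; for `|t| ≤ 1/2` one has `(1 + t)^p ≤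
e^{pt}`, which is expanded to second order. -/
theorem one_add_rpow_le {p : ℝ} (hp : 2 ≤ p) :
    ∃ C, 0 < C ∧ ∀ t : ℝ, |1 + t| ^ p ≤ 1 + p * t + C * (t ^ 2 + |t| ^ p) := by
  have hp0 : 0 < p := by linarith
  refine ⟨3 ^ p + 2 * p + p ^ 2 * Real.exp (p / 2), by positivity, fun t => ?_⟩
  have h3 : (0:ℝ) < 3 ^ p := by positivity
  have hE := Real.exp_pos (p / 2)
  have hts : 0 ≤ |t| ^ p := by positivity
  rcases le_total (1 / 2) |t| with ht | ht
  · have h1 : |1 + t| ^ p ≤ 3 ^ p * |t| ^ p := by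
      rw [← Real.mul_rpow (by norm_num) (abs_nonneg _)]
      refine Real.rpow_le_rpow (abs_nonneg _) ?_ hp0.le
      calc |1 + t| ≤ |1| + |t| := abs_add_le _ _
        _ ≤ 3 * |t| := by rw [abs_one]; linarith
    have h2 : -(2 * p * t ^ 2) ≤ p * t := by
      have : |t| ≤ 2 * t ^ 2 := by rw [← sq_abs]; nlinarith
      have := neg_abs_le t
      nlinarith
    have h4 : 0 ≤ (3 ^ p + p ^ 2 * Real.exp (p / 2)) * t ^ 2 := by positivity
    have h5 : 0 ≤ (2 * p + p ^ 2 * Real.exp (p / 2)) * |t| ^ p := by positivity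
    nlinarith
  · have hta := abs_le.1 ht
    have h1 : |1 + t| ^ p ≤ Real.exp (p * t) := by
      rw [abs_of_nonneg (by linarith), Real.rpow_def_of_pos (by linarith)]
      apply Real.exp_le_exp.2
      have := Real.log_le_sub_one_of_pos (show 0 < 1 + t by linarith)
      nlinarith
    have h2 := exp_le_one_add_add (μ := p) hp0.le ht
    rw [show p * (1 / 2) = p / 2 by ring] at h2
    have h4 : 0 ≤ (3 ^ p + 2 * p) * t ^ 2 := by positivity
    have h5 : 0 ≤ (3 ^ p + 2 * p + p ^ 2 * Real.exp (p / 2)) * |t| ^ p := by positivity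
    nlinarith

theorem abs_add_rpow_le {p : ℝ} (hp : 2 ≤ p) :
    ∃ C, 0 < C ∧ ∀ a b : ℝ, |a + b| ^ p ≤ |a| ^ p + p * (|a| ^ (p - 2) * a * b)
      + C * (|a| ^ (p - 2) * b ^ 2 + |b| ^ p) := by
  obtain ⟨C, hC, h⟩ := one_add_rpow_le hp
  refine ⟨C + 1, by linarith, fun a b => ?_⟩
  have hb : 0 ≤ |b| ^ p := by positivity
  by_cases ha : a = 0
  · subst ha
    have : 0 ≤ |(0:ℝ)| ^ (p - 2) * b ^ 2 := by positivity
    have h2 : 0 ≤ |(0:ℝ)| ^ p := by positivity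
    have h0 : |(0:ℝ)| ^ p = 0 := by rw [abs_zero, Real.zero_rpow (by linarith)]
    rw [zero_add, h0]
    nlinarith
  · have ha' : 0 < |a| := abs_pos.2 ha
    have h1 := h (b / a)
    have e1 : |a + b| ^ p = |a| ^ p * |1 + b / a| ^ p := by
      rw [← Real.mul_rpow ha'.le (abs_nonneg _), ← abs_mul]
      congr 2; field_simp
    have e2 : |a| ^ p = |a| ^ (p - 2) * a ^ 2 := by
      rw [Real.rpow_sub ha', Real.rpow_two, sq_abs]; field_simp
    have e3 : |b| ^ p = |a| ^ p * |b / a| ^ p := by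
      rw [← Real.mul_rpow ha'.le (abs_nonneg _), ← abs_mul]
      congr 2; field_simp
    have e4 : |a| ^ p * (1 + p * (b / a) + C * ((b / a) ^ 2 + |b / a| ^ p))
        = |a| ^ p + p * (|a| ^ (p - 2) * a * b) + C * (|a| ^ (p - 2) * b ^ 2 + |b| ^ p) := by
      rw [e3, e2]; field_simp
    have h2 := mul_le_mul_of_nonneg_left h1 (show 0 ≤ |a| ^ p by positivity)
    rw [← e1, e4] at h2
    have : 0 ≤ |a| ^ (p - 2) * b ^ 2 + |b| ^ p := by positivity
    linarith

/-- Young's inequality with a free parameter, by comparing `x²` with `s y²`. Taking `s` proportional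
to the number of summands makes the induction on partial sums close. -/
theorem rpow_mul_sq_le {p s x y : ℝ} (hp : 2 ≤ p) (hs : 0 < s) (hx : 0 ≤ x) (hy : 0 ≤ y) :
    x ^ (p - 2) * y ^ 2 ≤ x ^ p / s + s ^ (p / 2 - 1) * y ^ p := by
  have h1 : 0 ≤ x ^ p / s := by positivity
  have h2 : 0 ≤ s ^ (p / 2 - 1) * y ^ p := by positivity
  have hadd : ∀ z : ℝ, 0 ≤ z → z ^ p = z ^ (p - 2) * z ^ 2 := by
    intro z hz
    rw [← Real.rpow_two, ← Real.rpow_add_of_nonneg hz (by linarith) (by norm_num)]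
    congr 1; ring
  rcases le_total (s * y ^ 2) (x ^ 2) with h | h
  · have : x ^ (p - 2) * y ^ 2 ≤ x ^ p / s := by
      rw [le_div_iff₀ hs, hadd x hx]
      have : 0 ≤ x ^ (p - 2) := by positivity
      nlinarith
    linarith
  · have hxs : x ≤ s ^ (1 / 2 : ℝ) * y := by
      rw [← Real.sqrt_eq_rpow]
      refine le_of_sq_le_sq ?_ (by positivity)
      rw [mul_pow, Real.sq_sqrt hs.le]; exact h
    have : x ^ (p - 2) * y ^ 2 ≤ s ^ (p / 2 - 1) * y ^ p := by
      calc x ^ (p - 2) * y ^ 2 ≤ (s ^ (1 / 2 : ℝ) * y) ^ (p - 2) * y ^ 2 := by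
            gcongr
        _ = s ^ (p / 2 - 1) * y ^ p := by
            rw [Real.mul_rpow (by positivity) hy, ← Real.rpow_mul hs.le, hadd y hy]
            rw [show 1 / 2 * (p - 2) = p / 2 - 1 by ring]; ring
    linarith

end Moments

/-- Partial sums `∑_{j < k} ψ(Y, Z_j)`. -/
def partialSum {Ω E F : Type*} (ψ : E × F → ℝ) (Y : Ω → E)
    (Zc : ℕ → Ω → F) (k : ℕ) (ω : Ω) : ℝ :=
  ∑ j ∈ Finset.range k, ψ (Y ω, Zc j ω)

theorem partialSum_succ {Ω E F : Type*} {Y : Ω → E} {Zc : ℕ → Ω → F} {ψ : E × F → ℝ} (k : ℕ)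
    (ω : Ω) : partialSum ψ Y Zc (k + 1) ω = partialSum ψ Y Zc k ω + ψ (Y ω, Zc k ω) :=
  Finset.sum_range_succ _ _

/-! ### Moments of conditionally centred sums -/

section NestedSums

variable {Ω E F : Type*} [MeasurableSpace Ω] [MeasurableSpace E] [MeasurableSpace F]
  {P : Measure Ω} {Y : Ω → E} {Z : Ω → F} {Zc : ℕ → Ω → F} {ψ : E × F → ℝ}

theorem measurable_partialSum (hψ : Measurable ψ) (hY : Measurable Y)
    (hZc : ∀ k, Measurable (Zc k)) (k : ℕ) : Measurable (partialSum ψ Y Zc k) :=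
  Finset.measurable_sum _ fun j _ => hψ.comp (hY.prodMk (hZc j))

variable [IsProbabilityMeasure P]

theorem indepFun_partialSum (hψ : Measurable ψ) (hY : Measurable Y) (hZc : ∀ k, Measurable (Zc k))
    (hind : iIndepFun Zc P) (hYZ : IndepFun Y (fun ω k => Zc k ω) P) (k : ℕ) :
    IndepFun (fun ω => (Y ω, partialSum ψ Y Zc k ω)) (Zc k) P := by
  have h := indepFun_rest hY hZc hind hYZ k
  refine indepFun_of_measurable_comap h ?_
  have hT : Measurable[MeasurableSpace.comap (fun ω => (Y ω, fun j : {j // j ≠ k} => Zc j ω))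
      inferInstance] (fun ω => (Y ω, fun j : {j // j ≠ k} => Zc j ω)) := comap_measurable _
  have h1 := measurable_fst.comp hT
  refine h1.prodMk ?_
  refine Finset.measurable_sum _ fun j hj => hψ.comp (h1.prodMk ?_)
  have hjk : j ≠ k := (Finset.mem_range.1 hj).ne
  exact (measurable_pi_apply (⟨j, hjk⟩ : {j // j ≠ k})).comp (measurable_snd.comp hT)

theorem identDistrib_prodMk_left (hY : Measurable Y) (hZ : Measurable Z) {Z' : Ω → F}
    (hZ' : Measurable Z') (h : IndepFun Y Z P) (h' : IndepFun Y Z' P) (hid : IdentDistrib Z' Z P P) :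
    IdentDistrib (fun ω => (Y ω, Z' ω)) (fun ω => (Y ω, Z ω)) P P where
  aemeasurable_fst := (hY.prodMk hZ').aemeasurable
  aemeasurable_snd := (hY.prodMk hZ).aemeasurable
  map_eq := by
    rw [indepFun_iff_map_prod_eq_prod_map_map hY.aemeasurable hZ.aemeasurable] at h
    rw [indepFun_iff_map_prod_eq_prod_map_map hY.aemeasurable hZ'.aemeasurable] at h'
    rw [h, h', hid.map_eq]

/-- A Marcinkiewicz–Zygmund bound for conditionally centered sums. -/
theorem moment_partialSum_le (hψ : Measurable ψ) (hY : Measurable Y) (hZ : Measurable Z)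
    (hZc : ∀ k, Measurable (Zc k)) (hind : iIndepFun Zc P)
    (hYZc : IndepFun Y (fun ω k => Zc k ω) P) (hYZ : IndepFun Y Z P)
    (hid : ∀ k, IdentDistrib (Zc k) Z P P)
    (hcent : ∀ᵐ ω ∂P, ∫ ω', ψ (Y ω, Z ω') ∂P = 0) {p : ℝ} (hp : 2 ≤ p)
    (hm : Integrable (fun ω => |ψ (Y ω, Z ω)| ^ p) P) :
    ∃ C, 0 ≤ C ∧ ∀ k, Integrable (fun ω => |partialSum ψ Y Zc k ω| ^ p) P ∧
      ∫ ω, |partialSum ψ Y Zc k ω| ^ p ∂P ≤ C * (k : ℝ) ^ (p / 2) := by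
  obtain ⟨c, hc, hineq⟩ := abs_add_rpow_le hp
  have hp0 : 0 < p := by linarith
  set m := ∫ ω, |ψ (Y ω, Z ω)| ^ p ∂P with hmdef
  have hm0 : 0 ≤ m := integral_nonneg fun ω => by positivity
  -- With `s = κ k` the coefficient `c / s` is `1 / (2k)`: the moment of the `k`-th sum then
  -- contributes half of the admissible growth, and `A` is chosen so that the new summand
  -- contributes the other half.
  set κ := 2 * c with hκ
  have hκ0 : 0 < κ := by positivity
  set A := 1 + 2 * c * (κ ^ (p / 2 - 1) + 1) with hA
  have hA1 : 1 ≤ A := by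
    rw [hA]; have : 0 ≤ 2 * c * (κ ^ (p / 2 - 1) + 1) := by positivity
    linarith
  have hpm : Measurable fun x : ℝ => |x| ^ p := by fun_prop
  have hYZk : ∀ k, IndepFun Y (Zc k) P := fun k =>
    hYZc.comp measurable_id (measurable_pi_apply k)
  have hidk : ∀ k, IdentDistrib (fun ω => |ψ (Y ω, Zc k ω)| ^ p)
      (fun ω => |ψ (Y ω, Z ω)| ^ p) P P := fun k =>
    (identDistrib_prodMk_left hY hZ (hZc k) hYZ (hYZk k) (hid k)).comp (hpm.comp hψ)
  have hbi : ∀ k, Integrable (fun ω => |ψ (Y ω, Zc k ω)| ^ p) P := fun k =>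
    (hidk k).integrable_iff.2 hm
  have hbm : ∀ k, ∫ ω, |ψ (Y ω, Zc k ω)| ^ p ∂P = m := fun k => (hidk k).integral_eq
  have hSm := measurable_partialSum hψ hY hZc
  have hbmeas : ∀ k, Measurable fun ω => ψ (Y ω, Zc k ω) := fun k => hψ.comp (hY.prodMk (hZc k))
  refine ⟨A * m, by positivity, fun k => ?_⟩
  induction k with
  | zero =>
    have : (fun ω => |partialSum ψ Y Zc 0 ω| ^ p) = fun _ => 0 := by
      funext ω; simp [partialSum, Real.zero_rpow hp0.ne']
    rw [this]
    exact ⟨integrable_zero _ _ _, by simp; positivity⟩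
  | succ k ih =>
    obtain ⟨ih1, ih2⟩ := ih
    -- The first summand is treated apart, because the parameter `s = κ k` must be positive.
    rcases Nat.eq_zero_or_pos k with hk | hk
    · subst hk
      have : (fun ω => |partialSum ψ Y Zc (0 + 1) ω| ^ p) = fun ω => |ψ (Y ω, Zc 0 ω)| ^ p := by
        funext ω; simp [partialSum]
      rw [this, hbm]
      refine ⟨hbi 0, ?_⟩
      simp; nlinarith
    have hk0 : (0 : ℝ) < k := by exact_mod_cast hk
    set a := fun ω => partialSum ψ Y Zc k ω with ha
    set b := fun ω => ψ (Y ω, Zc k ω) with hb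
    set s := κ * k with hs
    have hs0 : 0 < s := by positivity
    have hcross_int : Integrable (fun ω => |a ω| ^ (p - 2) * a ω * b ω) P := by
      have hdom : Integrable (fun ω => |a ω| ^ p + (|a ω| ^ p / 1 + 1 ^ (p / 2 - 1) * |b ω| ^ p)) P :=
        ih1.add ((ih1.div_const 1).add ((hbi k).const_mul _))
      refine hdom.mono' ?_ (Eventually.of_forall fun ω => ?_)
      · exact ((((hSm k).abs.pow_const _).mul (hSm k)).mul (hbmeas k)).aestronglyMeasurable
      · have h1 := rpow_mul_sq_le hp one_pos (abs_nonneg (a ω)) (abs_nonneg (b ω))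
        have h2 : |a ω| ^ p = |a ω| ^ (p - 2) * |a ω| ^ 2 := by
          rw [← Real.rpow_two, ← Real.rpow_add_of_nonneg (abs_nonneg _) (by linarith) (by norm_num)]
          congr 1; ring
        rw [Real.norm_eq_abs, abs_mul, abs_mul, abs_of_nonneg (by positivity : 0 ≤ |a ω| ^ (p - 2))]
        have h3 : |a ω| * |b ω| ≤ |a ω| ^ 2 + |b ω| ^ 2 := by
          nlinarith [sq_nonneg (|a ω| - |b ω|), sq_nonneg (|a ω|), sq_nonneg (|b ω|)]
        have h4 : 0 ≤ |a ω| ^ (p - 2) := by positivity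
        calc |a ω| ^ (p - 2) * |a ω| * |b ω| = |a ω| ^ (p - 2) * (|a ω| * |b ω|) := by ring
          _ ≤ |a ω| ^ (p - 2) * (|a ω| ^ 2 + |b ω| ^ 2) := by gcongr
          _ = |a ω| ^ p + |a ω| ^ (p - 2) * |b ω| ^ 2 := by rw [h2]; ring
          _ ≤ _ := by linarith
    have hcross : ∫ ω, |a ω| ^ (p - 2) * a ω * b ω ∂P = 0 := by
      have hfun : Measurable fun q : (E × ℝ) × F => |q.1.2| ^ (p - 2) * q.1.2 * ψ (q.1.1, q.2) := by
        have : Measurable fun q : (E × ℝ) × F => ψ (q.1.1, q.2) :=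
          hψ.comp ((measurable_fst.comp measurable_fst).prodMk measurable_snd)
        have h2 : Measurable fun q : (E × ℝ) × F => q.1.2 := measurable_snd.comp measurable_fst
        exact ((h2.abs.pow_const _).mul h2).mul this
      rw [integral_indepFun (P' := P) (S := fun ω => (Y ω, partialSum ψ Y Zc k ω)) (U := Zc k)
        (U' := Z) (hY.prodMk (hSm k)) (hZc k) (indepFun_partialSum hψ hY hZc hind hYZc k) (hid k)
        hfun hcross_int]
      refine integral_eq_zero_of_ae ?_
      filter_upwards [hcent] with ω hω
      simp only [Pi.zero_apply]
      rw [integral_const_mul, hω, mul_zero]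
    have hpt : ∀ ω, |partialSum ψ Y Zc (k + 1) ω| ^ p ≤ |a ω| ^ p
        + p * (|a ω| ^ (p - 2) * a ω * b ω)
        + (c / s * |a ω| ^ p + c * (s ^ (p / 2 - 1) + 1) * |b ω| ^ p) := by
      intro ω
      rw [partialSum_succ]
      have h1 := hineq (a ω) (b ω)
      have h2 := rpow_mul_sq_le hp hs0 (abs_nonneg (a ω)) (abs_nonneg (b ω))
      rw [sq_abs] at h2
      have h3 := mul_le_mul_of_nonneg_left h2 hc.le
      have h4 : c * (|a ω| ^ p / s + s ^ (p / 2 - 1) * |b ω| ^ p)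
        = c / s * |a ω| ^ p + c * s ^ (p / 2 - 1) * |b ω| ^ p := by ring
      linarith
    have hdomi : Integrable (fun ω => |a ω| ^ p + p * (|a ω| ^ (p - 2) * a ω * b ω)
        + (c / s * |a ω| ^ p + c * (s ^ (p / 2 - 1) + 1) * |b ω| ^ p)) P :=
      (ih1.add (hcross_int.const_mul p)).add ((ih1.const_mul _).add ((hbi k).const_mul _))
    have hint : Integrable (fun ω => |partialSum ψ Y Zc (k + 1) ω| ^ p) P := by
      refine hdomi.mono' ((hSm (k + 1)).abs.pow_const _).aestronglyMeasurable
        (Eventually.of_forall fun ω => ?_)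
      rw [Real.norm_eq_abs, abs_of_nonneg (by positivity)]
      exact hpt ω
    refine ⟨hint, ?_⟩
    have h1 := integral_mono hint hdomi hpt
    have h2 : ∫ ω, (|a ω| ^ p + p * (|a ω| ^ (p - 2) * a ω * b ω)
        + (c / s * |a ω| ^ p + c * (s ^ (p / 2 - 1) + 1) * |b ω| ^ p)) ∂P
        = (∫ ω, |a ω| ^ p ∂P) + (c / s * (∫ ω, |a ω| ^ p ∂P) + c * (s ^ (p / 2 - 1) + 1) * m) := by
      have j1 : Integrable (fun ω => p * (|a ω| ^ (p - 2) * a ω * b ω)) P := hcross_int.const_mul p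
      have j2 : Integrable (fun ω => c / s * |a ω| ^ p) P := ih1.const_mul _
      have j3 : Integrable (fun ω => c * (s ^ (p / 2 - 1) + 1) * |b ω| ^ p) P :=
        (hbi k).const_mul _
      have j4 : Integrable (fun ω => |a ω| ^ p + p * (|a ω| ^ (p - 2) * a ω * b ω)) P := ih1.add j1
      have j5 : Integrable (fun ω => c / s * |a ω| ^ p
        + c * (s ^ (p / 2 - 1) + 1) * |b ω| ^ p) P := j2.add j3
      rw [integral_add j4 j5, integral_add ih1 j1, integral_const_mul, hcross,
        integral_add j2 j3, integral_const_mul, integral_const_mul, hbm]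
      ring
    rw [h2] at h1
    set u := ∫ ω, |a ω| ^ p ∂P with hu
    have e1 : c / s = 1 / (2 * k) := by rw [hs, hκ]; field_simp
    have e2 : s ^ (p / 2 - 1) = κ ^ (p / 2 - 1) * (k : ℝ) ^ (p / 2 - 1) :=
      Real.mul_rpow hκ0.le hk0.le
    have e3 : (1 : ℝ) ≤ (k : ℝ) ^ (p / 2 - 1) :=
      Real.one_le_rpow (by exact_mod_cast hk) (by linarith)
    have e4 : (k : ℝ) ^ (p / 2) = (k : ℝ) ^ (p / 2 - 1) * k := by
      rw [Real.rpow_sub hk0, Real.rpow_one]; field_simp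
    -- Bernoulli's inequality, in the form that yields the growth available in one induction step.
    have e5 : (k : ℝ) ^ (p / 2) + (k : ℝ) ^ (p / 2 - 1) ≤ ((k : ℝ) + 1) ^ (p / 2) := by
      have h := one_add_mul_self_le_rpow_one_add (s := 1 / (k : ℝ)) (p := p / 2)
        (by have : 0 < 1 / (k : ℝ) := by positivity
            linarith) (by linarith)
      have h' : 1 + 1 / (k : ℝ) ≤ (1 + 1 / (k : ℝ)) ^ (p / 2) := by
        refine le_trans ?_ h
        have : 0 < 1 / (k : ℝ) := by positivity
        nlinarith
      have e : ((k : ℝ) + 1) = k * (1 + 1 / k) := by field_simp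
      rw [e, Real.mul_rpow hk0.le (by positivity)]
      calc (k : ℝ) ^ (p / 2) + (k : ℝ) ^ (p / 2 - 1)
          = (k : ℝ) ^ (p / 2) * (1 + 1 / k) := by rw [e4]; field_simp
        _ ≤ _ := by gcongr
    push_cast
    set w := (k : ℝ) ^ (p / 2 - 1) with hw
    have e6 : c / s * u ≤ A * m * w / 2 := by
      rw [e1]
      calc 1 / (2 * (k : ℝ)) * u ≤ 1 / (2 * (k : ℝ)) * (A * m * (k : ℝ) ^ (p / 2)) := by gcongr
        _ = A * m * w / 2 := by rw [e4]; field_simp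
    have e7 : c * (s ^ (p / 2 - 1) + 1) * m ≤ A * m * w / 2 := by
      rw [e2]
      have : c * (κ ^ (p / 2 - 1) * w + 1) ≤ A / 2 * w := by
        have : c * (κ ^ (p / 2 - 1) * w + 1) ≤ c * (κ ^ (p / 2 - 1) + 1) * w := by nlinarith
        have : A / 2 * w = w / 2 + c * (κ ^ (p / 2 - 1) + 1) * w := by rw [hA]; ring
        linarith
      calc _ ≤ A / 2 * w * m := by gcongr
        _ = _ := by ring
    calc _ ≤ A * m * (k : ℝ) ^ (p / 2) + (A * m * w / 2 + A * m * w / 2) := by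
          refine h1.trans ?_; gcongr
      _ = A * m * ((k : ℝ) ^ (p / 2) + w) := by ring
      _ ≤ _ := by gcongr

/-- Exponential moments of conditionally sub-Gaussian sums. -/
theorem lintegral_exp_partialSum_le (hψ : Measurable ψ) (hY : Measurable Y)
    (hZc : ∀ k, Measurable (Zc k)) (hind : iIndepFun Zc P)
    (hYZc : IndepFun Y (fun ω k => Zc k ω) P)
    (hid : ∀ k, IdentDistrib (Zc k) Z P P) {v c : ℝ}
    (hv : ∀ᵐ ω ∂P, ∫⁻ ω', ENNReal.ofReal (Real.exp (v * ψ (Y ω, Z ω'))) ∂P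
      ≤ ENNReal.ofReal (Real.exp c)) (k : ℕ) :
    ∫⁻ ω, ENNReal.ofReal (Real.exp (v * partialSum ψ Y Zc k ω)) ∂P
      ≤ ENNReal.ofReal (Real.exp (c * k)) := by
  have hSm := measurable_partialSum hψ hY hZc
  induction k with
  | zero => simp [partialSum]
  | succ k ih =>
    have e : ∀ ω, ENNReal.ofReal (Real.exp (v * partialSum ψ Y Zc (k + 1) ω))
        = ENNReal.ofReal (Real.exp (v * partialSum ψ Y Zc k ω))
          * ENNReal.ofReal (Real.exp (v * ψ (Y ω, Zc k ω))) := by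
      intro ω
      rw [partialSum_succ, mul_add, Real.exp_add, ENNReal.ofReal_mul (Real.exp_pos _).le]
    simp_rw [e]
    have hfun : Measurable fun q : (E × ℝ) × F => ENNReal.ofReal (Real.exp (v * q.1.2))
        * ENNReal.ofReal (Real.exp (v * ψ (q.1.1, q.2))) := by
      have : Measurable fun q : (E × ℝ) × F => ψ (q.1.1, q.2) :=
        hψ.comp ((measurable_fst.comp measurable_fst).prodMk measurable_snd)
      have h2 : Measurable fun q : (E × ℝ) × F => q.1.2 := measurable_snd.comp measurable_fst
      exact (Real.measurable_exp.comp (h2.const_mul v)).ennreal_ofReal.mul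
        (Real.measurable_exp.comp (this.const_mul v)).ennreal_ofReal
    rw [lintegral_indepFun (P' := P) (S := fun ω => (Y ω, partialSum ψ Y Zc k ω)) (U := Zc k)
        (U' := Z) (hY.prodMk (hSm k)) (hZc k) (indepFun_partialSum hψ hY hZc hind hYZc k) (hid k)
        hfun]
    calc _ ≤ ∫⁻ ω, ENNReal.ofReal (Real.exp (v * partialSum ψ Y Zc k ω))
          * ENNReal.ofReal (Real.exp c) ∂P := by
          refine lintegral_mono_ae ?_
          filter_upwards [hv] with ω hω
          rw [lintegral_const_mul' _ _ ENNReal.ofReal_ne_top]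
          gcongr
      _ = (∫⁻ ω, ENNReal.ofReal (Real.exp (v * partialSum ψ Y Zc k ω)) ∂P)
          * ENNReal.ofReal (Real.exp c) := lintegral_mul_const' _ _ ENNReal.ofReal_ne_top
      _ ≤ ENNReal.ofReal (Real.exp (c * k)) * ENNReal.ofReal (Real.exp c) := by gcongr
      _ = _ := by
          rw [← ENNReal.ofReal_mul (Real.exp_pos _).le, ← Real.exp_add]
          push_cast; ring_nf

end NestedSums

/-! ### Probability that two variables fall on different sides of a threshold -/

section Switch

variable {Ω : Type*} [MeasurableSpace Ω] {P : Measure Ω}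

/-- The probability that exactly one of `A`, `B` reaches the threshold `ξ`. -/
noncomputable def switchProb (P : Measure Ω) (A B : Ω → ℝ) (ξ : ℝ) : ℝ :=
  P.real {ω | ¬ (ξ ≤ A ω ↔ ξ ≤ B ω)}

variable [IsProbabilityMeasure P]

theorem switchProb_triangle (A B C : Ω → ℝ) (ξ : ℝ) :
    switchProb P A C ξ ≤ switchProb P A B ξ + switchProb P C B ξ := by
  refine (measureReal_mono ?_).trans (measureReal_union_le _ _)
  intro ω hω
  simp only [Set.mem_ofPred_eq, Set.mem_union] at *
  tauto

/-- If only one of the two variables reaches `ξ`, either they are at least `t` apart or `B` lies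
within `t` of `ξ`; the latter event is controlled by the density of `B`. -/
theorem switchProb_le_tail {A B : Ω → ℝ} {f : ℝ → ℝ} (hf : IsContinuousPDF P B f)
    (hB : Measurable B) {b : ℝ} (hb : ∀ x, f x ≤ b) (ξ : ℝ) {t : ℝ} (ht : 0 ≤ t) :
    switchProb P A B ξ ≤ P.real {ω | t ≤ |A ω - B ω|} + 2 * b * t := by
  have h1 := hf.cdf_sub_le hB hb (x := ξ - t) (y := ξ + t) (by linarith)
  have h2 : switchProb P A B ξ ≤ P.real ({ω | t ≤ |A ω - B ω|} ∪ (B ⁻¹' Set.Ioc (ξ - t) (ξ + t))) := by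
    refine measureReal_mono ?_
    intro ω hω
    simp only [Set.mem_ofPred_eq, Set.mem_union, Set.mem_preimage, Set.mem_Ioc] at *
    by_contra hcon
    push Not at hcon
    obtain ⟨h3, h4⟩ := hcon
    have h5 := abs_lt.1 h3
    apply hω
    constructor
    · intro h; by_contra h6
      have := h4 (by linarith); linarith
    · intro h; by_contra h6
      push Not at h6
      have := h4 (by linarith); linarith
  refine h2.trans ((measureReal_union_le _ _).trans ?_)
  have h3 : P.real {ω | B ω ≤ ξ - t} + P.real (B ⁻¹' Set.Ioc (ξ - t) (ξ + t))
      = P.real {ω | B ω ≤ ξ + t} := by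
    rw [← measureReal_union _ (hB measurableSet_Ioc)]
    · congr 1; ext ω; simp only [Set.mem_ofPred_eq, Set.mem_union, Set.mem_preimage, Set.mem_Ioc]
      constructor
      · rintro (h | h)
        · linarith
        · exact h.2
      · intro h; rcases le_or_gt (B ω) (ξ - t) with h' | h'
        · exact Or.inl h'
        · exact Or.inr ⟨h', h⟩
    · rw [Set.disjoint_left]; intro ω h h'; exact absurd h'.1 (not_lt.2 h)
  linarith

end Switch

/-! ### The nested Monte Carlo error -/

section Nested

variable {Ω : Type*} [MeasurableSpace Ω] {P : Measure Ω} {d q : ℕ}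
  {φ : EuclideanSpace ℝ (Fin d) → EuclideanSpace ℝ (Fin q) → ℝ}
  {Y : Ω → EuclideanSpace ℝ (Fin d)} {Z : Ω → EuclideanSpace ℝ (Fin q)}
  {Zc : ℕ → Ω → EuclideanSpace ℝ (Fin q)}

theorem loss_zero : loss P φ Y Z Zc 0
    = P[fun ω => φ (Y ω) (Z ω) | MeasurableSpace.comap Y inferInstance] := if_pos rfl

theorem loss_pos {K : ℕ} (hK : 1 ≤ K) : loss P φ Y Z Zc K
    = fun ω => 1 / (K : ℝ) * ∑ k ∈ Finset.range K, φ (Y ω) (Zc k ω) := if_neg (by omega)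

theorem measurable_loss (hmodel : IsNestedModel P φ Y Z Zc) (K : ℕ) :
    Measurable (loss P φ Y Z Zc K) := by
  rcases Nat.eq_zero_or_pos K with rfl | hK
  · rw [loss_zero]
    exact (stronglyMeasurable_condExp.mono hmodel.measurable_Y.comap_le).measurable
  · rw [loss_pos hK]
    refine Measurable.const_mul (Finset.measurable_sum _ fun k _ => ?_) _
    exact hmodel.measurable_φ.comp (hmodel.measurable_Y.prodMk (hmodel.measurable_Zc k))

theorem loss_sub_eq {ψ : EuclideanSpace ℝ (Fin d) × EuclideanSpace ℝ (Fin q) → ℝ}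
    (hψ : ∀ ω z, ψ (Y ω, z) = φ (Y ω) z - loss P φ Y Z Zc 0 ω) {K : ℕ} (hK : 1 ≤ K) (ω : Ω) :
    loss P φ Y Z Zc K ω - loss P φ Y Z Zc 0 ω = 1 / (K : ℝ) * partialSum ψ Y Zc K ω := by
  have : (K : ℝ) ≠ 0 := by positivity
  unfold partialSum
  simp_rw [hψ]
  rw [loss_pos hK, Finset.sum_sub_distrib]
  simp
  field_simp

variable [IsProbabilityMeasure P]

theorem IsNestedModel.identDistrib_pair (hmodel : IsNestedModel P φ Y Z Zc) (k : ℕ) :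
    IdentDistrib (fun ω => (Y ω, Zc k ω)) (fun ω => (Y ω, Z ω)) P P :=
  identDistrib_prodMk_left hmodel.measurable_Y hmodel.measurable_Z (hmodel.measurable_Zc k)
    hmodel.indep_Y_Z (hmodel.indep_Y_Zc.comp measurable_id (measurable_pi_apply k))
    (hmodel.identDistrib_Zc k)

theorem memLp_loss (hmodel : IsNestedModel P φ Y Z Zc)
    (hL2 : MemLp (fun ω => φ (Y ω) (Z ω)) 2 P) (K : ℕ) : MemLp (loss P φ Y Z Zc K) 2 P := by
  rcases Nat.eq_zero_or_pos K with rfl | hK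
  · rw [loss_zero]
    exact hL2.condExp one_le_two
  · rw [loss_pos hK]
    have h : ∀ k, MemLp (fun ω => φ (Y ω) (Zc k ω)) 2 P := fun k =>
      ((hmodel.identDistrib_pair k).comp hmodel.measurable_φ).memLp_iff.2 hL2
    exact (memLp_finsetSum (Finset.range K) fun k _ => h k).const_mul _

/-- The conditional expectation is measurable with respect to `Y`, so it factors through `Y`. The
deviation thus becomes one function of `(Y, Z)`, into which the copies of `Z` can be inserted, and
its mean over `Z` with `Y` frozen vanishes. -/
theorem exists_residual (hmodel : IsNestedModel P φ Y Z Zc)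
    (hL2 : MemLp (fun ω => φ (Y ω) (Z ω)) 2 P) :
    ∃ ψ : EuclideanSpace ℝ (Fin d) × EuclideanSpace ℝ (Fin q) → ℝ, Measurable ψ ∧
      (∀ ω z, ψ (Y ω, z) = φ (Y ω) z - loss P φ Y Z Zc 0 ω) ∧
      ∀ᵐ ω ∂P, ∫ ω', ψ (Y ω, Z ω') ∂P = 0 := by
  have hX0 : Measurable[MeasurableSpace.comap Y inferInstance] (loss P φ Y Z Zc 0) := by
    rw [loss_zero]; exact stronglyMeasurable_condExp.measurable
  obtain ⟨g, hg, hgeq⟩ := hX0.exists_eq_measurable_comp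
  have hψ : Measurable fun q : EuclideanSpace ℝ (Fin d) × EuclideanSpace ℝ (Fin q) =>
      φ q.1 q.2 - g q.1 := hmodel.measurable_φ.sub (hg.comp measurable_fst)
  have hval : ∀ ω z, φ (Y ω) z - g (Y ω) = φ (Y ω) z - loss P φ Y Z Zc 0 ω := fun ω z => by
    rw [hgeq]; rfl
  refine ⟨fun q => φ q.1 q.2 - g q.1, hψ, hval, ?_⟩
  have hi1 : Integrable (fun ω => φ (Y ω) (Z ω)) P := hL2.integrable one_le_two
  have hi2 : Integrable (loss P φ Y Z Zc 0) P := (memLp_loss hmodel hL2 0).integrable one_le_two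
  have hint : Integrable (fun ω => φ (Y ω) (Z ω) - g (Y ω)) P := by
    refine (hi1.sub hi2).congr (Eventually.of_forall fun ω => ?_)
    exact (hval ω (Z ω)).symm
  have h1 := condExp_indepFun hmodel.measurable_Y hmodel.measurable_Z hmodel.indep_Y_Z hψ hint
  have h2 : P[fun ω => φ (Y ω) (Z ω) - g (Y ω) | MeasurableSpace.comap Y inferInstance] =ᵐ[P] 0 := by
    have e : (fun ω => φ (Y ω) (Z ω) - g (Y ω)) = (fun ω => φ (Y ω) (Z ω)) - loss P φ Y Z Zc 0 :=
      funext fun ω => hval ω (Z ω)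
    rw [e]
    refine (condExp_sub hi1 hi2 _).trans ?_
    rw [condExp_of_stronglyMeasurable hmodel.measurable_Y.comap_le hX0.stronglyMeasurable hi2,
      ← loss_zero (Zc := Zc), sub_self]
  filter_upwards [h1, h2] with ω h1 h2
  rw [h2] at h1
  rw [integral_map hmodel.measurable_Z.aemeasurable
    (f := fun z => φ (Y ω) z - g (Y ω)) (hψ.comp measurable_prodMk_left).aestronglyMeasurable] at h1
  exact h1.symm

theorem moment_loss_sub_le (hmodel : IsNestedModel P φ Y Z Zc)
    (hL2 : MemLp (fun ω => φ (Y ω) (Z ω)) 2 P) {p : ℝ} (hp : 2 ≤ p)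
    (hD : MomentScenario P (fun ω => φ (Y ω) (Z ω) - loss P φ Y Z Zc 0 ω) p) :
    ∃ C, 0 ≤ C ∧ ∀ K : ℕ, 1 ≤ K →
      Integrable (fun ω => |loss P φ Y Z Zc K ω - loss P φ Y Z Zc 0 ω| ^ p) P ∧
      ∫ ω, |loss P φ Y Z Zc K ω - loss P φ Y Z Zc 0 ω| ^ p ∂P ≤ C * (1 / (K : ℝ)) ^ (p / 2) := by
  obtain ⟨ψ, hψ, hψeq, hcent⟩ := exists_residual hmodel hL2
  have hm : Integrable (fun ω => |ψ (Y ω, Z ω)| ^ p) P := by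
    simp_rw [hψeq]; exact hD
  obtain ⟨C, hC, h⟩ := moment_partialSum_le hψ hmodel.measurable_Y hmodel.measurable_Z
    hmodel.measurable_Zc hmodel.iIndep_Zc hmodel.indep_Y_Zc hmodel.indep_Y_Z
    hmodel.identDistrib_Zc hcent hp hm
  refine ⟨C, hC, fun K hK => ?_⟩
  have hK0 : (0 : ℝ) < K := by exact_mod_cast hK
  have e : (fun ω => |loss P φ Y Z Zc K ω - loss P φ Y Z Zc 0 ω| ^ p)
      = fun ω => (1 / (K : ℝ)) ^ p * |partialSum ψ Y Zc K ω| ^ p := by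
    funext ω
    rw [loss_sub_eq hψeq hK, abs_mul, Real.mul_rpow (abs_nonneg _) (abs_nonneg _),
      abs_of_pos (by positivity)]
  rw [e]
  refine ⟨(h K).1.const_mul _, ?_⟩
  rw [integral_const_mul]
  calc (1 / (K : ℝ)) ^ p * ∫ ω, |partialSum ψ Y Zc K ω| ^ p ∂P
      ≤ (1 / (K : ℝ)) ^ p * (C * (K : ℝ) ^ (p / 2)) := by gcongr; exact (h K).2
    _ = C * (1 / (K : ℝ)) ^ (p / 2) := by
        rw [Real.div_rpow one_pos.le hK0.le, Real.div_rpow one_pos.le hK0.le, Real.one_rpow,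
          Real.one_rpow]
        have : (K : ℝ) ^ p = (K : ℝ) ^ (p / 2) * (K : ℝ) ^ (p / 2) := by
          rw [← Real.rpow_add hK0]; congr 1; ring
        rw [this]
        field_simp

theorem momentScenario_two (hmodel : IsNestedModel P φ Y Z Zc)
    (hL2 : MemLp (fun ω => φ (Y ω) (Z ω)) 2 P) :
    MomentScenario P (fun ω => φ (Y ω) (Z ω) - loss P φ Y Z Zc 0 ω) 2 := by
  have := (hL2.sub (memLp_loss hmodel hL2 0)).integrable_norm_rpow (by norm_num) (by norm_num)
  simpa [MomentScenario] using this

theorem sq_loss_sub_le (hmodel : IsNestedModel P φ Y Z Zc)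
    (hL2 : MemLp (fun ω => φ (Y ω) (Z ω)) 2 P) :
    ∃ C, 0 ≤ C ∧ ∀ K : ℕ, 1 ≤ K →
      ∫ ω, (loss P φ Y Z Zc K ω - loss P φ Y Z Zc 0 ω) ^ 2 ∂P ≤ C * (1 / (K : ℝ)) := by
  obtain ⟨C, hC, h⟩ := moment_loss_sub_le hmodel hL2 le_rfl (momentScenario_two hmodel hL2)
  refine ⟨C, hC, fun K hK => ?_⟩
  have := (h K hK).2
  simpa using this

/-- With `h = 1/K`, the tail bound `C h^{p/2} t^{-p}` balances the density term, of order `t`, at `t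
= h^{p/(2(1+p))}`. For `p < 2` the case `p = 2`, available from square integrability, is stronger,
since the exponent increases with `p`. -/
theorem switchProb_loss_le_of_moment (hmodel : IsNestedModel P φ Y Z Zc)
    (hL2 : MemLp (fun ω => φ (Y ω) (Z ω)) 2 P) {p : ℝ} (hp : 1 < p)
    (hD : MomentScenario P (fun ω => φ (Y ω) (Z ω) - loss P φ Y Z Zc 0 ω) p)
    {f : ℝ → ℝ} (hf : IsContinuousPDF P (loss P φ Y Z Zc 0) f) {b : ℝ} (hb0 : 0 ≤ b)
    (hb : ∀ x, f x ≤ b) :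
    ∃ C, 0 ≤ C ∧ ∀ K : ℕ, 1 ≤ K → ∀ ξ,
      switchProb P (loss P φ Y Z Zc K) (loss P φ Y Z Zc 0) ξ
        ≤ C * (1 / (K : ℝ)) ^ (p / (2 * (1 + p))) := by
  wlog hp2 : 2 ≤ p generalizing p
  · obtain ⟨C, hC, h⟩ := this one_lt_two (momentScenario_two hmodel hL2) le_rfl
    refine ⟨C, hC, fun K hK ξ => (h K hK ξ).trans ?_⟩
    have hK0 : (1 : ℝ) ≤ K := by exact_mod_cast hK
    refine mul_le_mul_of_nonneg_left ?_ hC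
    refine Real.rpow_le_rpow_of_exponent_ge (by positivity) ?_ ?_
    · rw [div_le_one (by linarith)]; exact hK0
    · rw [div_le_div_iff₀ (by linarith) (by norm_num)]
      push Not at hp2
      linarith
  obtain ⟨C, hC, h⟩ := moment_loss_sub_le hmodel hL2 hp2 hD
  refine ⟨C + 2 * b, by positivity, fun K hK ξ => ?_⟩
  have hK0 : (0 : ℝ) < K := by exact_mod_cast hK
  obtain ⟨k, hk⟩ : ∃ k, k = 1 / (K : ℝ) := ⟨_, rfl⟩
  have hk0 : 0 < k := by rw [hk]; positivity
  obtain ⟨h1, h2⟩ := h K hK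
  rw [← hk] at h2 ⊢
  set r := p / (2 * (1 + p)) with hr
  set t := k ^ r with ht
  have ht0 : 0 < t := by positivity
  refine (switchProb_le_tail hf (measurable_loss hmodel 0) hb ξ ht0.le).trans ?_
  have h3 := mul_meas_ge_le_integral_of_nonneg (μ := P)
    (Eventually.of_forall fun ω => by positivity) h1 (t ^ p)
  have h4 : {ω | t ^ p ≤ |loss P φ Y Z Zc K ω - loss P φ Y Z Zc 0 ω| ^ p}
      = {ω | t ≤ |loss P φ Y Z Zc K ω - loss P φ Y Z Zc 0 ω|} := by
    ext ω
    exact Real.rpow_le_rpow_iff ht0.le (abs_nonneg _) (by linarith)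
  rw [h4] at h3
  have h5 : P.real {ω | t ≤ |loss P φ Y Z Zc K ω - loss P φ Y Z Zc 0 ω|} ≤ C * t := by
    have htp : 0 < t ^ p := by positivity
    have : t ^ p * t = k ^ (p / 2) := by
      rw [ht, ← Real.rpow_mul hk0.le, ← Real.rpow_add hk0, hr]
      congr 1
      have : 1 + p ≠ 0 := by linarith
      field_simp
      ring
    have h6 : t ^ p * P.real {ω | t ≤ |loss P φ Y Z Zc K ω - loss P φ Y Z Zc 0 ω|}
        ≤ t ^ p * (C * t) := by
      calc _ ≤ _ := h3
        _ ≤ C * k ^ (p / 2) := h2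
        _ = _ := by rw [← this]; ring
    exact le_of_mul_le_mul_left h6 htp
  linarith

theorem tail_loss_le_of_gaussian (hmodel : IsNestedModel P φ Y Z Zc)
    (hL2 : MemLp (fun ω => φ (Y ω) (Z ω)) 2 P)
    (hD : GaussianScenario P Y (fun ω => φ (Y ω) (Z ω) - loss P φ Y Z Zc 0 ω)) :
    ∃ C, 0 < C ∧ ∀ K : ℕ, 1 ≤ K → ∀ t : ℝ, 0 ≤ t →
      P.real {ω | t ≤ |loss P φ Y Z Zc K ω - loss P φ Y Z Zc 0 ω|}
        ≤ 2 * Real.exp (-(t ^ 2 * K / (4 * C))) := by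
  obtain ⟨ψ, hψ, hψeq, hcent⟩ := exists_residual hmodel hL2
  obtain ⟨Cg, hCg, hg⟩ := hD
  -- The constant is a divisor below; adding `1` keeps it positive when `Cg = 0`.
  refine ⟨Cg + 1, by linarith, fun K hK t ht => ?_⟩
  have hK0 : (0 : ℝ) < K := by exact_mod_cast hK
  set C := Cg + 1
  have hCpos : 0 < C := by positivity
  have hexp : ∀ v : ℝ, ∫⁻ ω, ENNReal.ofReal (Real.exp (v * partialSum ψ Y Zc K ω)) ∂P
      ≤ ENNReal.ofReal (Real.exp (C * v ^ 2 * K)) := by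
    intro v
    refine lintegral_exp_partialSum_le (Z := Z) hψ hmodel.measurable_Y hmodel.measurable_Zc
      hmodel.iIndep_Zc hmodel.indep_Y_Zc hmodel.identDistrib_Zc ?_ K
    obtain ⟨hi, hle⟩ := hg v
    have hm : Measurable fun q => Real.exp (v * ψ q) := Real.measurable_exp.comp (hψ.const_mul v)
    have hi' : Integrable (fun ω => Real.exp (v * ψ (Y ω, Z ω))) P := by
      simp_rw [hψeq]; exact hi
    have h1 := condExp_indepFun hmodel.measurable_Y hmodel.measurable_Z hmodel.indep_Y_Z hm hi'
    have hprod := (indepFun_iff_map_prod_eq_prod_map_map hmodel.measurable_Y.aemeasurable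
      hmodel.measurable_Z.aemeasurable).1 hmodel.indep_Y_Z
    have := Measure.isProbabilityMeasure_map (μ := P) hmodel.measurable_Z.aemeasurable
    have := Measure.isProbabilityMeasure_map (μ := P) hmodel.measurable_Y.aemeasurable
    have h2 : Integrable (fun q => Real.exp (v * ψ q)) ((P.map Y).prod (P.map Z)) := by
      rw [← hprod, integrable_map_measure hm.aestronglyMeasurable
        (hmodel.measurable_Y.prodMk hmodel.measurable_Z).aemeasurable]
      exact hi'
    have h3 := ae_of_ae_map hmodel.measurable_Y.aemeasurable h2.prod_right_ae
    simp_rw [hψeq] at h1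
    filter_upwards [h1, h3, hle] with ω h1 h3 hle
    rw [h1] at hle
    have h4 : ∫ z, Real.exp (v * ψ (Y ω, z)) ∂(P.map Z) ≤ Real.exp (C * v ^ 2) := by
      simp_rw [hψeq]
      refine hle.trans (Real.exp_le_exp.2 ?_)
      have := sq_nonneg v
      gcongr; linarith
    rw [← lintegral_map (f := fun z => ENNReal.ofReal (Real.exp (v * ψ (Y ω, z))))
      (hm.comp measurable_prodMk_left).ennreal_ofReal hmodel.measurable_Z,
      ← ofReal_integral_eq_lintegral_ofReal h3 (Eventually.of_forall fun z => (Real.exp_pos _).le)]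
    exact ENNReal.ofReal_le_ofReal h4
  have hside : ∀ σ : ℝ, σ ^ 2 = 1 → P.real {ω | t * K ≤ σ * partialSum ψ Y Zc K ω}
      ≤ Real.exp (-(t ^ 2 * K / (4 * C))) := by
    intro σ hσ
    -- The minimizer of the Chernoff exponent `C v² K - v t K`.
    set v := t / (2 * C) with hv
    have hv0 : 0 ≤ v := by positivity
    have hm : Measurable fun ω => ENNReal.ofReal (Real.exp (v * σ * partialSum ψ Y Zc K ω)) :=
      (Real.measurable_exp.comp ((measurable_partialSum hψ hmodel.measurable_Y
        hmodel.measurable_Zc K).const_mul _)).ennreal_ofReal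
    have h1 := mul_meas_ge_le_lintegral (μ := P) hm (ENNReal.ofReal (Real.exp (v * (t * K))))
    have h2 : P {ω | t * K ≤ σ * partialSum ψ Y Zc K ω}
        ≤ P {ω | ENNReal.ofReal (Real.exp (v * (t * K)))
          ≤ ENNReal.ofReal (Real.exp (v * σ * partialSum ψ Y Zc K ω))} := by
      refine measure_mono fun ω hω => ?_
      refine ENNReal.ofReal_le_ofReal (Real.exp_le_exp.2 ?_)
      rw [mul_assoc]
      exact mul_le_mul_of_nonneg_left hω hv0
    have h3 : ENNReal.ofReal (Real.exp (v * (t * K))) * P {ω | t * K ≤ σ * partialSum ψ Y Zc K ω}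
        ≤ ENNReal.ofReal (Real.exp (C * v ^ 2 * K)) := by
      have := hexp (v * σ)
      rw [mul_pow, hσ, mul_one] at this
      exact (mul_le_mul_right h2 _).trans (h1.trans this)
    have h4 : Real.exp (v * (t * K)) * P.real {ω | t * K ≤ σ * partialSum ψ Y Zc K ω}
        ≤ Real.exp (C * v ^ 2 * K) := by
      have := ENNReal.toReal_mono ENNReal.ofReal_ne_top h3
      rwa [ENNReal.toReal_mul, ENNReal.toReal_ofReal (Real.exp_pos _).le,
        ENNReal.toReal_ofReal (Real.exp_pos _).le] at this
    have h5 : Real.exp (C * v ^ 2 * K) = Real.exp (v * (t * K)) * Real.exp (-(t ^ 2 * K / (4 * C))) := by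
      rw [← Real.exp_add]; congr 1; rw [hv]; field_simp; ring
    rw [h5] at h4
    exact le_of_mul_le_mul_left h4 (Real.exp_pos _)
  have hsub : {ω | t ≤ |loss P φ Y Z Zc K ω - loss P φ Y Z Zc 0 ω|}
      ⊆ {ω | t * K ≤ 1 * partialSum ψ Y Zc K ω} ∪ {ω | t * K ≤ -1 * partialSum ψ Y Zc K ω} := by
    intro ω hω
    simp only [Set.mem_ofPred_eq, Set.mem_union] at *
    rw [loss_sub_eq hψeq hK, abs_mul, abs_of_pos (show 0 < 1 / (K : ℝ) by positivity),
      one_div_mul_eq_div, le_div_iff₀ hK0, le_abs] at hω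
    rcases hω with h | h
    · left; linarith
    · right; linarith
  have h1 := hside 1 (by norm_num)
  have h2 := hside (-1) (by norm_num)
  calc _ ≤ _ := measureReal_mono hsub
    _ ≤ _ := measureReal_union_le _ _
    _ ≤ _ := by linarith

end Nested

/-! ### The bias parameters of the levels -/

section Levels

variable {K₀ M : ℕ}

theorem one_le_levelK (hK₀ : 1 ≤ K₀) (hM : 2 ≤ M) (ℓ : ℕ) : 1 ≤ levelK K₀ M ℓ :=
  Nat.one_le_iff_ne_zero.2 (mul_ne_zero (by omega) (pow_ne_zero _ (by omega)))

theorem levelH_pos (hK₀ : 1 ≤ K₀) (hM : 2 ≤ M) (ℓ : ℕ) : 0 < levelH K₀ M ℓ := by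
  have : (0 : ℝ) < levelK K₀ M ℓ := by exact_mod_cast one_le_levelK hK₀ hM ℓ
  unfold levelH; positivity

theorem levelH_le_pow (hK₀ : 1 ≤ K₀) (hM : 2 ≤ M) (ℓ : ℕ) : levelH K₀ M ℓ ≤ (1 / 2) ^ ℓ := by
  unfold levelH levelK
  rw [one_div_pow]
  apply one_div_le_one_div_of_le (by positivity)
  have h1 : (1 : ℝ) ≤ K₀ := by exact_mod_cast hK₀
  have h2 : (2 : ℝ) ≤ M := by exact_mod_cast hM
  push_cast
  calc (2 : ℝ) ^ ℓ = 1 * 2 ^ ℓ := (one_mul _).symm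
    _ ≤ K₀ * (M : ℝ) ^ ℓ := by gcongr

theorem levelH_le_one (hK₀ : 1 ≤ K₀) (hM : 2 ≤ M) (ℓ : ℕ) : levelH K₀ M ℓ ≤ 1 :=
  (levelH_le_pow hK₀ hM ℓ).trans (pow_le_one₀ (by norm_num) (by norm_num))

theorem levelH_le_half (hK₀ : 1 ≤ K₀) (hM : 2 ≤ M) {ℓ : ℕ} (hℓ : 1 ≤ ℓ) :
    levelH K₀ M ℓ ≤ 1 / 2 :=
  (levelH_le_pow hK₀ hM ℓ).trans (pow_le_of_le_one (by norm_num) (by norm_num) (by omega))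

theorem levelH_pred (hM : 2 ≤ M) {ℓ : ℕ} (hℓ : 1 ≤ ℓ) :
    levelH K₀ M (ℓ - 1) = M * levelH K₀ M ℓ := by
  obtain ⟨n, rfl⟩ : ∃ n, ℓ = n + 1 := ⟨ℓ - 1, by omega⟩
  have h2 : (M : ℝ) ≠ 0 := by positivity
  unfold levelH levelK
  simp only [Nat.add_sub_cancel]
  push_cast
  rw [pow_succ]
  by_cases h : (K₀ : ℝ) = 0
  · simp [h]
  · field_simp

end Levels

/-! ### Switching under a Lipschitz conditional distribution function -/

section Conditional

variable {Ω : Type*} [MeasurableSpace Ω] {P : Measure Ω} [IsProbabilityMeasure P]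

theorem condDistrib_Ioc_le (A G : Ω → ℝ) (g x y : ℝ) (hxy : x ≤ y) :
    condDistrib A G P g (Set.Ioc x y) ≤ ENNReal.ofReal (y - x) * condCdfLip P A G g := by
  rcases hxy.eq_or_lt with rfl | hlt
  · simp
  set κ := condDistrib A G P g
  have h1 : κ.real (Set.Ioc x y) = κ.real (Set.Iic y) - κ.real (Set.Iic x) := by
    have e : Set.Ioc x y = Set.Iic y \ Set.Iic x := by
      ext a; simp [and_comm]
    rw [e, measureReal_sdiff (Set.Iic_subset_Iic.2 hxy) measurableSet_Iic]
  have h2 : ENNReal.ofReal (|κ.real (Set.Iic x) - κ.real (Set.Iic y)| / |x - y|)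
      ≤ condCdfLip P A G g :=
    le_iSup_of_le x (le_iSup_of_le y (le_iSup_of_le hlt.ne le_rfl))
  have h3 : κ (Set.Ioc x y) = ENNReal.ofReal (y - x)
      * ENNReal.ofReal (|κ.real (Set.Iic x) - κ.real (Set.Iic y)| / |x - y|) := by
    rw [← ENNReal.ofReal_mul (by linarith), abs_sub_comm x y, abs_of_pos (sub_pos.2 hlt),
      abs_sub_comm, ← h1, abs_of_nonneg measureReal_nonneg]
    have : (y - x) * (κ.real (Set.Ioc x y) / (y - x)) = κ.real (Set.Ioc x y) := by
      have : y - x ≠ 0 := by linarith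
      field_simp
    rw [this, ofReal_measureReal]
  rw [h3]
  gcongr

/-- Given `G = g`, a switch forces `A` into an interval of length `s |g|` with endpoint `ξ`; its
conditional probability is at most that length times the Lipschitz constant. -/
theorem switchProb_le_of_condCdfLip {A B G : Ω → ℝ} (hA : Measurable A) (hG : Measurable G)
    {s : ℝ} (hs : 0 ≤ s) (hB : ∀ ω, B ω = A ω + s * G ω) {fA fB : ℝ → ℝ}
    (hfA : IsContinuousPDF P A fA) (hfB : IsContinuousPDF P B fB) (ξ : ℝ) :
    ENNReal.ofReal (switchProb P B A ξ)
      ≤ ENNReal.ofReal s * ∫⁻ ω, ENNReal.ofReal |G ω| * condCdfLip P A G (G ω) ∂P := by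
  have hBm : Measurable B := by
    have : B = fun ω => A ω + s * G ω := funext hB
    rw [this]; exact hA.add (hG.const_mul s)
  -- The strict and weak inequalities are arranged so that every slice lies in a half-open interval
  -- `Ioc`. The discrepancy with the thresholds of `switchProb` lies in the null events `A = ξ` and
  -- `B = ξ`.
  set T : Set (ℝ × ℝ) := {q | (q.2 ≤ ξ ∧ ξ < q.2 + s * q.1) ∨ (q.2 + s * q.1 ≤ ξ ∧ ξ < q.2)}
    with hT
  have hTm : MeasurableSet T := by
    refine MeasurableSet.union (MeasurableSet.inter ?_ ?_) (MeasurableSet.inter ?_ ?_)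
    · exact measurableSet_le measurable_snd measurable_const
    · exact measurableSet_lt measurable_const (measurable_snd.add (measurable_fst.const_mul s))
    · exact measurableSet_le (measurable_snd.add (measurable_fst.const_mul s)) measurable_const
    · exact measurableSet_lt measurable_const measurable_snd
  have h1 : ENNReal.ofReal (switchProb P B A ξ) = P ((fun ω => (G ω, A ω)) ⁻¹' T) := by
    unfold switchProb
    rw [ofReal_measureReal]
    apply measure_congr
    filter_upwards [hfA.ae_ne hA ξ, hfB.ae_ne hBm ξ] with ω h1 h2
    apply propext
    change ¬ (ξ ≤ B ω ↔ ξ ≤ A ω) ↔ ((A ω ≤ ξ ∧ ξ < A ω + s * G ω) ∨ (A ω + s * G ω ≤ ξ ∧ ξ < A ω))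
    rw [← hB]
    constructor
    · intro h
      by_cases h3 : ξ ≤ A ω
      · right
        refine ⟨?_, lt_of_le_of_ne h3 h1.symm⟩
        by_contra h4
        exact h ⟨fun _ => h3, fun _ => by linarith⟩
      · left
        refine ⟨by linarith, ?_⟩
        by_contra h4
        refine h ⟨fun h5 => ?_, fun h5 => absurd h5 h3⟩
        exact absurd (le_antisymm (not_lt.1 h4) h5) h2
    · rintro (⟨h3, h4⟩ | ⟨h3, h4⟩) h5
      · exact h1 (le_antisymm h3 (h5.1 h4.le))
      · exact h2 (le_antisymm h3 (h5.2 h4.le))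
  rw [h1, ← Measure.map_apply (hG.prodMk hA) hTm,
    ← compProd_map_condDistrib hA.aemeasurable, Measure.compProd_apply hTm,
    lintegral_map (Kernel.measurable_kernel_prodMk_left hTm) hG,
    ← lintegral_const_mul' _ _ ENNReal.ofReal_ne_top]
  refine lintegral_mono fun ω => ?_
  set g := G ω
  rw [← mul_assoc, ← ENNReal.ofReal_mul hs]
  rcases le_total 0 g with hg | hg
  · have hsg : 0 ≤ s * g := mul_nonneg hs hg
    have := condDistrib_Ioc_le (P := P) A G g (ξ - s * g) ξ (by linarith)
    rw [sub_sub_cancel] at this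
    rw [abs_of_nonneg hg]
    refine (measure_mono ?_).trans this
    rintro a (⟨h3, h4⟩ | ⟨h3, h4⟩)
    · simp only at h3 h4; exact ⟨by linarith, h3⟩
    · simp only at h3 h4; exfalso; linarith
  · have hsg : s * g ≤ 0 := mul_nonpos_of_nonneg_of_nonpos hs hg
    have := condDistrib_Ioc_le (P := P) A G g ξ (ξ - s * g) (by linarith)
    rw [abs_of_nonpos hg]
    rw [show ξ - s * g - ξ = s * -g by ring] at this
    refine (measure_mono ?_).trans this
    rintro a (⟨h3, h4⟩ | ⟨h3, h4⟩)
    · simp only at h3 h4; exfalso; linarith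
    · simp only at h3 h4; exact ⟨h4, by linarith⟩

end Conditional

/-! ### The three strong error rates -/

section Scenarios

variable {Ω : Type*} [MeasurableSpace Ω] {P : Measure Ω} [IsProbabilityMeasure P] {d q : ℕ}
  {φ : EuclideanSpace ℝ (Fin d) → EuclideanSpace ℝ (Fin q) → ℝ}
  {Y : Ω → EuclideanSpace ℝ (Fin d)} {Z : Ω → EuclideanSpace ℝ (Fin q)}
  {Zc : ℕ → Ω → EuclideanSpace ℝ (Fin q)}

/-- The first two scenarios compare each loss with the limit `X 0` and add the two errors; the third
compares consecutive levels directly. The bound on `h^{1/2}` lets later estimates absorb powers of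
`h` into `ε`. -/
theorem switchProb_level_le (hmodel : IsNestedModel P φ Y Z Zc)
    (hL2 : MemLp (fun ω => φ (Y ω) (Z ω)) 2 P) {X : ℕ → Ω → ℝ} (hX : X = loss P φ Y Z Zc)
    {f : ℕ → ℝ → ℝ} (hf : ∀ K, IsContinuousPDF P (X K) (f K)) {b : ℝ} (hb0 : 0 ≤ b)
    (hb : ∀ K x, f K x ≤ b) {K₀ M : ℕ} (hK₀ : 1 ≤ K₀) (hM : 2 ≤ M) {ε : ℝ → ℝ}
    (hε : IsStrongErrorRate P Y (fun ω => φ (Y ω) (Z ω) - X 0 ω) X K₀ M ε) :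
    ∃ C, 0 ≤ C ∧ ∀ ℓ, 1 ≤ ℓ →
      (∀ ξ, switchProb P (X (levelK K₀ M ℓ)) (X (levelK K₀ M (ℓ - 1))) ξ
        ≤ C * ε (levelH K₀ M ℓ)) ∧
      levelH K₀ M ℓ ^ (1 / 2 : ℝ) ≤ C * ε (levelH K₀ M ℓ) := by
  subst hX
  have hM1 : (1 : ℝ) ≤ M := by exact_mod_cast (by omega : 1 ≤ M)
  rcases hε with ⟨p, hp, hD, rfl⟩ | ⟨hD, rfl⟩ | ⟨hD, rfl⟩
  · obtain ⟨C, hC, h⟩ := switchProb_loss_le_of_moment hmodel hL2 hp hD (hf 0) hb0 (hb 0)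
    set r := p / (2 * (1 + p)) with hr
    have hr0 : 0 ≤ r := by positivity
    have hr1 : r ≤ 1 / 2 := by
      rw [hr, div_le_div_iff₀ (by positivity) (by norm_num)]; linarith
    refine ⟨C + C * M + 1, by positivity, fun ℓ hℓ => ?_⟩
    have hh := levelH_pos hK₀ hM ℓ
    have hh1 := levelH_le_one hK₀ hM ℓ
    have hhr : 0 < levelH K₀ M ℓ ^ r := by positivity
    constructor
    · intro ξ
      refine (switchProb_triangle _ (loss P φ Y Z Zc 0) _ ξ).trans ?_
      have h1 := h _ (one_le_levelK hK₀ hM ℓ) ξ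
      have h2 := h _ (one_le_levelK hK₀ hM (ℓ - 1)) ξ
      change _ ≤ C * levelH K₀ M ℓ ^ r at h1
      change _ ≤ C * levelH K₀ M (ℓ - 1) ^ r at h2
      rw [levelH_pred hM hℓ, Real.mul_rpow (by positivity) hh.le] at h2
      have h3 : (M : ℝ) ^ r ≤ M := by
        calc (M : ℝ) ^ r ≤ (M : ℝ) ^ (1 : ℝ) := Real.rpow_le_rpow_of_exponent_le hM1 (by linarith)
          _ = M := Real.rpow_one _
      have h4 : C * ((M : ℝ) ^ r * levelH K₀ M ℓ ^ r) ≤ C * (M * levelH K₀ M ℓ ^ r) := by gcongr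
      nlinarith
    · calc levelH K₀ M ℓ ^ (1 / 2 : ℝ) ≤ levelH K₀ M ℓ ^ r :=
            Real.rpow_le_rpow_of_exponent_ge hh hh1 hr1
        _ = 1 * levelH K₀ M ℓ ^ r := (one_mul _).symm
        _ ≤ _ := by
            gcongr
            have : 0 ≤ C + C * M := by positivity
            linarith
  · obtain ⟨C, hC, h⟩ := tail_loss_le_of_gaussian hmodel hL2 hD
    -- Chosen so that at distance `c e` the Gaussian tail is at most `2 k^{1/2}` even at the coarser
    -- level of the pair, where `K = 1 / (M k)`.
    set c := Real.sqrt (2 * C * M) with hc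
    have hc2 : c ^ 2 = 2 * C * M := Real.sq_sqrt (by positivity)
    set l2 := Real.log 2 ^ (1 / 2 : ℝ) with hl2
    have hlog2 : 0 < Real.log 2 := Real.log_pos (by norm_num)
    have hl20 : 0 < l2 := by positivity
    refine ⟨4 / l2 + 4 * b * c + 1 / l2, by positivity, fun ℓ hℓ => ?_⟩
    have hh := levelH_pos hK₀ hM ℓ
    have hh1 := levelH_le_half hK₀ hM hℓ
    obtain ⟨k, hk⟩ : ∃ k, k = levelH K₀ M ℓ := ⟨_, rfl⟩
    rw [← hk] at hh hh1
    -- Since `ℓ ≥ 1` forces `h_ℓ ≤ 1/2`, the logarithmic factor stays away from `0` and `h^{1/2}` is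
    -- dominated by the rate.
    have hlogk : Real.log 2 ≤ |Real.log k| := by
      have : Real.log k ≤ Real.log (1 / 2) := Real.log_le_log hh hh1
      rw [one_div, Real.log_inv] at this
      rw [abs_of_nonpos (by linarith)]; linarith
    have hlog : |Real.log k| = -Real.log k := by
      have : Real.log k ≤ Real.log (1 / 2) := Real.log_le_log hh hh1
      rw [one_div, Real.log_inv] at this
      exact abs_of_nonpos (by linarith)
    have hll : l2 ≤ |Real.log k| ^ (1 / 2 : ℝ) :=
      Real.rpow_le_rpow hlog2.le hlogk (by norm_num)
    set e := k ^ (1 / 2 : ℝ) * |Real.log k| ^ (1 / 2 : ℝ) with he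
    have hke : k ^ (1 / 2 : ℝ) ≤ 1 / l2 * e := by
      rw [one_div_mul_eq_div, le_div_iff₀ hl20, he]
      gcongr
    have he0 : 0 < e := by
      have : 0 < |Real.log k| := by linarith
      positivity
    have key : ∀ K : ℕ, 1 ≤ K → 1 / (M * k) ≤ (K : ℝ) → ∀ ξ,
        switchProb P (loss P φ Y Z Zc K) (loss P φ Y Z Zc 0) ξ ≤ 2 / l2 * e + 2 * b * c * e := by
      intro K hK hKk ξ
      have ht : 0 ≤ c * e := by positivity
      refine (switchProb_le_tail (hf 0) (measurable_loss hmodel 0) (hb 0) ξ ht).trans ?_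
      have h1 := h K hK (c * e) ht
      have h2 : Real.exp (-((c * e) ^ 2 * K / (4 * C))) ≤ k ^ (1 / 2 : ℝ) := by
        rw [Real.rpow_def_of_pos hh]
        apply Real.exp_le_exp.2
        have e2 : e ^ 2 = k * |Real.log k| := by
          rw [he, ← Real.sqrt_eq_rpow, ← Real.sqrt_eq_rpow, mul_pow, Real.sq_sqrt hh.le,
            Real.sq_sqrt (abs_nonneg _)]
        rw [mul_pow, hc2, e2]
        have h3 : 1 ≤ K * (M * k) := by
          rwa [div_le_iff₀ (by positivity)] at hKk
        have h4 : 2 * C * M * (k * |Real.log k|) * K / (4 * C)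
            = (K * (M * k)) * |Real.log k| / 2 := by field_simp; ring
        rw [h4]
        have h5 : 1 * |Real.log k| ≤ (K * (M * k)) * |Real.log k| := by gcongr
        linarith
      have h6 : 2 / l2 * e = 2 * (1 / l2 * e) := by ring
      linarith
    constructor
    · intro ξ
      refine (switchProb_triangle _ (loss P φ Y Z Zc 0) _ ξ).trans ?_
      have hKl : ((levelK K₀ M ℓ : ℕ) : ℝ) = 1 / k := by
        rw [hk]; unfold levelH; rw [one_div_one_div]
      have hKl' : ((levelK K₀ M (ℓ - 1) : ℕ) : ℝ) = 1 / (M * k) := by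
        rw [hk, ← levelH_pred hM hℓ]; unfold levelH; rw [one_div_one_div]
      have h1 := key _ (one_le_levelK hK₀ hM ℓ) (by
        rw [hKl]; apply one_div_le_one_div_of_le hh; nlinarith) ξ
      have h2 := key _ (one_le_levelK hK₀ hM (ℓ - 1)) (by rw [hKl']) ξ
      rw [← hk]
      have : 0 ≤ 1 / l2 * e := by positivity
      calc _ ≤ 2 / l2 * e + 2 * b * c * e + (2 / l2 * e + 2 * b * c * e) := add_le_add h1 h2
        _ ≤ (4 / l2 + 4 * b * c + 1 / l2) * e := by
          have : (4 / l2 + 4 * b * c + 1 / l2) * e = 2 / l2 * e + 2 * b * c * e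
            + (2 / l2 * e + 2 * b * c * e) + 1 / l2 * e := by ring
          linarith
    · rw [← hk]
      refine hke.trans ?_
      change _ ≤ _ * e
      gcongr
      have : 0 ≤ 4 / l2 + 4 * b * c := by positivity
      linarith
  · set S := ⨆ (ℓ : ℕ) (_ : 1 ≤ ℓ), ∫⁻ ω, ENNReal.ofReal |levelG (loss P φ Y Z Zc) K₀ M ℓ ω| *
      condCdfLip P (loss P φ Y Z Zc (levelK K₀ M (ℓ - 1))) (levelG (loss P φ Y Z Zc) K₀ M ℓ)
        (levelG (loss P φ Y Z Zc) K₀ M ℓ ω) ∂P with hS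
    have hStop : S ≠ ⊤ := ne_of_lt hD
    refine ⟨S.toReal + 1, by positivity, fun ℓ hℓ => ?_⟩
    have hh := levelH_pos hK₀ hM ℓ
    have hhr : 0 < levelH K₀ M ℓ ^ (1 / 2 : ℝ) := by positivity
    refine ⟨fun ξ => ?_, ?_⟩
    · have hG : Measurable (levelG (loss P φ Y Z Zc) K₀ M ℓ) :=
        ((measurable_loss hmodel _).sub (measurable_loss hmodel _)).const_mul _
      have h1 := switchProb_le_of_condCdfLip (B := loss P φ Y Z Zc (levelK K₀ M ℓ))
        (measurable_loss hmodel (levelK K₀ M (ℓ - 1))) hG hhr.le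
        (fun ω => by
          unfold levelG
          rw [← mul_assoc, ← Real.rpow_add hh]
          norm_num) (hf _) (hf _) ξ
      have h2 : ∫⁻ ω, ENNReal.ofReal |levelG (loss P φ Y Z Zc) K₀ M ℓ ω| *
          condCdfLip P (loss P φ Y Z Zc (levelK K₀ M (ℓ - 1))) (levelG (loss P φ Y Z Zc) K₀ M ℓ)
          (levelG (loss P φ Y Z Zc) K₀ M ℓ ω) ∂P ≤ S := by
        rw [hS]
        exact le_iSup_of_le ℓ (le_iSup_of_le hℓ le_rfl)
      have h3 : ENNReal.ofReal (switchProb P (loss P φ Y Z Zc (levelK K₀ M ℓ))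
          (loss P φ Y Z Zc (levelK K₀ M (ℓ - 1))) ξ)
          ≤ ENNReal.ofReal (levelH K₀ M ℓ ^ (1 / 2 : ℝ)) * S := h1.trans (by gcongr)
      have h4 := ENNReal.toReal_mono (ENNReal.mul_ne_top ENNReal.ofReal_ne_top hStop) h3
      rw [ENNReal.toReal_ofReal (by unfold switchProb; positivity), ENNReal.toReal_mul,
        ENNReal.toReal_ofReal hhr.le] at h4
      nlinarith
    · have : 0 ≤ S.toReal := ENNReal.toReal_nonneg
      nlinarith

end Scenarios

/-- Bounds, uniform over the bias parameters, on the objective functions `W K` (shifted to have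
minimum `0`, attained at `z K`), their derivatives `g K` and second derivatives `p K`. -/
structure UniformBounds (W g p : ℕ → ℝ → ℝ) (z : ℕ → ℝ) (k B μ l c lip R δ : ℝ) : Prop where
  potential : ∀ K, IsConvexPotential (W K) (g K) (p K) (z K) k B
  μ_pos : 0 < μ
  l_pos : 0 < l
  c_pos : 0 < c
  R_nonneg : 0 ≤ R
  δ_pos : 0 < δ
  drift : ∀ K x, l * W K x ^ 2 ≤ g K x ^ 2 * (2 * W K x + μ * W K x ^ 2)
  lower : ∀ K x, |x - z K| ≤ 1 → c ≤ p K x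
  lipschitz : ∀ K x y, |p K x - p K y| ≤ lip * |x - y|
  z_bound : ∀ K, |z K| ≤ R
  z_rate : ∀ K : ℕ, 1 ≤ K → |z K - z 0| ≤ R * (1 / (K : ℝ))
  p_rate : ∀ K : ℕ, 1 ≤ K → |p K (z K) - p 0 (z 0)| ≤ R * (1 / (K : ℝ)) ^ (1 / 4 + δ)

/-! ### Supremum and Lipschitz norms -/

section Norms

theorem abs_le_supNorm {h : ℝ → ℝ} {C : ℝ} (hC : ∀ x, |h x| ≤ C) (x : ℝ) : |h x| ≤ supNorm h :=
  le_ciSup (f := fun x => |h x|) ⟨C, by rintro _ ⟨y, rfl⟩; exact hC y⟩ x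

theorem supNorm_le {h : ℝ → ℝ} {C : ℝ} (hC : ∀ x, |h x| ≤ C) : supNorm h ≤ C := ciSup_le hC

theorem div_abs_le {h : ℝ → ℝ} {C : ℝ} (hC0 : 0 ≤ C) (hC : ∀ x y, |h x - h y| ≤ C * |x - y|)
    (q : ℝ × ℝ) : |h q.1 - h q.2| / |q.1 - q.2| ≤ C := by
  rcases (abs_nonneg (q.1 - q.2)).eq_or_lt with h0 | h0
  · rw [← h0, div_zero]; exact hC0
  · rw [div_le_iff₀ h0]; exact hC _ _

theorem lipNorm_le {h : ℝ → ℝ} {C : ℝ} (hC0 : 0 ≤ C) (hC : ∀ x y, |h x - h y| ≤ C * |x - y|) :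
    lipNorm h ≤ C := ciSup_le (div_abs_le hC0 hC)

theorem abs_sub_le_lipNorm {h : ℝ → ℝ} {C : ℝ} (hC0 : 0 ≤ C)
    (hC : ∀ x y, |h x - h y| ≤ C * |x - y|) (x y : ℝ) : |h x - h y| ≤ lipNorm h * |x - y| := by
  rcases eq_or_ne x y with rfl | hxy
  · simp
  · have h0 : 0 < |x - y| := abs_pos.2 (sub_ne_zero.2 hxy)
    have := le_ciSup (f := fun q : ℝ × ℝ => |h q.1 - h q.2| / |q.1 - q.2|)
      ⟨C, by rintro _ ⟨q, rfl⟩; exact div_abs_le hC0 hC q⟩ (x, y)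
    rwa [div_le_iff₀ h0] at this

end Norms

/-! ### Bounds uniform in the bias parameter -/

section Uniform

variable {Ω : Type*} [MeasurableSpace Ω] {P : Measure Ω} [IsProbabilityMeasure P]

theorem IsContinuousPDF.le_cdf_sub {X : Ω → ℝ} {f : ℝ → ℝ} (hf : IsContinuousPDF P X f)
    (hX : Measurable X) {c x y : ℝ} (hxy : x ≤ y) (hc : ∀ t ∈ Set.Icc x y, c ≤ f t) :
    c * (y - x) ≤ P.real {ω | X ω ≤ y} - P.real {ω | X ω ≤ x} := by
  rw [hf.cdf_sub hX hxy]
  calc c * (y - x) = ∫ t in x..y, c := by simp [mul_comm]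
    _ ≤ ∫ t in x..y, f t :=
      intervalIntegral.integral_mono_on hxy (by simp) (hf.continuous.intervalIntegrable _ _) hc

/-- A positive constant has infinite mass. This excludes a vanishing Lipschitz constant of `V''`,
which stands in a denominator of `lambdaOf`. -/
theorem IsContinuousPDF.not_const {X : Ω → ℝ} {f : ℝ → ℝ} (hf : IsContinuousPDF P X f)
    (hX : Measurable X) {c : ℝ} (hc : 0 < c) (h : ∀ x, f x = c) : False := by
  have h1 := hf.measure_eq hX MeasurableSet.univ
  simp [h, hc] at h1

/-- Two points where a distribution function takes nearby values are close. -/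
theorem IsContinuousPDF.abs_sub_le_or {X : Ω → ℝ} {f : ℝ → ℝ} (hf : IsContinuousPDF P X f)
    (hX : Measurable X) {c ξ₀ ξ : ℝ} (hc : ∀ t ∈ Metric.ball ξ₀ 2, c ≤ f t) :
    (|ξ - ξ₀| ≤ 1 ∧ c * |ξ - ξ₀| ≤ |P.real {ω | X ω ≤ ξ} - P.real {ω | X ω ≤ ξ₀}|) ∨
      c ≤ |P.real {ω | X ω ≤ ξ} - P.real {ω | X ω ≤ ξ₀}| := by
  have hmono : ∀ {a b : ℝ}, a ≤ b → P.real {ω | X ω ≤ a} ≤ P.real {ω | X ω ≤ b} :=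
    fun hab => measureReal_mono fun ω h => le_trans h hab
  have hball : ∀ t, ξ₀ - 1 ≤ t → t ≤ ξ₀ + 1 → c ≤ f t := fun t h1 h2 => hc t (by
    rw [Metric.mem_ball, Real.dist_eq, abs_lt]; constructor <;> linarith)
  rcases le_total ξ₀ ξ with h | h
  · rw [abs_of_nonneg (sub_nonneg.2 h), abs_of_nonneg (sub_nonneg.2 (hmono h))]
    rcases le_total ξ (ξ₀ + 1) with h1 | h1
    · exact Or.inl ⟨by linarith, hf.le_cdf_sub hX h fun t ht =>
        hball t (by linarith [ht.1]) (by linarith [ht.2])⟩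
    · right
      have h2 := hf.le_cdf_sub hX (show ξ₀ ≤ ξ₀ + 1 by linarith) fun t ht =>
        hball t (by linarith [ht.1]) (by linarith [ht.2])
      have h3 := hmono h1
      linarith
  · rw [abs_sub_comm, abs_sub_comm (P.real _), abs_of_nonneg (sub_nonneg.2 h),
      abs_of_nonneg (sub_nonneg.2 (hmono h))]
    rcases le_total (ξ₀ - 1) ξ with h1 | h1
    · exact Or.inl ⟨by linarith, hf.le_cdf_sub hX h fun t ht =>
        hball t (by linarith [ht.1]) (by linarith [ht.2])⟩
    · right
      have h2 := hf.le_cdf_sub hX (show ξ₀ - 1 ≤ ξ₀ by linarith) fun t ht =>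
        hball t (by linarith [ht.1]) (by linarith [ht.2])
      have h3 := hmono h1
      linarith

variable {α : ℝ} {X : ℕ → Ω → ℝ} {f : ℕ → ℝ → ℝ} {ξs : ℕ → ℝ}

/-- Both `F_h(ξ⋆ʰ)` and `F_0(ξ⋆⁰)` equal `α`, so `F_h(ξ⋆ʰ) - F_h(ξ⋆⁰)` is minus the bias of the
distribution function at `ξ⋆⁰`, which is `O(h)`. The lower bound on the densities inverts this. -/
theorem minimizer_rate (hα : α ∈ Set.Ioo (0 : ℝ) 1) (hX : ∀ K, Measurable (X K))
    (hXi : ∀ K, Integrable (X K) P) (hξs : ∀ K, ξs K ∈ argmin (objective P α (X K)))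
    (hexp : ExpansionAssumption P α X f) (hdens : DensityAssumption f (ξs 0)) :
    ∃ R, 0 ≤ R ∧ ∀ K : ℕ, 1 ≤ K → |ξs K - ξs 0| ≤ R * (1 / (K : ℝ)) := by
  obtain ⟨v, w, hvw, hlim⟩ := hexp.expansion
  obtain ⟨-, hw, -⟩ := hlim (ξs 0) (hξs 0)
  obtain ⟨c, hc0, hc⟩ := hdens.lower_bound 2 two_pos
  have hcdf : ∀ K, P.real {ω | X K ω ≤ ξs K} = α := fun K =>
    cdf_eq_of_mem_argmin (hexp.pdf K) (hX K) (hXi K) hα.2 (hξs K)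
  obtain ⟨b, hb⟩ := (Metric.isBounded_range_of_tendsto _ hw).exists_norm_le
  have hb' : ∀ K, |w (ξs 0) K| ≤ b := fun K => hb _ ⟨K, rfl⟩
  have hb0 : 0 ≤ b := (abs_nonneg _).trans (hb' 0)
  set C := |v (ξs 0)| + b with hC
  have hC0 : 0 ≤ C := by positivity
  have h1 : ∀ K : ℕ, 1 ≤ K →
      |P.real {ω | X K ω ≤ ξs K} - P.real {ω | X K ω ≤ ξs 0}| ≤ C * (1 / (K : ℝ)) := by
    intro K hK
    have := hvw K hK (ξs 0)
    rw [hcdf 0] at this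
    have hK0 : (0 : ℝ) < K := by exact_mod_cast hK
    rw [hcdf K, abs_sub_comm, this, ← add_mul, abs_mul, abs_of_pos (show 0 < 1 / (K : ℝ) by positivity)]
    gcongr
    exact (abs_add_le _ _).trans (by rw [hC]; gcongr; exact hb' K)
  -- The second alternative of `abs_sub_le_or` forces `c ≤ C / K`, so it concerns only the finitely
  -- many `K ≤ N`, absorbed by `S * N`.
  obtain ⟨N, hN⟩ := exists_nat_ge (C / c)
  set S := ∑ K ∈ Finset.range (N + 1), |ξs K - ξs 0| with hS
  have hS0 : 0 ≤ S := Finset.sum_nonneg fun _ _ => abs_nonneg _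
  refine ⟨C / c + S * N, by positivity, fun K hK => ?_⟩
  have hK0 : (0 : ℝ) < K := by exact_mod_cast hK
  have hK1 : 0 < 1 / (K : ℝ) := by positivity
  rcases (hexp.pdf K).abs_sub_le_or (hX K) (ξ := ξs K) (fun t ht => hc K t ht) with ⟨-, h2⟩ | h2
  · have h3 : |ξs K - ξs 0| ≤ C / c * (1 / (K : ℝ)) := by
      rw [div_mul_eq_mul_div, le_div_iff₀ hc0]
      linarith [h1 K hK]
    have : 0 ≤ S * N * (1 / (K : ℝ)) := by positivity
    linarith
  · have h3 : (K : ℝ) ≤ N := by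
      refine le_trans ?_ hN
      rw [le_div_iff₀ hc0]
      have := h2.trans (h1 K hK)
      rw [mul_one_div, le_div_iff₀ hK0] at this
      linarith
    have h4 : |ξs K - ξs 0| ≤ S :=
      Finset.single_le_sum (f := fun K => |ξs K - ξs 0|) (fun _ _ => abs_nonneg _)
        (Finset.mem_range.2 (Nat.lt_succ_of_le (by exact_mod_cast h3)))
    have h5 : 1 ≤ N * (1 / (K : ℝ)) := by
      rw [mul_one_div, le_div_iff₀ hK0]; linarith
    have : 0 ≤ C / c * (1 / (K : ℝ)) := by positivity
    nlinarith

/-- The point is that `lambdaBar`, an infimum over infinitely many bias parameters, is positive and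
serves as a common rate. Both follow from uniform bounds on the densities once the minimizers are
known to stay bounded. The last conclusion compares this rate with the slope of the linearization.
-/
theorem exists_uniformBounds (hα : α ∈ Set.Ioo (0 : ℝ) 1) (hX : ∀ K, Measurable (X K))
    (hXi : ∀ K, Integrable (X K) P) (hξs : ∀ K, ξs K ∈ argmin (objective P α (X K)))
    (hexp : ExpansionAssumption P α X f) (hdens : DensityAssumption f (ξs 0))
    (hrate : DensityRateAssumption f) :
    0 < (⨆ K, supNorm (f K)) ∧ (∀ K x, f K x ≤ ⨆ K, supNorm (f K)) ∧
    ∃ c lip R δ : ℝ, UniformBounds (fun K x => objective P α (X K) x - objective P α (X K) (ξs K))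
      (fun K x => (P.real {ω | X K ω ≤ x} - α) / (1 - α)) (fun K x => f K x / (1 - α)) ξs
      (kConst α) ((⨆ K, supNorm (f K)) / (1 - α)) (4 * ((⨆ K, supNorm (f K)) / (1 - α)))
      (lambdaBar (fun K => objective P α (X K)) ξs 2) c lip R δ ∧
      lambdaBar (fun K => objective P α (X K)) ξs 2 ≤ 3 / 4 * (f 0 (ξs 0) / (1 - α)) := by
  have h1α : 0 < 1 - α := by linarith [hα.2]
  obtain ⟨C, hC⟩ := hdens.bounded_lipschitz
  have hC0 : 0 ≤ C := (abs_nonneg _).trans ((hC 0).1 0)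
  set B := ⨆ K, supNorm (f K) with hBdef
  have hfB : ∀ K x, f K x ≤ B := fun K x => by
    have h1 := abs_le_supNorm (hC K).1 x
    have h2 : supNorm (f K) ≤ B := le_ciSup (f := fun K => supNorm (f K))
      ⟨C, by rintro _ ⟨K, rfl⟩; exact supNorm_le (hC K).1⟩ K
    exact (le_abs_self _).trans (h1.trans h2)
  obtain ⟨R, hR0, hR⟩ := minimizer_rate hα hX hXi hξs hexp hdens
  have hzR : ∀ K, |ξs K - ξs 0| ≤ R := by
    intro K
    rcases Nat.eq_zero_or_pos K with rfl | hK
    · simpa using hR0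
    · have hK1 : (1 : ℝ) ≤ K := by exact_mod_cast hK
      refine (hR K hK).trans ?_
      calc R * (1 / (K : ℝ)) ≤ R * 1 := by
            gcongr; rw [div_le_one (by linarith)]; exact hK1
        _ = R := mul_one R
  -- All minimizers lie within `R` of `ξs 0`, so this ball contains the unit neighbourhoods of all
  -- of them.
  obtain ⟨c, hc0, hc⟩ := hdens.lower_bound (R + 2) (by linarith)
  have hlow : ∀ K x, |x - ξs K| ≤ 1 → c ≤ f K x := by
    intro K x hx
    apply hc
    rw [Metric.mem_ball, Real.dist_eq]
    have := abs_sub_le x (ξs K) (ξs 0)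
    linarith [hzR K]
  have hB0 : 0 < B := hc0.trans_le ((hlow 0 (ξs 0) (by simp)).trans (hfB 0 _))
  have hdd : ∀ K, deriv (deriv (objective P α (X K))) = fun ξ => f K ξ / (1 - α) := fun K =>
    deriv_deriv_objective (hexp.pdf K) (hX K) (hXi K) hα.2
  set p : ℕ → ℝ → ℝ := fun K x => f K x / (1 - α) with hp
  set lip := C / (1 - α) with hlip
  have hlip0 : 0 ≤ lip := by positivity
  have hplip : ∀ K x y, |p K x - p K y| ≤ lip * |x - y| := by
    intro K x y
    rw [hp, hlip]
    simp only
    rw [← sub_div, abs_div, abs_of_pos h1α, div_mul_eq_mul_div]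
    gcongr
    exact (hC K).2 x y
  have hp0 : ∀ K x, 0 ≤ p K x := fun K x => div_nonneg ((hexp.pdf K).nonneg x) h1α.le
  have hpB : ∀ K x, |p K x| ≤ B / (1 - α) := fun K x => by
    rw [abs_of_nonneg (hp0 K x)]
    exact div_le_div_of_nonneg_right (hfB K x) h1α.le
  set c' := c / (1 - α) with hc'
  have hc'0 : 0 < c' := by positivity
  have hpc : ∀ K x, |x - ξs K| ≤ 1 → c' ≤ p K x := fun K x hx =>
    div_le_div_of_nonneg_right (hlow K x hx) h1α.le
  have hpz : ∀ K, c' ≤ p K (ξs K) := fun K => hpc K _ (by simp)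
  have hlipK : ∀ K, lipNorm (p K) ≤ lip := fun K => lipNorm_le hlip0 (hplip K)
  have hlipK0 : ∀ K, 0 < lipNorm (p K) := by
    intro K
    by_contra hcon
    push Not at hcon
    refine (hexp.pdf K).not_const (hX K) (c := f K (ξs K))
      (hc0.trans_le (hlow K _ (by simp))) fun x => ?_
    have h1 := abs_sub_le_lipNorm hlip0 (hplip K) x (ξs K)
    have h2 : lipNorm (p K) * |x - ξs K| ≤ 0 :=
      mul_nonpos_of_nonpos_of_nonneg hcon (abs_nonneg _)
    have h3 : p K x - p K (ξs K) = 0 := abs_nonpos_iff.1 (h1.trans h2)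
    have h4 : p K x = p K (ξs K) := by linarith
    rw [hp] at h4
    simp only at h4
    rwa [div_left_inj' h1α.ne'] at h4
  have hlam : ∀ K, lambdaOf (objective P α (X K)) (ξs K) 2
      = min (3 / 4 * p K (ξs K))
        (4 * supNorm (p K) * (p K (ξs K) ^ 4 / (4 * lipNorm (p K) ^ 2))) := by
    intro K
    unfold lambdaOf
    rw [hdd K]
    norm_num
    rfl
  set m := min (3 / 4 * c') (4 * c' * (c' ^ 4 / (4 * lip ^ 2))) with hm
  have hlip1 : 0 < lip := (hlipK0 0).trans_le (hlipK 0)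
  have hm0 : 0 < m := lt_min (by positivity) (by positivity)
  have hmle : ∀ K, m ≤ lambdaOf (objective P α (X K)) (ξs K) 2 := by
    intro K
    rw [hlam, hm]
    have h1 := hpz K
    have h2 := hlipK K
    have h3 := hlipK0 K
    have h4 : c' ≤ supNorm (p K) :=
      (h1.trans (le_abs_self _)).trans (abs_le_supNorm (hpB K) _)
    have h5 : 0 ≤ supNorm (p K) := hc'0.le.trans h4
    apply min_le_min
    · gcongr
    · gcongr
  set l := lambdaBar (fun K => objective P α (X K)) ξs 2 with hl
  have hl0 : 0 < l := hm0.trans_le (le_ciInf hmle)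
  have hlle : ∀ K, l ≤ lambdaOf (objective P α (X K)) (ξs K) 2 := fun K =>
    ciInf_le ⟨m, by rintro _ ⟨K, rfl⟩; exact hmle K⟩ K
  have hl1 : ∀ K, l ≤ 3 / 4 * p K (ξs K) := fun K =>
    (hlle K).trans (by rw [hlam]; exact min_le_left _ _)
  -- Replacing the supremum norm at `K` by the uniform bound only enlarges the right-hand side, so
  -- one `μ` serves all bias parameters.
  have hl2 : ∀ K, l ≤ 4 * (B / (1 - α)) * (p K (ξs K) ^ 4 / (4 * lipNorm (p K) ^ 2)) := fun K => by
    refine (hlle K).trans ?_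
    rw [hlam]
    refine (min_le_right _ _).trans ?_
    have := supNorm_le (hpB K)
    gcongr
  obtain ⟨D, δ, hD0, hδ0, hD⟩ := hrate
  -- With `1/4 + δ' ≤ 1` the `O(h)` displacement of the minimizers is absorbed into `h^{1/4 + δ'}`.
  set δ' := min δ (3 / 4) with hδ'
  have hδ'0 : 0 < δ' := lt_min hδ0 (by norm_num)
  have hpot : ∀ K, IsConvexPotential
      (fun x => objective P α (X K) x - objective P α (X K) (ξs K))
      (fun x => (P.real {ω | X K ω ≤ x} - α) / (1 - α)) (p K) (ξs K) (kConst α)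
      (B / (1 - α)) := fun K =>
    isConvexPotential_objective (hexp.pdf K) (hX K) (hXi K) hα (hξs K) hB0 (hfB K)
  refine ⟨hB0, hfB, c', lip, R + |ξs 0| + lip * R + D / (1 - α), δ', ?_, hl1 0⟩
  have hDα : 0 ≤ D / (1 - α) := by positivity
  have hlR : 0 ≤ lip * R := by positivity
  have hz0 := abs_nonneg (ξs 0)
  exact
    { potential := hpot
      μ_pos := by positivity
      l_pos := hl0
      c_pos := hc'0
      R_nonneg := by positivity
      δ_pos := hδ'0
      drift := fun K x => (hpot K).drift (hlipK0 K)
        (fun x => abs_sub_le_lipNorm hlip0 (hplip K) x (ξs K)) (by positivity)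
        (hc'0.trans_le (hpz K)) (hl1 K) (hl2 K) x
      lower := hpc
      lipschitz := hplip
      z_bound := fun K => by
        have h1 := hzR K
        have h2 := abs_sub_abs_le_abs_sub (ξs K) (ξs 0)
        linarith
      z_rate := fun K hK => by
        refine (hR K hK).trans ?_
        gcongr
        linarith
      p_rate := fun K hK => by
        have hK1 : (1 : ℝ) ≤ K := by exact_mod_cast hK
        have hk0 : 0 < 1 / (K : ℝ) := by positivity
        have hk1 : 1 / (K : ℝ) ≤ 1 := by rw [div_le_one (by linarith)]; exact hK1
        have h1 : |p K (ξs K) - p K (ξs 0)| ≤ lip * R * (1 / (K : ℝ)) ^ (1 / 4 + δ') := by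
          refine (hplip K _ _).trans ?_
          rw [mul_assoc]
          gcongr
          refine (hR K hK).trans ?_
          gcongr
          calc 1 / (K : ℝ) = (1 / (K : ℝ)) ^ (1 : ℝ) := (Real.rpow_one _).symm
            _ ≤ _ := Real.rpow_le_rpow_of_exponent_ge hk0 hk1 (by
              have := min_le_right δ (3 / 4); rw [hδ']; linarith)
        have h2 : |p K (ξs 0) - p 0 (ξs 0)| ≤ D / (1 - α) * (1 / (K : ℝ)) ^ (1 / 4 + δ') := by
          rw [hp]
          simp only
          rw [← sub_div, abs_div, abs_of_pos h1α, div_mul_eq_mul_div]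
          gcongr
          refine (hD K hK {ξs 0} isCompact_singleton _ rfl).trans ?_
          gcongr ?_ * ?_
          exact Real.rpow_le_rpow_of_exponent_ge hk0 hk1 (by
              have := min_le_left δ (3 / 4); rw [hδ']; linarith)
        have h3 := abs_sub_le (p K (ξs K)) (p K (ξs 0)) (p 0 (ξs 0))
        have h4 : 0 ≤ (R + |ξs 0|) * (1 / (K : ℝ)) ^ (1 / 4 + δ') := by positivity
        linarith }

end Uniform

/-! ### Measurability and independence of the iterates -/

section Sampling

variable {Ω : Type*} [MeasurableSpace Ω] {P : Measure Ω} {X : ℕ → Ω → ℝ} {K₀ M : ℕ}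
  {init : ℕ → ℕ → Ω → ℝ × ℝ} {x : ℕ → ℕ → ℕ → Ω → ℝ} {α : ℝ} {γ : ℕ → ℝ}

/-- The pair of samples `i.2` at level `i.1`. -/
def samplePair (x : ℕ → ℕ → ℕ → Ω → ℝ) (i : ℕ × ℕ) (ω : Ω) : ℝ × ℝ :=
  (x i.1 (i.1 - 1) i.2 ω, x i.1 i.1 i.2 ω)

/-- The initial values and all sample pairs but the one with index `i`. -/
def otherInputs (init : ℕ → ℕ → Ω → ℝ × ℝ) (x : ℕ → ℕ → ℕ → Ω → ℝ) (i : ℕ × ℕ) (ω : Ω) :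
    (ℕ → (ℝ × ℝ) × (ℝ × ℝ)) × ({j : ℕ × ℕ // j ≠ i} → ℝ × ℝ) :=
  (fun ℓ => (init ℓ (ℓ - 1) ω, init ℓ ℓ ω), fun j => samplePair x j ω)

/-- The σ-algebra generated by everything but the sample pair with index `i`. -/
abbrev otherSigma (init : ℕ → ℕ → Ω → ℝ × ℝ) (x : ℕ → ℕ → ℕ → Ω → ℝ) (i : ℕ × ℕ) :
    MeasurableSpace Ω :=
  MeasurableSpace.comap (otherInputs init x i) inferInstance

omit [MeasurableSpace Ω] in
theorem measurable_iterate {m : MeasurableSpace Ω} {θ : Ω → ℝ × ℝ} {y : ℕ → Ω → ℝ} {n : ℕ}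
    (hθ : Measurable θ) (hy : ∀ k < n, Measurable (y k)) :
    Measurable fun ω => iterate α γ (θ ω) (fun k => y k ω) n := by
  induction n with
  | zero => exact hθ
  | succ n ih =>
    have h1 := ih fun k hk => hy k (by omega)
    have h2 := hy n (by omega)
    have hξ := measurable_fst.comp h1
    have hχ := measurable_snd.comp h1
    have hH : Measurable fun ω => H1 α (iterate α γ (θ ω) (fun k => y k ω) n).1 (y n ω) :=
      ((Measurable.ite (measurableSet_le hξ h2) measurable_const measurable_const).const_mul
        _).const_sub 1
    have hH2 : Measurable fun ω => H2 α (iterate α γ (θ ω) (fun k => y k ω) n).1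
        (iterate α γ (θ ω) (fun k => y k ω) n).2 (y n ω) :=
      hχ.sub (hξ.add (((h2.sub hξ).max measurable_const).const_mul _))
    exact (hξ.sub (hH.const_mul _)).prodMk (hχ.sub (hH2.const_mul _))

omit [MeasurableSpace Ω] in
theorem measurable_otherSigma_init (i : ℕ × ℕ) {ℓ j : ℕ} (hj : j = ℓ - 1 ∨ j = ℓ) :
    Measurable[otherSigma init x i] (init ℓ j) := by
  have hT : Measurable[otherSigma init x i] (otherInputs init x i) := comap_measurable _
  have h1 := (measurable_pi_apply ℓ).comp (measurable_fst.comp hT)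
  rcases hj with rfl | rfl
  · exact measurable_fst.comp h1
  · exact measurable_snd.comp h1

omit [MeasurableSpace Ω] in
theorem measurable_otherSigma_x (i : ℕ × ℕ) {ℓ j n : ℕ} (hj : j = ℓ - 1 ∨ j = ℓ)
    (hi : (ℓ, n) ≠ i) : Measurable[otherSigma init x i] (x ℓ j n) := by
  have hT : Measurable[otherSigma init x i] (otherInputs init x i) := comap_measurable _
  have h1 := (measurable_pi_apply (⟨(ℓ, n), hi⟩ : {j : ℕ × ℕ // j ≠ i})).comp
    (measurable_snd.comp hT)
  rcases hj with rfl | rfl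
  · exact measurable_fst.comp h1
  · exact measurable_snd.comp h1

omit [MeasurableSpace Ω] in
/-- The iterates of a level do not use the samples of other levels, nor those of later steps. -/
theorem measurable_otherSigma_levelIterate (i : ℕ × ℕ) {ℓ j n : ℕ} (hj : j = ℓ - 1 ∨ j = ℓ)
    (hi : ℓ ≠ i.1 ∨ n ≤ i.2) :
    Measurable[otherSigma init x i] (levelIterate α γ init x ℓ j n) := by
  refine measurable_iterate (measurable_otherSigma_init i hj) fun k hk =>
    measurable_otherSigma_x i hj ?_
  rintro rfl
  rcases hi with h | h
  · exact h rfl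
  · exact absurd hk (by simpa using h)

variable (hsamp : IsMultilevelSampling P X K₀ M init x)
include hsamp

theorem IsMultilevelSampling.measurable_samplePair (i : ℕ × ℕ) : Measurable (samplePair x i) :=
  (hsamp.measurable_x _ _ _).prodMk (hsamp.measurable_x _ _ _)

theorem IsMultilevelSampling.otherSigma_le (i : ℕ × ℕ) :
    otherSigma init x i ≤ (inferInstance : MeasurableSpace Ω) := by
  refine Measurable.comap_le (Measurable.prodMk ?_ ?_)
  · exact measurable_pi_lambda _ fun ℓ =>
      (hsamp.measurable_init _ _).prodMk (hsamp.measurable_init _ _)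
  · exact measurable_pi_lambda _ fun j => hsamp.measurable_samplePair _

theorem IsMultilevelSampling.measurable_levelIterate {ℓ j : ℕ} (n : ℕ) :
    Measurable (levelIterate α γ init x ℓ j n) :=
  measurable_iterate (hsamp.measurable_init _ _) fun _ _ => hsamp.measurable_x _ _ _

variable [IsProbabilityMeasure P]

/-- Replaces the filtration: what avoids sample `i` includes both the past of its own level and
everything at the other levels, so one σ-algebra yields orthogonality over steps and over levels. -/
theorem IsMultilevelSampling.indepFun_other {E : Type*} [MeasurableSpace E] {i : ℕ × ℕ}
    {S : Ω → E} (hS : Measurable[otherSigma init x i] S) : IndepFun S (samplePair x i) P :=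
  indepFun_of_measurable_comap (indepFun_rest (A := fun ω (ℓ : ℕ) => (init ℓ (ℓ - 1) ω, init ℓ ℓ ω))
    (measurable_pi_lambda _ fun _ =>
      (hsamp.measurable_init _ _).prodMk (hsamp.measurable_init _ _))
    hsamp.measurable_samplePair hsamp.iIndep hsamp.indep_init i) hS

theorem IsMultilevelSampling.indepFun_other_single {E : Type*} [MeasurableSpace E] {ℓ j n : ℕ}
    (hj : j = ℓ - 1 ∨ j = ℓ) {S : Ω → E} (hS : Measurable[otherSigma init x (ℓ, n)] S) :
    IndepFun S (x ℓ j n) P := by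
  have h := hsamp.indepFun_other hS
  rcases hj with rfl | rfl
  · exact h.comp measurable_id measurable_fst
  · exact h.comp measurable_id measurable_snd

omit [IsProbabilityMeasure P] in
theorem IsMultilevelSampling.identDistrib_single {ℓ j n : ℕ} (hj : j = ℓ - 1 ∨ j = ℓ) :
    IdentDistrib (x ℓ j n) (X (levelK K₀ M j)) P P := by
  have h := hsamp.identDistrib ℓ n
  rcases hj with rfl | rfl
  · exact h.comp measurable_fst
  · exact h.comp measurable_snd

end Sampling

/-! ### Fourth moments of the iterates -/

section FourthMoment

variable {Ω : Type*} [MeasurableSpace Ω] {P : Measure Ω} [IsProbabilityMeasure P]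

theorem measurable_H1 (α : ℝ) : Measurable fun q : ℝ × ℝ => H1 α q.1 q.2 :=
  ((Measurable.ite (measurableSet_le measurable_fst measurable_snd) measurable_const
    measurable_const).const_mul _).const_sub 1

/-- Averaging a function of one step of the scheme over the sample. -/
theorem lintegral_step {X : Ω → ℝ} {f : ℝ → ℝ} (hf : IsContinuousPDF P X f) (hX : Measurable X)
    {α c : ℝ} (hα : α < 1) (y : ℝ) {F : ℝ → ℝ} (hF : ∀ y, 0 ≤ F y) :
    ∫⁻ ω, ENNReal.ofReal (F (y - c * H1 α y (X ω))) ∂P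
      = ENNReal.ofReal (P.real {ω | X ω ≤ y} * F (y + -c)
        + (1 - P.real {ω | X ω ≤ y}) * F (y + c * (α / (1 - α)))) := by
  have h1α : (1 - α) ≠ 0 := by linarith
  have hs : MeasurableSet {ω | y ≤ X ω} := measurableSet_le measurable_const hX
  have e : (fun ω => F (y - c * H1 α y (X ω)))
      = fun ω => F (y + -c) + {ω | y ≤ X ω}.indicator
          (fun _ => F (y + c * (α / (1 - α))) - F (y + -c)) ω := by
    funext ω
    unfold H1
    by_cases h : y ≤ X ω
    · rw [if_pos h, Set.indicator_of_mem (by exact h)]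
      have : y - c * (1 - 1 / (1 - α) * 1) = y + c * (α / (1 - α)) := by field_simp; ring
      rw [this]; ring
    · rw [if_neg h, Set.indicator_of_notMem (by exact h)]
      ring_nf
  have hi : Integrable (fun ω => F (y - c * H1 α y (X ω))) P := by
    rw [e]
    exact (integrable_const _).add ((integrable_const _).indicator hs)
  rw [← ofReal_integral_eq_lintegral_ofReal hi (Eventually.of_forall fun ω => hF _), e,
    integral_add (integrable_const _) ((integrable_const _).indicator hs),
    integral_indicator_const _ hs, hf.measureReal_le hX]
  congr 1
  simp
  ring

variable {X : ℕ → Ω → ℝ} {K₀ M : ℕ} {init : ℕ → ℕ → Ω → ℝ × ℝ} {x : ℕ → ℕ → ℕ → Ω → ℝ} {α : ℝ}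
  {f : ℕ → ℝ → ℝ} {W g p : ℕ → ℝ → ℝ} {z : ℕ → ℝ} {B μ l c lip R δ γ₁ β : ℝ}

/-- Since `W` grows at most with slope `kConst α`, the Lyapunov function is bounded by `(y - z)⁴`
times an exponential of rate `μ kConst α`. The weight imposed on the initial values has four times
this rate. -/
theorem lyapunov_initial {b : ℝ}
    (hU : UniformBounds W g p z (kConst α) (b / (1 - α)) (4 * (b / (1 - α))) l c lip R δ)
    (hinit : InitMoments P α b init) :
    ∃ D : ℝ, 0 ≤ D ∧ ∀ ℓ j K, (j = ℓ - 1 ∨ j = ℓ) →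
      ∫⁻ ω, ENNReal.ofReal (expSq (4 * (b / (1 - α))) (W K (init ℓ j ω).1)) ∂P
        ≤ ENNReal.ofReal D := by
  set B := b / (1 - α) with hB
  set k := kConst α with hk
  have hk0 : 0 < k := (hU.potential 0).k_pos
  have hB0 : 0 < B := (hU.potential 0).B_pos
  set s := 16 / (1 - α) * k * b with hs
  have hs' : s = 4 * (4 * B * k) := by rw [hs, hB]; ring
  have hs0 : 0 < s := by rw [hs']; positivity
  have hR := hU.R_nonneg
  set S := ⨆ (ℓ : ℕ) (j ∈ Finset.Icc (ℓ - 1) ℓ), ∫⁻ ω, ENNReal.ofReal (|(init ℓ j ω).1| ^ 4 *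
      Real.exp (16 / (1 - α) * kConst α * b * |(init ℓ j ω).1|)) ∂P with hS
  have hStop : S ≠ ⊤ := ne_of_lt (lt_of_le_of_lt le_self_add hinit)
  set A := B ^ 2 / 4 * 8 * Real.exp (4 * B * k * R) with hA
  have hA0 : 0 ≤ A := by positivity
  have hpt : ∀ K y, expSq (4 * B) (W K y)
      ≤ A * (1 + R ^ 4) * (|y| ^ 4 * Real.exp (s * |y|)) + A * R ^ 4 * Real.exp s := by
    intro K y
    have h1 := (hU.potential K).expSq_le (μ := 4 * B) (by positivity) y
    have hz := hU.z_bound K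
    have habs : |y - z K| ≤ |y| + R := (abs_sub _ _).trans (by linarith)
    have h2 : (y - z K) ^ 4 ≤ 8 * (|y| ^ 4 + R ^ 4) := by
      have e : (y - z K) ^ 4 = |y - z K| ^ 4 := by
        rw [show (4 : ℕ) = 2 * 2 from rfl, pow_mul, pow_mul, sq_abs]
      rw [e]
      calc |y - z K| ^ 4 ≤ (|y| + R) ^ 4 := pow_le_pow_left₀ (abs_nonneg _) habs 4
        _ ≤ 2 ^ (4 - 1) * (|y| ^ 4 + R ^ 4) := add_pow_le (abs_nonneg _) hR 4
        _ = _ := by norm_num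
    have h3 : Real.exp (4 * B * k * |y - z K|)
        ≤ Real.exp (4 * B * k * R) * Real.exp (s * |y|) := by
      rw [← Real.exp_add]
      apply Real.exp_le_exp.2
      have : 4 * B * k * |y - z K| ≤ 4 * B * k * (|y| + R) := by gcongr
      have : 0 ≤ 4 * B * k * |y| := by positivity
      rw [hs']; linarith
    have h4 : Real.exp (s * |y|) ≤ |y| ^ 4 * Real.exp (s * |y|) + Real.exp s := by
      rcases le_total |y| 1 with h | h
      · have : Real.exp (s * |y|) ≤ Real.exp s := Real.exp_le_exp.2 (by nlinarith)
        have : 0 ≤ |y| ^ 4 * Real.exp (s * |y|) := by positivity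
        linarith
      · have : 1 ≤ |y| ^ 4 := one_le_pow₀ h
        have := Real.exp_pos (s * |y|)
        have := Real.exp_pos s
        nlinarith
    calc expSq (4 * B) (W K y)
        ≤ B ^ 2 / 4 * (y - z K) ^ 4 * Real.exp (4 * B * k * |y - z K|) := h1
      _ ≤ B ^ 2 / 4 * (8 * (|y| ^ 4 + R ^ 4))
          * (Real.exp (4 * B * k * R) * Real.exp (s * |y|)) := by gcongr
      _ = A * (|y| ^ 4 * Real.exp (s * |y|)) + A * R ^ 4 * Real.exp (s * |y|) := by rw [hA]; ring
      _ ≤ A * (|y| ^ 4 * Real.exp (s * |y|))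
          + A * R ^ 4 * (|y| ^ 4 * Real.exp (s * |y|) + Real.exp s) := by gcongr
      _ = _ := by ring
  set A₁ := A * (1 + R ^ 4) with hA₁
  set A₂ := A * R ^ 4 * Real.exp s with hA₂
  have hA₁0 : 0 ≤ A₁ := by positivity
  have hA₂0 : 0 ≤ A₂ := by positivity
  refine ⟨A₁ * S.toReal + A₂, by positivity, fun ℓ j K hj => ?_⟩
  have hjS : ∫⁻ ω, ENNReal.ofReal (|(init ℓ j ω).1| ^ 4 * Real.exp (s * |(init ℓ j ω).1|)) ∂P
      ≤ S := by
    refine le_iSup_of_le ℓ (le_iSup₂_of_le j (Finset.mem_Icc.2 ?_) le_rfl)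
    rcases hj with rfl | rfl
    · exact ⟨le_rfl, by omega⟩
    · exact ⟨by omega, le_rfl⟩
  calc ∫⁻ ω, ENNReal.ofReal (expSq (4 * B) (W K (init ℓ j ω).1)) ∂P
      ≤ ∫⁻ ω, (ENNReal.ofReal A₁ * ENNReal.ofReal (|(init ℓ j ω).1| ^ 4
          * Real.exp (s * |(init ℓ j ω).1|)) + ENNReal.ofReal A₂) ∂P := by
        refine lintegral_mono fun ω => ?_
        simp only
        rw [← ENNReal.ofReal_mul hA₁0, ← ENNReal.ofReal_add (by positivity) hA₂0]
        exact ENNReal.ofReal_le_ofReal (hpt K _)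
    _ = ENNReal.ofReal A₁ * (∫⁻ ω, ENNReal.ofReal (|(init ℓ j ω).1| ^ 4
          * Real.exp (s * |(init ℓ j ω).1|)) ∂P) + ENNReal.ofReal A₂ := by
        rw [lintegral_add_right _ measurable_const, lintegral_const_mul' _ _ ENNReal.ofReal_ne_top]
        simp
    _ ≤ ENNReal.ofReal A₁ * S + ENNReal.ofReal A₂ := by gcongr
    _ = ENNReal.ofReal (A₁ * S.toReal + A₂) := by
        rw [ENNReal.ofReal_add (by positivity) hA₂0, ENNReal.ofReal_mul hA₁0,
          ENNReal.ofReal_toReal hStop]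

end FourthMoment

section FourthMoment

variable {Ω : Type*} [MeasurableSpace Ω] {P : Measure Ω} [IsProbabilityMeasure P]
  {X : ℕ → Ω → ℝ} {K₀ M : ℕ} {init : ℕ → ℕ → Ω → ℝ × ℝ} {x : ℕ → ℕ → ℕ → Ω → ℝ} {α : ℝ}
  {f : ℕ → ℝ → ℝ} {W p : ℕ → ℝ → ℝ} {z : ℕ → ℝ} {B μ l c lip R δ γ₁ β : ℝ}

/-- The error `ξ^{h_j}_n - z_j` of the first component of the iterates of level `ℓ`. -/
noncomputable def iterateError (α : ℝ) (γ : ℕ → ℝ) (init : ℕ → ℕ → Ω → ℝ × ℝ) (x : ℕ → ℕ → ℕ → Ω → ℝ)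
    (K₀ M : ℕ) (z : ℕ → ℝ) (ℓ j n : ℕ) (ω : Ω) : ℝ :=
  (levelIterate α γ init x ℓ j n ω).1 - z (levelK K₀ M j)

omit [IsProbabilityMeasure P] in
theorem IsMultilevelSampling.measurable_iterateError (hsamp : IsMultilevelSampling P X K₀ M init x)
    {γ : ℕ → ℝ} {ℓ j : ℕ} (n : ℕ) :
    Measurable (iterateError α γ init x K₀ M z ℓ j n) :=
  (measurable_fst.comp (hsamp.measurable_levelIterate n)).sub_const _

theorem continuous_expSq (μ : ℝ) : Continuous (expSq μ) := by
  unfold expSq; fun_prop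

theorem IsConvexPotential.continuous {W g p : ℝ → ℝ} {z k B : ℝ}
    (h : IsConvexPotential W g p z k B) : Continuous W :=
  continuous_iff_continuousAt.2 fun x => (h.hasDerivAt_W x).continuousAt

/-- One step, averaged over the fresh sample, contracts at rate `l - η` with forcing `γ³`; for `β =
1` the loss `η` is small enough to keep `(l - η) γ₁ > 2`. The bound carries the index `n + 1`
because `stepSize` vanishes at `0`. -/
theorem lintegral_expSq_le (hα : α ∈ Set.Ioo (0 : ℝ) 1) (hX : ∀ K, Measurable (X K))
    (hf : ∀ K, IsContinuousPDF P (X K) (f K))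
    (hU : UniformBounds W (fun K x => (P.real {ω | X K ω ≤ x} - α) / (1 - α)) p z (kConst α) B μ
      l c lip R δ)
    (hγ₁ : 0 < γ₁) (hβ : β ∈ Set.Ioc (0 : ℝ) 1) (hβ1 : β = 1 → 2 < l * γ₁)
    (hsamp : IsMultilevelSampling P X K₀ M init x)
    (hinit : ∃ D : ℝ, 0 ≤ D ∧ ∀ ℓ j K, (j = ℓ - 1 ∨ j = ℓ) →
      ∫⁻ ω, ENNReal.ofReal (expSq μ (W K (init ℓ j ω).1)) ∂P ≤ ENNReal.ofReal D) :
    ∃ C : ℝ, 0 ≤ C ∧ ∀ ℓ j n, (j = ℓ - 1 ∨ j = ℓ) →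
      ∫⁻ ω, ENNReal.ofReal (expSq μ (W (levelK K₀ M j)
        (levelIterate α (stepSize γ₁ β) init x ℓ j n ω).1)) ∂P
        ≤ ENNReal.ofReal (C * stepSize γ₁ β (n + 1) ^ 2) := by
  obtain ⟨D₀, hD₀, hinit⟩ := hinit
  have hl := hU.l_pos
  have hk : 0 < kConst α := (hU.potential 0).k_pos
  have hB : 0 < B := (hU.potential 0).B_pos
  obtain ⟨η, hη, hηl, hηβ⟩ : ∃ η, 0 < η ∧ 0 < l - η ∧ (β = 1 → 2 < (l - η) * γ₁) := by
    by_cases h : β = 1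
    · refine ⟨(l - 2 / γ₁) / 2, ?_, ?_, fun _ => ?_⟩
      · have : 2 / γ₁ < l := by rw [div_lt_iff₀ hγ₁]; exact hβ1 h
        linarith
      · have : 0 < 2 / γ₁ := by positivity
        linarith
      · have h2 : 2 / γ₁ * γ₁ = 2 := by field_simp
        have := hβ1 h
        nlinarith
    · exact ⟨l / 2, by linarith, by linarith, fun h' => absurd h' h⟩
  obtain ⟨C₁, hC₁, hstep⟩ := lyapunov_step (μ := μ) hk hB hU.μ_pos.le hγ₁ hη
  -- The summand `(l - η)²` keeps `1 - (l - η) s + D s²` nonnegative for every `s`, so the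
  -- coefficients pass through `ENNReal.ofReal`.
  set D := D₀ + C₁ + (l - η) ^ 2 with hD
  have hD0 : 0 ≤ D := by positivity
  obtain ⟨C, hC, hrec⟩ := recursion_bound (p := 2) (p' := 2) (D := D) hγ₁ hβ two_pos two_pos hηl
    hηβ hηβ hD0
  refine ⟨C, hC, fun ℓ j n hj => ?_⟩
  set K := levelK K₀ M j with hK
  set ξ : ℕ → Ω → ℝ := fun n ω => (levelIterate α (stepSize γ₁ β) init x ℓ j n ω).1 with hξ
  set U : ℕ → ℝ≥0∞ := fun n => ∫⁻ ω, ENNReal.ofReal (expSq μ (W K (ξ n ω))) ∂P with hUdef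
  have hmeasL : Measurable fun y => expSq μ (W K y) :=
    ((continuous_expSq μ).comp (hU.potential K).continuous).measurable
  have hξm : ∀ n, Measurable (ξ n) := fun n =>
    measurable_fst.comp (hsamp.measurable_levelIterate n)
  have hcoef : ∀ s : ℝ, 0 ≤ 1 - (l - η) * s + D * s ^ 2 := by
    intro s
    have : (l - η) ^ 2 * s ^ 2 ≤ D * s ^ 2 := by gcongr; rw [hD]; linarith
    nlinarith [sq_nonneg ((l - η) * s - 1)]
  have hU1 : ∀ n, U (n + 1) ≤
      ENNReal.ofReal (1 - (l - η) * stepSize γ₁ β (n + 1) + D * stepSize γ₁ β (n + 1) ^ 2) * U n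
        + ENNReal.ofReal (D * stepSize γ₁ β (n + 1) ^ 3) := by
    intro n
    have hs := stepSize_succ_pos (β := β) hγ₁ n
    have hsle := stepSize_le (n := n + 1) hγ₁ hβ.1.le (by omega)
    set s := stepSize γ₁ β (n + 1) with hsdef
    have e1 : U (n + 1) = ∫⁻ ω, ∫⁻ ω',
        ENNReal.ofReal (expSq μ (W K (ξ n ω - s * H1 α (ξ n ω) (X K ω')))) ∂P ∂P := by
      refine lintegral_indepFun (S := ξ n) (U := x ℓ j n) (U' := X K)
        (f := fun q => ENNReal.ofReal (expSq μ (W K (q.1 - s * H1 α q.1 q.2)))) (hξm n)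
        (hsamp.measurable_x _ _ _) ?_ (hsamp.identDistrib_single hj) ?_
      · exact hsamp.indepFun_other_single hj
          (measurable_fst.comp (measurable_otherSigma_levelIterate _ hj (Or.inr le_rfl)))
      · exact (hmeasL.comp (measurable_fst.sub ((measurable_H1 α).const_mul s))).ennreal_ofReal
    rw [e1]
    calc ∫⁻ ω, ∫⁻ ω', ENNReal.ofReal (expSq μ (W K (ξ n ω - s * H1 α (ξ n ω) (X K ω')))) ∂P ∂P
        ≤ ∫⁻ ω, (ENNReal.ofReal (1 - (l - η) * s + D * s ^ 2)
            * ENNReal.ofReal (expSq μ (W K (ξ n ω))) + ENNReal.ofReal (D * s ^ 3)) ∂P := by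
          refine lintegral_mono fun ω => ?_
          simp only
          rw [lintegral_step (hf K) (hX K) hα.2 (ξ n ω) (F := fun y => expSq μ (W K y))
            (fun y => expSq_nonneg _ _), ← ENNReal.ofReal_mul (hcoef s),
            ← ENNReal.ofReal_add (mul_nonneg (hcoef s) (expSq_nonneg _ _)) (by positivity)]
          refine ENNReal.ofReal_le_ofReal ?_
          have h1α : 0 < 1 - α := by linarith [hα.2]
          have hα0 := hα.1
          have := hstep (W K) _ (p K) (z K) l (hU.potential K) (hU.drift K) (ξ n ω) s
            (P.real {ω' | X K ω' ≤ ξ n ω}) (-s) (s * (α / (1 - α))) hs hsle measureReal_nonneg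
            measureReal_le_one ?_ ?_ ?_
          · have hn := expSq_nonneg μ (W K (ξ n ω))
            have hCD : C₁ ≤ D := by
              have := sq_nonneg (l - η)
              rw [hD]; linarith
            have h2 : C₁ * s ^ 2 * expSq μ (W K (ξ n ω)) ≤ D * s ^ 2 * expSq μ (W K (ξ n ω)) := by
              gcongr
            have h3 : C₁ * s ^ 3 ≤ D * s ^ 3 := by gcongr
            linarith
          · rw [abs_neg, abs_of_pos hs]
            have : 1 ≤ kConst α := le_max_left _ _
            nlinarith
          · rw [abs_of_nonneg (by positivity), mul_comm]
            have : α / (1 - α) ≤ kConst α := le_max_right _ _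
            gcongr
          · field_simp
            ring
      _ = _ := by
          rw [lintegral_add_right _ measurable_const, lintegral_const_mul' _ _ ENNReal.ofReal_ne_top]
          simp [hUdef]
  -- Integrability is not assumed: finiteness propagates from the initial values along the
  -- recursion.
  have hUfin : ∀ n, U n ≠ ⊤ := by
    intro n
    induction n with
    | zero => exact ne_top_of_le_ne_top ENNReal.ofReal_ne_top (hinit ℓ j K hj)
    | succ n ih =>
      exact ne_top_of_le_ne_top (ENNReal.add_ne_top.2
        ⟨ENNReal.mul_ne_top ENNReal.ofReal_ne_top ih, ENNReal.ofReal_ne_top⟩) (hU1 n)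
  have key := hrec (fun n => (U n).toReal) 0 1 le_rfl zero_le_one (fun n => ENNReal.toReal_nonneg)
    (by
      refine ENNReal.toReal_le_of_le_ofReal (by positivity) ((hinit ℓ j K hj).trans ?_)
      refine ENNReal.ofReal_le_ofReal ?_
      have := sq_nonneg (l - η)
      rw [hD]; linarith)
    (fun n => by
      have hs := stepSize_succ_pos (β := β) hγ₁ n
      refine ENNReal.toReal_le_of_le_ofReal ?_ ((hU1 n).trans_eq ?_)
      · have := hcoef (stepSize γ₁ β (n + 1))
        have := @ENNReal.toReal_nonneg (U n)
        positivity
      · rw [ENNReal.ofReal_add (mul_nonneg (hcoef _) ENNReal.toReal_nonneg) (by positivity),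
          ENNReal.ofReal_mul (hcoef _), ENNReal.ofReal_toReal (hUfin n)]
        congr 2
        rw [Real.rpow_two]
        ring) n
  refine (ENNReal.le_ofReal_iff_toReal_le (hUfin n) (by positivity)).2 (key.trans_eq ?_)
  rw [Real.rpow_two]
  ring

theorem fourth_moment_le (hα : α ∈ Set.Ioo (0 : ℝ) 1) (hX : ∀ K, Measurable (X K))
    (hf : ∀ K, IsContinuousPDF P (X K) (f K))
    (hU : UniformBounds W (fun K x => (P.real {ω | X K ω ≤ x} - α) / (1 - α)) p z (kConst α) B μ
      l c lip R δ)
    (hγ₁ : 0 < γ₁) (hβ : β ∈ Set.Ioc (0 : ℝ) 1) (hβ1 : β = 1 → 2 < l * γ₁)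
    (hsamp : IsMultilevelSampling P X K₀ M init x)
    (hinit : ∃ D : ℝ, 0 ≤ D ∧ ∀ ℓ j K, (j = ℓ - 1 ∨ j = ℓ) →
      ∫⁻ ω, ENNReal.ofReal (expSq μ (W K (init ℓ j ω).1)) ∂P ≤ ENNReal.ofReal D) :
    ∃ C : ℝ, 0 ≤ C ∧ ∀ ℓ j n, (j = ℓ - 1 ∨ j = ℓ) →
      Integrable (fun ω => iterateError α (stepSize γ₁ β) init x K₀ M z ℓ j n ω ^ 4) P ∧
      ∫ ω, iterateError α (stepSize γ₁ β) init x K₀ M z ℓ j n ω ^ 4 ∂P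
        ≤ C * stepSize γ₁ β (n + 1) ^ 2 := by
  obtain ⟨C₁, hC₁, h1⟩ := lintegral_expSq_le hα hX hf hU hγ₁ hβ hβ1 hsamp hinit
  obtain ⟨C₂, hC₂, h2⟩ := IsConvexPotential.pow_four_le_expSq (k := kConst α) (B := B) hU.c_pos
    hU.μ_pos
  refine ⟨C₂ * C₁, by positivity, fun ℓ j n hj => ?_⟩
  have hs := stepSize_succ_pos (β := β) hγ₁ n
  have hm : Measurable fun ω => iterateError α (stepSize γ₁ β) init x K₀ M z ℓ j n ω ^ 4 :=
    (hsamp.measurable_iterateError n).pow_const 4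
  have hlin : ∫⁻ ω, ENNReal.ofReal (iterateError α (stepSize γ₁ β) init x K₀ M z ℓ j n ω ^ 4) ∂P
      ≤ ENNReal.ofReal (C₂ * C₁ * stepSize γ₁ β (n + 1) ^ 2) := by
    rw [mul_assoc, ENNReal.ofReal_mul hC₂]
    refine le_trans ?_ (mul_le_mul_right (h1 ℓ j n hj) _)
    rw [← lintegral_const_mul' _ _ ENNReal.ofReal_ne_top]
    refine lintegral_mono fun ω => ?_
    simp only
    rw [← ENNReal.ofReal_mul hC₂]
    exact ENNReal.ofReal_le_ofReal
      (h2 _ _ _ _ (hU.potential (levelK K₀ M j)) (hU.lower _) _)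
  have h0 : ∀ ω, 0 ≤ iterateError α (stepSize γ₁ β) init x K₀ M z ℓ j n ω ^ 4 := fun ω => by
    positivity
  have hint : Integrable (fun ω => iterateError α (stepSize γ₁ β) init x K₀ M z ℓ j n ω ^ 4) P :=
    (lintegral_ofReal_ne_top_iff_integrable hm.aestronglyMeasurable
      (Eventually.of_forall h0)).1 (ne_top_of_le_ne_top ENNReal.ofReal_ne_top hlin)
  refine ⟨hint, ?_⟩
  rw [integral_eq_lintegral_of_nonneg_ae (Eventually.of_forall h0) hm.aestronglyMeasurable]
  exact ENNReal.toReal_le_of_le_ofReal (by positivity) hlin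

/-- Second and first moments from the fourth one. -/
theorem moments_of_fourth {e : Ω → ℝ} (he : Measurable e) (hint : Integrable (fun ω => e ω ^ 4) P)
    {C s : ℝ} (hs : 0 < s) (h : ∫ ω, e ω ^ 4 ∂P ≤ C * s ^ 2) :
    MemLp e 2 P ∧ ∫ ω, e ω ^ 2 ∂P ≤ (C + 1) * s ∧
      ∫ ω, |e ω| ∂P ≤ (C + 2) * s ^ (1 / 2 : ℝ) := by
  have hi2 : Integrable (fun ω => e ω ^ 2) P := by
    refine (hint.add (integrable_const (1 : ℝ))).mono' (he.pow_const 2).aestronglyMeasurable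
      (Eventually.of_forall fun ω => ?_)
    simp only [Pi.add_apply]
    rw [Real.norm_of_nonneg (by positivity)]
    nlinarith [sq_nonneg (e ω ^ 2 - 1), sq_nonneg (e ω ^ 2)]
  have hL : MemLp e 2 P := (memLp_two_iff_integrable_sq he.aestronglyMeasurable).2 hi2
  have h2 : ∫ ω, e ω ^ 2 ∂P ≤ (C + 1) * s := by
    have : ∫ ω, e ω ^ 2 ∂P ≤ ∫ ω, (s⁻¹ * e ω ^ 4 + s) ∂P := by
      refine integral_mono hi2 ((hint.const_mul _).add (integrable_const _)) fun ω => ?_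
      simp only
      have e1 : s⁻¹ * e ω ^ 4 + s - e ω ^ 2 = s⁻¹ * ((e ω ^ 2 - s / 2) ^ 2 + 3 / 4 * s ^ 2) := by
        field_simp
        ring
      have : 0 ≤ s⁻¹ * ((e ω ^ 2 - s / 2) ^ 2 + 3 / 4 * s ^ 2) := by positivity
      linarith
    rw [integral_add (hint.const_mul _) (integrable_const _), integral_const_mul] at this
    have h3 : s⁻¹ * ∫ ω, e ω ^ 4 ∂P ≤ s⁻¹ * (C * s ^ 2) := by gcongr
    have h4 : s⁻¹ * (C * s ^ 2) = C * s := by field_simp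
    simp at this
    linarith
  refine ⟨hL, h2, ?_⟩
  set t := s ^ (1 / 2 : ℝ) with ht
  have ht0 : 0 < t := by positivity
  have htt : s = t ^ 2 := by
    rw [ht, ← Real.rpow_natCast, ← Real.rpow_mul hs.le]; norm_num
  have : ∫ ω, |e ω| ∂P ≤ ∫ ω, (t⁻¹ * e ω ^ 2 + t) ∂P := by
    refine integral_mono (hL.integrable (by norm_num)).abs
      ((hi2.const_mul _).add (integrable_const _)) fun ω => ?_
    simp only
    have e1 : t⁻¹ * e ω ^ 2 + t - |e ω| = t⁻¹ * ((|e ω| - t / 2) ^ 2 + 3 / 4 * t ^ 2) := by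
      rw [← sq_abs (e ω)]
      field_simp
      ring
    have : 0 ≤ t⁻¹ * ((|e ω| - t / 2) ^ 2 + 3 / 4 * t ^ 2) := by positivity
    linarith
  rw [integral_add (hi2.const_mul _) (integrable_const _), integral_const_mul] at this
  have h3 : t⁻¹ * ∫ ω, e ω ^ 2 ∂P ≤ t⁻¹ * ((C + 1) * s) := by gcongr
  have h4 : t⁻¹ * ((C + 1) * s) = (C + 1) * t := by rw [htt]; field_simp
  simp at this
  linarith

end FourthMoment

/-! ### Sums in `L²` -/

section Sums

variable {Ω : Type*} [MeasurableSpace Ω] {P : Measure Ω} {ι : Type*}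

/-- A weighted form of the triangle inequality in `L²`. -/
theorem integral_sq_sum_le (s : Finset ι) {F : ι → Ω → ℝ} {w : ι → ℝ} {C : ℝ}
    (hw : ∀ i ∈ s, 0 < w i) (hF : ∀ i ∈ s, MemLp (F i) 2 P)
    (h : ∀ i ∈ s, ∫ ω, F i ω ^ 2 ∂P ≤ C * w i ^ 2) :
    ∫ ω, (∑ i ∈ s, F i ω) ^ 2 ∂P ≤ C * (∑ i ∈ s, w i) ^ 2 := by
  have hi : ∀ i ∈ s, Integrable (fun ω => F i ω ^ 2 / w i) P := fun i hi =>
    (hF i hi).integrable_sq.div_const _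
  calc ∫ ω, (∑ i ∈ s, F i ω) ^ 2 ∂P
      ≤ ∫ ω, (∑ i ∈ s, w i) * ∑ i ∈ s, F i ω ^ 2 / w i ∂P := by
        refine integral_mono (memLp_finsetSum s hF).integrable_sq
          ((integrable_finsetSum s hi).const_mul _) fun ω => ?_
        refine Finset.sum_sq_le_sum_mul_sum_of_sq_le_mul s (fun i hi => (hw i hi).le)
          (fun i hi => div_nonneg (sq_nonneg _) (hw i hi).le) fun i hi => ?_
        exact (mul_div_cancel₀ _ (hw i hi).ne').ge
    _ = (∑ i ∈ s, w i) * ∑ i ∈ s, (∫ ω, F i ω ^ 2 ∂P) / w i := by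
        rw [integral_const_mul, integral_finsetSum s hi]
        simp_rw [integral_div]
    _ ≤ (∑ i ∈ s, w i) * ∑ i ∈ s, C * w i := by
        refine mul_le_mul_of_nonneg_left (Finset.sum_le_sum fun i hi => ?_)
          (Finset.sum_nonneg fun i hi => (hw i hi).le)
        rw [div_le_iff₀ (hw i hi)]
        exact (h i hi).trans_eq (by ring)
    _ = _ := by rw [← Finset.mul_sum]; ring

theorem integral_sq_sum_of_orthogonal (s : Finset ι) {F : ι → Ω → ℝ}
    (hF : ∀ i ∈ s, MemLp (F i) 2 P)
    (h : ∀ i ∈ s, ∀ j ∈ s, i ≠ j → ∫ ω, F i ω * F j ω ∂P = 0) :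
    ∫ ω, (∑ i ∈ s, F i ω) ^ 2 ∂P = ∑ i ∈ s, ∫ ω, F i ω ^ 2 ∂P := by
  have hij : ∀ i ∈ s, ∀ j ∈ s, Integrable (fun ω => F i ω * F j ω) P := fun i hi j hj =>
    (hF i hi).integrable_mul (hF j hj)
  simp_rw [sq, Finset.sum_mul_sum]
  rw [integral_finsetSum s fun i hi => integrable_finsetSum s (hij i hi)]
  refine Finset.sum_congr rfl fun i hi => ?_
  rw [integral_finsetSum s (hij i hi)]
  exact Finset.sum_eq_single_of_mem i hi fun j hj hne => h i hi j hj hne.symm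

/-- Young's inequality with weight `a` spends half of the contraction `2 a s` on the cross term and
leaves the rate `a`; hence `2 < a γ₁` is needed later for a squared remainder decaying like `γ²`
when `β = 1`. -/
theorem sq_linear_step_le {a G : ℝ} (ha : 0 < a) (hG : 0 ≤ G) {s : ℝ} (hs : 0 ≤ s) (hsG : s ≤ G)
    (r ρ : ℝ) : ((1 - s * a) * r - s * ρ) ^ 2
      ≤ (1 - a * s + (2 * a ^ 2 + (1 + G * a) / a + G) * s ^ 2) * r ^ 2
        + (2 * a ^ 2 + (1 + G * a) / a + G) * s * ρ ^ 2 := by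
  have h1 : -(2 * (1 - s * a) * r * ρ) ≤ (1 + s * a) * (a * r ^ 2 + ρ ^ 2 / a) := by
    have h2 : 2 * |r * ρ| ≤ a * r ^ 2 + ρ ^ 2 / a := by
      have : a * r ^ 2 + ρ ^ 2 / a - 2 * |r * ρ| = (a * |r| - |ρ|) ^ 2 / a := by
        rw [abs_mul, ← sq_abs r, ← sq_abs ρ]; field_simp; ring
      have : 0 ≤ (a * |r| - |ρ|) ^ 2 / a := by positivity
      linarith
    have h3 : |1 - s * a| ≤ 1 + s * a := by
      have : 0 ≤ s * a := by positivity
      exact abs_le.2 ⟨by linarith, by linarith⟩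
    calc -(2 * (1 - s * a) * r * ρ) ≤ |2 * (1 - s * a) * r * ρ| := neg_le_abs _
      _ = |1 - s * a| * (2 * |r * ρ|) := by
          rw [show 2 * (1 - s * a) * r * ρ = (1 - s * a) * (2 * (r * ρ)) by ring, abs_mul, abs_mul]
          norm_num
      _ ≤ _ := by gcongr
  have h4 : (1 + s * a) * (ρ ^ 2 / a) ≤ (1 + G * a) / a * ρ ^ 2 := by
    have : (1 + s * a) * (ρ ^ 2 / a) = (1 + s * a) / a * ρ ^ 2 := by ring
    rw [this]; gcongr
  have h5 : s * ρ ^ 2 ≤ G * ρ ^ 2 := by gcongr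
  have h6 : 0 ≤ ((1 + G * a) / a + G) * s ^ 2 * r ^ 2 := by positivity
  have h7 : 0 ≤ a ^ 2 * s * ρ ^ 2 := by positivity
  have h8 := mul_le_mul_of_nonneg_left h1 hs
  have h9 := mul_le_mul_of_nonneg_left h4 hs
  have h10 := mul_le_mul_of_nonneg_left h5 hs
  nlinarith

end Sums

/-! ### Linearization of the scheme -/

section Linearization

variable {Ω : Type*} [MeasurableSpace Ω]

/-- The derivative of `objective`. -/
noncomputable def slope (P : Measure Ω) (α : ℝ) (X : Ω → ℝ) (y : ℝ) : ℝ :=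
  (P.real {ω | X ω ≤ y} - α) / (1 - α)

/-- What the analysis of the schemes uses about the losses, the sampling and the iterates. -/
structure SchemeBounds (P : Measure Ω) (α γ₁ β : ℝ) (X : ℕ → Ω → ℝ) (W p : ℕ → ℝ → ℝ) (z : ℕ → ℝ)
    (K₀ M : ℕ) (init : ℕ → ℕ → Ω → ℝ × ℝ) (x : ℕ → ℕ → ℕ → Ω → ℝ) (ε : ℝ → ℝ)
    (B lip R δ C : ℝ) : Prop where
  α_mem : α ∈ Set.Ioo (0 : ℝ) 1
  γ₁_pos : 0 < γ₁
  β_mem : β ∈ Set.Ioc (0 : ℝ) 1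
  one_le_K₀ : 1 ≤ K₀
  two_le_M : 2 ≤ M
  potential : ∀ K, IsConvexPotential (W K) (slope P α (X K)) (p K) (z K) (kConst α) B
  a_pos : 0 < p 0 (z 0)
  a_large : β = 1 → 2 < p 0 (z 0) * γ₁
  R_nonneg : 0 ≤ R
  δ_pos : 0 < δ
  C_pos : 0 < C
  lipschitz : ∀ K x y, |p K x - p K y| ≤ lip * |x - y|
  z_rate : ∀ K : ℕ, 1 ≤ K → |z K - z 0| ≤ R * (1 / (K : ℝ))
  p_rate : ∀ K : ℕ, 1 ≤ K → |p K (z K) - p 0 (z 0)| ≤ R * (1 / (K : ℝ)) ^ (1 / 4 + δ)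
  sampling : IsMultilevelSampling P X K₀ M init x
  moment : ∀ ℓ j n, (j = ℓ - 1 ∨ j = ℓ) →
    Integrable (fun ω => iterateError α (stepSize γ₁ β) init x K₀ M z ℓ j n ω ^ 4) P ∧
      ∫ ω, iterateError α (stepSize γ₁ β) init x K₀ M z ℓ j n ω ^ 4 ∂P
        ≤ C * stepSize γ₁ β (n + 1) ^ 2
  measurable_X : ∀ K, Measurable (X K)
  memLp_X : ∀ K, MemLp (X K) 2 P
  tail_sub_le : ∀ K x y, x ≤ y → P.real {ω | x ≤ X K ω} - P.real {ω | y ≤ X K ω} ≤ C * (y - x)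
  integral_H1 : ∀ K y, ∫ ω, H1 α y (X K ω) ∂P = slope P α (X K) y
  W_eq : ∀ K x, W K x = objective P α (X K) x - objective P α (X K) (z K)
  switch : ∀ ℓ, 1 ≤ ℓ → ∀ ξ,
    switchProb P (X (levelK K₀ M ℓ)) (X (levelK K₀ M (ℓ - 1))) ξ ≤ C * ε (levelH K₀ M ℓ)
  sqrt_le : ∀ ℓ, 1 ≤ ℓ → levelH K₀ M ℓ ^ (1 / 2 : ℝ) ≤ C * ε (levelH K₀ M ℓ)
  sq_loss : ∀ ℓ, 1 ≤ ℓ → ∫ ω, (X (levelK K₀ M ℓ) ω - X (levelK K₀ M (ℓ - 1)) ω) ^ 2 ∂P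
    ≤ C * levelH K₀ M ℓ

/-- The martingale increment of one step of the scheme for the first component. -/
noncomputable def noise (P : Measure Ω) (α : ℝ) (γ : ℕ → ℝ) (X : ℕ → Ω → ℝ) (K₀ M : ℕ)
    (init : ℕ → ℕ → Ω → ℝ × ℝ) (x : ℕ → ℕ → ℕ → Ω → ℝ) (ℓ j n : ℕ) (ω : Ω) : ℝ :=
  H1 α (levelIterate α γ init x ℓ j n ω).1 (x ℓ j n ω)
    - slope P α (X (levelK K₀ M j)) (levelIterate α γ init x ℓ j n ω).1

/-- The linear recursion with slope `a`, started at `0` and driven by `noise`. -/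
noncomputable def linearPart (P : Measure Ω) (α : ℝ) (γ : ℕ → ℝ) (X : ℕ → Ω → ℝ) (K₀ M : ℕ)
    (init : ℕ → ℕ → Ω → ℝ × ℝ) (x : ℕ → ℕ → ℕ → Ω → ℝ) (a : ℝ) (ℓ j : ℕ) : ℕ → Ω → ℝ
  | 0 => fun _ => 0
  | n + 1 => fun ω => (1 - γ (n + 1) * a) * linearPart P α γ X K₀ M init x a ℓ j n ω
      - γ (n + 1) * noise P α γ X K₀ M init x ℓ j n ω

variable {P : Measure Ω} {α γ₁ β : ℝ} {γ : ℕ → ℝ} {X : ℕ → Ω → ℝ} {W p : ℕ → ℝ → ℝ}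
  {z : ℕ → ℝ} {K₀ M : ℕ} {init : ℕ → ℕ → Ω → ℝ × ℝ} {x : ℕ → ℕ → ℕ → Ω → ℝ} {ε : ℝ → ℝ}
  {B lip R δ C a : ℝ} {ℓ j n : ℕ}

theorem measurable_slope [IsProbabilityMeasure P] {α : ℝ} (hα : α < 1) (X : Ω → ℝ) :
    Measurable (slope P α X) := by
  have : Monotone (slope P α X) := fun y y' hy => by
    unfold slope
    have h1 : 0 < 1 - α := by linarith
    refine div_le_div_of_nonneg_right (sub_le_sub_right ?_ _) h1.le
    exact measureReal_mono fun ω (hω : X ω ≤ y) => hω.trans hy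
  exact this.measurable

omit [MeasurableSpace Ω] in
theorem measurable_H1_comp {m : MeasurableSpace Ω} {ξ y : Ω → ℝ} (hξ : Measurable ξ)
    (hy : Measurable y) : Measurable fun ω => H1 α (ξ ω) (y ω) :=
  (measurable_H1 α).comp (hξ.prodMk hy)

theorem iterateError_succ (ω : Ω) :
    iterateError α γ init x K₀ M z ℓ j (n + 1) ω = iterateError α γ init x K₀ M z ℓ j n ω
      - γ (n + 1) * (noise P α γ X K₀ M init x ℓ j n ω
        + slope P α (X (levelK K₀ M j)) (levelIterate α γ init x ℓ j n ω).1) := by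
  simp only [iterateError, noise, levelIterate, iterate]
  ring

variable [IsProbabilityMeasure P]

theorem measurable_otherSigma_noise (hα : α < 1) (i : ℕ × ℕ) (hj : j = ℓ - 1 ∨ j = ℓ)
    (hi : ℓ ≠ i.1 ∨ n < i.2) :
    Measurable[otherSigma init x i] (noise P α γ X K₀ M init x ℓ j n) := by
  have h1 := measurable_fst.comp (measurable_otherSigma_levelIterate (init := init) (x := x)
    (α := α) (γ := γ) i hj (hi.imp_right le_of_lt))
  refine (measurable_H1_comp h1 (measurable_otherSigma_x i hj ?_)).sub
    ((measurable_slope hα _).comp h1)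
  rintro rfl
  simp at hi

theorem measurable_otherSigma_linearPart (hα : α < 1) (i : ℕ × ℕ) (hj : j = ℓ - 1 ∨ j = ℓ)
    (hi : ℓ ≠ i.1 ∨ n ≤ i.2) :
    Measurable[otherSigma init x i] (linearPart P α γ X K₀ M init x a ℓ j n) := by
  induction n with
  | zero => exact measurable_const
  | succ n ih =>
    exact ((ih (hi.imp_right (by omega))).const_mul _).sub
      ((measurable_otherSigma_noise hα i hj (hi.imp_right (by omega))).const_mul _)

namespace SchemeBounds

variable (h : SchemeBounds P α γ₁ β X W p z K₀ M init x ε B lip R δ C)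
include h

theorem measurable_noise (n : ℕ) : Measurable (noise P α γ X K₀ M init x ℓ j n) := by
  have h1 := measurable_fst.comp (h.sampling.measurable_levelIterate (α := α) (γ := γ) (ℓ := ℓ)
    (j := j) n)
  exact (measurable_H1_comp h1 (h.sampling.measurable_x _ _ _)).sub
    ((measurable_slope h.α_mem.2 _).comp h1)

omit [IsProbabilityMeasure P] in
theorem abs_noise_le (ω : Ω) : |noise P α γ X K₀ M init x ℓ j n ω| ≤ 2 * kConst α := by
  have h1 := abs_H1_le h.α_mem (levelIterate α γ init x ℓ j n ω).1 (x ℓ j n ω)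
  have h2 := (h.potential (levelK K₀ M j)).abs_g_le (levelIterate α γ init x ℓ j n ω).1
  exact (abs_sub _ _).trans (by linarith)

theorem memLp_noise (n : ℕ) : MemLp (noise P α γ X K₀ M init x ℓ j n) 2 P :=
  MemLp.of_bound (h.measurable_noise n).aestronglyMeasurable (2 * kConst α)
    (Eventually.of_forall fun ω => h.abs_noise_le ω)

theorem memLp_linearPart (n : ℕ) : MemLp (linearPart P α γ X K₀ M init x a ℓ j n) 2 P := by
  induction n with
  | zero => exact memLp_const 0
  | succ n ih => exact (ih.const_mul _).sub ((h.memLp_noise n).const_mul _)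

theorem moments : ∃ C' : ℝ, 0 ≤ C' ∧ ∀ ℓ j n, (j = ℓ - 1 ∨ j = ℓ) →
    MemLp (iterateError α (stepSize γ₁ β) init x K₀ M z ℓ j n) 2 P ∧
    ∫ ω, iterateError α (stepSize γ₁ β) init x K₀ M z ℓ j n ω ^ 2 ∂P
      ≤ C' * stepSize γ₁ β (n + 1) ∧
    ∫ ω, |iterateError α (stepSize γ₁ β) init x K₀ M z ℓ j n ω| ∂P
      ≤ C' * stepSize γ₁ β (n + 1) ^ (1 / 2 : ℝ) := by
  have hC := h.C_pos
  refine ⟨C + 2, by linarith, fun ℓ j n hj => ?_⟩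
  have hs := stepSize_succ_pos (β := β) h.γ₁_pos n
  obtain ⟨h1, h2, h3⟩ := moments_of_fourth (h.sampling.measurable_iterateError n)
    (h.moment ℓ j n hj).1 hs (h.moment ℓ j n hj).2
  exact ⟨h1, h2.trans (by nlinarith), h3⟩

omit [IsProbabilityMeasure P] in
theorem abs_slope_sub_le (K : ℕ) (hK : 1 ≤ K) (y : ℝ) :
    |slope P α (X K) y - p 0 (z 0) * (y - z K)|
      ≤ R * (1 / (K : ℝ)) ^ (1 / 4 + δ) * |y - z K| + lip / 2 * (y - z K) ^ 2 := by
  have h1 := (h.potential K).g_sub_linear (fun x => h.lipschitz K x _) y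
  have h2 := h.p_rate K hK
  calc |slope P α (X K) y - p 0 (z 0) * (y - z K)|
      = |(slope P α (X K) y - p K (z K) * (y - z K))
          + (p K (z K) - p 0 (z 0)) * (y - z K)| := by congr 1; ring
    _ ≤ |slope P α (X K) y - p K (z K) * (y - z K)|
          + |p K (z K) - p 0 (z 0)| * |y - z K| := by
        rw [← abs_mul]; exact abs_add_le _ _
    _ ≤ lip / 2 * (y - z K) ^ 2 + R * (1 / (K : ℝ)) ^ (1 / 4 + δ) * |y - z K| := by gcongr
    _ = _ := by ring

/-- The difference between the iterates and the linear recursion is of smaller order. -/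
theorem remainder_le : ∃ C' : ℝ, 0 ≤ C' ∧ ∀ ℓ j n, (j = ℓ - 1 ∨ j = ℓ) →
    ∫ ω, (iterateError α (stepSize γ₁ β) init x K₀ M z ℓ j n ω
        - linearPart P α (stepSize γ₁ β) X K₀ M init x (p 0 (z 0)) ℓ j n ω) ^ 2 ∂P
      ≤ C' * (levelH K₀ M j ^ (1 / 2 + 2 * δ) * stepSize γ₁ β (n + 1)
        + stepSize γ₁ β (n + 1) ^ 2) := by
  obtain ⟨C₁, hC₁, hmom⟩ := h.moments
  have ha := h.a_pos
  have hC := h.C_pos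
  have hR := h.R_nonneg
  have hγ₁ := h.γ₁_pos
  set a := p 0 (z 0) with hadef
  set D₁ := 2 * a ^ 2 + (1 + γ₁ * a) / a + γ₁ with hD₁
  have hD₁0 : 0 ≤ D₁ := by positivity
  set D₂ := 2 * R ^ 2 * C₁ + lip ^ 2 * C with hD₂
  have hD₂0 : 0 ≤ D₂ := by positivity
  set D := D₁ + D₁ * D₂ + C₁ * γ₁ with hD
  -- The mismatch of slopes contributes `h^{1/2 + 2δ} E e²`, of order `γ`, and the curvature
  -- contributes `E e⁴`, of order `γ²`: hence the exponents `1` and `2`.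
  obtain ⟨C', hC', hrec⟩ := recursion_bound (p := 1) (p' := 2) (l := a) (D := D) hγ₁ h.β_mem
    one_pos two_pos ha (fun hb => by linarith [h.a_large hb]) (fun hb => h.a_large hb)
    (by positivity)
  refine ⟨C', hC', fun ℓ j n hj => ?_⟩
  set e := iterateError α (stepSize γ₁ β) init x K₀ M z ℓ j with he
  set m := linearPart P α (stepSize γ₁ β) X K₀ M init x a ℓ j with hm
  set K := levelK K₀ M j with hK
  have hK1 : 1 ≤ K := one_le_levelK h.one_le_K₀ h.two_le_M j
  set t := levelH K₀ M j with ht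
  have ht0 : 0 < t := levelH_pos h.one_le_K₀ h.two_le_M j
  have htK : (1 / (K : ℝ)) = t := rfl
  set ρ : ℕ → Ω → ℝ := fun n ω => slope P α (X K) (levelIterate α (stepSize γ₁ β) init x ℓ j n ω).1
    - a * e n ω with hρ
  have heL : ∀ n, MemLp (e n) 2 P := fun n => (hmom ℓ j n hj).1
  have hmL : ∀ n, MemLp (m n) 2 P := fun n => h.memLp_linearPart n
  have hrL : ∀ n, MemLp (fun ω => e n ω - m n ω) 2 P := fun n => (heL n).sub (hmL n)
  have hρle : ∀ n ω, ρ n ω ^ 2 ≤ 2 * R ^ 2 * t ^ (1 / 2 + 2 * δ) * e n ω ^ 2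
      + lip ^ 2 * e n ω ^ 4 := by
    intro n ω
    have h1 := h.abs_slope_sub_le K hK1 (levelIterate α (stepSize γ₁ β) init x ℓ j n ω).1
    have h2 : |ρ n ω| ≤ R * t ^ (1 / 4 + δ) * |e n ω| + lip / 2 * e n ω ^ 2 := h1
    have h3 : t ^ (1 / 2 + 2 * δ) = (t ^ (1 / 4 + δ)) ^ 2 := by
      rw [← Real.rpow_natCast, ← Real.rpow_mul ht0.le]; congr 1; push_cast; ring
    have h4 : ρ n ω ^ 2 ≤ (R * t ^ (1 / 4 + δ) * |e n ω| + lip / 2 * e n ω ^ 2) ^ 2 := by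
      rw [← sq_abs (ρ n ω)]; exact pow_le_pow_left₀ (abs_nonneg _) h2 2
    have h5 := add_sq_le (a := R * t ^ (1 / 4 + δ) * |e n ω|) (b := lip / 2 * e n ω ^ 2)
    have h6 : (R * t ^ (1 / 4 + δ) * |e n ω|) ^ 2 = R ^ 2 * (t ^ (1 / 4 + δ)) ^ 2 * e n ω ^ 2 := by
      rw [mul_pow, mul_pow, sq_abs]
    rw [h3]
    have h7 : 0 ≤ lip ^ 2 * e n ω ^ 4 := by positivity
    nlinarith
  have hρi : ∀ n, Integrable (fun ω => 2 * R ^ 2 * t ^ (1 / 2 + 2 * δ) * e n ω ^ 2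
      + lip ^ 2 * e n ω ^ 4) P := fun n =>
    ((heL n).integrable_sq.const_mul _).add ((h.moment ℓ j n hj).1.const_mul _)
  have hρE : ∀ n, ∫ ω, (2 * R ^ 2 * t ^ (1 / 2 + 2 * δ) * e n ω ^ 2 + lip ^ 2 * e n ω ^ 4) ∂P
      ≤ D₂ * (t ^ (1 / 2 + 2 * δ) * stepSize γ₁ β (n + 1) + stepSize γ₁ β (n + 1) ^ 2) := by
    intro n
    have hs := stepSize_succ_pos (β := β) hγ₁ n
    rw [integral_add ((heL n).integrable_sq.const_mul _) ((h.moment ℓ j n hj).1.const_mul _),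
      integral_const_mul, integral_const_mul]
    have h1 := mul_le_mul_of_nonneg_left (hmom ℓ j n hj).2.1
      (show 0 ≤ 2 * R ^ 2 * t ^ (1 / 2 + 2 * δ) by positivity)
    have h2 := mul_le_mul_of_nonneg_left (h.moment ℓ j n hj).2 (sq_nonneg lip)
    have h3 : 0 ≤ lip ^ 2 * C * (t ^ (1 / 2 + 2 * δ) * stepSize γ₁ β (n + 1)) := by positivity
    have h4 : 0 ≤ 2 * R ^ 2 * C₁ * stepSize γ₁ β (n + 1) ^ 2 := by positivity
    rw [hD₂]
    nlinarith
  have hstep : ∀ n ω, (e (n + 1) ω - m (n + 1) ω) ^ 2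
      ≤ (1 - a * stepSize γ₁ β (n + 1) + D₁ * stepSize γ₁ β (n + 1) ^ 2) * (e n ω - m n ω) ^ 2
        + D₁ * stepSize γ₁ β (n + 1) * (2 * R ^ 2 * t ^ (1 / 2 + 2 * δ) * e n ω ^ 2
          + lip ^ 2 * e n ω ^ 4) := by
    intro n ω
    have hs := stepSize_succ_pos (β := β) hγ₁ n
    have hsle := stepSize_le (n := n + 1) hγ₁ h.β_mem.1.le (by omega)
    -- Both recursions consume the same noise, which cancels; only the linearization error `ρ`
    -- remains.
    have e1 : e (n + 1) ω - m (n + 1) ω = (1 - stepSize γ₁ β (n + 1) * a) * (e n ω - m n ω)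
        - stepSize γ₁ β (n + 1) * ρ n ω := by
      simp only [he, hm, hρ, linearPart]
      rw [iterateError_succ (P := P) (X := X)]
      ring
    rw [e1]
    refine (sq_linear_step_le ha hγ₁.le hs.le hsle _ _).trans ?_
    have := hρle n ω
    gcongr
  refine (hrec (fun n => ∫ ω, (e n ω - m n ω) ^ 2 ∂P) (t ^ (1 / 2 + 2 * δ)) 1 (by positivity)
    zero_le_one (fun n => integral_nonneg fun ω => sq_nonneg _) ?_ (fun n => ?_) n).trans_eq ?_
  -- The linear part starts at `0`, so the initial error goes entirely into the remainder; this
  -- accounts for the summand `C₁ * γ₁` of `D`.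
  · have e0 : ∀ ω, (e 0 ω - m 0 ω) ^ 2 = e 0 ω ^ 2 := fun ω => by simp [hm, linearPart]
    simp_rw [e0]
    have := (hmom ℓ j 0 hj).2.1
    rw [zero_add, stepSize_one] at this
    have h0 : 0 ≤ D₁ + D₁ * D₂ := by positivity
    rw [hD]; linarith
  · have hs := stepSize_succ_pos (β := β) hγ₁ n
    have hI := integral_mono (hrL (n + 1)).integrable_sq
      (((hrL n).integrable_sq.const_mul _).add ((hρi n).const_mul _)) (hstep n)
    simp only [Pi.add_apply] at hI
    rw [integral_add ((hrL n).integrable_sq.const_mul _) ((hρi n).const_mul _),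
      integral_const_mul, integral_const_mul] at hI
    rw [Real.rpow_one, Real.rpow_two, one_mul]
    refine hI.trans (add_le_add ?_ ?_)
    · refine mul_le_mul_of_nonneg_right ?_ (integral_nonneg fun ω => sq_nonneg _)
      have : D₁ ≤ D := by
        have : 0 ≤ D₁ * D₂ + C₁ * γ₁ := by positivity
        rw [hD]; linarith
      gcongr
    · refine (mul_le_mul_of_nonneg_left (hρE n) (by positivity)).trans ?_
      have h1 : D₁ * D₂ ≤ D := by
        have : 0 ≤ D₁ + C₁ * γ₁ := by positivity
        rw [hD]; linarith
      calc _ = D₁ * D₂ * stepSize γ₁ β (n + 1)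
            * (t ^ (1 / 2 + 2 * δ) * stepSize γ₁ β (n + 1) + stepSize γ₁ β (n + 1) ^ 2) := by ring
        _ ≤ _ := by gcongr
  · rw [Real.rpow_one, Real.rpow_two, one_mul]

end SchemeBounds

end Linearization

/-! ### Orthogonality and variance of the linear parts -/

section Martingale

variable {Ω : Type*} [MeasurableSpace Ω] {P : Measure Ω} [IsProbabilityMeasure P]
  {α γ₁ β : ℝ} {γ : ℕ → ℝ} {X : ℕ → Ω → ℝ} {W p : ℕ → ℝ → ℝ}
  {z : ℕ → ℝ} {K₀ M : ℕ} {init : ℕ → ℕ → Ω → ℝ × ℝ} {x : ℕ → ℕ → ℕ → Ω → ℝ} {ε : ℝ → ℝ}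
  {B lip R δ C a : ℝ} {ℓ j n : ℕ}

/-- A centred function of a sample pair is orthogonal to every function of the other inputs. -/
theorem IsMultilevelSampling.integral_mul_eq_zero (hsamp : IsMultilevelSampling P X K₀ M init x)
    {E : Type*} [MeasurableSpace E] {i : ℕ × ℕ} {S : Ω → ℝ} {T : Ω → E}
    (hS : Measurable[otherSigma init x i] S) (hT : Measurable[otherSigma init x i] T)
    {F : E × (ℝ × ℝ) → ℝ} (hF : Measurable F)
    (hF0 : ∀ t, ∫ ω, F (t, (X (levelK K₀ M (i.1 - 1)) ω, X (levelK K₀ M i.1) ω)) ∂P = 0)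
    (hint : Integrable (fun ω => S ω * F (T ω, samplePair x i ω)) P) :
    ∫ ω, S ω * F (T ω, samplePair x i ω) ∂P = 0 := by
  have hST : Measurable[otherSigma init x i] fun ω => (S ω, T ω) := hS.prodMk hT
  have hle := hsamp.otherSigma_le i
  rw [integral_indepFun (S := fun ω => (S ω, T ω)) (U := samplePair x i)
    (f := fun q => q.1.1 * F (q.1.2, q.2)) (hST.mono hle le_rfl) (hsamp.measurable_samplePair i)
    (hsamp.indepFun_other hST) (hsamp.identDistrib i.1 i.2) (by fun_prop) hint]
  simp_rw [integral_const_mul, hF0]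
  simp

omit [IsProbabilityMeasure P] in
theorem integrable_fun_sub {Y Y' : Ω → ℝ} (hY : Integrable Y P) (hY' : Integrable Y' P) :
    Integrable (fun ω => Y ω - Y' ω) P :=
  hY.sub hY'

theorem integral_sq_sub_integral_le {Y : Ω → ℝ} (hY : MemLp Y 2 P) {c : ℝ}
    (hc : ∫ ω, Y ω ∂P = c) : ∫ ω, (Y ω - c) ^ 2 ∂P ≤ ∫ ω, Y ω ^ 2 ∂P := by
  have h1 := hY.integrable (by norm_num)
  have h2 := hY.integrable_sq
  have e : ∀ ω, (Y ω - c) ^ 2 = Y ω ^ 2 - 2 * c * Y ω + c ^ 2 := fun ω => by ring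
  simp_rw [e]
  rw [integral_add (integrable_fun_sub h2 (h1.const_mul _)) (integrable_const _),
    integral_sub h2 (h1.const_mul _), integral_const_mul, hc]
  simp
  nlinarith [sq_nonneg c]

theorem memLp_H1 (hα : α ∈ Set.Ioo (0 : ℝ) 1) {A : Ω → ℝ} (hA : Measurable A) (ξ : ℝ) :
    MemLp (fun ω => H1 α ξ (A ω)) 2 P :=
  MemLp.of_bound (measurable_H1_comp measurable_const hA).aestronglyMeasurable (kConst α)
    (Eventually.of_forall fun _ => abs_H1_le hα _ _)

/-- The integrand is `(1 - α)⁻²` on the event that the two indicators disagree. Passing from `(ξ,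
D)` through `(ξ, A)` to `(ξ', A)` separates the change of variable from the shift of threshold. -/
theorem integral_sq_H1_sub_le {A D : Ω → ℝ} (hA : Measurable A) (hD : Measurable D) {b : ℝ}
    (htail : ∀ x y, x ≤ y → P.real {ω | x ≤ A ω} - P.real {ω | y ≤ A ω} ≤ b * (y - x))
    (ξ ξ' : ℝ) : ∫ ω, (H1 α ξ (D ω) - H1 α ξ' (A ω)) ^ 2 ∂P
      ≤ (1 / (1 - α)) ^ 2 * (switchProb P D A ξ + b * |ξ - ξ'|) := by
  have hsA : ∀ y, MeasurableSet {ω | y ≤ A ω} := fun y => measurableSet_le measurable_const hA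
  have hsD : ∀ y, MeasurableSet {ω | y ≤ D ω} := fun y => measurableSet_le measurable_const hD
  have hshift : ∀ x y, x ≤ y → P.real {ω | x ≤ A ω ∧ ¬ y ≤ A ω} ≤ b * (y - x) := by
    intro x y hxy
    have e : {ω | x ≤ A ω ∧ ¬ y ≤ A ω} = {ω | x ≤ A ω} \ {ω | y ≤ A ω} := rfl
    rw [e, measureReal_sdiff (s₁ := {ω | x ≤ A ω}) (s₂ := {ω | y ≤ A ω})
      (fun ω (hω : y ≤ A ω) => hxy.trans hω) (hsA y)]
    exact htail x y hxy
  have hsub : P.real {ω | ¬ (ξ ≤ A ω ↔ ξ' ≤ A ω)} ≤ b * |ξ - ξ'| := by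
    rcases le_total ξ ξ' with hle | hle
    · refine le_trans (measureReal_mono fun ω hω => ?_) ((hshift ξ ξ' hle).trans_eq ?_)
      · have hω' : ¬ (ξ ≤ A ω ↔ ξ' ≤ A ω) := hω
        have : ξ' ≤ A ω → ξ ≤ A ω := hle.trans
        exact (by tauto : ξ ≤ A ω ∧ ¬ ξ' ≤ A ω)
      · rw [abs_sub_comm, abs_of_nonneg (by linarith)]
    · refine le_trans (measureReal_mono fun ω hω => ?_) ((hshift ξ' ξ hle).trans_eq ?_)
      · have hω' : ¬ (ξ ≤ A ω ↔ ξ' ≤ A ω) := hω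
        have : ξ ≤ A ω → ξ' ≤ A ω := hle.trans
        exact (by tauto : ξ' ≤ A ω ∧ ¬ ξ ≤ A ω)
      · rw [abs_of_nonneg (by linarith)]
  have hs1 : MeasurableSet {ω | ¬ (ξ ≤ D ω ↔ ξ' ≤ A ω)} := by
    have e : {ω | ¬ (ξ ≤ D ω ↔ ξ' ≤ A ω)}
        = ({ω | ξ ≤ D ω} \ {ω | ξ' ≤ A ω}) ∪ ({ω | ξ' ≤ A ω} \ {ω | ξ ≤ D ω}) := by
      ext ω
      simp only [Set.mem_ofPred_eq, Set.mem_union, Set.mem_sdiff]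
      tauto
    rw [e]
    exact ((hsD _).diff (hsA _)).union ((hsA _).diff (hsD _))
  have e : (fun ω => (H1 α ξ (D ω) - H1 α ξ' (A ω)) ^ 2)
      = {ω | ¬ (ξ ≤ D ω ↔ ξ' ≤ A ω)}.indicator fun _ => (1 / (1 - α)) ^ 2 := by
    funext ω
    unfold H1
    by_cases h1 : ξ ≤ D ω <;> by_cases h2 : ξ' ≤ A ω <;> simp [h1, h2]
  rw [e, integral_indicator_const _ hs1, smul_eq_mul, mul_comm]
  refine mul_le_mul_of_nonneg_left ?_ (sq_nonneg _)
  refine le_trans (le_trans (measureReal_mono ?_) (measureReal_union_le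
    {ω | ¬ (ξ ≤ D ω ↔ ξ ≤ A ω)} {ω | ¬ (ξ ≤ A ω ↔ ξ' ≤ A ω)})) (add_le_add le_rfl hsub)
  intro ω hω
  simp only [Set.mem_ofPred_eq, Set.mem_union] at hω ⊢
  tauto

/-- The difference of the martingale increments at the two bias parameters of a level. -/
noncomputable def noiseDiff (P : Measure Ω) (α : ℝ) (γ : ℕ → ℝ) (X : ℕ → Ω → ℝ) (K₀ M : ℕ)
    (init : ℕ → ℕ → Ω → ℝ × ℝ) (x : ℕ → ℕ → ℕ → Ω → ℝ) (ℓ n : ℕ) (ω : Ω) : ℝ :=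
  noise P α γ X K₀ M init x ℓ ℓ n ω - noise P α γ X K₀ M init x ℓ (ℓ - 1) n ω

/-- The difference of the linear recursions at the two bias parameters of a level. -/
noncomputable def linearDiff (P : Measure Ω) (α : ℝ) (γ : ℕ → ℝ) (X : ℕ → Ω → ℝ) (K₀ M : ℕ)
    (init : ℕ → ℕ → Ω → ℝ × ℝ) (x : ℕ → ℕ → ℕ → Ω → ℝ) (a : ℝ) (ℓ n : ℕ) (ω : Ω) : ℝ :=
  linearPart P α γ X K₀ M init x a ℓ ℓ n ω - linearPart P α γ X K₀ M init x a ℓ (ℓ - 1) n ω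

omit [IsProbabilityMeasure P] in
theorem linearDiff_succ (ω : Ω) : linearDiff P α γ X K₀ M init x a ℓ (n + 1) ω
    = (1 - γ (n + 1) * a) * linearDiff P α γ X K₀ M init x a ℓ n ω
      - γ (n + 1) * noiseDiff P α γ X K₀ M init x ℓ n ω := by
  simp only [linearDiff, noiseDiff, linearPart]
  ring

theorem measurable_otherSigma_linearDiff (hα : α < 1) (i : ℕ × ℕ) (hi : ℓ ≠ i.1 ∨ n ≤ i.2) :
    Measurable[otherSigma init x i] (linearDiff P α γ X K₀ M init x a ℓ n) :=
  (measurable_otherSigma_linearPart hα i (Or.inr rfl) hi).sub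
    (measurable_otherSigma_linearPart hα i (Or.inl rfl) hi)

namespace SchemeBounds

variable (h : SchemeBounds P α γ₁ β X W p z K₀ M init x ε B lip R δ C)
include h

theorem memLp_noiseDiff (n : ℕ) : MemLp (noiseDiff P α γ X K₀ M init x ℓ n) 2 P :=
  (h.memLp_noise n).sub (h.memLp_noise n)

theorem memLp_linearDiff (n : ℕ) : MemLp (linearDiff P α γ X K₀ M init x a ℓ n) 2 P :=
  (h.memLp_linearPart n).sub (h.memLp_linearPart n)

theorem integral_mul_noiseDiff {S : Ω → ℝ} (hS : Measurable[otherSigma init x (ℓ, n)] S)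
    (hS2 : MemLp S 2 P) : ∫ ω, S ω * noiseDiff P α γ X K₀ M init x ℓ n ω ∂P = 0 := by
  have hξ : ∀ j, (j = ℓ - 1 ∨ j = ℓ) → Measurable[otherSigma init x (ℓ, n)]
      fun ω => (levelIterate α γ init x ℓ j n ω).1 := fun j hj =>
    measurable_fst.comp (measurable_otherSigma_levelIterate _ hj (Or.inr le_rfl))
  have hs := fun K => measurable_slope (P := P) h.α_mem.2 (X K)
  refine h.sampling.integral_mul_eq_zero (i := (ℓ, n)) (S := S)
    (T := fun ω => ((levelIterate α γ init x ℓ ℓ n ω).1, (levelIterate α γ init x ℓ (ℓ - 1) n ω).1))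
    (F := fun q => (H1 α q.1.1 q.2.2 - slope P α (X (levelK K₀ M ℓ)) q.1.1)
      - (H1 α q.1.2 q.2.1 - slope P α (X (levelK K₀ M (ℓ - 1))) q.1.2)) hS
    ((hξ ℓ (Or.inr rfl)).prodMk (hξ (ℓ - 1) (Or.inl rfl))) ?_ (fun t => ?_) ?_
  · refine ((measurable_H1_comp (by fun_prop) (by fun_prop)).sub ((hs _).comp (by fun_prop))).sub
      ((measurable_H1_comp (by fun_prop) (by fun_prop)).sub ((hs _).comp (by fun_prop)))
  · have hi := fun K y => (memLp_H1 (P := P) h.α_mem (h.measurable_X K) y).integrable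
      (by norm_num)
    simp only
    rw [integral_sub (integrable_fun_sub (hi _ _) (integrable_const _)) (integrable_fun_sub (hi _ _) (integrable_const _)),
      integral_sub (hi _ _) (integrable_const _), integral_sub (hi _ _) (integrable_const _),
      h.integral_H1, h.integral_H1]
    simp
  · exact hS2.integrable_mul (h.memLp_noiseDiff (γ := γ) (ℓ := ℓ) n)

/-- Unrolled, the linear part is a combination of increments at the steps `k < n`, each centred
given all other inputs. With `S` taken from another level this is the orthogonality of levels;
starting at `0` makes it insensitive to dependence between the initial values. -/
theorem integral_linearDiff_mul {S : Ω → ℝ} (hS : ∀ k < n, Measurable[otherSigma init x (ℓ, k)] S)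
    (hS2 : MemLp S 2 P) : ∫ ω, linearDiff P α γ X K₀ M init x a ℓ n ω * S ω ∂P = 0 := by
  induction n with
  | zero => simp [linearDiff, linearPart]
  | succ n ih =>
    have e : ∀ ω, linearDiff P α γ X K₀ M init x a ℓ (n + 1) ω * S ω
        = (1 - γ (n + 1) * a) * (linearDiff P α γ X K₀ M init x a ℓ n ω * S ω)
          - γ (n + 1) * (S ω * noiseDiff P α γ X K₀ M init x ℓ n ω) := fun ω => by
      rw [linearDiff_succ]; ring
    simp_rw [e]
    rw [integral_sub, integral_const_mul, integral_const_mul,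
      ih fun k hk => hS k (hk.trans n.lt_succ_self),
      h.integral_mul_noiseDiff (hS n n.lt_succ_self) hS2]
    · simp
    · exact ((h.memLp_linearDiff n).integrable_mul hS2).const_mul _
    · exact (hS2.integrable_mul (h.memLp_noiseDiff n)).const_mul _

omit [IsProbabilityMeasure P] in
theorem ε_pos (hℓ : 1 ≤ ℓ) : 0 < ε (levelH K₀ M ℓ) := by
  have h1 : 0 < levelH K₀ M ℓ ^ (1 / 2 : ℝ) :=
    Real.rpow_pos_of_pos (levelH_pos h.one_le_K₀ h.two_le_M ℓ) _
  exact (mul_pos_iff_of_pos_left h.C_pos).1 (h1.trans_le (h.sqrt_le ℓ hℓ))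

omit [IsProbabilityMeasure P] in
theorem levelH_le_ε (hℓ : 1 ≤ ℓ) : levelH K₀ M ℓ ≤ C * ε (levelH K₀ M ℓ) := by
  have h0 := levelH_pos h.one_le_K₀ h.two_le_M ℓ
  have h1 := levelH_le_one h.one_le_K₀ h.two_le_M ℓ
  refine le_trans ?_ (h.sqrt_le ℓ hℓ)
  calc levelH K₀ M ℓ = levelH K₀ M ℓ ^ (1 : ℝ) := (Real.rpow_one _).symm
    _ ≤ _ := Real.rpow_le_rpow_of_exponent_ge h0 h1 (by norm_num)

omit [IsProbabilityMeasure P] in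
theorem abs_z_sub_le (hℓ : 1 ≤ ℓ) :
    |z (levelK K₀ M ℓ) - z (levelK K₀ M (ℓ - 1))| ≤ R * (1 + M) * levelH K₀ M ℓ := by
  have h1 := h.z_rate _ (one_le_levelK h.one_le_K₀ h.two_le_M ℓ)
  have h2 := h.z_rate _ (one_le_levelK h.one_le_K₀ h.two_le_M (ℓ - 1))
  have h3 : (1 : ℝ) / (levelK K₀ M (ℓ - 1) : ℝ) = M * levelH K₀ M ℓ := levelH_pred h.two_le_M hℓ
  rw [h3] at h2
  have h4 : |z (levelK K₀ M ℓ) - z 0| ≤ R * levelH K₀ M ℓ := h1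
  have h5 : z (levelK K₀ M ℓ) - z (levelK K₀ M (ℓ - 1))
      = (z (levelK K₀ M ℓ) - z 0) - (z (levelK K₀ M (ℓ - 1)) - z 0) := by ring
  rw [h5]
  refine (abs_sub _ _).trans ?_
  linarith

omit [IsProbabilityMeasure P] in
theorem abs_iterate_sub_le (hℓ : 1 ≤ ℓ) (ω : Ω) :
    |(levelIterate α γ init x ℓ ℓ n ω).1 - (levelIterate α γ init x ℓ (ℓ - 1) n ω).1|
      ≤ |iterateError α γ init x K₀ M z ℓ ℓ n ω| + |iterateError α γ init x K₀ M z ℓ (ℓ - 1) n ω|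
        + R * (1 + M) * levelH K₀ M ℓ := by
  have e : (levelIterate α γ init x ℓ ℓ n ω).1 - (levelIterate α γ init x ℓ (ℓ - 1) n ω).1
      = (iterateError α γ init x K₀ M z ℓ ℓ n ω - iterateError α γ init x K₀ M z ℓ (ℓ - 1) n ω)
        + (z (levelK K₀ M ℓ) - z (levelK K₀ M (ℓ - 1))) := by
    simp only [iterateError]; ring
  rw [e]
  exact (abs_add_le _ _).trans (add_le_add (abs_sub _ _) (h.abs_z_sub_le hℓ))

/-- With the positions of both iterates frozen, the variance is at most a multiple of the switching
probability plus their distance. That distance is bounded by the two errors, of mean order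
`γ^{1/2}`, and the gap of the targets, which is `O(h)` and hence absorbed by `ε`. -/
theorem integral_sq_noiseDiff_le : ∃ C' : ℝ, 0 ≤ C' ∧ ∀ ℓ n, 1 ≤ ℓ →
    ∫ ω, noiseDiff P α (stepSize γ₁ β) X K₀ M init x ℓ n ω ^ 2 ∂P
      ≤ C' * (ε (levelH K₀ M ℓ) + stepSize γ₁ β (n + 1) ^ (1 / 2 : ℝ)) := by
  obtain ⟨C₁, hC₁, hmom⟩ := h.moments
  have hC := h.C_pos
  have hR := h.R_nonneg
  refine ⟨(1 / (1 - α)) ^ 2 * (C + C * (R * (1 + M) * C) + C * (2 * C₁)), by positivity,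
    fun ℓ n hℓ => ?_⟩
  have hε := h.ε_pos hℓ
  have hs := stepSize_succ_pos (β := β) h.γ₁_pos n
  set t := levelH K₀ M ℓ with ht
  set ξ : ℕ → Ω → ℝ := fun j ω => (levelIterate α (stepSize γ₁ β) init x ℓ j n ω).1 with hξdef
  set e := fun j => iterateError α (stepSize γ₁ β) init x K₀ M z ℓ j n with he
  have hξ : ∀ j, (j = ℓ - 1 ∨ j = ℓ) → Measurable[otherSigma init x (ℓ, n)] (ξ j) := fun j hj =>
    measurable_fst.comp (measurable_otherSigma_levelIterate _ hj (Or.inr le_rfl))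
  have hle := h.sampling.otherSigma_le (ℓ, n)
  have hT : Measurable[otherSigma init x (ℓ, n)] fun ω => (ξ ℓ ω, ξ (ℓ - 1) ω) :=
    (hξ ℓ (Or.inr rfl)).prodMk (hξ (ℓ - 1) (Or.inl rfl))
  have hsl := fun K => measurable_slope (P := P) h.α_mem.2 (X K)
  have hlaw := integral_indepFun (S := fun ω => (ξ ℓ ω, ξ (ℓ - 1) ω)) (U := samplePair x (ℓ, n))
    (f := fun q => ((H1 α q.1.1 q.2.2 - slope P α (X (levelK K₀ M ℓ)) q.1.1)
      - (H1 α q.1.2 q.2.1 - slope P α (X (levelK K₀ M (ℓ - 1))) q.1.2)) ^ 2)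
    (hT.mono hle le_rfl) (h.sampling.measurable_samplePair (ℓ, n))
    (h.sampling.indepFun_other hT) (h.sampling.identDistrib ℓ n)
    ((((measurable_H1_comp (by fun_prop) (by fun_prop)).sub ((hsl _).comp (by fun_prop))).sub
      ((measurable_H1_comp (by fun_prop) (by fun_prop)).sub
        ((hsl _).comp (by fun_prop)))).pow_const 2)
    (h.memLp_noiseDiff (γ := stepSize γ₁ β) (ℓ := ℓ) n).integrable_sq
  have hinner : ∀ y y' : ℝ, ∫ ω, ((H1 α y (X (levelK K₀ M ℓ) ω) - slope P α (X (levelK K₀ M ℓ)) y)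
      - (H1 α y' (X (levelK K₀ M (ℓ - 1)) ω) - slope P α (X (levelK K₀ M (ℓ - 1))) y')) ^ 2 ∂P
      ≤ (1 / (1 - α)) ^ 2 * (C * ε t + C * |y - y'|) := by
    intro y y'
    have hH := fun K y => memLp_H1 (P := P) h.α_mem (h.measurable_X K) y
    have h1 := integral_sq_sub_integral_le ((hH (levelK K₀ M ℓ) y).sub (hH (levelK K₀ M (ℓ - 1)) y'))
      (c := slope P α (X (levelK K₀ M ℓ)) y - slope P α (X (levelK K₀ M (ℓ - 1))) y') (by
        simp only [Pi.sub_apply]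
        rw [integral_sub ((hH _ _).integrable (by norm_num)) ((hH _ _).integrable (by norm_num)),
          h.integral_H1, h.integral_H1])
    have h2 := integral_sq_H1_sub_le (α := α) (h.measurable_X (levelK K₀ M (ℓ - 1)))
      (h.measurable_X (levelK K₀ M ℓ)) (h.tail_sub_le _) y y'
    have e1 : ∀ ω, ((H1 α y (X (levelK K₀ M ℓ) ω) - slope P α (X (levelK K₀ M ℓ)) y)
        - (H1 α y' (X (levelK K₀ M (ℓ - 1)) ω) - slope P α (X (levelK K₀ M (ℓ - 1))) y'))
        = H1 α y (X (levelK K₀ M ℓ) ω) - H1 α y' (X (levelK K₀ M (ℓ - 1)) ω)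
          - (slope P α (X (levelK K₀ M ℓ)) y - slope P α (X (levelK K₀ M (ℓ - 1))) y') :=
      fun ω => by ring
    simp_rw [e1]
    refine h1.trans (h2.trans ?_)
    have := h.switch ℓ hℓ y
    gcongr
  have hei : ∀ j, (j = ℓ - 1 ∨ j = ℓ) → Integrable (fun ω => |e j ω|) P := fun j hj =>
    ((hmom ℓ j n hj).1.integrable (by norm_num)).abs
  have hi1 := hei ℓ (Or.inr rfl)
  have hi2 := hei (ℓ - 1) (Or.inl rfl)
  have hmaj : Integrable (fun ω => (1 / (1 - α)) ^ 2
      * (C * ε t + C * (|e ℓ ω| + |e (ℓ - 1) ω| + R * (1 + M) * t))) P :=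
    ((integrable_const _).add (((hi1.add hi2).add (integrable_const _)).const_mul _)).const_mul _
  calc ∫ ω, noiseDiff P α (stepSize γ₁ β) X K₀ M init x ℓ n ω ^ 2 ∂P
      = _ := hlaw
    _ ≤ ∫ ω, (1 / (1 - α)) ^ 2
        * (C * ε t + C * (|e ℓ ω| + |e (ℓ - 1) ω| + R * (1 + M) * t)) ∂P := by
        refine integral_mono_of_nonneg (Eventually.of_forall fun ω =>
          integral_nonneg fun ω' => sq_nonneg _) hmaj (Eventually.of_forall fun ω => ?_)
        refine (hinner _ _).trans ?_
        have := h.abs_iterate_sub_le (γ := stepSize γ₁ β) (n := n) hℓ ω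
        exact mul_le_mul_of_nonneg_left
          (add_le_add le_rfl (mul_le_mul_of_nonneg_left this hC.le)) (sq_nonneg _)
    _ = (1 / (1 - α)) ^ 2 * (C * ε t
          + C * (∫ ω, |e ℓ ω| ∂P + ∫ ω, |e (ℓ - 1) ω| ∂P + R * (1 + M) * t)) := by
        rw [integral_const_mul, integral_add (integrable_const _)
          (((hi1.fun_add hi2).fun_add (integrable_const _)).const_mul _), integral_const,
          integral_const_mul,
          integral_add (hi1.fun_add hi2) (integrable_const _), integral_add hi1 hi2]
        simp
    _ ≤ (1 / (1 - α)) ^ 2 * (C * ε t + C * (C₁ * stepSize γ₁ β (n + 1) ^ (1 / 2 : ℝ)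
          + C₁ * stepSize γ₁ β (n + 1) ^ (1 / 2 : ℝ) + R * (1 + M) * (C * ε t))) := by
        have h1 := (hmom ℓ ℓ n (Or.inr rfl)).2.2
        have h2 := (hmom ℓ (ℓ - 1) n (Or.inl rfl)).2.2
        have h3 := h.levelH_le_ε hℓ
        gcongr
    _ ≤ _ := by
        rw [mul_assoc ((1 / (1 - α)) ^ 2)]
        refine mul_le_mul_of_nonneg_left ?_ (sq_nonneg _)
        have h1 : 0 ≤ (C + C * (R * (1 + M) * C)) * stepSize γ₁ β (n + 1) ^ (1 / 2 : ℝ) := by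
          positivity
        have h2 : 0 ≤ C * (2 * C₁) * ε t := by positivity
        linarith

/-- The cross term with the fresh increment vanishes, so the second moment obeys a recursion with
forcing `γ² (ε + γ^{1/2})`; dividing by one step size gives the two rates. -/
theorem integral_sq_linearDiff_le : ∃ C' : ℝ, 0 ≤ C' ∧ ∀ ℓ n, 1 ≤ ℓ →
    ∫ ω, linearDiff P α (stepSize γ₁ β) X K₀ M init x (p 0 (z 0)) ℓ n ω ^ 2 ∂P
      ≤ C' * (ε (levelH K₀ M ℓ) * stepSize γ₁ β (n + 1)
        + stepSize γ₁ β (n + 1) ^ (3 / 2 : ℝ)) := by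
  obtain ⟨C₁, hC₁, hd⟩ := h.integral_sq_noiseDiff_le
  have ha := h.a_pos
  set a := p 0 (z 0) with hadef
  obtain ⟨C', hC', hrec⟩ := recursion_bound (p := 1) (p' := 3 / 2) (l := a) (D := a ^ 2 + C₁)
    h.γ₁_pos h.β_mem one_pos (by norm_num) ha (fun hb => by linarith [h.a_large hb])
    (fun hb => by linarith [h.a_large hb]) (by positivity)
  refine ⟨C', hC', fun ℓ n hℓ => ?_⟩
  have hε := h.ε_pos hℓ
  refine (hrec (fun n => ∫ ω, linearDiff P α (stepSize γ₁ β) X K₀ M init x a ℓ n ω ^ 2 ∂P)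
    (ε (levelH K₀ M ℓ)) 1 hε.le zero_le_one (fun n => integral_nonneg fun ω => sq_nonneg _) ?_
    (fun n => ?_) n).trans_eq (by rw [Real.rpow_one, one_mul])
  · simp only [linearDiff, linearPart]
    simp
    positivity
  · have hs := stepSize_succ_pos (β := β) h.γ₁_pos n
    set s := stepSize γ₁ β (n + 1) with hsdef
    have hq := h.memLp_linearDiff (γ := stepSize γ₁ β) (a := a) (ℓ := ℓ) n
    have hdL := h.memLp_noiseDiff (γ := stepSize γ₁ β) (ℓ := ℓ) n
    have e : ∀ ω, linearDiff P α (stepSize γ₁ β) X K₀ M init x a ℓ (n + 1) ω ^ 2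
        = (1 - s * a) ^ 2 * linearDiff P α (stepSize γ₁ β) X K₀ M init x a ℓ n ω ^ 2
          - 2 * (1 - s * a) * s * (linearDiff P α (stepSize γ₁ β) X K₀ M init x a ℓ n ω
            * noiseDiff P α (stepSize γ₁ β) X K₀ M init x ℓ n ω)
          + s ^ 2 * noiseDiff P α (stepSize γ₁ β) X K₀ M init x ℓ n ω ^ 2 := fun ω => by
      rw [linearDiff_succ]; ring
    have hqd : Integrable (fun ω => linearDiff P α (stepSize γ₁ β) X K₀ M init x a ℓ n ω
        * noiseDiff P α (stepSize γ₁ β) X K₀ M init x ℓ n ω) P := hq.integrable_mul hdL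
    simp_rw [e]
    rw [integral_add (integrable_fun_sub (hq.integrable_sq.const_mul _) (hqd.const_mul _))
      (hdL.integrable_sq.const_mul _), integral_sub (hq.integrable_sq.const_mul _)
      (hqd.const_mul _), integral_const_mul, integral_const_mul,
      integral_const_mul, h.integral_mul_noiseDiff
        (measurable_otherSigma_linearDiff h.α_mem.2 _ (Or.inr le_rfl)) hq, mul_zero, sub_zero]
    have hE0 : 0 ≤ ∫ ω, linearDiff P α (stepSize γ₁ β) X K₀ M init x a ℓ n ω ^ 2 ∂P :=
      integral_nonneg fun ω => sq_nonneg _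
    refine add_le_add (mul_le_mul_of_nonneg_right ?_ hE0) ?_
    · have h1 : 0 ≤ C₁ * s ^ 2 := by positivity
      have h2 : 0 ≤ a * s := by positivity
      nlinarith
    · have h3 : s ^ (3 / 2 : ℝ) = s * s ^ (1 / 2 : ℝ) := by
        rw [show (3 / 2 : ℝ) = 1 + 1 / 2 by norm_num, Real.rpow_add hs, Real.rpow_one]
      rw [Real.rpow_one, h3]
      calc s ^ 2 * ∫ ω, noiseDiff P α (stepSize γ₁ β) X K₀ M init x ℓ n ω ^ 2 ∂P
          ≤ s ^ 2 * (C₁ * (ε (levelH K₀ M ℓ) + s ^ (1 / 2 : ℝ))) := by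
            have := hd ℓ n hℓ
            gcongr
        _ = C₁ * s * (ε (levelH K₀ M ℓ) * s + 1 * (s * s ^ (1 / 2 : ℝ))) := by ring
        _ ≤ _ := by
            gcongr
            have := sq_nonneg a
            linarith

end SchemeBounds

end Martingale

/-! ### Mean square error of the first component -/

section QuantileError

variable {Ω : Type*} [MeasurableSpace Ω] {P : Measure Ω} [IsProbabilityMeasure P]
  {α γ₁ β : ℝ} {γ : ℕ → ℝ} {X : ℕ → Ω → ℝ} {W p : ℕ → ℝ → ℝ}
  {z : ℕ → ℝ} {K₀ M : ℕ} {init : ℕ → ℕ → Ω → ℝ × ℝ} {x : ℕ → ℕ → ℕ → Ω → ℝ} {ε : ℝ → ℝ}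
  {B lip R δ C a : ℝ} {ℓ j n : ℕ}

theorem sum_Icc_sub_pred (u : ℕ → ℝ) (L : ℕ) :
    ∑ ℓ ∈ Finset.Icc 1 L, (u ℓ - u (ℓ - 1)) = u L - u 0 := by
  induction L with
  | zero => simp
  | succ L ih => rw [Finset.sum_Icc_succ_top (by omega), ih]; simp

theorem sum_levelH_rpow_le (hK₀ : 1 ≤ K₀) (hM : 2 ≤ M) {θ : ℝ} (hθ : 0 < θ) (L : ℕ) :
    ∑ ℓ ∈ Finset.Icc 1 L, levelH K₀ M ℓ ^ θ ≤ (1 - (1 / 2 : ℝ) ^ θ)⁻¹ := by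
  have hr0 : (0 : ℝ) ≤ (1 / 2 : ℝ) ^ θ := by positivity
  have hr1 : (1 / 2 : ℝ) ^ θ < 1 := Real.rpow_lt_one (by norm_num) (by norm_num) hθ
  calc ∑ ℓ ∈ Finset.Icc 1 L, levelH K₀ M ℓ ^ θ
      ≤ ∑ ℓ ∈ Finset.Icc 1 L, ((1 / 2 : ℝ) ^ θ) ^ ℓ := by
        refine Finset.sum_le_sum fun ℓ _ => ?_
        rw [← Real.rpow_natCast, ← Real.rpow_mul (by norm_num), mul_comm, Real.rpow_mul (by norm_num),
          Real.rpow_natCast]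
        exact Real.rpow_le_rpow (levelH_pos hK₀ hM ℓ).le (levelH_le_pow hK₀ hM ℓ) hθ.le
    _ ≤ ∑' ℓ : ℕ, ((1 / 2 : ℝ) ^ θ) ^ ℓ :=
        (summable_geometric_of_lt_one hr0 hr1).sum_le_tsum _ fun ℓ _ => pow_nonneg hr0 ℓ
    _ = _ := tsum_geometric_of_lt_one hr0 hr1

omit [MeasurableSpace Ω] in
theorem estimator_fst (L : ℕ) (N : ℕ → ℕ) (ω : Ω) :
    (estimator α γ init x L N ω).1 = (levelIterate α γ init x 0 0 (N 0) ω).1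
      + ∑ ℓ ∈ Finset.Icc 1 L, ((levelIterate α γ init x ℓ ℓ (N ℓ) ω).1
        - (levelIterate α γ init x ℓ (ℓ - 1) (N ℓ) ω).1) := by
  simp [estimator, Prod.fst_sum]

omit [MeasurableSpace Ω] in
theorem estimator_snd (L : ℕ) (N : ℕ → ℕ) (ω : Ω) :
    (estimator α γ init x L N ω).2 = (levelIterate α γ init x 0 0 (N 0) ω).2
      + ∑ ℓ ∈ Finset.Icc 1 L, ((levelIterate α γ init x ℓ ℓ (N ℓ) ω).2
        - (levelIterate α γ init x ℓ (ℓ - 1) (N ℓ) ω).2) := by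
  simp [estimator, Prod.snd_sum]

/-- The difference, at the two bias parameters of a level, of the errors left over by the
linearization. -/
noncomputable def remainderDiff (P : Measure Ω) (α : ℝ) (γ : ℕ → ℝ) (X : ℕ → Ω → ℝ) (K₀ M : ℕ)
    (init : ℕ → ℕ → Ω → ℝ × ℝ) (x : ℕ → ℕ → ℕ → Ω → ℝ) (z : ℕ → ℝ) (a : ℝ) (ℓ n : ℕ) (ω : Ω) : ℝ :=
  (iterateError α γ init x K₀ M z ℓ ℓ n ω - linearPart P α γ X K₀ M init x a ℓ ℓ n ω)
    - (iterateError α γ init x K₀ M z ℓ (ℓ - 1) n ω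
      - linearPart P α γ X K₀ M init x a ℓ (ℓ - 1) n ω)

theorem iterate_sub_eq (P : Measure Ω) (X : ℕ → Ω → ℝ) (z : ℕ → ℝ) (K₀ M : ℕ) (a : ℝ) (ω : Ω) :
    (levelIterate α γ init x ℓ ℓ n ω).1 - (levelIterate α γ init x ℓ (ℓ - 1) n ω).1
      = (z (levelK K₀ M ℓ) - z (levelK K₀ M (ℓ - 1))) + linearDiff P α γ X K₀ M init x a ℓ n ω
        + remainderDiff P α γ X K₀ M init x z a ℓ n ω := by
  simp only [linearDiff, remainderDiff, iterateError]
  ring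

namespace SchemeBounds

variable (h : SchemeBounds P α γ₁ β X W p z K₀ M init x ε B lip R δ C)
include h

theorem memLp_iterateError (hj : j = ℓ - 1 ∨ j = ℓ) :
    MemLp (iterateError α (stepSize γ₁ β) init x K₀ M z ℓ j n) 2 P := by
  obtain ⟨_, _, h1⟩ := h.moments
  exact (h1 ℓ j n hj).1

theorem memLp_remainderDiff :
    MemLp (remainderDiff P α (stepSize γ₁ β) X K₀ M init x z a ℓ n) 2 P :=
  ((h.memLp_iterateError (Or.inr rfl)).sub (h.memLp_linearPart n)).sub
    ((h.memLp_iterateError (Or.inl rfl)).sub (h.memLp_linearPart n))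

theorem integral_sq_remainderDiff_le : ∃ C' : ℝ, 0 ≤ C' ∧ ∀ ℓ n, 1 ≤ ℓ →
    ∫ ω, remainderDiff P α (stepSize γ₁ β) X K₀ M init x z (p 0 (z 0)) ℓ n ω ^ 2 ∂P
      ≤ C' * (levelH K₀ M ℓ ^ (1 / 2 + 2 * δ) * stepSize γ₁ β (n + 1)
        + stepSize γ₁ β (n + 1) ^ 2) := by
  obtain ⟨C₁, hC₁, h1⟩ := h.remainder_le
  set a := p 0 (z 0) with ha
  refine ⟨2 * (C₁ + C₁ * (1 + (M : ℝ) ^ (1 / 2 + 2 * δ))), by positivity, fun ℓ n hℓ => ?_⟩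
  have hL : ∀ j, (j = ℓ - 1 ∨ j = ℓ) → MemLp (fun ω =>
      iterateError α (stepSize γ₁ β) init x K₀ M z ℓ j n ω
        - linearPart P α (stepSize γ₁ β) X K₀ M init x a ℓ j n ω) 2 P := fun j hj =>
    (h.memLp_iterateError hj).sub (h.memLp_linearPart n)
  have hi1 := (hL ℓ (Or.inr rfl)).integrable_sq
  have hi2 := (hL (ℓ - 1) (Or.inl rfl)).integrable_sq
  have hs := stepSize_succ_pos (β := β) h.γ₁_pos n
  have ht := levelH_pos h.one_le_K₀ h.two_le_M ℓ
  have hI : ∫ ω, remainderDiff P α (stepSize γ₁ β) X K₀ M init x z a ℓ n ω ^ 2 ∂P ≤ _ :=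
    integral_mono h.memLp_remainderDiff.integrable_sq
    ((hi1.const_mul 2).fun_add (hi2.const_mul 2)) (fun ω => by
      simp only [remainderDiff]
      nlinarith [sq_nonneg ((iterateError α (stepSize γ₁ β) init x K₀ M z ℓ ℓ n ω
        - linearPart P α (stepSize γ₁ β) X K₀ M init x a ℓ ℓ n ω)
        + (iterateError α (stepSize γ₁ β) init x K₀ M z ℓ (ℓ - 1) n ω
        - linearPart P α (stepSize γ₁ β) X K₀ M init x a ℓ (ℓ - 1) n ω))])
  rw [integral_add (hi1.const_mul 2) (hi2.const_mul 2), integral_const_mul,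
    integral_const_mul] at hI
  have h2 := h1 ℓ ℓ n (Or.inr rfl)
  have h3 := h1 ℓ (ℓ - 1) n (Or.inl rfl)
  rw [levelH_pred h.two_le_M hℓ, Real.mul_rpow (by positivity) ht.le] at h3
  set s := stepSize γ₁ β (n + 1) with hsdef
  set t := levelH K₀ M ℓ ^ (1 / 2 + 2 * δ) with htdef
  have ht0 : 0 ≤ t := by positivity
  have h4 : (M : ℝ) ^ (1 / 2 + 2 * δ) * t * s + s ^ 2
      ≤ (1 + (M : ℝ) ^ (1 / 2 + 2 * δ)) * (t * s + s ^ 2) := by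
    have : 0 ≤ t * s + (M : ℝ) ^ (1 / 2 + 2 * δ) * s ^ 2 := by positivity
    linarith
  have h5 := mul_le_mul_of_nonneg_left h4 hC₁
  linarith

omit [IsProbabilityMeasure P] in
-- Cauchy–Schwarz with the factors `h^δ` and `h^{1/4} g^{1/2}`: `∑ h^{2δ}` is bounded by a geometric
-- series and `h^{1/2}` by a multiple of `ε(h)`. This is where a density rate strictly better than
-- `h^{1/4}` is used.
theorem sq_sum_remainder_rate_le (L : ℕ) {g : ℕ → ℝ} (hg : ∀ ℓ, 0 ≤ g ℓ) :
    (∑ ℓ ∈ Finset.Icc 1 L, levelH K₀ M ℓ ^ (1 / 4 + δ) * g ℓ ^ (1 / 2 : ℝ)) ^ 2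
      ≤ (1 - (1 / 2 : ℝ) ^ (2 * δ))⁻¹ * (C * ∑ ℓ ∈ Finset.Icc 1 L, g ℓ * ε (levelH K₀ M ℓ)) := by
  have ht := fun ℓ => levelH_pos h.one_le_K₀ h.two_le_M ℓ
  have hδ := h.δ_pos
  calc (∑ ℓ ∈ Finset.Icc 1 L, levelH K₀ M ℓ ^ (1 / 4 + δ) * g ℓ ^ (1 / 2 : ℝ)) ^ 2
      ≤ (∑ ℓ ∈ Finset.Icc 1 L, levelH K₀ M ℓ ^ (2 * δ))
        * ∑ ℓ ∈ Finset.Icc 1 L, levelH K₀ M ℓ ^ (1 / 2 : ℝ) * g ℓ := by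
        refine Finset.sum_sq_le_sum_mul_sum_of_sq_le_mul _
          (fun ℓ _ => Real.rpow_nonneg (ht ℓ).le _)
          (fun ℓ _ => mul_nonneg (Real.rpow_nonneg (ht ℓ).le _) (hg ℓ)) fun ℓ _ => ?_
        rw [mul_pow, ← Real.rpow_natCast (g ℓ ^ (1 / 2 : ℝ)), ← Real.rpow_mul (hg ℓ),
          ← Real.rpow_natCast (levelH K₀ M ℓ ^ (1 / 4 + δ)), ← Real.rpow_mul (ht ℓ).le,
          ← mul_assoc, ← Real.rpow_add (ht ℓ)]
        norm_num
        refine le_of_eq ?_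
        congr 2
        ring
    _ ≤ _ := by
        refine mul_le_mul (sum_levelH_rpow_le h.one_le_K₀ h.two_le_M (by linarith) L) ?_
          (Finset.sum_nonneg fun ℓ _ => mul_nonneg (Real.rpow_nonneg (ht ℓ).le _) (hg ℓ)) ?_
        · rw [Finset.mul_sum]
          refine Finset.sum_le_sum fun ℓ hℓ => ?_
          have := mul_le_mul_of_nonneg_right (h.sqrt_le ℓ (Finset.mem_Icc.1 hℓ).1) (hg ℓ)
          linarith
        · have : (1 / 2 : ℝ) ^ (2 * δ) < 1 :=
            Real.rpow_lt_one (by norm_num) (by norm_num) (by linarith)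
          exact inv_nonneg.2 (by linarith)

omit [IsProbabilityMeasure P] in
theorem stepSize_succ_le (hn : 1 ≤ n) : stepSize γ₁ β (n + 1) ≤ stepSize γ₁ β n :=
  stepSize_anti h.γ₁_pos h.β_mem.1.le hn n.le_succ

/-- The mean square error of the first component of the multilevel estimator. -/
theorem integral_sq_estimator_fst_le : ∃ C' : ℝ, 0 ≤ C' ∧ ∀ (L : ℕ) (N : ℕ → ℕ),
    (∀ ℓ ≤ L, 1 ≤ N ℓ) →
    Integrable (fun ω => ((estimator α (stepSize γ₁ β) init x L N ω).1 - z (levelK K₀ M L)) ^ 2) P ∧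
    ∫ ω, ((estimator α (stepSize γ₁ β) init x L N ω).1 - z (levelK K₀ M L)) ^ 2 ∂P
      ≤ C' * (stepSize γ₁ β (N 0) + (∑ ℓ ∈ Finset.Icc 1 L, stepSize γ₁ β (N ℓ)) ^ 2
        + ∑ ℓ ∈ Finset.Icc 1 L, stepSize γ₁ β (N ℓ) ^ (3 / 2 : ℝ)
        + ∑ ℓ ∈ Finset.Icc 1 L, stepSize γ₁ β (N ℓ) * ε (levelH K₀ M ℓ)) := by
  obtain ⟨C₁, hC₁, hmom⟩ := h.moments
  obtain ⟨C₂, hC₂, hlin⟩ := h.integral_sq_linearDiff_le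
  obtain ⟨C₃, hC₃, hrem⟩ := h.integral_sq_remainderDiff_le
  set a := p 0 (z 0) with ha
  set S := (1 - (1 / 2 : ℝ) ^ (2 * δ))⁻¹ * C with hS
  have hC := h.C_pos
  have hδ := h.δ_pos
  have hS0 : 0 ≤ S := by
    have : (1 / 2 : ℝ) ^ (2 * δ) < 1 := Real.rpow_lt_one (by norm_num) (by norm_num) (by linarith)
    exact mul_nonneg (inv_nonneg.2 (by linarith)) hC.le
  refine ⟨3 * (C₁ + C₂ + 2 * C₃ + 2 * C₃ * S), by positivity, fun L N hN => ?_⟩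
  set g : ℕ → ℝ := fun ℓ => stepSize γ₁ β (N ℓ) with hg
  have hg0 : ∀ ℓ, 0 ≤ g ℓ := fun ℓ => stepSize_nonneg h.γ₁_pos _
  have hgle : ∀ ℓ ≤ L, stepSize γ₁ β (N ℓ + 1) ≤ g ℓ := fun ℓ hℓ => h.stepSize_succ_le (hN ℓ hℓ)
  set e := iterateError α (stepSize γ₁ β) init x K₀ M z 0 0 (N 0) with he
  set Q : ℕ → Ω → ℝ := fun ℓ => linearDiff P α (stepSize γ₁ β) X K₀ M init x a ℓ (N ℓ) with hQ
  set D : ℕ → Ω → ℝ := fun ℓ => remainderDiff P α (stepSize γ₁ β) X K₀ M init x z a ℓ (N ℓ) with hD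
  have heL : MemLp e 2 P := h.memLp_iterateError (Or.inr rfl)
  have hQL : ∀ ℓ, MemLp (Q ℓ) 2 P := fun ℓ => h.memLp_linearDiff (N ℓ)
  have hDL : ∀ ℓ, MemLp (D ℓ) 2 P := fun ℓ => h.memLp_remainderDiff
  have hQS : MemLp (fun ω => ∑ ℓ ∈ Finset.Icc 1 L, Q ℓ ω) 2 P := memLp_finsetSum _ fun ℓ _ => hQL ℓ
  have hDS : MemLp (fun ω => ∑ ℓ ∈ Finset.Icc 1 L, D ℓ ω) 2 P := memLp_finsetSum _ fun ℓ _ => hDL ℓ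
  -- The minimizers telescope over the levels, leaving the error of level `0`, the linear parts and
  -- the remainders.
  have hdec : ∀ ω, (estimator α (stepSize γ₁ β) init x L N ω).1 - z (levelK K₀ M L)
      = e ω + ∑ ℓ ∈ Finset.Icc 1 L, Q ℓ ω + ∑ ℓ ∈ Finset.Icc 1 L, D ℓ ω := by
    intro ω
    rw [estimator_fst]
    simp_rw [iterate_sub_eq P X z K₀ M a]
    rw [Finset.sum_add_distrib, Finset.sum_add_distrib,
      sum_Icc_sub_pred (fun ℓ => z (levelK K₀ M ℓ))]
    simp only [he, hQ, hD, iterateError]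
    ring
  simp_rw [hdec]
  have htot : MemLp (fun ω => e ω + ∑ ℓ ∈ Finset.Icc 1 L, Q ℓ ω + ∑ ℓ ∈ Finset.Icc 1 L, D ℓ ω)
    2 P := (heL.add hQS).add hDS
  refine ⟨htot.integrable_sq, ?_⟩
  have he2 : ∫ ω, e ω ^ 2 ∂P ≤ C₁ * g 0 :=
    (hmom 0 0 (N 0) (Or.inr rfl)).2.1.trans
      (mul_le_mul_of_nonneg_left (hgle 0 (Nat.zero_le _)) hC₁)
  have hQ2 : ∫ ω, (∑ ℓ ∈ Finset.Icc 1 L, Q ℓ ω) ^ 2 ∂P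
      ≤ C₂ * (∑ ℓ ∈ Finset.Icc 1 L, g ℓ * ε (levelH K₀ M ℓ)
        + ∑ ℓ ∈ Finset.Icc 1 L, g ℓ ^ (3 / 2 : ℝ)) := by
    rw [integral_sq_sum_of_orthogonal _ (fun ℓ _ => hQL ℓ), ← Finset.sum_add_distrib,
      Finset.mul_sum]
    · refine Finset.sum_le_sum fun ℓ hℓ => (hlin ℓ (N ℓ) (Finset.mem_Icc.1 hℓ).1).trans ?_
      have h1 := hgle ℓ (Finset.mem_Icc.1 hℓ).2
      have h2 := h.ε_pos (Finset.mem_Icc.1 hℓ).1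
      have h3 := stepSize_succ_pos (β := β) h.γ₁_pos (N ℓ)
      rw [mul_comm (g ℓ)]
      gcongr
    -- At distinct levels, the linear part of level `j` avoids every sample of level `i`.
    · intro i hi j hj hij
      exact h.integral_linearDiff_mul (fun k _ =>
        measurable_otherSigma_linearDiff h.α_mem.2 _ (Or.inl hij.symm)) (hQL j)
  have hD2 : ∫ ω, (∑ ℓ ∈ Finset.Icc 1 L, D ℓ ω) ^ 2 ∂P
      ≤ 2 * C₃ * (S * ∑ ℓ ∈ Finset.Icc 1 L, g ℓ * ε (levelH K₀ M ℓ)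
        + (∑ ℓ ∈ Finset.Icc 1 L, g ℓ) ^ 2) := by
    -- The remainders may be correlated across levels. The weights are the separate square roots of
    -- `h^{1/2 + 2δ} g` and `g²`, whose sum dominates the `L²` norm up to a constant.
    have h1 := integral_sq_sum_le (Finset.Icc 1 L) (F := D) (C := C₃)
      (w := fun ℓ => levelH K₀ M ℓ ^ (1 / 4 + δ) * g ℓ ^ (1 / 2 : ℝ) + g ℓ)
      (fun ℓ hℓ => ?_) (fun ℓ _ => hDL ℓ) (fun ℓ hℓ => ?_)
    · refine h1.trans ?_
      rw [Finset.sum_add_distrib]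
      have h2 := h.sq_sum_remainder_rate_le L hg0
      rw [← mul_assoc, ← hS] at h2
      have h3 := add_sq_le
        (a := ∑ ℓ ∈ Finset.Icc 1 L, levelH K₀ M ℓ ^ (1 / 4 + δ) * g ℓ ^ (1 / 2 : ℝ))
        (b := ∑ ℓ ∈ Finset.Icc 1 L, g ℓ)
      rw [mul_comm 2 C₃, mul_assoc]
      refine mul_le_mul_of_nonneg_left (h3.trans ?_) hC₃
      linarith
    · have h2 := levelH_pos h.one_le_K₀ h.two_le_M ℓ
      have h3 : 0 < g ℓ := stepSize_pos h.γ₁_pos (hN ℓ (Finset.mem_Icc.1 hℓ).2)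
      positivity
    · refine (hrem ℓ (N ℓ) (Finset.mem_Icc.1 hℓ).1).trans (mul_le_mul_of_nonneg_left ?_ hC₃)
      have h2 := levelH_pos h.one_le_K₀ h.two_le_M ℓ
      have h3 := hgle ℓ (Finset.mem_Icc.1 hℓ).2
      have h4 := stepSize_succ_pos (β := β) h.γ₁_pos (N ℓ)
      have h5 : (levelH K₀ M ℓ ^ (1 / 4 + δ) * g ℓ ^ (1 / 2 : ℝ)) ^ 2
          = levelH K₀ M ℓ ^ (1 / 2 + 2 * δ) * g ℓ := by
        rw [mul_pow, ← Real.rpow_natCast (g ℓ ^ (1 / 2 : ℝ)), ← Real.rpow_mul (hg0 ℓ),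
          ← Real.rpow_natCast (levelH K₀ M ℓ ^ (1 / 4 + δ)), ← Real.rpow_mul h2.le]
        norm_num
        left
        congr 1
        ring
      have h6 : 0 ≤ levelH K₀ M ℓ ^ (1 / 4 + δ) * g ℓ ^ (1 / 2 : ℝ) * g ℓ := by
        have := hg0 ℓ
        positivity
      calc levelH K₀ M ℓ ^ (1 / 2 + 2 * δ) * stepSize γ₁ β (N ℓ + 1)
            + stepSize γ₁ β (N ℓ + 1) ^ 2
          ≤ levelH K₀ M ℓ ^ (1 / 2 + 2 * δ) * g ℓ + g ℓ ^ 2 := by gcongr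
        _ ≤ _ := by rw [add_sq, h5]; linarith
  have hi1 := heL.integrable_sq.const_mul 3
  have hi2 := hQS.integrable_sq.const_mul 3
  have hi3 := hDS.integrable_sq.const_mul 3
  have hI : ∫ ω, (e ω + ∑ ℓ ∈ Finset.Icc 1 L, Q ℓ ω + ∑ ℓ ∈ Finset.Icc 1 L, D ℓ ω) ^ 2 ∂P ≤ _ :=
    integral_mono htot.integrable_sq ((hi1.fun_add hi2).fun_add hi3) (fun ω => by
      simp only
      nlinarith [sq_nonneg (e ω - ∑ ℓ ∈ Finset.Icc 1 L, Q ℓ ω),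
        sq_nonneg (e ω - ∑ ℓ ∈ Finset.Icc 1 L, D ℓ ω),
        sq_nonneg (∑ ℓ ∈ Finset.Icc 1 L, Q ℓ ω - ∑ ℓ ∈ Finset.Icc 1 L, D ℓ ω)])
  rw [integral_add (hi1.fun_add hi2) hi3, integral_add hi1 hi2, integral_const_mul,
    integral_const_mul, integral_const_mul] at hI
  have hp1 : 0 ≤ ∑ ℓ ∈ Finset.Icc 1 L, g ℓ ^ (3 / 2 : ℝ) :=
    Finset.sum_nonneg fun ℓ _ => Real.rpow_nonneg (hg0 ℓ) _
  have hp2 : 0 ≤ ∑ ℓ ∈ Finset.Icc 1 L, g ℓ * ε (levelH K₀ M ℓ) :=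
    Finset.sum_nonneg fun ℓ hℓ => mul_nonneg (hg0 ℓ) (h.ε_pos (Finset.mem_Icc.1 hℓ).1).le
  have hp3 := sq_nonneg (∑ ℓ ∈ Finset.Icc 1 L, g ℓ)
  have hp0 := hg0 0
  set A₀ := g 0
  set A₁ := (∑ ℓ ∈ Finset.Icc 1 L, g ℓ) ^ 2
  set A₂ := ∑ ℓ ∈ Finset.Icc 1 L, g ℓ ^ (3 / 2 : ℝ)
  set A₃ := ∑ ℓ ∈ Finset.Icc 1 L, g ℓ * ε (levelH K₀ M ℓ)
  have hT : 0 ≤ A₀ + A₁ + A₂ + A₃ := by positivity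
  have k1 := mul_le_mul_of_nonneg_left (show A₀ ≤ A₀ + A₁ + A₂ + A₃ by linarith) hC₁
  have k2 := mul_le_mul_of_nonneg_left (show A₃ + A₂ ≤ A₀ + A₁ + A₂ + A₃ by linarith) hC₂
  have k3 := mul_le_mul_of_nonneg_left (show A₁ ≤ A₀ + A₁ + A₂ + A₃ by linarith) hC₃
  have k4 := mul_le_mul_of_nonneg_left (show A₃ ≤ A₀ + A₁ + A₂ + A₃ by linarith)
    (mul_nonneg hC₃ hS0)
  linarith

end SchemeBounds

end QuantileError

/-! ### Averaged step sizes -/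

section AvgStep

theorem sum_Icc_eq_sum_range (u : ℕ → ℝ) (n : ℕ) :
    ∑ k ∈ Finset.Icc 1 n, u k = ∑ k ∈ Finset.range n, u (k + 1) := by
  induction n with
  | zero => simp
  | succ n ih => rw [Finset.sum_Icc_succ_top (by omega), ih, Finset.sum_range_succ]

theorem avgStep_eq (γ₁ β : ℝ) (n : ℕ) :
    avgStep γ₁ β n = 1 / (n : ℝ) * ∑ k ∈ Finset.range n, stepSize γ₁ β (k + 1) := by
  rw [avgStep, sum_Icc_eq_sum_range]

theorem avgStep_pos {γ₁ β : ℝ} (hγ₁ : 0 < γ₁) {n : ℕ} (hn : 1 ≤ n) : 0 < avgStep γ₁ β n := by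
  have hn0 : (0 : ℝ) < n := by exact_mod_cast hn
  unfold avgStep
  refine mul_pos (by positivity) (Finset.sum_pos (fun k hk => ?_) ⟨1, Finset.mem_Icc.2 ⟨le_rfl, hn⟩⟩)
  exact stepSize_pos hγ₁ (Finset.mem_Icc.1 hk).1

theorem sum_rpow_neg_half_le (n : ℕ) :
    ∑ k ∈ Finset.range n, ((k + 1 : ℕ) : ℝ) ^ (-(1 / 2) : ℝ) ≤ 2 * √n := by
  induction n with
  | zero => simp
  | succ n ih =>
    rw [Finset.sum_range_succ]
    have h0 : (0 : ℝ) < ((n + 1 : ℕ) : ℝ) := by positivity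
    have h1 : 0 < √((n + 1 : ℕ) : ℝ) := Real.sqrt_pos.2 h0
    have h2 : √((n + 1 : ℕ) : ℝ) ^ 2 = (n : ℝ) + 1 := by rw [Real.sq_sqrt h0.le]; push_cast; ring
    have h3 : √(n : ℝ) ^ 2 = n := Real.sq_sqrt (Nat.cast_nonneg n)
    have h4 : ((n + 1 : ℕ) : ℝ) ^ (-(1 / 2) : ℝ) = 1 / √((n + 1 : ℕ) : ℝ) := by
      rw [Real.rpow_neg h0.le, ← Real.sqrt_eq_rpow, one_div]
    have h5 : 1 / √((n + 1 : ℕ) : ℝ) ≤ 2 * √((n + 1 : ℕ) : ℝ) - 2 * √(n : ℝ) := by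
      rw [div_le_iff₀ h1]
      nlinarith [sq_nonneg (√((n + 1 : ℕ) : ℝ) - √(n : ℝ))]
    rw [h4]
    linarith

/-- Only the exponent `min (1/2) β` is needed, because the target saturates at `1/n`. With exponents
at most `1/2` everything reduces to `∑ k^{-1/2} ≤ 2 √n`, without a separate logarithmic case at `β =
1`. -/
theorem sq_avgStep_le {γ₁ β : ℝ} (hγ₁ : 0 < γ₁) {n : ℕ} (hn : 1 ≤ n) :
    avgStep γ₁ β n ^ 2 ≤ 4 * γ₁ ^ 2 * (1 / (n : ℝ) ^ (min 1 (2 * β))) := by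
  have hn0 : (0 : ℝ) < n := by exact_mod_cast hn
  set b := min (1 / 2) β with hb
  have hb2 : min 1 (2 * β) = b * 2 := by
    rw [hb, min_mul_of_nonneg _ _ (by norm_num : (0 : ℝ) ≤ 2)]
    congr 1
    · norm_num
    · ring
  have hbh : b ≤ 1 / 2 := min_le_left _ _
  have hterm : ∀ k ∈ Finset.range n, stepSize γ₁ β (k + 1)
      ≤ γ₁ * (n : ℝ) ^ (1 / 2 - b) * ((k + 1 : ℕ) : ℝ) ^ (-(1 / 2) : ℝ) := by
    intro k hk
    have hk1 : (1 : ℝ) ≤ ((k + 1 : ℕ) : ℝ) := by exact_mod_cast Nat.succ_le_succ (Nat.zero_le k)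
    have hkn : ((k + 1 : ℕ) : ℝ) ≤ n := by exact_mod_cast Finset.mem_range.1 hk
    unfold stepSize
    rw [mul_assoc]
    refine mul_le_mul_of_nonneg_left ?_ hγ₁.le
    calc ((k + 1 : ℕ) : ℝ) ^ (-β) ≤ ((k + 1 : ℕ) : ℝ) ^ (-b) :=
          Real.rpow_le_rpow_of_exponent_le hk1 (neg_le_neg (min_le_right _ _))
      _ = ((k + 1 : ℕ) : ℝ) ^ (1 / 2 - b) * ((k + 1 : ℕ) : ℝ) ^ (-(1 / 2) : ℝ) := by
          rw [← Real.rpow_add (by linarith)]; congr 1; ring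
      _ ≤ _ := by
          refine mul_le_mul_of_nonneg_right ?_ (by positivity)
          exact Real.rpow_le_rpow (by linarith) hkn (by linarith)
  have h1 : avgStep γ₁ β n ≤ 2 * γ₁ * (n : ℝ) ^ (-b) := by
    rw [avgStep_eq]
    calc 1 / (n : ℝ) * ∑ k ∈ Finset.range n, stepSize γ₁ β (k + 1)
        ≤ 1 / (n : ℝ) * (γ₁ * (n : ℝ) ^ (1 / 2 - b) * (2 * √n)) := by
          refine mul_le_mul_of_nonneg_left ((Finset.sum_le_sum hterm).trans ?_) (by positivity)
          rw [← Finset.mul_sum]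
          exact mul_le_mul_of_nonneg_left (sum_rpow_neg_half_le n) (by positivity)
      _ = 2 * γ₁ * ((n : ℝ) ^ (-1 : ℝ) * (n : ℝ) ^ (1 / 2 - b) * (n : ℝ) ^ (1 / 2 : ℝ)) := by
          rw [Real.sqrt_eq_rpow, Real.rpow_neg_one]; ring
      _ = _ := by
          rw [← Real.rpow_add hn0, ← Real.rpow_add hn0]; congr 2; ring
  calc avgStep γ₁ β n ^ 2 ≤ (2 * γ₁ * (n : ℝ) ^ (-b)) ^ 2 :=
        pow_le_pow_left₀ (avgStep_pos hγ₁ hn).le h1 2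
    _ = 4 * γ₁ ^ 2 * ((n : ℝ) ^ (-b)) ^ 2 := by ring
    _ = _ := by
        rw [hb2, Real.rpow_mul hn0.le, Real.rpow_neg hn0.le]
        norm_num

end AvgStep

/-! ### Increments of the second component -/

section ValueNoise

variable {Ω : Type*} [MeasurableSpace Ω]

/-- The integrand of `objective`. -/
noncomputable def pinball (α ξ x : ℝ) : ℝ := ξ + 1 / (1 - α) * max (x - ξ) 0

/-- The martingale increment of one step of the scheme for the second component. -/
noncomputable def valueNoise (P : Measure Ω) (α : ℝ) (γ : ℕ → ℝ) (X : ℕ → Ω → ℝ) (K₀ M : ℕ)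
    (init : ℕ → ℕ → Ω → ℝ × ℝ) (x : ℕ → ℕ → ℕ → Ω → ℝ) (ℓ j n : ℕ) (ω : Ω) : ℝ :=
  pinball α (levelIterate α γ init x ℓ j n ω).1 (x ℓ j n ω)
    - objective P α (X (levelK K₀ M j)) (levelIterate α γ init x ℓ j n ω).1

variable {P : Measure Ω} {α γ₁ β : ℝ} {γ : ℕ → ℝ} {X : ℕ → Ω → ℝ} {W p : ℕ → ℝ → ℝ}
  {z : ℕ → ℝ} {K₀ M : ℕ} {init : ℕ → ℕ → Ω → ℝ × ℝ} {x : ℕ → ℕ → ℕ → Ω → ℝ} {ε : ℝ → ℝ}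
  {B lip R δ C a : ℝ} {ℓ j n : ℕ}

omit [MeasurableSpace Ω] in
theorem measurable_pinball {m : MeasurableSpace Ω} {ξ y : Ω → ℝ} (hξ : Measurable ξ)
    (hy : Measurable y) : Measurable fun ω => pinball α (ξ ω) (y ω) :=
  hξ.add (((hy.sub hξ).max measurable_const).const_mul _)

theorem sq_pinball_sub_le (hα : α ∈ Set.Ioo (0 : ℝ) 1) (ξ ξ' y y' : ℝ) :
    (pinball α ξ y - pinball α ξ' y') ^ 2
      ≤ 2 * (1 + 1 / (1 - α)) ^ 2 * ((ξ - ξ') ^ 2 + (y - y') ^ 2) := by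
  have h1 : 0 < 1 / (1 - α) := by
    have := hα.2
    exact one_div_pos.2 (by linarith)
  set c := 1 / (1 - α) with hc
  have h2 : |max (y - ξ) 0 - max (y' - ξ') 0| ≤ |y - y'| + |ξ - ξ'| := by
    refine (abs_max_sub_max_le_abs _ _ _).trans ?_
    rw [show y - ξ - (y' - ξ') = (y - y') - (ξ - ξ') by ring]
    exact abs_sub _ _
  have h3 : |pinball α ξ y - pinball α ξ' y'| ≤ (1 + c) * (|ξ - ξ'| + |y - y'|) := by
    have e : pinball α ξ y - pinball α ξ' y'
        = (ξ - ξ') + c * (max (y - ξ) 0 - max (y' - ξ') 0) := by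
      simp only [pinball, ← hc]; ring
    rw [e]
    calc |(ξ - ξ') + c * (max (y - ξ) 0 - max (y' - ξ') 0)|
        ≤ |ξ - ξ'| + c * |max (y - ξ) 0 - max (y' - ξ') 0| := by
          refine (abs_add_le _ _).trans ?_
          rw [abs_mul, abs_of_pos h1]
      _ ≤ |ξ - ξ'| + c * (|y - y'| + |ξ - ξ'|) := by gcongr
      _ ≤ _ := by nlinarith [abs_nonneg (y - y')]
  calc (pinball α ξ y - pinball α ξ' y') ^ 2 = |pinball α ξ y - pinball α ξ' y'| ^ 2 :=
        (sq_abs _).symm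
    _ ≤ ((1 + c) * (|ξ - ξ'| + |y - y'|)) ^ 2 := pow_le_pow_left₀ (abs_nonneg _) h3 2
    _ = (1 + c) ^ 2 * (|ξ - ξ'| + |y - y'|) ^ 2 := by ring
    _ ≤ (1 + c) ^ 2 * (2 * (|ξ - ξ'| ^ 2 + |y - y'| ^ 2)) := by
        gcongr
        exact add_sq_le
    _ = _ := by rw [sq_abs, sq_abs]; ring

omit [MeasurableSpace Ω] in
-- The step `1/(n+1)` makes the second component an exact average. Its first step has size `1` and
-- erases the initial value; at `n = 0` the factor `n` does so.
theorem mul_iterate_snd (ω : Ω) : (n : ℝ) * (levelIterate α γ init x ℓ j n ω).2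
    = ∑ k ∈ Finset.range n, pinball α (levelIterate α γ init x ℓ j k ω).1 (x ℓ j k ω) := by
  induction n with
  | zero => simp
  | succ n ih =>
    rw [Finset.sum_range_succ, ← ih]
    have h1 : ((n : ℝ) + 1) ≠ 0 := by positivity
    simp only [levelIterate, iterate, H2, pinball]
    push_cast
    field_simp
    ring

variable [IsProbabilityMeasure P]

omit [IsProbabilityMeasure P] in
theorem memLp_pinball {ξ y : Ω → ℝ} (hξ : MemLp ξ 2 P) (hy : MemLp y 2 P) :
    MemLp (fun ω => pinball α (ξ ω) (y ω)) 2 P := by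
  refine hξ.add (MemLp.const_mul ?_ _)
  exact (hy.sub hξ).pos_part

theorem integral_pinball {Y : Ω → ℝ} (hY : MemLp Y 2 P) (ξ : ℝ) :
    ∫ ω, pinball α ξ (Y ω) ∂P = objective P α Y ξ := by
  have hi : Integrable (fun ω => max (Y ω - ξ) 0) P :=
    ((hY.integrable (by norm_num)).sub (integrable_const ξ)).pos_part
  unfold pinball objective
  rw [integral_add (integrable_const _) (hi.const_mul _), integral_const_mul]
  simp

namespace SchemeBounds

variable (h : SchemeBounds P α γ₁ β X W p z K₀ M init x ε B lip R δ C)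
include h

omit [IsProbabilityMeasure P] in
theorem objective_eq (K : ℕ) (y : ℝ) :
    objective P α (X K) y = W K y + objective P α (X K) (z K) := by
  rw [h.W_eq]; ring

omit [IsProbabilityMeasure P] in
theorem continuous_objective (K : ℕ) : Continuous (objective P α (X K)) := by
  have : objective P α (X K) = fun y => W K y + objective P α (X K) (z K) :=
    funext (h.objective_eq K)
  rw [this]
  exact (h.potential K).continuous.add continuous_const

omit [IsProbabilityMeasure P] in
theorem memLp_x (hj : j = ℓ - 1 ∨ j = ℓ) : MemLp (x ℓ j n) 2 P :=
  (h.sampling.identDistrib_single hj).memLp_iff.2 (h.memLp_X _)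

theorem memLp_iterate (hj : j = ℓ - 1 ∨ j = ℓ) :
    MemLp (fun ω => (levelIterate α (stepSize γ₁ β) init x ℓ j n ω).1) 2 P := by
  have e : (fun ω => (levelIterate α (stepSize γ₁ β) init x ℓ j n ω).1)
      = fun ω => iterateError α (stepSize γ₁ β) init x K₀ M z ℓ j n ω + z (levelK K₀ M j) := by
    funext ω; simp [iterateError]
  rw [e]
  exact (h.memLp_iterateError hj).add (memLp_const _)

omit [IsProbabilityMeasure P] in
theorem measurable_iterate_fst (n : ℕ) :
    Measurable fun ω => (levelIterate α γ init x ℓ j n ω).1 :=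
  measurable_fst.comp (h.sampling.measurable_levelIterate n)

theorem memLp_W (hj : j = ℓ - 1 ∨ j = ℓ) : MemLp (fun ω => W (levelK K₀ M j)
    (levelIterate α (stepSize γ₁ β) init x ℓ j n ω).1) 2 P := by
  refine MemLp.of_le_mul (c := kConst α) (h.memLp_iterateError (n := n) hj) ?_
    (Eventually.of_forall fun ω => ?_)
  · exact ((h.potential _).continuous.measurable.comp
      (h.measurable_iterate_fst n)).aestronglyMeasurable
  · rw [Real.norm_of_nonneg ((h.potential _).W_nonneg _)]
    exact (h.potential _).W_le_abs _

theorem memLp_valueNoise (hj : j = ℓ - 1 ∨ j = ℓ) :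
    MemLp (valueNoise P α (stepSize γ₁ β) X K₀ M init x ℓ j n) 2 P := by
  refine (memLp_pinball (h.memLp_iterate hj) (h.memLp_x hj)).sub ?_
  have e : (fun ω => objective P α (X (levelK K₀ M j))
      (levelIterate α (stepSize γ₁ β) init x ℓ j n ω).1) = fun ω => W (levelK K₀ M j)
        (levelIterate α (stepSize γ₁ β) init x ℓ j n ω).1
        + objective P α (X (levelK K₀ M j)) (z (levelK K₀ M j)) :=
    funext fun ω => h.objective_eq _ _
  rw [e]
  exact (h.memLp_W hj).add (memLp_const _)

omit [IsProbabilityMeasure P] in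
theorem measurable_otherSigma_valueNoise (i : ℕ × ℕ) (hj : j = ℓ - 1 ∨ j = ℓ)
    (hi : (ℓ, n) ≠ i) (hi' : ℓ ≠ i.1 ∨ n ≤ i.2) :
    Measurable[otherSigma init x i] (valueNoise P α γ X K₀ M init x ℓ j n) := by
  have h1 := measurable_fst.comp (measurable_otherSigma_levelIterate (init := init) (x := x)
    (α := α) (γ := γ) i hj hi')
  exact (measurable_pinball h1 (measurable_otherSigma_x i hj hi)).sub
    ((h.continuous_objective _).measurable.comp h1)

theorem integral_mul_valueNoise (hj : j = ℓ - 1 ∨ j = ℓ) {S : Ω → ℝ}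
    (hS : Measurable[otherSigma init x (ℓ, n)] S) (hS2 : MemLp S 2 P) :
    ∫ ω, S ω * valueNoise P α (stepSize γ₁ β) X K₀ M init x ℓ j n ω ∂P = 0 := by
  have hT : Measurable[otherSigma init x (ℓ, n)]
      fun ω => (levelIterate α (stepSize γ₁ β) init x ℓ j n ω).1 :=
    measurable_fst.comp (measurable_otherSigma_levelIterate _ hj (Or.inr le_rfl))
  have hint : Integrable (fun ω => S ω * valueNoise P α (stepSize γ₁ β) X K₀ M init x ℓ j n ω) P :=
    hS2.integrable_mul (h.memLp_valueNoise hj)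
  have h0 : ∀ K t, ∫ ω, (pinball α t (X K ω) - objective P α (X K) t) ∂P = 0 := fun K t => by
    rw [integral_sub ((memLp_pinball (memLp_const t) (h.memLp_X K)).integrable (by norm_num))
      (integrable_const _), integral_pinball (h.memLp_X K)]
    simp
  have ho := fun K => (h.continuous_objective K).measurable
  rcases hj with rfl | rfl
  · exact h.sampling.integral_mul_eq_zero (i := (ℓ, n)) hS hT
      (F := fun q => pinball α q.1 q.2.1 - objective P α (X (levelK K₀ M (ℓ - 1))) q.1)
      ((measurable_pinball (by fun_prop) (by fun_prop)).sub ((ho _).comp (by fun_prop)))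
      (fun t => h0 _ t) hint
  · exact h.sampling.integral_mul_eq_zero (i := (j, n)) hS hT
      (F := fun q => pinball α q.1 q.2.2 - objective P α (X (levelK K₀ M j)) q.1)
      ((measurable_pinball (by fun_prop) (by fun_prop)).sub ((ho _).comp (by fun_prop)))
      (fun t => h0 _ t) hint

/-- The two iterates differ by the gap of the targets, whose square is at most a multiple of `h`,
the linear parts and the remainders. The remainder rate fits because `h^{1/2 + 2δ} ≤ C ε(h)` and `γ²
≤ γ₁^{1/2} γ^{3/2}`. -/
theorem integral_sq_iterate_sub_le : ∃ C' : ℝ, 0 ≤ C' ∧ ∀ ℓ n, 1 ≤ ℓ →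
    ∫ ω, ((levelIterate α (stepSize γ₁ β) init x ℓ ℓ n ω).1
        - (levelIterate α (stepSize γ₁ β) init x ℓ (ℓ - 1) n ω).1) ^ 2 ∂P
      ≤ C' * (levelH K₀ M ℓ + stepSize γ₁ β (n + 1) * ε (levelH K₀ M ℓ)
        + stepSize γ₁ β (n + 1) ^ (3 / 2 : ℝ)) := by
  obtain ⟨C₂, hC₂, hlin⟩ := h.integral_sq_linearDiff_le
  obtain ⟨C₃, hC₃, hrem⟩ := h.integral_sq_remainderDiff_le
  set a := p 0 (z 0) with ha
  have hC := h.C_pos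
  have hR := h.R_nonneg
  have hγ₁ := h.γ₁_pos
  have hδ := h.δ_pos
  refine ⟨3 * ((R * (1 + M)) ^ 2 + C₂ + C₃ * (C + γ₁ ^ (1 / 2 : ℝ))), by positivity,
    fun ℓ n hℓ => ?_⟩
  have hs := stepSize_succ_pos (β := β) hγ₁ n
  have hsle := stepSize_le (n := n + 1) hγ₁ h.β_mem.1.le (by omega)
  have ht := levelH_pos h.one_le_K₀ h.two_le_M ℓ
  have ht1 := levelH_le_one h.one_le_K₀ h.two_le_M ℓ
  have hε := h.ε_pos hℓ
  have hz := h.abs_z_sub_le hℓ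
  have hq := hlin ℓ n hℓ
  have hr := hrem ℓ n hℓ
  have hsq := h.sqrt_le ℓ hℓ
  have hqi := (h.memLp_linearDiff (γ := stepSize γ₁ β) (a := a) (ℓ := ℓ) n).integrable_sq.const_mul 3
  have hri := (h.memLp_remainderDiff (a := a) (ℓ := ℓ) (n := n)).integrable_sq.const_mul 3
  set s := stepSize γ₁ β (n + 1) with hsdef
  set t := levelH K₀ M ℓ with htdef
  have hz2 : (z (levelK K₀ M ℓ) - z (levelK K₀ M (ℓ - 1))) ^ 2 ≤ (R * (1 + M)) ^ 2 * t := by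
    rw [← sq_abs]
    calc |z (levelK K₀ M ℓ) - z (levelK K₀ M (ℓ - 1))| ^ 2 ≤ (R * (1 + M) * t) ^ 2 :=
          pow_le_pow_left₀ (abs_nonneg _) hz 2
      _ = (R * (1 + M)) ^ 2 * (t * t) := by ring
      _ ≤ _ := by gcongr; nlinarith
  have hI : ∫ ω, ((levelIterate α (stepSize γ₁ β) init x ℓ ℓ n ω).1
        - (levelIterate α (stepSize γ₁ β) init x ℓ (ℓ - 1) n ω).1) ^ 2 ∂P ≤ _ :=
    integral_mono ((h.memLp_iterate (Or.inr rfl)).sub (h.memLp_iterate (Or.inl rfl))).integrable_sq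
      (((integrable_const (3 * ((R * (1 + M)) ^ 2 * t))).fun_add hqi).fun_add hri) (fun ω => by
      simp only
      rw [iterate_sub_eq P X z K₀ M a]
      set u := z (levelK K₀ M ℓ) - z (levelK K₀ M (ℓ - 1))
      set v := linearDiff P α (stepSize γ₁ β) X K₀ M init x a ℓ n ω
      set w := remainderDiff P α (stepSize γ₁ β) X K₀ M init x z a ℓ n ω
      nlinarith [sq_nonneg (u - v), sq_nonneg (u - w), sq_nonneg (v - w)])
  rw [integral_add ((integrable_const _).fun_add hqi) hri, integral_add (integrable_const _) hqi,
    integral_const, integral_const_mul, integral_const_mul] at hI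
  simp only [probReal_univ, one_smul] at hI
  have h1 : t ^ (1 / 2 + 2 * δ) ≤ C * ε t :=
    (Real.rpow_le_rpow_of_exponent_ge ht ht1 (by linarith)).trans hsq
  have h2 : s ^ 2 ≤ γ₁ ^ (1 / 2 : ℝ) * s ^ (3 / 2 : ℝ) := by
    have e : s ^ 2 = s ^ (1 / 2 : ℝ) * s ^ (3 / 2 : ℝ) := by
      rw [← Real.rpow_add hs, ← Real.rpow_natCast]; norm_num
    rw [e]
    gcongr
  have h3 : C₃ * (t ^ (1 / 2 + 2 * δ) * s + s ^ 2)
      ≤ C₃ * (C * ε t * s + γ₁ ^ (1 / 2 : ℝ) * s ^ (3 / 2 : ℝ)) := by gcongr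
  set S := s ^ (3 / 2 : ℝ) with hS
  have hS0 : 0 ≤ S := by positivity
  set G := γ₁ ^ (1 / 2 : ℝ) with hG
  have hG0 : 0 ≤ G := by positivity
  have hse : 0 ≤ s * ε t := by positivity
  have k1 : (R * (1 + M)) ^ 2 * t ≤ (R * (1 + M)) ^ 2 * (t + s * ε t + S) := by
    gcongr; linarith
  have k2 : C₂ * (ε t * s + S) ≤ C₂ * (t + s * ε t + S) :=
    mul_le_mul_of_nonneg_left (by linarith) hC₂
  have k3 : C * ε t * s + G * S ≤ (C + G) * (t + s * ε t + S) := by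
    have : 0 ≤ (C + G) * t + C * S + G * (s * ε t) := by positivity
    linarith
  have k4 := mul_le_mul_of_nonneg_left k3 hC₃
  linarith

/-- The mean square of the difference of the martingale increments of the second component. -/
theorem integral_sq_valueNoise_sub_le : ∃ C' : ℝ, 0 ≤ C' ∧ ∀ ℓ n, 1 ≤ ℓ →
    ∫ ω, (valueNoise P α (stepSize γ₁ β) X K₀ M init x ℓ ℓ n ω
        - valueNoise P α (stepSize γ₁ β) X K₀ M init x ℓ (ℓ - 1) n ω) ^ 2 ∂P
      ≤ C' * (levelH K₀ M ℓ + stepSize γ₁ β (n + 1) * ε (levelH K₀ M ℓ)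
        + stepSize γ₁ β (n + 1) ^ (3 / 2 : ℝ)) := by
  obtain ⟨C₁, hC₁, hit⟩ := h.integral_sq_iterate_sub_le
  have hC := h.C_pos
  have hγ₁ := h.γ₁_pos
  set c := 2 * (1 + 1 / (1 - α)) ^ 2 with hc
  have hc0 : 0 ≤ c := by positivity
  refine ⟨c * (C₁ + C), by positivity, fun ℓ n hℓ => ?_⟩
  have hs := stepSize_succ_pos (β := β) hγ₁ n
  have ht := levelH_pos h.one_le_K₀ h.two_le_M ℓ
  have hε := h.ε_pos hℓ
  set t := levelH K₀ M ℓ with htdef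
  set ξ : ℕ → Ω → ℝ := fun j ω => (levelIterate α (stepSize γ₁ β) init x ℓ j n ω).1 with hξdef
  have hξ : ∀ j, (j = ℓ - 1 ∨ j = ℓ) → Measurable[otherSigma init x (ℓ, n)] (ξ j) := fun j hj =>
    measurable_fst.comp (measurable_otherSigma_levelIterate _ hj (Or.inr le_rfl))
  have hle := h.sampling.otherSigma_le (ℓ, n)
  have hT : Measurable[otherSigma init x (ℓ, n)] fun ω => (ξ ℓ ω, ξ (ℓ - 1) ω) :=
    (hξ ℓ (Or.inr rfl)).prodMk (hξ (ℓ - 1) (Or.inl rfl))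
  have ho := fun K => (h.continuous_objective K).measurable
  have hlaw := integral_indepFun (S := fun ω => (ξ ℓ ω, ξ (ℓ - 1) ω)) (U := samplePair x (ℓ, n))
    (f := fun q => ((pinball α q.1.1 q.2.2 - objective P α (X (levelK K₀ M ℓ)) q.1.1)
      - (pinball α q.1.2 q.2.1 - objective P α (X (levelK K₀ M (ℓ - 1))) q.1.2)) ^ 2)
    (hT.mono hle le_rfl) (h.sampling.measurable_samplePair (ℓ, n))
    (h.sampling.indepFun_other hT) (h.sampling.identDistrib ℓ n)
    ((((measurable_pinball (by fun_prop) (by fun_prop)).sub ((ho _).comp (by fun_prop))).sub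
      ((measurable_pinball (by fun_prop) (by fun_prop)).sub
        ((ho _).comp (by fun_prop)))).pow_const 2)
    ((h.memLp_valueNoise (ℓ := ℓ) (n := n) (Or.inr rfl)).sub
      (h.memLp_valueNoise (Or.inl rfl))).integrable_sq
  have hinner : ∀ y y' : ℝ, ∫ ω, ((pinball α y (X (levelK K₀ M ℓ) ω)
        - objective P α (X (levelK K₀ M ℓ)) y)
      - (pinball α y' (X (levelK K₀ M (ℓ - 1)) ω)
        - objective P α (X (levelK K₀ M (ℓ - 1))) y')) ^ 2 ∂P
      ≤ c * (y - y') ^ 2 + c * (C * t) := by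
    intro y y'
    have hH := fun K y => memLp_pinball (P := P) (α := α) (memLp_const y) (h.memLp_X K)
    have h1 := integral_sq_sub_integral_le ((hH (levelK K₀ M ℓ) y).sub (hH (levelK K₀ M (ℓ - 1)) y'))
      (c := objective P α (X (levelK K₀ M ℓ)) y - objective P α (X (levelK K₀ M (ℓ - 1))) y') (by
        simp only [Pi.sub_apply]
        rw [integral_sub ((hH _ _).integrable (by norm_num)) ((hH _ _).integrable (by norm_num)),
          integral_pinball (h.memLp_X _), integral_pinball (h.memLp_X _)])
    have e1 : ∀ ω, (pinball α y (X (levelK K₀ M ℓ) ω) - objective P α (X (levelK K₀ M ℓ)) y)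
        - (pinball α y' (X (levelK K₀ M (ℓ - 1)) ω) - objective P α (X (levelK K₀ M (ℓ - 1))) y')
        = pinball α y (X (levelK K₀ M ℓ) ω) - pinball α y' (X (levelK K₀ M (ℓ - 1)) ω)
          - (objective P α (X (levelK K₀ M ℓ)) y - objective P α (X (levelK K₀ M (ℓ - 1))) y') :=
      fun ω => by ring
    simp_rw [e1]
    refine h1.trans ?_
    have hXi : Integrable (fun ω => (X (levelK K₀ M ℓ) ω - X (levelK K₀ M (ℓ - 1)) ω) ^ 2) P :=
      ((h.memLp_X (levelK K₀ M ℓ)).sub (h.memLp_X (levelK K₀ M (ℓ - 1)))).integrable_sq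
    calc _ ≤ ∫ ω, (c * (y - y') ^ 2
          + c * (X (levelK K₀ M ℓ) ω - X (levelK K₀ M (ℓ - 1)) ω) ^ 2) ∂P := by
          refine integral_mono ((hH _ y).sub (hH _ y')).integrable_sq
            ((integrable_const _).fun_add (hXi.const_mul _)) fun ω => ?_
          exact (sq_pinball_sub_le h.α_mem _ _ _ _).trans_eq (by ring)
      _ = c * (y - y') ^ 2
          + c * ∫ ω, (X (levelK K₀ M ℓ) ω - X (levelK K₀ M (ℓ - 1)) ω) ^ 2 ∂P := by
          rw [integral_add (integrable_const _) (hXi.const_mul _), integral_const]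
          rw [integral_const_mul]
          simp
      _ ≤ _ := by
          have := h.sq_loss ℓ hℓ
          gcongr
  have hdi : Integrable (fun ω => (ξ ℓ ω - ξ (ℓ - 1) ω) ^ 2) P :=
    ((h.memLp_iterate (Or.inr rfl)).sub (h.memLp_iterate (Or.inl rfl))).integrable_sq
  calc ∫ ω, (valueNoise P α (stepSize γ₁ β) X K₀ M init x ℓ ℓ n ω
        - valueNoise P α (stepSize γ₁ β) X K₀ M init x ℓ (ℓ - 1) n ω) ^ 2 ∂P
      = _ := hlaw
    _ ≤ ∫ ω, (c * (ξ ℓ ω - ξ (ℓ - 1) ω) ^ 2 + c * (C * t)) ∂P := by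
        refine integral_mono_of_nonneg (Eventually.of_forall fun ω =>
          integral_nonneg fun ω' => sq_nonneg _)
          ((hdi.const_mul _).fun_add (integrable_const _)) (Eventually.of_forall fun ω => ?_)
        exact hinner _ _
    _ = c * ∫ ω, (ξ ℓ ω - ξ (ℓ - 1) ω) ^ 2 ∂P + c * (C * t) := by
        rw [integral_add (hdi.const_mul _) (integrable_const _), integral_const]
        rw [integral_const_mul]
        simp
    _ ≤ c * (C₁ * (t + stepSize γ₁ β (n + 1) * ε t + stepSize γ₁ β (n + 1) ^ (3 / 2 : ℝ)))
        + c * (C * (t + stepSize γ₁ β (n + 1) * ε t + stepSize γ₁ β (n + 1) ^ (3 / 2 : ℝ))) := by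
        have h1 := hit ℓ n hℓ
        have h2 : 0 ≤ stepSize γ₁ β (n + 1) * ε t + stepSize γ₁ β (n + 1) ^ (3 / 2 : ℝ) := by
          positivity
        have h3 : t ≤ t + stepSize γ₁ β (n + 1) * ε t + stepSize γ₁ β (n + 1) ^ (3 / 2 : ℝ) := by
          linarith
        gcongr
    _ = _ := by ring

/-- At level `0` there is no coupling to exploit; a bound uniform in the step is enough for an
averaged variance of order `1/n`. -/
theorem integral_sq_valueNoise_zero_le : ∃ C' : ℝ, 0 ≤ C' ∧ ∀ n,
    ∫ ω, valueNoise P α (stepSize γ₁ β) X K₀ M init x 0 0 n ω ^ 2 ∂P ≤ C' := by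
  obtain ⟨C₁, hC₁, hmom⟩ := h.moments
  have hγ₁ := h.γ₁_pos
  set c := 2 * (1 + 1 / (1 - α)) ^ 2 with hc
  have hc0 : 0 ≤ c := by positivity
  set K := levelK K₀ M 0 with hK
  set v := objective P α (X K) (z K) with hv
  set E := ∫ ω, X K ω ^ 2 ∂P with hE
  have hE0 : 0 ≤ E := integral_nonneg fun ω => sq_nonneg _
  set A := 4 * c + 4 * kConst α ^ 2 with hA
  have hA0 : 0 ≤ A := by positivity
  refine ⟨A * (C₁ * γ₁) + (4 * c * z K ^ 2 + 4 * v ^ 2) + 2 * c * E, by positivity, fun n => ?_⟩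
  set e := iterateError α (stepSize γ₁ β) init x K₀ M z 0 0 n with he
  have heL : MemLp e 2 P := h.memLp_iterateError (Or.inr rfl)
  have hx : MemLp (x 0 0 n) 2 P := h.memLp_x (Or.inr rfl)
  have hEx : ∫ ω, x 0 0 n ω ^ 2 ∂P = E :=
    ((h.sampling.identDistrib_single (ℓ := 0) (j := 0) (n := n) (Or.inr rfl)).comp
      (measurable_id.pow_const 2)).integral_eq
  have hpt : ∀ ω, valueNoise P α (stepSize γ₁ β) X K₀ M init x 0 0 n ω ^ 2
      ≤ A * e ω ^ 2 + (4 * c * z K ^ 2 + 4 * v ^ 2) + 2 * c * x 0 0 n ω ^ 2 := by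
    intro ω
    set ξ := (levelIterate α (stepSize γ₁ β) init x 0 0 n ω).1 with hξ
    have eξ : ξ = e ω + z K := by simp [he, iterateError, hξ, hK]
    have h1 := sq_pinball_sub_le h.α_mem ξ 0 (x 0 0 n ω) 0
    have h0 : pinball α 0 0 = 0 := by simp [pinball]
    rw [h0, sub_zero, sub_zero, sub_zero, ← hc] at h1
    have h2 : W K ξ ^ 2 ≤ kConst α ^ 2 * e ω ^ 2 := by
      have h3 := pow_le_pow_left₀ ((h.potential K).W_nonneg ξ) ((h.potential K).W_le_abs ξ) 2
      rw [mul_pow, sq_abs] at h3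
      rw [eξ] at h3 ⊢
      simpa using h3
    have h4 : valueNoise P α (stepSize γ₁ β) X K₀ M init x 0 0 n ω
        = pinball α ξ (x 0 0 n ω) - (W K ξ + v) := by
      rw [valueNoise, ← hK, h.objective_eq]
    rw [h4]
    set q := pinball α ξ (x 0 0 n ω)
    have h5 : (q - (W K ξ + v)) ^ 2 ≤ 2 * q ^ 2 + 4 * W K ξ ^ 2 + 4 * v ^ 2 := by
      nlinarith [sq_nonneg (q + (W K ξ + v)), sq_nonneg (W K ξ - v)]
    have h6 : ξ ^ 2 ≤ 2 * e ω ^ 2 + 2 * z K ^ 2 := by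
      rw [eξ]; nlinarith [sq_nonneg (e ω - z K)]
    have h7 := mul_le_mul_of_nonneg_left h6 hc0
    rw [hA]
    linarith
  have hi1 := heL.integrable_sq.const_mul A
  have hi2 := hx.integrable_sq.const_mul (2 * c)
  have hI := integral_mono (h.memLp_valueNoise (ℓ := 0) (n := n) (Or.inr rfl)).integrable_sq
    ((hi1.fun_add (integrable_const _)).fun_add hi2) hpt
  rw [integral_add (hi1.fun_add (integrable_const _)) hi2, integral_add hi1 (integrable_const _),
    integral_const, integral_const_mul, integral_const_mul, hEx] at hI
  refine hI.trans ?_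
  simp only [probReal_univ, one_smul]
  have h1 := (hmom 0 0 n (Or.inr rfl)).2.1
  have h2 : C₁ * stepSize γ₁ β (n + 1) ≤ C₁ * γ₁ :=
    mul_le_mul_of_nonneg_left (stepSize_le hγ₁ h.β_mem.1.le (by omega)) hC₁
  have h3 := mul_le_mul_of_nonneg_left (h1.trans h2) hA0
  linarith

end SchemeBounds

end ValueNoise

/-! ### Mean square error of the second component -/

section ValueError

variable {Ω : Type*} [MeasurableSpace Ω] {P : Measure Ω} [IsProbabilityMeasure P]
  {α γ₁ β : ℝ} {γ : ℕ → ℝ} {X : ℕ → Ω → ℝ} {W p : ℕ → ℝ → ℝ}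
  {z : ℕ → ℝ} {K₀ M : ℕ} {init : ℕ → ℕ → Ω → ℝ × ℝ} {x : ℕ → ℕ → ℕ → Ω → ℝ} {ε : ℝ → ℝ}
  {B lip R δ C a : ℝ} {ℓ j n : ℕ}

/-- The average of the optimality gaps of the first components of the iterates. -/
noncomputable def avgGap (α : ℝ) (γ : ℕ → ℝ) (init : ℕ → ℕ → Ω → ℝ × ℝ)
    (x : ℕ → ℕ → ℕ → Ω → ℝ) (K₀ M : ℕ) (W : ℕ → ℝ → ℝ) (ℓ j n : ℕ) (ω : Ω) : ℝ :=
  ∑ k ∈ Finset.range n, 1 / (n : ℝ) * W (levelK K₀ M j) (levelIterate α γ init x ℓ j k ω).1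

namespace SchemeBounds

variable (h : SchemeBounds P α γ₁ β X W p z K₀ M init x ε B lip R δ C)
include h

omit [IsProbabilityMeasure P] in
-- Each summand of the empirical mean splits into the minimum, the optimality gap at the current
-- iterate and a centred increment.
theorem iterate_snd_eq (hn : 1 ≤ n) (ω : Ω) : (levelIterate α γ init x ℓ j n ω).2
    = objective P α (X (levelK K₀ M j)) (z (levelK K₀ M j)) + avgGap α γ init x K₀ M W ℓ j n ω
      + ∑ k ∈ Finset.range n, 1 / (n : ℝ) * valueNoise P α γ X K₀ M init x ℓ j k ω := by
  have hn0 : (n : ℝ) ≠ 0 := by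
    have : (0 : ℝ) < n := by exact_mod_cast hn
    exact this.ne'
  have h1 := mul_iterate_snd (α := α) (γ := γ) (init := init) (x := x) (ℓ := ℓ) (j := j) (n := n) ω
  have h2 : ∀ k, pinball α (levelIterate α γ init x ℓ j k ω).1 (x ℓ j k ω)
      = objective P α (X (levelK K₀ M j)) (z (levelK K₀ M j))
        + W (levelK K₀ M j) (levelIterate α γ init x ℓ j k ω).1
        + valueNoise P α γ X K₀ M init x ℓ j k ω := fun k => by
    rw [valueNoise, h.objective_eq _ (levelIterate α γ init x ℓ j k ω).1]; ring
  simp_rw [h2] at h1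
  rw [Finset.sum_add_distrib, Finset.sum_add_distrib, Finset.sum_const, Finset.card_range,
    nsmul_eq_mul] at h1
  rw [avgGap, ← Finset.mul_sum, ← Finset.mul_sum]
  field_simp
  linarith

theorem memLp_avgGap (hj : j = ℓ - 1 ∨ j = ℓ) :
    MemLp (avgGap α (stepSize γ₁ β) init x K₀ M W ℓ j n) 2 P :=
  memLp_finsetSum _ fun _ _ => (h.memLp_W hj).const_mul _

/-- The gap is quadratic in the error, so the fourth moment bounds its `L²` norm by a multiple of
`γ_k`. Gaps at different steps are correlated, hence the triangle inequality and the averaged step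
size. -/
theorem integral_sq_avgGap_le (hj : j = ℓ - 1 ∨ j = ℓ) (hn : 1 ≤ n) :
    ∫ ω, avgGap α (stepSize γ₁ β) init x K₀ M W ℓ j n ω ^ 2 ∂P
      ≤ (B / 2) ^ 2 * C * avgStep γ₁ β n ^ 2 := by
  have hn0 : (0 : ℝ) < n := by exact_mod_cast hn
  rw [avgStep_eq, Finset.mul_sum]
  refine integral_sq_sum_le _ (fun k _ => ?_) (fun k _ => (h.memLp_W hj).const_mul _) fun k _ => ?_
  · have := stepSize_succ_pos (β := β) h.γ₁_pos k
    positivity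
  · have hm := h.moment ℓ j k hj
    calc ∫ ω, (1 / (n : ℝ) * W (levelK K₀ M j)
          (levelIterate α (stepSize γ₁ β) init x ℓ j k ω).1) ^ 2 ∂P
        ≤ ∫ ω, (1 / (n : ℝ)) ^ 2 * ((B / 2) ^ 2
          * iterateError α (stepSize γ₁ β) init x K₀ M z ℓ j k ω ^ 4) ∂P := by
          refine integral_mono ((h.memLp_W hj).const_mul _).integrable_sq
            ((hm.1.const_mul _).const_mul _) fun ω => ?_
          simp only
          rw [mul_pow]
          refine mul_le_mul_of_nonneg_left ?_ (sq_nonneg _)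
          refine (pow_le_pow_left₀ ((h.potential _).W_nonneg _)
            ((h.potential _).W_le_sq _) 2).trans_eq ?_
          rw [iterateError]; ring
      _ = (1 / (n : ℝ)) ^ 2 * ((B / 2) ^ 2
          * ∫ ω, iterateError α (stepSize γ₁ β) init x K₀ M z ℓ j k ω ^ 4 ∂P) := by
          rw [integral_const_mul, integral_const_mul]
      _ ≤ (1 / (n : ℝ)) ^ 2 * ((B / 2) ^ 2 * (C * stepSize γ₁ β (k + 1) ^ 2)) := by
          have := hm.2
          gcongr
      _ = _ := by ring

theorem integral_sq_avg_valueNoise_zero_le : ∃ C' : ℝ, 0 ≤ C' ∧ ∀ n : ℕ, 1 ≤ n →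
    ∫ ω, (∑ k ∈ Finset.range n,
      1 / (n : ℝ) * valueNoise P α (stepSize γ₁ β) X K₀ M init x 0 0 k ω) ^ 2 ∂P
      ≤ C' * (1 / (n : ℝ)) := by
  obtain ⟨C', hC', hv⟩ := h.integral_sq_valueNoise_zero_le
  refine ⟨C', hC', fun n hn => ?_⟩
  have hn0 : (0 : ℝ) < n := by exact_mod_cast hn
  have hL : ∀ k, MemLp (valueNoise P α (stepSize γ₁ β) X K₀ M init x 0 0 k) 2 P := fun k =>
    h.memLp_valueNoise (Or.inr rfl)
  have hmeas : ∀ i j, i < j → Measurable[otherSigma init x (0, j)]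
      (valueNoise P α (stepSize γ₁ β) X K₀ M init x 0 0 i) := fun i j hij =>
    h.measurable_otherSigma_valueNoise _ (Or.inr rfl) (by simp; omega) (Or.inr hij.le)
  have horth : ∀ i j, i ≠ j → ∫ ω, valueNoise P α (stepSize γ₁ β) X K₀ M init x 0 0 i ω
      * valueNoise P α (stepSize γ₁ β) X K₀ M init x 0 0 j ω ∂P = 0 := by
    intro i j hij
    rcases lt_or_gt_of_ne hij with hlt | hlt
    · exact h.integral_mul_valueNoise (Or.inr rfl) (hmeas i j hlt) (hL i)
    · simp_rw [mul_comm (valueNoise P α (stepSize γ₁ β) X K₀ M init x 0 0 i _)]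
      exact h.integral_mul_valueNoise (Or.inr rfl) (hmeas j i hlt) (hL j)
  rw [integral_sq_sum_of_orthogonal _ fun k _ => (hL k).const_mul _]
  · calc ∑ k ∈ Finset.range n, ∫ ω, (1 / (n : ℝ)
          * valueNoise P α (stepSize γ₁ β) X K₀ M init x 0 0 k ω) ^ 2 ∂P
        ≤ ∑ _k ∈ Finset.range n, (1 / (n : ℝ)) ^ 2 * C' := by
          refine Finset.sum_le_sum fun k _ => ?_
          simp_rw [mul_pow]
          rw [integral_const_mul]
          exact mul_le_mul_of_nonneg_left (hv k) (sq_nonneg _)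
      _ = _ := by
          rw [Finset.sum_const, Finset.card_range, nsmul_eq_mul]
          field_simp
  · intro i _ j _ hij
    have e : ∀ ω, 1 / (n : ℝ) * valueNoise P α (stepSize γ₁ β) X K₀ M init x 0 0 i ω
        * (1 / (n : ℝ) * valueNoise P α (stepSize γ₁ β) X K₀ M init x 0 0 j ω)
        = (1 / (n : ℝ)) ^ 2 * (valueNoise P α (stepSize γ₁ β) X K₀ M init x 0 0 i ω
          * valueNoise P α (stepSize γ₁ β) X K₀ M init x 0 0 j ω) := fun ω => by ring
    simp_rw [e]
    rw [integral_const_mul, horth i j hij, mul_zero]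

/-- The increments are indexed jointly by level and step. For two distinct indices, at least one
increment avoids the sample of the other, against which that other is centred; so all cross terms
vanish. -/
theorem integral_sq_sum_valueNoise_sub_le : ∃ C' : ℝ, 0 ≤ C' ∧ ∀ (L : ℕ) (N : ℕ → ℕ),
    (∀ ℓ ≤ L, 1 ≤ N ℓ) →
    ∫ ω, (∑ ℓ ∈ Finset.Icc 1 L, ∑ k ∈ Finset.range (N ℓ), 1 / (N ℓ : ℝ)
      * (valueNoise P α (stepSize γ₁ β) X K₀ M init x ℓ ℓ k ω
        - valueNoise P α (stepSize γ₁ β) X K₀ M init x ℓ (ℓ - 1) k ω)) ^ 2 ∂P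
      ≤ C' * (∑ ℓ ∈ Finset.Icc 1 L, levelH K₀ M ℓ / (N ℓ : ℝ)
        + ∑ ℓ ∈ Finset.Icc 1 L, avgStep γ₁ β (N ℓ) / (N ℓ : ℝ) * ε (levelH K₀ M ℓ)
        + ∑ ℓ ∈ Finset.Icc 1 L, 1 / (N ℓ : ℝ) ^ 2
          * ∑ k ∈ Finset.Icc 1 (N ℓ), stepSize γ₁ β k ^ (3 / 2 : ℝ)) := by
  obtain ⟨C', hC', hv⟩ := h.integral_sq_valueNoise_sub_le
  refine ⟨C', hC', fun L N hN => ?_⟩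
  set D : ℕ → ℕ → Ω → ℝ := fun ℓ k ω => valueNoise P α (stepSize γ₁ β) X K₀ M init x ℓ ℓ k ω
    - valueNoise P α (stepSize γ₁ β) X K₀ M init x ℓ (ℓ - 1) k ω with hD
  have hDL : ∀ ℓ k, MemLp (D ℓ k) 2 P := fun ℓ k =>
    (h.memLp_valueNoise (Or.inr rfl)).sub (h.memLp_valueNoise (Or.inl rfl))
  have hmeas : ∀ ℓ k (i : ℕ × ℕ), (ℓ, k) ≠ i → (ℓ ≠ i.1 ∨ k ≤ i.2) →
      Measurable[otherSigma init x i] (D ℓ k) := fun ℓ k i h1 h2 =>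
    (h.measurable_otherSigma_valueNoise i (Or.inr rfl) h1 h2).sub
      (h.measurable_otherSigma_valueNoise i (Or.inl rfl) h1 h2)
  have hzero : ∀ ℓ k ℓ' k', (ℓ, k) ≠ (ℓ', k') → (ℓ ≠ ℓ' ∨ k ≤ k') →
      ∫ ω, D ℓ k ω * D ℓ' k' ω ∂P = 0 := by
    intro ℓ k ℓ' k' h1 h2
    have hS := hmeas ℓ k (ℓ', k') h1 h2
    have e : ∀ ω, D ℓ k ω * D ℓ' k' ω
        = D ℓ k ω * valueNoise P α (stepSize γ₁ β) X K₀ M init x ℓ' ℓ' k' ω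
          - D ℓ k ω * valueNoise P α (stepSize γ₁ β) X K₀ M init x ℓ' (ℓ' - 1) k' ω :=
      fun ω => mul_sub _ _ _
    have hi : ∀ j, (j = ℓ' - 1 ∨ j = ℓ') → Integrable (fun ω =>
        D ℓ k ω * valueNoise P α (stepSize γ₁ β) X K₀ M init x ℓ' j k' ω) P := fun j hj =>
      (hDL ℓ k).integrable_mul (h.memLp_valueNoise hj)
    simp_rw [e]
    rw [integral_sub (hi ℓ' (Or.inr rfl)) (hi (ℓ' - 1) (Or.inl rfl)),
      h.integral_mul_valueNoise (Or.inr rfl) hS (hDL ℓ k),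
      h.integral_mul_valueNoise (Or.inl rfl) hS (hDL ℓ k), sub_zero]
  have horth : ∀ ℓ k ℓ' k', (ℓ, k) ≠ (ℓ', k') → ∫ ω, D ℓ k ω * D ℓ' k' ω ∂P = 0 := by
    intro ℓ k ℓ' k' hne
    -- Otherwise the level is the same and the first factor is the later one; the roles are
    -- exchanged.
    by_cases h1 : ℓ ≠ ℓ' ∨ k ≤ k'
    · exact hzero ℓ k ℓ' k' hne h1
    · simp_rw [mul_comm (D ℓ k _)]
      refine hzero ℓ' k' ℓ k hne.symm (Or.inr ?_)
      by_contra h2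
      exact h1 (Or.inr (by omega))
  have e : ∀ ω, ∑ ℓ ∈ Finset.Icc 1 L, ∑ k ∈ Finset.range (N ℓ), 1 / (N ℓ : ℝ) * D ℓ k ω
      = ∑ i ∈ (Finset.Icc 1 L).sigma fun ℓ => Finset.range (N ℓ),
        1 / (N i.1 : ℝ) * D i.1 i.2 ω := fun ω =>
    Finset.sum_sigma' _ _ _
  simp only [hD] at e
  simp_rw [e]
  rw [integral_sq_sum_of_orthogonal _ (F := fun (i : Σ _ : ℕ, ℕ) ω =>
    1 / (N i.1 : ℝ) * D i.1 i.2 ω) fun i _ => (hDL i.1 i.2).const_mul _]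
  · rw [Finset.sum_sigma, ← Finset.sum_add_distrib, ← Finset.sum_add_distrib, Finset.mul_sum]
    refine Finset.sum_le_sum fun ℓ hℓ => ?_
    have hℓ' := Finset.mem_Icc.1 hℓ
    have hN0 : (0 : ℝ) < N ℓ := by exact_mod_cast hN ℓ hℓ'.2
    calc ∑ k ∈ Finset.range (N ℓ), ∫ ω, (1 / (N ℓ : ℝ) * D ℓ k ω) ^ 2 ∂P
        ≤ ∑ k ∈ Finset.range (N ℓ), (1 / (N ℓ : ℝ)) ^ 2 * (C' * (levelH K₀ M ℓ
          + stepSize γ₁ β (k + 1) * ε (levelH K₀ M ℓ)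
          + stepSize γ₁ β (k + 1) ^ (3 / 2 : ℝ))) := by
          refine Finset.sum_le_sum fun k _ => ?_
          simp_rw [mul_pow]
          rw [integral_const_mul]
          exact mul_le_mul_of_nonneg_left (hv ℓ k hℓ'.1) (sq_nonneg _)
      _ = _ := by
          rw [avgStep_eq, sum_Icc_eq_sum_range (fun k => stepSize γ₁ β k ^ (3 / 2 : ℝ)),
            ← Finset.mul_sum, ← Finset.mul_sum, Finset.sum_add_distrib, Finset.sum_add_distrib,
            Finset.sum_const, Finset.card_range, nsmul_eq_mul, ← Finset.sum_mul]
          field_simp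
  · intro i _ i' _ hne
    have e' : ∀ ω, 1 / (N i.1 : ℝ) * D i.1 i.2 ω * (1 / (N i'.1 : ℝ) * D i'.1 i'.2 ω)
        = 1 / (N i.1 : ℝ) * (1 / (N i'.1 : ℝ)) * (D i.1 i.2 ω * D i'.1 i'.2 ω) :=
      fun ω => by ring
    simp_rw [e']
    rw [integral_const_mul, horth, mul_zero]
    rintro h1
    obtain ⟨h2, h3⟩ := Prod.mk.inj h1
    exact hne (Sigma.ext h2 (heq_of_eq h3))

/-- The mean square error of the second component of the multilevel estimator. -/
theorem integral_sq_estimator_snd_le : ∃ C' : ℝ, 0 ≤ C' ∧ ∀ (L : ℕ) (N : ℕ → ℕ),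
    (∀ ℓ ≤ L, 1 ≤ N ℓ) →
    Integrable (fun ω => ((estimator α (stepSize γ₁ β) init x L N ω).2
      - objective P α (X (levelK K₀ M L)) (z (levelK K₀ M L))) ^ 2) P ∧
    ∫ ω, ((estimator α (stepSize γ₁ β) init x L N ω).2
      - objective P α (X (levelK K₀ M L)) (z (levelK K₀ M L))) ^ 2 ∂P
      ≤ C' * (1 / (N 0 : ℝ) ^ (min 1 (2 * β))
        + ∑ ℓ ∈ Finset.Icc 1 L, levelH K₀ M ℓ / (N ℓ : ℝ)
        + ∑ ℓ ∈ Finset.Icc 1 L, avgStep γ₁ β (N ℓ) / (N ℓ : ℝ) * ε (levelH K₀ M ℓ)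
        + ∑ ℓ ∈ Finset.Icc 1 L, 1 / (N ℓ : ℝ) ^ 2
          * ∑ k ∈ Finset.Icc 1 (N ℓ), stepSize γ₁ β k ^ (3 / 2 : ℝ)
        + (∑ ℓ ∈ Finset.Icc 1 L, avgStep γ₁ β (N ℓ)) ^ 2) := by
  obtain ⟨C₁, hC₁, hz⟩ := h.integral_sq_avg_valueNoise_zero_le
  obtain ⟨C₂, hC₂, hv⟩ := h.integral_sq_sum_valueNoise_sub_le
  have hC := h.C_pos
  have hγ₁ := h.γ₁_pos
  set G := (B / 2) ^ 2 * C with hG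
  have hG0 : 0 ≤ G := by positivity
  refine ⟨4 * (G * (4 * γ₁ ^ 2) + C₁ + 4 * G + C₂), by positivity, fun L N hN => ?_⟩
  have hN0 : 1 ≤ N 0 := hN 0 (Nat.zero_le _)
  set T₁ := avgGap α (stepSize γ₁ β) init x K₀ M W 0 0 (N 0) with hT₁
  set T₂ : Ω → ℝ := fun ω => ∑ k ∈ Finset.range (N 0),
    1 / (N 0 : ℝ) * valueNoise P α (stepSize γ₁ β) X K₀ M init x 0 0 k ω with hT₂
  set F : ℕ → Ω → ℝ := fun ℓ ω => avgGap α (stepSize γ₁ β) init x K₀ M W ℓ ℓ (N ℓ) ω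
    - avgGap α (stepSize γ₁ β) init x K₀ M W ℓ (ℓ - 1) (N ℓ) ω with hF
  set T₃ : Ω → ℝ := fun ω => ∑ ℓ ∈ Finset.Icc 1 L, F ℓ ω with hT₃
  set T₄ : Ω → ℝ := fun ω => ∑ ℓ ∈ Finset.Icc 1 L, ∑ k ∈ Finset.range (N ℓ), 1 / (N ℓ : ℝ)
      * (valueNoise P α (stepSize γ₁ β) X K₀ M init x ℓ ℓ k ω
        - valueNoise P α (stepSize γ₁ β) X K₀ M init x ℓ (ℓ - 1) k ω) with hT₄
  have hFL : ∀ ℓ, MemLp (F ℓ) 2 P := fun ℓ =>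
    (h.memLp_avgGap (Or.inr rfl)).sub (h.memLp_avgGap (Or.inl rfl))
  have hL1 : MemLp T₁ 2 P := h.memLp_avgGap (Or.inr rfl)
  have hL2 : MemLp T₂ 2 P :=
    memLp_finsetSum _ fun k _ => (h.memLp_valueNoise (Or.inr rfl)).const_mul _
  have hL3 : MemLp T₃ 2 P := memLp_finsetSum _ fun ℓ _ => hFL ℓ
  have hL4 : MemLp T₄ 2 P := memLp_finsetSum _ fun ℓ _ => memLp_finsetSum _ fun k _ =>
    ((h.memLp_valueNoise (Or.inr rfl)).sub (h.memLp_valueNoise (Or.inl rfl))).const_mul _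
  -- The minimal values telescope, leaving gaps and centred increments, each from level `0` and from
  -- the level differences.
  have hdec : ∀ ω, (estimator α (stepSize γ₁ β) init x L N ω).2
      - objective P α (X (levelK K₀ M L)) (z (levelK K₀ M L)) = T₁ ω + T₂ ω + T₃ ω + T₄ ω := by
    intro ω
    have e1 : ∀ ℓ ∈ Finset.Icc 1 L, (levelIterate α (stepSize γ₁ β) init x ℓ ℓ (N ℓ) ω).2
        - (levelIterate α (stepSize γ₁ β) init x ℓ (ℓ - 1) (N ℓ) ω).2
        = (objective P α (X (levelK K₀ M ℓ)) (z (levelK K₀ M ℓ))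
          - objective P α (X (levelK K₀ M (ℓ - 1))) (z (levelK K₀ M (ℓ - 1)))) + F ℓ ω
          + ∑ k ∈ Finset.range (N ℓ), 1 / (N ℓ : ℝ)
            * (valueNoise P α (stepSize γ₁ β) X K₀ M init x ℓ ℓ k ω
              - valueNoise P α (stepSize γ₁ β) X K₀ M init x ℓ (ℓ - 1) k ω) := by
      intro ℓ hℓ
      have hNℓ := hN ℓ (Finset.mem_Icc.1 hℓ).2
      rw [h.iterate_snd_eq hNℓ, h.iterate_snd_eq hNℓ]
      simp_rw [mul_sub, Finset.sum_sub_distrib]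
      simp only [hF]
      ring
    rw [estimator_snd, Finset.sum_congr rfl e1, Finset.sum_add_distrib, Finset.sum_add_distrib,
      sum_Icc_sub_pred (fun ℓ => objective P α (X (levelK K₀ M ℓ)) (z (levelK K₀ M ℓ))),
      h.iterate_snd_eq hN0]
    simp only [hT₁, hT₂, hT₃, hT₄]
    ring
  simp_rw [hdec]
  have htot : MemLp (fun ω => T₁ ω + T₂ ω + T₃ ω + T₄ ω) 2 P := ((hL1.add hL2).add hL3).add hL4
  refine ⟨htot.integrable_sq, ?_⟩
  have hi1 := hL1.integrable_sq.const_mul 4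
  have hi2 := hL2.integrable_sq.const_mul 4
  have hi3 := hL3.integrable_sq.const_mul 4
  have hi4 := hL4.integrable_sq.const_mul 4
  have hI : ∫ ω, (T₁ ω + T₂ ω + T₃ ω + T₄ ω) ^ 2 ∂P ≤ _ :=
    integral_mono htot.integrable_sq (((hi1.fun_add hi2).fun_add hi3).fun_add hi4) (fun ω => by
      simp only
      nlinarith [sq_nonneg (T₁ ω - T₂ ω), sq_nonneg (T₁ ω - T₃ ω), sq_nonneg (T₁ ω - T₄ ω),
        sq_nonneg (T₂ ω - T₃ ω), sq_nonneg (T₂ ω - T₄ ω), sq_nonneg (T₃ ω - T₄ ω)])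
  rw [integral_add ((hi1.fun_add hi2).fun_add hi3) hi4, integral_add (hi1.fun_add hi2) hi3,
    integral_add hi1 hi2, integral_const_mul, integral_const_mul, integral_const_mul,
    integral_const_mul] at hI
  have hn0 : (1 : ℝ) ≤ N 0 := by exact_mod_cast hN0
  have b1 : ∫ ω, T₁ ω ^ 2 ∂P ≤ G * (4 * γ₁ ^ 2 * (1 / (N 0 : ℝ) ^ (min 1 (2 * β)))) :=
    (h.integral_sq_avgGap_le (Or.inr rfl) hN0).trans
      (mul_le_mul_of_nonneg_left (sq_avgStep_le hγ₁ hN0) hG0)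
  have b2 : ∫ ω, T₂ ω ^ 2 ∂P ≤ C₁ * (1 / (N 0 : ℝ) ^ (min 1 (2 * β))) := by
    refine (hz (N 0) hN0).trans (mul_le_mul_of_nonneg_left ?_ hC₁)
    refine one_div_le_one_div_of_le (by positivity) ?_
    calc (N 0 : ℝ) ^ (min 1 (2 * β)) ≤ (N 0 : ℝ) ^ (1 : ℝ) :=
          Real.rpow_le_rpow_of_exponent_le hn0 (min_le_left _ _)
      _ = _ := Real.rpow_one _
  have b3 : ∫ ω, T₃ ω ^ 2 ∂P ≤ 4 * G * (∑ ℓ ∈ Finset.Icc 1 L, avgStep γ₁ β (N ℓ)) ^ 2 := by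
    refine integral_sq_sum_le _ (fun ℓ hℓ => avgStep_pos hγ₁ (hN ℓ (Finset.mem_Icc.1 hℓ).2))
      (fun ℓ _ => hFL ℓ) fun ℓ hℓ => ?_
    have hNℓ := hN ℓ (Finset.mem_Icc.1 hℓ).2
    have j1 := (h.memLp_avgGap (ℓ := ℓ) (n := N ℓ) (Or.inr rfl)).integrable_sq.const_mul 2
    have j2 := (h.memLp_avgGap (ℓ := ℓ) (n := N ℓ) (Or.inl rfl)).integrable_sq.const_mul 2
    have hJ : ∫ ω, F ℓ ω ^ 2 ∂P ≤ _ :=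
      integral_mono (hFL ℓ).integrable_sq (j1.fun_add j2) (fun ω => by
        simp only [hF]
        nlinarith [sq_nonneg (avgGap α (stepSize γ₁ β) init x K₀ M W ℓ ℓ (N ℓ) ω
          + avgGap α (stepSize γ₁ β) init x K₀ M W ℓ (ℓ - 1) (N ℓ) ω)])
    rw [integral_add j1 j2, integral_const_mul, integral_const_mul] at hJ
    have h1 := h.integral_sq_avgGap_le (ℓ := ℓ) (Or.inr rfl) hNℓ
    have h2 := h.integral_sq_avgGap_le (ℓ := ℓ) (Or.inl rfl) hNℓ
    rw [← hG] at h1 h2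
    linarith
  have b4 := hv L N hN
  have p0 : 0 ≤ 1 / (N 0 : ℝ) ^ (min 1 (2 * β)) := by positivity
  have p1 : 0 ≤ ∑ ℓ ∈ Finset.Icc 1 L, levelH K₀ M ℓ / (N ℓ : ℝ) := Finset.sum_nonneg fun ℓ _ =>
    div_nonneg (levelH_pos h.one_le_K₀ h.two_le_M ℓ).le (Nat.cast_nonneg _)
  have p2 : 0 ≤ ∑ ℓ ∈ Finset.Icc 1 L, avgStep γ₁ β (N ℓ) / (N ℓ : ℝ) * ε (levelH K₀ M ℓ) :=
    Finset.sum_nonneg fun ℓ hℓ => mul_nonneg (div_nonneg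
      (avgStep_pos hγ₁ (hN ℓ (Finset.mem_Icc.1 hℓ).2)).le (Nat.cast_nonneg _))
      (h.ε_pos (Finset.mem_Icc.1 hℓ).1).le
  have p3 : 0 ≤ ∑ ℓ ∈ Finset.Icc 1 L, 1 / (N ℓ : ℝ) ^ 2
      * ∑ k ∈ Finset.Icc 1 (N ℓ), stepSize γ₁ β k ^ (3 / 2 : ℝ) := Finset.sum_nonneg fun ℓ _ =>
    mul_nonneg (by positivity) (Finset.sum_nonneg fun k _ =>
      Real.rpow_nonneg (stepSize_nonneg hγ₁ k) _)
  have p4 := sq_nonneg (∑ ℓ ∈ Finset.Icc 1 L, avgStep γ₁ β (N ℓ))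
  set A₀ := 1 / (N 0 : ℝ) ^ (min 1 (2 * β))
  set A₁ := ∑ ℓ ∈ Finset.Icc 1 L, levelH K₀ M ℓ / (N ℓ : ℝ)
  set A₂ := ∑ ℓ ∈ Finset.Icc 1 L, avgStep γ₁ β (N ℓ) / (N ℓ : ℝ) * ε (levelH K₀ M ℓ)
  set A₃ := ∑ ℓ ∈ Finset.Icc 1 L, 1 / (N ℓ : ℝ) ^ 2
    * ∑ k ∈ Finset.Icc 1 (N ℓ), stepSize γ₁ β k ^ (3 / 2 : ℝ)
  set A₄ := (∑ ℓ ∈ Finset.Icc 1 L, avgStep γ₁ β (N ℓ)) ^ 2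
  have k1 := mul_le_mul_of_nonneg_left (show A₀ ≤ A₀ + A₁ + A₂ + A₃ + A₄ by linarith)
    (show 0 ≤ G * (4 * γ₁ ^ 2) by positivity)
  have k2 := mul_le_mul_of_nonneg_left (show A₀ ≤ A₀ + A₁ + A₂ + A₃ + A₄ by linarith) hC₁
  have k3 := mul_le_mul_of_nonneg_left (show A₄ ≤ A₀ + A₁ + A₂ + A₃ + A₄ by linarith) hG0
  have k4 := mul_le_mul_of_nonneg_left
    (show A₁ + A₂ + A₃ ≤ A₀ + A₁ + A₂ + A₃ + A₄ by linarith) hC₂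
  linarith

end SchemeBounds

end ValueError

/-! ### From the assumptions to the scheme bounds -/

section Assumptions

variable {Ω : Type*} [MeasurableSpace Ω] {P : Measure Ω} [IsProbabilityMeasure P] {d q : ℕ}
  {φ : EuclideanSpace ℝ (Fin d) → EuclideanSpace ℝ (Fin q) → ℝ}
  {Y : Ω → EuclideanSpace ℝ (Fin d)} {Z : Ω → EuclideanSpace ℝ (Fin q)}
  {Zc : ℕ → Ω → EuclideanSpace ℝ (Fin q)}

theorem sq_loss_level_sub_le (hmodel : IsNestedModel P φ Y Z Zc)
    (hL2 : MemLp (fun ω => φ (Y ω) (Z ω)) 2 P) {K₀ M : ℕ} (hK₀ : 1 ≤ K₀) (hM : 2 ≤ M) :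
    ∃ C, 0 ≤ C ∧ ∀ ℓ, 1 ≤ ℓ → ∫ ω, (loss P φ Y Z Zc (levelK K₀ M ℓ) ω
      - loss P φ Y Z Zc (levelK K₀ M (ℓ - 1)) ω) ^ 2 ∂P ≤ C * levelH K₀ M ℓ := by
  obtain ⟨C, hC, h⟩ := sq_loss_sub_le hmodel hL2
  refine ⟨2 * C * (1 + M), by positivity, fun ℓ hℓ => ?_⟩
  have hL := memLp_loss hmodel hL2
  have i1 : ∀ K, Integrable (fun ω => 2 * (loss P φ Y Z Zc K ω - loss P φ Y Z Zc 0 ω) ^ 2) P :=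
    fun K => ((hL K).sub (hL 0)).integrable_sq.const_mul 2
  have hI := integral_mono ((hL (levelK K₀ M ℓ)).sub (hL (levelK K₀ M (ℓ - 1)))).integrable_sq
    ((i1 (levelK K₀ M ℓ)).fun_add (i1 (levelK K₀ M (ℓ - 1)))) fun ω => by
      simp only [Pi.sub_apply]
      nlinarith [sq_nonneg ((loss P φ Y Z Zc (levelK K₀ M ℓ) ω - loss P φ Y Z Zc 0 ω)
        + (loss P φ Y Z Zc (levelK K₀ M (ℓ - 1)) ω - loss P φ Y Z Zc 0 ω))]
  simp only [Pi.sub_apply] at hI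
  rw [integral_add (i1 _) (i1 _), integral_const_mul, integral_const_mul] at hI
  have h1 := h _ (one_le_levelK hK₀ hM ℓ)
  have h2 := h _ (one_le_levelK hK₀ hM (ℓ - 1))
  have e1 : (1 : ℝ) / (levelK K₀ M ℓ : ℝ) = levelH K₀ M ℓ := rfl
  have e2 : (1 : ℝ) / (levelK K₀ M (ℓ - 1) : ℝ) = M * levelH K₀ M ℓ := levelH_pred hM hℓ
  rw [e1] at h1
  rw [e2] at h2
  linarith

/-- Separates the probabilistic input from the analysis of the schemes: afterwards only
`SchemeBounds` is used, with one constant dominating those of the fourth moments, the densities, the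
switching probabilities and the losses. -/
theorem exists_schemeBounds (hmodel : IsNestedModel P φ Y Z Zc)
    (hL2 : MemLp (fun ω => φ (Y ω) (Z ω)) 2 P) {α : ℝ} (hα : α ∈ Set.Ioo (0 : ℝ) 1)
    {X : ℕ → Ω → ℝ} (hX : X = loss P φ Y Z Zc) {ξs : ℕ → ℝ}
    (hξs : ∀ K, ξs K ∈ argmin (objective P α (X K))) {f : ℕ → ℝ → ℝ}
    (hexp : ExpansionAssumption P α X f) (hdens : DensityAssumption f (ξs 0))
    (hrate : DensityRateAssumption f) {K₀ M : ℕ} (hK₀ : 1 ≤ K₀) (hM : 2 ≤ M) {ε : ℝ → ℝ}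
    (hε : IsStrongErrorRate P Y (fun ω => φ (Y ω) (Z ω) - X 0 ω) X K₀ M ε)
    {γ₁ β : ℝ} (hγ₁ : 0 < γ₁) (hβ : β ∈ Set.Ioc (0 : ℝ) 1)
    (hβ1 : β = 1 → 2 < lambdaBar (fun K => objective P α (X K)) ξs 2 * γ₁)
    {init : ℕ → ℕ → Ω → ℝ × ℝ} {x : ℕ → ℕ → ℕ → Ω → ℝ}
    (hsamp : IsMultilevelSampling P X K₀ M init x)
    (hinit : InitMoments P α (⨆ K, supNorm (f K)) init) :
    ∃ (W p : ℕ → ℝ → ℝ) (B lip R δ C : ℝ),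
      SchemeBounds P α γ₁ β X W p ξs K₀ M init x ε B lip R δ C := by
  have hXm : ∀ K, Measurable (X K) := fun K => hX ▸ measurable_loss hmodel K
  have hXL : ∀ K, MemLp (X K) 2 P := fun K => hX ▸ memLp_loss hmodel hL2 K
  have hf := hexp.pdf
  obtain ⟨hb, hfb, c, lip, R, δ, hU, hlam⟩ := exists_uniformBounds hα hXm
    (fun K => (hXL K).integrable (by norm_num)) hξs hexp hdens hrate
  set b := ⨆ K, supNorm (f K) with hbdef
  obtain ⟨C₁, hC₁, hmom⟩ := fourth_moment_le hα hXm hf hU hγ₁ hβ hβ1 hsamp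
    (lyapunov_initial hU hinit)
  obtain ⟨C₂, hC₂, hsw⟩ := switchProb_level_le hmodel hL2 hX hf hb.le hfb hK₀ hM hε
  obtain ⟨C₃, hC₃, hsq⟩ := sq_loss_level_sub_le hmodel hL2 hK₀ hM
  have ha : 0 < f 0 (ξs 0) / (1 - α) :=
    hU.c_pos.trans_le (hU.lower 0 (ξs 0) (by simp))
  have hε0 : ∀ ℓ, 1 ≤ ℓ → 0 ≤ ε (levelH K₀ M ℓ) := by
    intro ℓ hℓ
    have h1 : 0 < levelH K₀ M ℓ ^ (1 / 2 : ℝ) := Real.rpow_pos_of_pos (levelH_pos hK₀ hM ℓ) _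
    exact (pos_of_mul_pos_right (h1.trans_le (hsw ℓ hℓ).2) hC₂).le
  refine ⟨_, _, _, lip, R, δ, C₁ + b + C₂ + C₃, {
    α_mem := hα
    γ₁_pos := hγ₁
    β_mem := hβ
    one_le_K₀ := hK₀
    two_le_M := hM
    potential := hU.potential
    a_pos := ha
    a_large := fun h1 => ?_
    R_nonneg := hU.R_nonneg
    δ_pos := hU.δ_pos
    C_pos := by linarith
    lipschitz := hU.lipschitz
    z_rate := hU.z_rate
    p_rate := hU.p_rate
    sampling := hsamp
    moment := fun ℓ j n hj => ⟨(hmom ℓ j n hj).1, (hmom ℓ j n hj).2.trans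
      (mul_le_mul_of_nonneg_right (by linarith) (sq_nonneg _))⟩
    measurable_X := hXm
    memLp_X := hXL
    tail_sub_le := fun K y y' hy => ?_
    integral_H1 := fun K y => integral_H1 (hf K) (hXm K) hα.2 y
    W_eq := fun K y => rfl
    switch := fun ℓ hℓ ξ => ((hsw ℓ hℓ).1 ξ).trans
      (mul_le_mul_of_nonneg_right (by linarith) (hε0 ℓ hℓ))
    sqrt_le := fun ℓ hℓ => (hsw ℓ hℓ).2.trans
      (mul_le_mul_of_nonneg_right (by linarith) (hε0 ℓ hℓ))
    sq_loss := fun ℓ hℓ => by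
      rw [hX]
      exact (hsq ℓ hℓ).trans
        (mul_le_mul_of_nonneg_right (by linarith) (levelH_pos hK₀ hM ℓ).le) }⟩
  -- `lambdaBar` is at most `3/4` of the slope `a`, so its condition on `γ₁` passes to `a`.
  · refine (hβ1 h1).trans_le (mul_le_mul_of_nonneg_right (hlam.trans ?_) hγ₁.le)
    linarith
  · rw [(hf K).measureReal_le (hXm K), (hf K).measureReal_le (hXm K)]
    have h1 := (hf K).cdf_sub_le (hXm K) (hfb K) hy
    have h2 : b * (y' - y) ≤ (C₁ + b + C₂ + C₃) * (y' - y) :=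
      mul_le_mul_of_nonneg_right (by linarith) (by linarith)
    linarith

end Assumptions
end MLSA

theorem mainTheorem2
    {Ω : Type*} [MeasurableSpace Ω] (P : Measure Ω) [IsProbabilityMeasure P]
    {d q : ℕ}
    (φ : EuclideanSpace ℝ (Fin d) → EuclideanSpace ℝ (Fin q) → ℝ)
    (Y : Ω → EuclideanSpace ℝ (Fin d)) (Z : Ω → EuclideanSpace ℝ (Fin q))
    (Zc : ℕ → Ω → EuclideanSpace ℝ (Fin q))
    (hmodel : MLSA.IsNestedModel P φ Y Z Zc)
    (hL2 : MemLp (fun ω => φ (Y ω) (Z ω)) 2 P)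
    (α : ℝ) (hα : α ∈ Set.Ioo (0 : ℝ) 1)
    -- the losses, their objective functions and the minimizers, indexed by `K` with `h = 1 / K`
    (X : ℕ → Ω → ℝ) (hX : X = MLSA.loss P φ Y Z Zc)
    (V : ℕ → ℝ → ℝ) (hV : V = fun K => MLSA.objective P α (X K))
    (ξs : ℕ → ℝ) (hξs : ∀ K, ξs K ∈ MLSA.argmin (V K))
    (f : ℕ → ℝ → ℝ)
    (hexp : MLSA.ExpansionAssumption P α X f)
    (hdens : MLSA.DensityAssumption f (ξs 0))
    (hrate : MLSA.DensityRateAssumption f)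
    -- the levels and the strong error scenario
    (K₀ M : ℕ) (hK₀ : 1 ≤ K₀) (hM : 2 ≤ M)
    (ε : ℝ → ℝ)
    (hε : MLSA.IsStrongErrorRate P Y (fun ω => φ (Y ω) (Z ω) - X 0 ω) X K₀ M ε)
    -- the learning rates
    (γ₁ β : ℝ) (hγ₁ : 0 < γ₁) (hβ : β ∈ Set.Ioc (0 : ℝ) 1)
    (hβ1 : β = 1 → 2 < MLSA.lambdaBar V ξs 2 * γ₁)
    (γ : ℕ → ℝ) (hγ : γ = MLSA.stepSize γ₁ β)
    -- the inputs of the multilevel scheme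
    (init : ℕ → ℕ → Ω → ℝ × ℝ) (x : ℕ → ℕ → ℕ → Ω → ℝ)
    (hsamp : MLSA.IsMultilevelSampling P X K₀ M init x)
    (hinit : MLSA.InitMoments P α (⨆ K, MLSA.supNorm (f K)) init) :
    ∃ C : ℝ, ∀ L : ℕ, 1 ≤ L → ∀ N : ℕ → ℕ, (∀ ℓ ≤ L, 1 ≤ N ℓ) →
      (Integrable (fun ω => ((MLSA.estimator α γ init x L N ω).1
          - ξs (MLSA.levelK K₀ M L)) ^ 2) P ∧
        ∫ ω, ((MLSA.estimator α γ init x L N ω).1 - ξs (MLSA.levelK K₀ M L)) ^ 2 ∂P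
          ≤ C * (γ (N 0)
            + (∑ ℓ ∈ Finset.Icc 1 L, γ (N ℓ)) ^ 2
            + ∑ ℓ ∈ Finset.Icc 1 L, γ (N ℓ) ^ (3 / 2 : ℝ)
            + ∑ ℓ ∈ Finset.Icc 1 L, γ (N ℓ) * ε (MLSA.levelH K₀ M ℓ))) ∧
      (Integrable (fun ω => ((MLSA.estimator α γ init x L N ω).2
          - V (MLSA.levelK K₀ M L) (ξs (MLSA.levelK K₀ M L))) ^ 2) P ∧
        ∫ ω, ((MLSA.estimator α γ init x L N ω).2
            - V (MLSA.levelK K₀ M L) (ξs (MLSA.levelK K₀ M L))) ^ 2 ∂P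
          ≤ C * (1 / (N 0 : ℝ) ^ (min 1 (2 * β))
            + ∑ ℓ ∈ Finset.Icc 1 L, MLSA.levelH K₀ M ℓ / (N ℓ : ℝ)
            + ∑ ℓ ∈ Finset.Icc 1 L,
                MLSA.avgStep γ₁ β (N ℓ) / (N ℓ : ℝ) * ε (MLSA.levelH K₀ M ℓ)
            + ∑ ℓ ∈ Finset.Icc 1 L,
                1 / (N ℓ : ℝ) ^ 2 * ∑ k ∈ Finset.Icc 1 (N ℓ), γ k ^ (3 / 2 : ℝ)
            + (∑ ℓ ∈ Finset.Icc 1 L, MLSA.avgStep γ₁ β (N ℓ)) ^ 2)) := by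
  subst hV hγ
  obtain ⟨W, p, B, lip, R, δ, C, h⟩ := MLSA.exists_schemeBounds hmodel hL2 hα hX hξs hexp hdens
    hrate hK₀ hM hε hγ₁ hβ hβ1 hsamp hinit
  obtain ⟨C₁, hC₁, h1⟩ := h.integral_sq_estimator_fst_le
  obtain ⟨C₂, hC₂, h2⟩ := h.integral_sq_estimator_snd_le
  have hs := fun n => MLSA.stepSize_nonneg (β := β) hγ₁ n
  have hε0 : ∀ L, ∀ ℓ ∈ Finset.Icc 1 L, 0 ≤ ε (MLSA.levelH K₀ M ℓ) := fun L ℓ hℓ =>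
    (h.ε_pos (Finset.mem_Icc.1 hℓ).1).le
  have ha : ∀ n, 0 ≤ MLSA.avgStep γ₁ β n := fun n =>
    mul_nonneg (by positivity) (Finset.sum_nonneg fun k _ => hs k)
  refine ⟨C₁ + C₂, fun L _ N hN => ⟨⟨(h1 L N hN).1, (h1 L N hN).2.trans
    (mul_le_mul_of_nonneg_right (by linarith) ?_)⟩, ⟨(h2 L N hN).1, (h2 L N hN).2.trans
    (mul_le_mul_of_nonneg_right (by linarith) ?_)⟩⟩⟩
  · refine add_nonneg (add_nonneg (add_nonneg (hs _) (sq_nonneg _)) ?_) ?_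
    · exact Finset.sum_nonneg fun ℓ _ => Real.rpow_nonneg (hs _) _
    · exact Finset.sum_nonneg fun ℓ hℓ => mul_nonneg (hs _) (hε0 L ℓ hℓ)
  · refine add_nonneg (add_nonneg (add_nonneg (add_nonneg (by positivity) ?_) ?_) ?_)
      (sq_nonneg _)
    · exact Finset.sum_nonneg fun ℓ _ =>
        div_nonneg (MLSA.levelH_pos hK₀ hM ℓ).le (Nat.cast_nonneg _)
    · exact Finset.sum_nonneg fun ℓ hℓ =>
        mul_nonneg (div_nonneg (ha _) (Nat.cast_nonneg _)) (hε0 L ℓ hℓ)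
    · exact Finset.sum_nonneg fun ℓ _ => mul_nonneg (by positivity)
        (Finset.sum_nonneg fun k _ => Real.rpow_nonneg (hs _) _)
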